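/- **Setting.** For matrices $A,B,C\in\mathbb{R}^{n\times r}$ with columns $a_k,b_k,c_k$ let $T=\sum_{k=1}^r a_k\otimes b_k\otimes c_k\in\mathbb{R}^{n\times n\times n}$, where $A^TA=B^TB=I_r$ (so $r\le n$). For a band-width $b\ge 0$ the unknown positions are the triples $(i_1,i_2,i_3)$ such that $|i_k-i_\ell|\le b$ for some $k\ne\ell$. What is given is $S=T+E$, together with $n,r,b$, where $E$ is an arbitrary unknown tensor supported on the unknown positions. "For generic $A,B,C$" means: for all triples $(A,B,C)$ with $A^TA=B^TB=I_r$ off the zero set of a polynomial in the entries which depends only on $n,r,b$ and does not vanish identically on any nonempty relatively open set of such triples. Running times are numbers of steps of one fixed program (for all $n,r,b$) on a random access machine with exact real arithmetic: each arithmetic operation or comparison of real numbers, each memory access, and each addition, subtraction or comparison of indices is one step. **Theorem.** Let $n\ge 8(4b+2)$ and $r\ge 3(4b+2)$, $r\le n$. 1. (Unique recovery in polynomial time.) For generic $A,B,C$, $T$ is the only tensor of the form $\sum_{k=1}^r a_k'\otimes b_k'\otimes c_k'$, with $\{a_k'\}$ and $\{b_k'\}$ orthonormal, that agrees with $T$ on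 the known positions. There is a program that uses only $+,-,\times,/$ and comparisons, makes at most $Kn^d$ steps on every input, with $K,d$ absolute constants, and for generic $A,B,C$ and every such $E$ computes $T$ exactly from $S$. 2. (Alternating least squares.) Let $k_i=(2b+1)(i-1)+1$ for $i=1,\dots,5$, let $M_i=S(:,:,k_i)$, and let $\mathcal{U}(k)$ be the set of $n\times n$ matrices supported on the $(p,q)$ with $|p-q|\le b$ or $|p-k|\le b$ or $|q-k|\le b$. *First stage:* minimize over $X_i\in\mathcal{U}(k_i)$, vanishing in the rows $p$ with $|p-k_i|\le 2b$, the sum over $i,j$ of the squares of the entries of $$X_iM_j^T-M_jX_i^T+M_iX_j^T-X_jM_i^T-(M_iM_j^T-M_jM_i^T)$$ at the positions $(p,q)$ with $|p-q|>2b$ and $p,q$ both at distance more than $2b$ from $k_i$ and from $k_j$. Start at $X=0$; one sweep minimizes, for each $i$ in turn and each row of $X_i$ in turn, over the unknown entries of that row, all else fixed. Let $X^{(N)}$ be the result after $N$ sweeps. *Second stage:* with $\widehat M_i=M_i-X_i^{(N)}$ for $i\in\{1,3,5\}$, minimize over $Z_i\in\mathcal{U}(k_i)$, supported in the rows $p$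 with $|p-k_i|\le 2b$, the quantity $\sum_{i,j}\|(\widehat M_i-Z_i)^T(\widehat M_j-Z_j)-(\widehat M_j-Z_j)^T(\widehat M_i-Z_i)\|^2$, again from $Z=0$, by $N$ sweeps, one column of one $Z_i$ at a time. There is a program, which in addition may compute spectral decompositions of symmetric $d\times d$ matrices, each counted as $d^3$ steps, such that on input $n,r,b,S$ and a number $N$ of iterations it makes $$O\big(\max(n^3,\;n^2r^2,\;n^2(b+1)^2N)\big)$$ steps, with an absolute constant and for every $S$, and such that for generic $A,B,C$ and every such $E$: the sequence $X^{(N)}$ is uniquely defined and the program computes $X^{(N)}$, as well as an outcome of the second stage; it outputs matrices $\widehat A,\widehat B,\widehat C\in\mathbb{R}^{n\times r}$; and there are $c$ and $\rho<1$, independent of $N$, such that for all $N$ the distance in Euclidean norm from $X^{(N)}$ to the true noise in the rows concerned, and also $\big\|\sum_k\widehat a_k\otimes\widehat b_k\otimes\widehat c_k-T\big\|$, are at most $c\,\rho^N$. This holds for every choice of the spectral decompositions. -/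

import Mathlib

open scoped Matrix

/-! ### Tensors, the sampling pattern, and genericity -/

/-- Real `n × n × n` tensors. -/
abbrev Tensor (n : ℕ) : Type := Fin n → Fin n → Fin n → ℝ

/-- The tensor `∑ₖ aₖ ⊗ bₖ ⊗ cₖ`, where `aₖ`, `bₖ`, `cₖ` are the columns of `A`, `B`, `C`. -/
def cpTensor {n r : ℕ} (A B C : Matrix (Fin n) (Fin r) ℝ) : Tensor n :=
  fun i j l => ∑ k, A i k * B j k * C l k

/-- The Euclidean norm of a tensor. -/
noncomputable def tensorNorm {n : ℕ} (T : Tensor n) : ℝ :=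
  Real.sqrt (∑ i, ∑ j, ∑ l, T i j l ^ 2)

/-- `|p - q| ≤ w`. -/
abbrev Near (w p q : ℕ) : Prop := p ≤ q + w ∧ q ≤ p + w

/-- The positions of the unknown entries in the slice number `k`: a band of width `b` around
the diagonal, and the rows and the columns at distance at most `b` from `k`. -/
abbrev InBand (b k p q : ℕ) : Prop := Near b p q ∨ Near b p k ∨ Near b q k

/-- The noise tensor `E` vanishes off the locally correlated band pattern of width `b`, the set
of `(i, j, l)` two of whose entries differ by at most `b`. -/
def BandSupported {n : ℕ} (b : ℕ) (E : Tensor n) : Prop :=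
  ∀ i j l : Fin n, ¬ InBand b l i j → E i j l = 0

/-- The triples `(A, B, C)` such that `A` and `B` have orthonormal columns. -/
def orthFactors (n r : ℕ) : Set (Fin 3 → Matrix (Fin n) (Fin r) ℝ) :=
  {F | (F 0)ᵀ * F 0 = 1 ∧ (F 1)ᵀ * F 1 = 1}

/-- `P` holds for generic `(A, B, C)` such that `A` and `B` have orthonormal columns: it holds
off the zero set of a polynomial in the entries which does not vanish identically on any
nonempty relatively open set of such triples. -/
def GenericOrth (n r : ℕ) (P : (A B C : Matrix (Fin n) (Fin r) ℝ) → Prop) : Prop :=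
  ∃ f : MvPolynomial (Fin 3 × Fin n × Fin r) ℝ,
    orthFactors n r ⊆
      closure {F | F ∈ orthFactors n r ∧ MvPolynomial.eval (fun x => F x.1 x.2.1 x.2.2) f ≠ 0} ∧
    ∀ F ∈ orthFactors n r, MvPolynomial.eval (fun x => F x.1 x.2.1 x.2.2) f ≠ 0 →
      P (F 0) (F 1) (F 2)

/-- Among all tensors of the same form (with orthonormal `aₖ` and orthonormal `bₖ`, and the same
number of terms), `∑ₖ aₖ ⊗ bₖ ⊗ cₖ` is determined by its entries off the band pattern. -/
def DeterminedOffBand {n r : ℕ} (b : ℕ) (A B C : Matrix (Fin n) (Fin r) ℝ) : Prop :=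
  ∀ A' B' C' : Matrix (Fin n) (Fin r) ℝ, A'ᵀ * A' = 1 → B'ᵀ * B' = 1 →
    (∀ i j l : Fin n, ¬ InBand b l i j → cpTensor A' B' C' i j l = cpTensor A B C i j l) →
    cpTensor A' B' C' = cpTensor A B C

/-! ### Alternating least squares -/

/-- Tuples of `m` square matrices. -/
abbrev Stack (m n : ℕ) : Type := Fin m → Matrix (Fin n) (Fin n) ℝ

/-- The Euclidean norm of a tuple of matrices. -/
noncomputable def stackNorm {m n : ℕ} (X : Stack m n) : ℝ :=
  Real.sqrt (∑ i, ∑ p, ∑ q, X i p q ^ 2)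

/-- `Y` minimizes `f` among all tuples that differ from `X` only in the entries in `D`. -/
def IsBlockMin {m n : ℕ} (f : Stack m n → ℝ) (D : Set (Fin m × Fin n × Fin n))
    (X Y : Stack m n) : Prop :=
  (∀ i p q, (i, p, q) ∉ D → Y i p q = X i p q) ∧
  ∀ Z : Stack m n, (∀ i p q, (i, p, q) ∉ D → Z i p q = X i p q) → f Y ≤ f Z

/-- `Y` arises from `X` by one sweep of alternating minimization of `f` over a list of blocks. -/
def IsSweep {m n : ℕ} (f : Stack m n → ℝ) :
    List (Set (Fin m × Fin n × Fin n)) → Stack m n → Stack m n → Prop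
  | [], X, Y => Y = X
  | D :: L, X, Y => ∃ W, IsBlockMin f D X W ∧ IsSweep f L W Y

/-- A sequence of iterates of alternating minimization, started at zero. -/
def IsAlternating {m n : ℕ} (f : Stack m n → ℝ) (L : List (Set (Fin m × Fin n × Fin n)))
    (X : ℕ → Stack m n) : Prop :=
  X 0 = 0 ∧ ∀ t, IsSweep f L (X t) (X (t + 1))

/-- The matrix `S(:, :, k)`, with `k` counted from zero. -/
def slice {n : ℕ} (S : Tensor n) (k : ℕ) : Matrix (Fin n) (Fin n) ℝ :=
  Matrix.of fun p q => if h : k < n then S p q ⟨k, h⟩ else 0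

/-- The numbers (counted from zero) of the distinguished slices; `i` is counted from zero too. -/
abbrev center (b i : ℕ) : ℕ := (2 * b + 1) * i

/-- The five distinguished slices. -/
def fiveSlices {n : ℕ} (b : ℕ) (S : Tensor n) : Stack 5 n := fun i => slice S (center b i)

/-- The positions at which the quadratic terms `Xⱼ Xᵢᵀ - Xᵢ Xⱼᵀ` may be nonzero, for slices
number `k` and `k'`. -/
abbrev InQuad (b k k' p q : ℕ) : Prop :=
  Near (2 * b) p q ∨ Near (2 * b) p k ∨ Near (2 * b) q k ∨ Near (2 * b) p k' ∨ Near (2 * b) q k'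

/-- The residual of the linear part of
`(Mᵢ - Xᵢ) (Mⱼ - Xⱼ)ᵀ = (Mⱼ - Xⱼ) (Mᵢ - Xᵢ)ᵀ`. -/
def residual₁ {n : ℕ} (M X : Stack 5 n) (i j : Fin 5) : Matrix (Fin n) (Fin n) ℝ :=
  X i * (M j)ᵀ - M j * (X i)ᵀ + M i * (X j)ᵀ - X j * (M i)ᵀ - (M i * (M j)ᵀ - M j * (M i)ᵀ)

/-- The least-squares objective of the first system of coupled Sylvester-like equations,
restricted to the entries without quadratic terms. -/
noncomputable def objective₁ {n : ℕ} (b : ℕ) (M X : Stack 5 n) : ℝ :=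
  ∑ i : Fin 5, ∑ j : Fin 5, ∑ p : Fin n, ∑ q : Fin n,
    if InQuad b (center b i) (center b j) p q then 0 else residual₁ M X i j p q ^ 2

/-- The blocks of the first stage, in order: for each slice `i`, the unknown entries in the row
`l`, for each `l` at distance more than `2b` from the number of that slice. -/
def rowBlocks (b n : ℕ) : List (Set (Fin 5 × Fin n × Fin n)) :=
  (List.finRange 5).flatMap fun i =>
    ((List.finRange n).filter fun l : Fin n => ¬ Near (2 * b) l (center b i)).map fun l : Fin n =>
      {x | x.1 = i ∧ x.2.1 = l ∧ InBand b (center b i) x.2.1 x.2.2}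

/-- What the first stage has to find: the noise in the five slices, in the rows at distance more
than `2b` from the number of the slice. -/
def outerNoise {n : ℕ} (b : ℕ) (E : Tensor n) : Stack 5 n := fun i =>
  Matrix.of fun p q => if Near (2 * b) p (center b i) then 0 else fiveSlices b E i p q

/-- The data of the second stage: the first, third and fifth distinguished slice, corrected by
the outcome `X` of the first stage. -/
def threeSlices {n : ℕ} (b : ℕ) (S : Tensor n) (X : Stack 5 n) : Stack 3 n :=
  ![fiveSlices b S 0 - X 0, fiveSlices b S 2 - X 2, fiveSlices b S 4 - X 4]

/-- The least-squares objective of the second system,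
`(Mᵢ - Zᵢ)ᵀ (Mⱼ - Zⱼ) = (Mⱼ - Zⱼ)ᵀ (Mᵢ - Zᵢ)`. -/
noncomputable def objective₂ {n : ℕ} (M Z : Stack 3 n) : ℝ :=
  ∑ i : Fin 3, ∑ j : Fin 3, ∑ p : Fin n, ∑ q : Fin n,
    ((M i - Z i)ᵀ * (M j - Z j) - (M j - Z j)ᵀ * (M i - Z i)) p q ^ 2

/-- The blocks of the second stage, in order: for each of the three slices, for each column `l`,
the unknown entries of that column in the rows at distance at most `2b` from the number of the
slice. -/
def columnBlocks (b n : ℕ) : List (Set (Fin 3 × Fin n × Fin n)) :=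
  (List.finRange 3).flatMap fun i =>
    (List.finRange n).map fun l : Fin n =>
      {x | x.1 = i ∧ x.2.2 = l ∧ Near (2 * b) x.2.1 (center b (2 * i)) ∧
        InBand b (center b (2 * i)) x.2.1 x.2.2}

/-! ### A random access machine with exact real arithmetic

Programs have registers for natural numbers (used as sizes and indices, with addition and
truncated subtraction only) and arrays of real numbers with three indices. Every program
halts; the semantics computes the final memory and the number of steps. -/

/-- The memory: `reg x` is the register `x`, `mem a i j l` is the entry `(i, j, l)` of the
array `a`. -/
structure Memory where
  reg : ℕ → ℕ
  mem : ℕ → ℕ → ℕ → ℕ → ℝ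

/-- Index expressions. -/
inductive IndexExpr where
  | reg (x : ℕ)
  | lit (c : ℕ)
  | plus (e f : IndexExpr)
  | minus (e f : IndexExpr)

/-- The value of an index expression. -/
def IndexExpr.eval (s : Memory) : IndexExpr → ℕ
  | .reg x => s.reg x
  | .lit c => c
  | .plus e f => e.eval s + f.eval s
  | .minus e f => e.eval s - f.eval s

/-- The number of steps for evaluating an index expression. -/
def IndexExpr.cost : IndexExpr → ℕ
  | .reg _ => 1
  | .lit _ => 1
  | .plus e f => e.cost + f.cost + 1
  | .minus e f => e.cost + f.cost + 1

/-- Real expressions. -/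
inductive RealExpr where
  | lit (c : ℕ)
  | get (a : ℕ) (i j l : IndexExpr)
  | plus (e f : RealExpr)
  | minus (e f : RealExpr)
  | times (e f : RealExpr)
  | over (e f : RealExpr)

/-- The value of a real expression (the quotient by zero is zero). -/
noncomputable def RealExpr.eval (s : Memory) : RealExpr → ℝ
  | .lit c => c
  | .get a i j l => s.mem a (i.eval s) (j.eval s) (l.eval s)
  | .plus e f => e.eval s + f.eval s
  | .minus e f => e.eval s - f.eval s
  | .times e f => e.eval s * f.eval s
  | .over e f => e.eval s / f.eval s

/-- The number of steps for evaluating a real expression. -/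
def RealExpr.cost : RealExpr → ℕ
  | .lit _ => 1
  | .get _ i j l => i.cost + j.cost + l.cost + 1
  | .plus e f => e.cost + f.cost + 1
  | .minus e f => e.cost + f.cost + 1
  | .times e f => e.cost + f.cost + 1
  | .over e f => e.cost + f.cost + 1

/-- Tests. -/
inductive Test where
  | indexLe (e f : IndexExpr)
  | realLe (e f : RealExpr)

/-- The meaning of a test. -/
def Test.Holds (s : Memory) : Test → Prop
  | .indexLe e f => e.eval s ≤ f.eval s
  | .realLe e f => e.eval s ≤ f.eval s

/-- The number of steps for a test. -/
def Test.cost : Test → ℕ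
  | .indexLe e f => e.cost + f.cost + 1
  | .realLe e f => e.cost + f.cost + 1

/-- Programs. `loop x e c` evaluates `e` once and runs `c` with the register `x` set to
`0, 1, …, e - 1` in turn. `eigen d a v w` is a spectral decomposition: it reads the
symmetric matrix `(mem a i j 0)` with `i, j < d`, and stores an orthonormal basis of
eigenvectors as the columns of the array `v` and the eigenvalues in the array `w`. -/
inductive Prog where
  | skip
  | seq (c c' : Prog)
  | setReg (x : ℕ) (e : IndexExpr)
  | setMem (a : ℕ) (i j l : IndexExpr) (e : RealExpr)
  | branch (t : Test) (c c' : Prog)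
  | loop (x : ℕ) (e : IndexExpr) (c : Prog)
  | eigen (d : IndexExpr) (a v w : ℕ)

/-- The program uses nothing but the four arithmetic operations and comparisons. -/
def Prog.Arithmetic : Prog → Prop
  | .skip => True
  | .seq c c' => c.Arithmetic ∧ c'.Arithmetic
  | .setReg _ _ => True
  | .setMem _ _ _ _ _ => True
  | .branch _ c c' => c.Arithmetic ∧ c'.Arithmetic
  | .loop _ _ c => c.Arithmetic
  | .eigen _ _ _ _ => False

/-- A routine for spectral decompositions `M = V diag(w) Vᵀ` of real symmetric matrices. Nothing
is required of the choice of the decomposition, nor of the outcome on other matrices. -/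
structure EigenSolver where
  vec : (d : ℕ) → Matrix (Fin d) (Fin d) ℝ → Matrix (Fin d) (Fin d) ℝ
  val : (d : ℕ) → Matrix (Fin d) (Fin d) ℝ → Fin d → ℝ
  orthonormal : ∀ d M, Mᵀ = M → (vec d M)ᵀ * vec d M = 1
  decomposition : ∀ d M, Mᵀ = M → vec d M * Matrix.diagonal (val d M) * (vec d M)ᵀ = M

theorem exists_spectral_decomposition (d : ℕ) (M : Matrix (Fin d) (Fin d) ℝ) :
    ∃ x : Matrix (Fin d) (Fin d) ℝ × (Fin d → ℝ),
      Mᵀ = M → x.1ᵀ * x.1 = 1 ∧ x.1 * Matrix.diagonal x.2 * x.1ᵀ = M := by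
  by_cases h : Mᵀ = M
  · have hM : M.IsHermitian := by
      rw [Matrix.IsHermitian, Matrix.conjTranspose_eq_transpose_of_trivial, h]
    refine ⟨((hM.eigenvectorUnitary : Matrix (Fin d) (Fin d) ℝ), hM.eigenvalues), fun _ => ?_⟩
    have h1 := Unitary.coe_star_mul_self hM.eigenvectorUnitary
    have h2 := hM.spectral_theorem
    simp only [Unitary.conjStarAlgAut_apply, Matrix.star_eq_conjTranspose,
      Matrix.conjTranspose_eq_transpose_of_trivial] at h1 h2
    exact ⟨h1, h2.symm⟩
  · exact ⟨(0, 0), fun h' => absurd h' h⟩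

/-- Spectral decompositions exist. -/
instance : Nonempty EigenSolver :=
  ⟨{ vec := fun d M => (exists_spectral_decomposition d M).choose.1
     val := fun d M => (exists_spectral_decomposition d M).choose.2
     orthonormal := fun d M h => ((exists_spectral_decomposition d M).choose_spec h).1
     decomposition := fun d M h => ((exists_spectral_decomposition d M).choose_spec h).2 }⟩

/-- Set a register. -/
def Memory.setReg (s : Memory) (x v : ℕ) : Memory :=
  { s with reg := Function.update s.reg x v }

/-- Set an entry of an array. -/
def Memory.setMem (s : Memory) (a i j l : ℕ) (v : ℝ) : Memory :=
  { s with mem := fun a' i' j' l' =>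
      if a' = a ∧ i' = i ∧ j' = j ∧ l' = l then v else s.mem a' i' j' l' }

/-- Store a spectral decomposition. -/
def Memory.setEigen (eig : EigenSolver) (s : Memory) (d a v w : ℕ) : Memory :=
  let M : Matrix (Fin d) (Fin d) ℝ := Matrix.of fun i j => s.mem a i j 0
  { s with mem := fun a' i' j' l' =>
      if h : a' = v ∧ (i' < d ∧ j' < d) ∧ l' = 0 then eig.vec d M ⟨i', h.2.1.1⟩ ⟨j', h.2.1.2⟩
      else if h : a' = w ∧ i' < d ∧ j' = 0 ∧ l' = 0 then eig.val d M ⟨i', h.2.1⟩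
      else s.mem a' i' j' l' }

/-- Run `f 0, f 1, …, f (k - 1)` in turn, adding up the numbers of steps. -/
def runLoop (f : ℕ → Memory → Memory × ℕ) : ℕ → Memory → Memory × ℕ
  | 0, s => (s, 0)
  | k + 1, s =>
      let u := runLoop f k s
      let v := f k u.1
      (v.1, u.2 + v.2 + 1)

open Classical in
/-- The final memory and the number of steps. A spectral decomposition of a `d × d` matrix
counts as `d ^ 3` steps. -/
noncomputable def Prog.run (eig : EigenSolver) : Prog → Memory → Memory × ℕ
  | .skip, s => (s, 1)
  | .seq c c', s =>
      let u := c.run eig s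
      let v := c'.run eig u.1
      (v.1, u.2 + v.2)
  | .setReg x e, s => (s.setReg x (e.eval s), e.cost + 1)
  | .setMem a i j l e, s =>
      (s.setMem a (i.eval s) (j.eval s) (l.eval s) (e.eval s),
        i.cost + j.cost + l.cost + e.cost + 1)
  | .branch t c c', s =>
      let u := if t.Holds s then c.run eig s else c'.run eig s
      (u.1, u.2 + t.cost)
  | .loop x e c, s =>
      let u := runLoop (fun k s' => c.run eig (s'.setReg x k)) (e.eval s) s
      (u.1, u.2 + e.cost + 1)
  | .eigen d a v w, s => (s.setEigen eig (d.eval s) a v w, (d.eval s) ^ 3 + d.cost + 1)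

/-- The input: the registers `0, 1, 2, 3` hold `n, r, b, N`, the array `0` holds the tensor `S`,
and everything else is zero. -/
def input (n r b N : ℕ) (S : Tensor n) : Memory where
  reg x := if x = 0 then n else if x = 1 then r else if x = 2 then b else if x = 3 then N else 0
  mem a i j l :=
    if h : a = 0 ∧ i < n ∧ j < n ∧ l < n then S ⟨i, h.2.1⟩ ⟨j, h.2.2.1⟩ ⟨l, h.2.2.2⟩ else 0

/-- The tensor stored in the array `a`. -/
def Memory.tensor (s : Memory) (n a : ℕ) : Tensor n := fun i j l => s.mem a i j l

/-- The tuple of square matrices stored in the array `a`. -/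
def Memory.stack (s : Memory) (m n a : ℕ) : Stack m n :=
  fun i => Matrix.of fun p q => s.mem a i p q

/-- The `n × r` matrix stored in the array `a`. -/
def Memory.matrix (s : Memory) (n r a : ℕ) : Matrix (Fin n) (Fin r) ℝ :=
  Matrix.of fun i k => s.mem a i k 0

set_option linter.unusedSimpArgs false
set_option linter.unusedSectionVars false
set_option linter.unusedVariables false

/-! Every slice of the tensor is `A diag(w) Bᵀ`. Since `B` has orthonormal columns, `Tᵢ Tⱼᵀ = A
diag(wᵢ wⱼ) Aᵀ` is symmetric in `i` and `j`; since `A` has, so is `Tᵢᵀ Tⱼ`. These identities are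
quadratic equations for the noise, but its band shape makes them linear where it matters. Off the
positions `InQuad` the supports of a row of `Xᵢ` and a row of `Xⱼ` do not meet
(`sparse_mul_transpose`), so the products of unknowns vanish there, and so do the products of
unknowns with the noise hidden in the data (`sylv_sparse`). The first stage is therefore a linear
system whose homogeneous part depends on `T` alone. What it leaves are the rows close to the number
of the slice. For the first, third and fifth distinguished slice these row windows are disjoint, so
in the equations `Tᵢᵀ Tⱼ = Tⱼᵀ Tᵢ` all quadratic terms vanish (`inner_mul_eq_zero`), and the second
stage is linear as well.

The two homogeneous systems have only the zero solution for generic factors (`generic_injective₁`,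
`generic_injective₂`). Injectivity is the nonvanishing of a Gram determinant, a polynomial, so
examples suffice, provided that a polynomial which vanishes on an open piece of the set of triples
vanishes at one of the examples. The set need not be connected when `r = n`. Products of two
reflections are joined to the identity by analytic paths, and every matrix with orthonormal columns
is reached by reflections up to a sign of its first column (`localZeros_move`). Hence an example has
to work for all signs of the first columns of `A` and `B`; for conditions on the tensor alone the
signs are absorbed by `C`.

Once the first slice `T = A diag(d) Bᵀ` is known and the `d k` are nonzero with distinct squares,
the matrices `(T Tᵀ) ^ k T` with `k < r` span all `A diag(w) Bᵀ`, by a Vandermonde determinant.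
Generically the known entries in two rows determine an element of this span (`ProbeInjective`), so
every other slice follows by linear algebra. This gives uniqueness (`determinedOffBand`) and the
exact program. The latter solves the two large systems in the Krylov space of their normal operator,
where Cayley–Hamilton places the solution (`krylov_solution`), with a small system solved by
successive orthogonal projections, which need neither pivoting nor square roots.

For alternating least squares the point is an abstract contraction. During a sweep the objective
drops by the sum of the squares of the step lengths, while every block gradient at the end is
bounded by the total step length, because it was zero just after its own step
(`BlockSweep.exists_bound`). With injectivity this bounds the remaining distance by the drop, so
each sweep contracts. The second stage works with data that are wrong by a geometrically small
amount; uniform rates for nearby systems show that `N` sweeps on the `N`-th system still converge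
geometrically (`geometricDecay_diagonal`). For the output, suitable polynomials in `T Tᵀ` converge
to the projections onto the `aₖ`, so one eigenvector of each approximation follows each `aₖ` up to
sign; these have the `r` largest eigenvalues in the end (`exists_top_vectors`). The product of the
computed columns of `A` and `B` does not see the sign, and the least-squares fit of `C` is stable
(`geometricLimit_leastSquares`).

The programs are written as simultaneous assignments of terms with bounded sums, compiled once and
for all. The step count is reduced to a decidable check on the nesting of loops (`exists_cost_le`):
the product of the bounds of all enclosing loops must stay within the budget. The budget of a sweep
is met because the products `(Xᵢ - Mᵢ / 2) Mⱼᵀ` are updated with each row and are not recomputed. -/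

section
open Finset (range sum_congr mem_range sum_range sum_mul mul_sum sum_comm sum_sub_distrib
  induction_on sum_insert univ mem_univ sum_nonneg sum_eq_zero subset_univ card_map card_le_card
  Icc mem_map mem_filter sum_eq_single card_union_le mem_union sum_add_distrib sum_pos' card_univ
  smul_sum sum_le_sum sum_const card_range abs_sum_le_sum_abs sum_ite_eq' sum_mul_sum mem_image)
open Matrix (dotProduct_mulVec mulVec_transpose mulVec_mulVec vecMulVec transpose_sub
  transpose_smul sub_mulVec smul_mulVec one_apply mulVec of_apply mulVecLin transpose_apply
  mul_apply diagonal transpose_add smul_mul cons_val_zero mul_diagonal diagonal_mul_diagonal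
  transpose_transpose vandermonde one_apply_eq)

local notation "Mat" n:max r:max => Matrix (Fin n) (Fin r) ℝ

/-! ### Execution of programs -/

/-- The final memory. -/
noncomputable def Prog.exec (eig : EigenSolver) (c : Prog) (s : Memory) : Memory :=
  (c.run eig s).1

/-- Iteration of indexed state transformers. -/
def iterFrom (f : ℕ → Memory → Memory) : ℕ → Memory → Memory
  | 0, s => s
  | k + 1, s => f k (iterFrom f k s)

theorem runLoop_fst (f : ℕ → Memory → Memory × ℕ) (k : ℕ) (s : Memory) :
    (runLoop f k s).1 = iterFrom (fun j t => (f j t).1) k s := by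
  induction k with
  | zero => rfl
  | succ k ih => simp [runLoop, iterFrom, ih]

section exec
variable (eig : EigenSolver) (s : Memory)

theorem exec_skip : Prog.skip.exec eig s = s := rfl

theorem exec_seq (c c' : Prog) : (c.seq c').exec eig s = c'.exec eig (c.exec eig s) := rfl

theorem exec_setReg (x : ℕ) (e : IndexExpr) :
    (Prog.setReg x e).exec eig s = s.setReg x (e.eval s) := rfl

theorem exec_setMem (a : ℕ) (i j l : IndexExpr) (e : RealExpr) :
    (Prog.setMem a i j l e).exec eig s =
      s.setMem a (i.eval s) (j.eval s) (l.eval s) (e.eval s) := rfl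

open Classical in
theorem exec_branch (t : Test) (c c' : Prog) :
    (Prog.branch t c c').exec eig s = if t.Holds s then c.exec eig s else c'.exec eig s := by
  simp only [Prog.exec, Prog.run]
  split_ifs <;> rfl

theorem exec_loop (x : ℕ) (e : IndexExpr) (c : Prog) :
    (Prog.loop x e c).exec eig s =
      iterFrom (fun k t => c.exec eig (t.setReg x k)) (e.eval s) s := by
  simp only [Prog.exec, Prog.run, runLoop_fst]

theorem exec_eigen (d : IndexExpr) (a v w : ℕ) :
    (Prog.eigen d a v w).exec eig s = s.setEigen eig (d.eval s) a v w := rfl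
end exec

/-- Programs are executed symbolically from an equation for the final memory. Each instruction
peeled off yields a new variable for the intermediate memory, so that terms do not grow. -/
theorem of_eq_seq {eig : EigenSolver} {s u : Memory} {c c' : Prog}
    (hu : u = (c.seq c').exec eig s) : ∃ t, t = c.exec eig s ∧ u = c'.exec eig t := ⟨_, rfl, hu⟩

theorem iterFrom_induction {f : ℕ → Memory → Memory} {m : ℕ} {s : Memory}
    (I : ℕ → Memory → Prop) (h0 : I 0 s) (hs : ∀ k < m, ∀ t, I k t → I (k + 1) (f k t)) :
    I m (iterFrom f m s) := by
  have : ∀ k ≤ m, I k (iterFrom f k s) := by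
    intro k
    induction k with
    | zero => exact fun _ => h0
    | succ k ih => exact fun hk => hs k hk _ (ih (by omega))
  exact this m le_rfl

theorem exec_loop_induction (eig : EigenSolver) {s : Memory} {x : ℕ} {e : IndexExpr} {c : Prog}
    (I : ℕ → Memory → Prop) (h0 : I 0 s)
    (hs : ∀ k < e.eval s, ∀ t, I k t → I (k + 1) (c.exec eig (t.setReg x k))) :
    I (e.eval s) ((Prog.loop x e c).exec eig s) := by
  rw [exec_loop]
  exact iterFrom_induction I h0 hs

theorem of_eq_loop_seq {eig : EigenSolver} {s u : Memory} {x : ℕ} {e : IndexExpr} {c c' : Prog}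
    (hu : u = ((Prog.loop x e c).seq c').exec eig s) (P : ℕ → Memory → Prop) (h0 : P 0 s)
    (h : ∀ k < e.eval s, ∀ t, P k t → ∀ v, v = c.exec eig (t.setReg x k) → P (k + 1) v) :
    ∃ t, u = c'.exec eig t ∧ P (e.eval s) t :=
  ⟨_, hu, exec_loop_induction eig P h0 fun k hk t ht => h k hk t ht _ rfl⟩

@[simp] theorem Memory.setReg_mem (s : Memory) (x v : ℕ) : (s.setReg x v).mem = s.mem := rfl

theorem Memory.setReg_reg (s : Memory) (x v y : ℕ) :
    (s.setReg x v).reg y = if y = x then v else s.reg y := by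
  simp [Memory.setReg, Function.update_apply]

@[simp] theorem Memory.setMem_reg (s : Memory) (a i j l : ℕ) (v : ℝ) :
    (s.setMem a i j l v).reg = s.reg := rfl

theorem Memory.setMem_mem (s : Memory) (a i j l : ℕ) (v : ℝ) (a' i' j' l' : ℕ) :
    (s.setMem a i j l v).mem a' i' j' l' =
      if a' = a ∧ i' = i ∧ j' = j ∧ l' = l then v else s.mem a' i' j' l' := rfl

/-! ### Expressions with sums and case distinctions -/

instance : Add IndexExpr := ⟨.plus⟩
instance : Sub IndexExpr := ⟨.minus⟩
instance {k : ℕ} : OfNat IndexExpr k := ⟨.lit k⟩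

theorem IndexExpr.eval_add (s : Memory) (e f : IndexExpr) :
    (e + f).eval s = e.eval s + f.eval s := rfl
theorem IndexExpr.eval_sub (s : Memory) (e f : IndexExpr) :
    (e - f).eval s = e.eval s - f.eval s := rfl
theorem IndexExpr.eval_ofNat (s : Memory) (k : ℕ) :
    (OfNat.ofNat k : IndexExpr).eval s = k := rfl

/-- Real expressions with bounded sums (`sum x e E` binds the register `x`) and case
distinctions. -/
inductive Term where
  | lit (c : ℕ)
  | get (a : ℕ) (i j l : IndexExpr)
  | plus (E F : Term)
  | minus (E F : Term)
  | times (E F : Term)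
  | quot (E F : Term)
  | sum (x : ℕ) (e : IndexExpr) (E : Term)
  | ite (t : Test) (E F : Term)

instance : Add Term := ⟨.plus⟩
instance : Sub Term := ⟨.minus⟩
instance : Mul Term := ⟨.times⟩
instance : Div Term := ⟨.quot⟩
instance {k : ℕ} : OfNat Term k := ⟨.lit k⟩

open Classical in
/-- The value of a term. -/
noncomputable def Term.eval : Term → Memory → ℝ
  | .lit c, _ => c
  | .get a i j l, s => s.mem a (i.eval s) (j.eval s) (l.eval s)
  | .plus E F, s => E.eval s + F.eval s
  | .minus E F, s => E.eval s - F.eval s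
  | .times E F, s => E.eval s * F.eval s
  | .quot E F, s => E.eval s / F.eval s
  | .sum x e E, s => ∑ k ∈ range (e.eval s), E.eval (s.setReg x k)
  | .ite t E F, s => if t.Holds s then E.eval s else F.eval s

theorem Term.eval_add (s : Memory) (E F : Term) : (E + F).eval s = E.eval s + F.eval s := rfl
theorem Term.eval_sub (s : Memory) (E F : Term) : (E - F).eval s = E.eval s - F.eval s := rfl
theorem Term.eval_mul (s : Memory) (E F : Term) : (E * F).eval s = E.eval s * F.eval s := rfl
theorem Term.eval_div (s : Memory) (E F : Term) : (E / F).eval s = E.eval s / F.eval s := rfl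
theorem Term.eval_ofNat (s : Memory) (k : ℕ) : (OfNat.ofNat k : Term).eval s = (k : ℝ) := rfl
theorem Term.eval_get (s : Memory) (a : ℕ) (i j l : IndexExpr) :
    (Term.get a i j l).eval s = s.mem a (i.eval s) (j.eval s) (l.eval s) := rfl
theorem Term.eval_sum (s : Memory) (x : ℕ) (e : IndexExpr) (E : Term) :
    (Term.sum x e E).eval s = ∑ k ∈ range (e.eval s), E.eval (s.setReg x k) := rfl

/-- The array that holds intermediate results. -/
abbrev scratch : ℕ := 20

/-- Registers below this bound are available in terms. -/
abbrev regBound : ℕ := 1000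

/-- Higher registers are reserved: compiled sums save the old value of their bound register there.
-/
def IndexExpr.low : IndexExpr → Bool
  | .reg x => decide (x < regBound)
  | .lit _ => true
  | .plus e f => e.low && f.low
  | .minus e f => e.low && f.low

def RealExpr.avoids (L : List ℕ) : RealExpr → Bool
  | .lit _ => true
  | .get a i j l => !(L.contains a) && i.low && j.low && l.low
  | .plus e f => e.avoids L && f.avoids L
  | .minus e f => e.avoids L && f.avoids L
  | .times e f => e.avoids L && f.avoids L
  | .over e f => e.avoids L && f.avoids L

def Test.avoids (L : List ℕ) : Test → Bool
  | .indexLe e f => e.low && f.low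
  | .realLe e f => e.avoids L && f.avoids L

/-- The term does not read the arrays in the list `L`. -/
def Term.avoids (L : List ℕ) : Term → Bool
  | .lit _ => true
  | .get a i j l => !(L.contains a) && i.low && j.low && l.low
  | .plus E F => E.avoids L && F.avoids L
  | .minus E F => E.avoids L && F.avoids L
  | .times E F => E.avoids L && F.avoids L
  | .quot E F => E.avoids L && F.avoids L
  | .sum x e E => decide (x < regBound) && e.low && E.avoids L
  | .ite t E F => t.avoids L && E.avoids L && F.avoids L

/-- Two memories agree up to the arrays in `L` and the high registers. -/
def Agree (L : List ℕ) (s t : Memory) : Prop :=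
  (∀ x < regBound, s.reg x = t.reg x) ∧ ∀ a, a ∉ L → s.mem a = t.mem a

theorem Agree.trans {L : List ℕ} {s t u : Memory} (h : Agree L s t) (h' : Agree L t u) :
    Agree L s u :=
  ⟨fun x hx => (h.1 x hx).trans (h'.1 x hx), fun a ha => (h.2 a ha).trans (h'.2 a ha)⟩

theorem Agree.setReg {L : List ℕ} {s t : Memory} (h : Agree L s t) (x v : ℕ) :
    Agree L (s.setReg x v) (t.setReg x v) := by
  refine ⟨fun y hy => ?_, fun a ha => h.2 a ha⟩
  simp only [Memory.setReg_reg]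
  split_ifs
  · rfl
  · exact h.1 y hy

theorem IndexExpr.eval_congr {L : List ℕ} {s t : Memory} (h : Agree L s t) (e : IndexExpr)
    (he : e.low = true) : e.eval s = e.eval t := by
  induction e with
  | reg x => exact h.1 x (by simpa [IndexExpr.low] using he)
  | lit c => rfl
  | plus e f ihe ihf =>
    simp only [IndexExpr.low, Bool.and_eq_true] at he
    simp only [IndexExpr.eval, ihe he.1, ihf he.2]
  | minus e f ihe ihf =>
    simp only [IndexExpr.low, Bool.and_eq_true] at he
    simp only [IndexExpr.eval, ihe he.1, ihf he.2]

theorem RealExpr.eval_congr {L : List ℕ} {s t : Memory} (h : Agree L s t) (e : RealExpr)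
    (he : e.avoids L = true) : e.eval s = e.eval t := by
  induction e with
  | lit c => rfl
  | get a i j l =>
    simp only [RealExpr.avoids, Bool.and_eq_true, Bool.not_eq_true', List.contains_eq_mem,
      decide_eq_false_iff_not] at he
    simp only [RealExpr.eval, IndexExpr.eval_congr h i he.1.1.2, IndexExpr.eval_congr h j he.1.2,
      IndexExpr.eval_congr h l he.2, h.2 a he.1.1.1]
  | _ e f ihe ihf =>
    simp only [RealExpr.avoids, Bool.and_eq_true] at he
    simp only [RealExpr.eval, ihe he.1, ihf he.2]

theorem Test.holds_congr {L : List ℕ} {s t : Memory} (h : Agree L s t) (e : Test)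
    (he : e.avoids L = true) : e.Holds s ↔ e.Holds t := by
  cases e with
  | indexLe e f =>
    simp only [Test.avoids, Bool.and_eq_true] at he
    simp only [Test.Holds, IndexExpr.eval_congr h e he.1, IndexExpr.eval_congr h f he.2]
  | realLe e f =>
    simp only [Test.avoids, Bool.and_eq_true] at he
    simp only [Test.Holds, RealExpr.eval_congr h e he.1, RealExpr.eval_congr h f he.2]

theorem Term.eval_congr {L : List ℕ} (E : Term) (hE : E.avoids L = true) {s t : Memory}
    (h : Agree L s t) : E.eval s = E.eval t := by
  induction E generalizing s t with
  | lit c => rfl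
  | get a i j l =>
    simp only [Term.avoids, Bool.and_eq_true, Bool.not_eq_true', List.contains_eq_mem,
      decide_eq_false_iff_not] at hE
    simp only [Term.eval, IndexExpr.eval_congr h i hE.1.1.2, IndexExpr.eval_congr h j hE.1.2,
      IndexExpr.eval_congr h l hE.2, h.2 a hE.1.1.1]
  | plus E F ihe ihf | minus E F ihe ihf | times E F ihe ihf | quot E F ihe ihf =>
    simp only [Term.avoids, Bool.and_eq_true] at hE
    simp only [Term.eval, ihe hE.1 h, ihf hE.2 h]
  | sum x e E ih =>
    simp only [Term.avoids, Bool.and_eq_true] at hE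
    simp only [Term.eval, IndexExpr.eval_congr h e hE.1.2]
    exact sum_congr rfl fun k _ => ih hE.2 (h.setReg x k)
  | ite c E F ihe ihf =>
    simp only [Term.avoids, Bool.and_eq_true] at hE
    have hc := Test.holds_congr h c hE.1.1
    simp only [Term.eval, ihe hE.1.2 h, ihf hE.2 h]
    by_cases h' : c.Holds t
    · rw [if_pos h', if_pos (hc.2 h')]
    · rw [if_neg h', if_neg fun h'' => h' (hc.1 h'')]

/-- The entry number `d` of the scratch array. -/
def scratchGet (d : ℕ) : RealExpr := .get scratch (.lit d) (.lit 0) (.lit 0)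

/-- Store the value of a real expression in the entry number `d` of the scratch array. -/
def scratchSet (d : ℕ) (e : RealExpr) : Prog := .setMem scratch (.lit d) (.lit 0) (.lit 0) e

/-- A program that stores the value of the term in the entry number `d` of the scratch array. -/
def Term.compile : Term → ℕ → Prog
  | .lit c, d => scratchSet d (.lit c)
  | .get a i j l, d => scratchSet d (.get a i j l)
  | .plus E F, d => (E.compile d).seq ((F.compile (d + 1)).seq
      (scratchSet d (.plus (scratchGet d) (scratchGet (d + 1)))))
  | .minus E F, d => (E.compile d).seq ((F.compile (d + 1)).seq
      (scratchSet d (.minus (scratchGet d) (scratchGet (d + 1)))))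
  | .times E F, d => (E.compile d).seq ((F.compile (d + 1)).seq
      (scratchSet d (.times (scratchGet d) (scratchGet (d + 1)))))
  | .quot E F, d => (E.compile d).seq ((F.compile (d + 1)).seq
      (scratchSet d (.over (scratchGet d) (scratchGet (d + 1)))))
  | .sum x e E, d => (Prog.setReg (regBound + d) (.reg x)).seq ((scratchSet d (.lit 0)).seq
      ((Prog.loop x e ((E.compile (d + 1)).seq
        (scratchSet d (.plus (scratchGet d) (scratchGet (d + 1)))))).seq
      (Prog.setReg x (.reg (regBound + d)))))
  | .ite t E F, d => .branch t (E.compile d) (F.compile d)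

theorem exec_scratchSet_agree (eig : EigenSolver) (L : List ℕ) (hL : scratch ∈ L) (d : ℕ)
    (e : RealExpr) (s : Memory) : Agree L ((scratchSet d e).exec eig s) s := by
  refine ⟨fun x _ => rfl, fun a ha => ?_⟩
  funext i j l
  rw [scratchSet, exec_setMem, Memory.setMem_mem, if_neg]
  rintro ⟨rfl, -⟩
  exact ha hL

theorem exec_scratchSet_mem (eig : EigenSolver) (d : ℕ) (e : RealExpr) (s : Memory) (i : ℕ) :
    ((scratchSet d e).exec eig s).mem scratch i 0 0 =
      if i = d then e.eval s else s.mem scratch i 0 0 := by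
  simp only [scratchSet, exec_setMem, Memory.setMem_mem, IndexExpr.eval, and_true, true_and]

/-- The program `c` stores the real number `v s` in the entry number `d` of the scratch array. -/
def Computes (eig : EigenSolver) (c : Prog) (d : ℕ) (v : Memory → ℝ) : Prop :=
  ∀ s t, t = c.exec eig s → Agree [scratch] t s ∧
    (∀ i < d, t.mem scratch i 0 0 = s.mem scratch i 0 0) ∧
    (∀ i < d, t.reg (regBound + i) = s.reg (regBound + i)) ∧ t.mem scratch d 0 0 = v s

theorem Computes.scratchSet (eig : EigenSolver) (d : ℕ) (e : RealExpr) :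
    Computes eig (scratchSet d e) d e.eval := by
  rintro s _ rfl
  refine ⟨exec_scratchSet_agree eig _ (by simp) d _ s, fun i hi => ?_, fun i hi => rfl, ?_⟩ <;>
    rw [exec_scratchSet_mem]
  · rw [if_neg (by omega)]
  · rw [if_pos rfl]

/-- The number `d` is the height of a stack in the scratch array. A subterm compiled at `d + 1`
leaves everything below untouched, so the left operand in entry `d` survives the evaluation of the
right one; a sum accumulates in entry `d` and keeps the former value of its register in the register
`regBound + d`. -/
theorem Term.compile_spec (eig : EigenSolver) (L : List ℕ) (hL : scratch ∈ L) (E : Term)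
    (hE : E.avoids L = true) (d : ℕ) : Computes eig (E.compile d) d E.eval := by
  have hsub : ∀ {s t : Memory}, Agree [scratch] s t → Agree L s t := fun h =>
    ⟨h.1, fun a ha => h.2 a (by rintro h'; simp at h'; exact ha (h' ▸ hL))⟩
  have hs : scratch ∈ [scratch] := by simp
  -- The four arithmetic operations share one argument.
  have binary : ∀ (E F : Term) (op : RealExpr → RealExpr → RealExpr) (f : ℝ → ℝ → ℝ),
      (∀ e e' s, (op e e').eval s = f (e.eval s) (e'.eval s)) →
      E.avoids L = true → F.avoids L = true →
      (∀ d, Computes eig (E.compile d) d E.eval) → (∀ d, Computes eig (F.compile d) d F.eval) →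
      ∀ d, Computes eig ((E.compile d).seq ((F.compile (d + 1)).seq
        (Prog.setMem scratch (.lit d) (.lit 0) (.lit 0) (op (scratchGet d) (scratchGet (d + 1))))))
        d fun s => f (E.eval s) (F.eval s) := by
    rintro E F op f hop hE hF ihE ihF d s u hu
    obtain ⟨s1, e1, hu⟩ := of_eq_seq hu
    obtain ⟨s2, e2, hu⟩ := of_eq_seq hu
    obtain ⟨h1, h2, h3, h4⟩ := ihE d s s1 e1
    obtain ⟨k1, k2, k3, k4⟩ := ihF (d + 1) s1 s2 e2
    obtain ⟨l1, l2, l3, l4⟩ := Computes.scratchSet eig d _ s2 u hu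
    refine ⟨l1.trans (k1.trans h1), fun i hi => (l2 i hi).trans ((k2 i (by omega)).trans (h2 i hi)),
      fun i hi => (l3 i hi).trans ((k3 i (by omega)).trans (h3 i hi)), l4.trans ?_⟩
    simp only [hop, scratchGet, RealExpr.eval, IndexExpr.eval]
    rw [k2 d (by omega), h4, k4, Term.eval_congr F hF (hsub h1)]
  induction E generalizing d with
  | lit c => exact Computes.scratchSet eig d (.lit c)
  | get a i j l => exact Computes.scratchSet eig d (.get a i j l)
  | plus E F ihe ihf =>
    simp only [Term.avoids, Bool.and_eq_true] at hE
    exact binary E F .plus (· + ·) (fun _ _ _ => rfl) hE.1 hE.2 (ihe hE.1) (ihf hE.2) d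
  | minus E F ihe ihf =>
    simp only [Term.avoids, Bool.and_eq_true] at hE
    exact binary E F .minus (· - ·) (fun _ _ _ => rfl) hE.1 hE.2 (ihe hE.1) (ihf hE.2) d
  | times E F ihe ihf =>
    simp only [Term.avoids, Bool.and_eq_true] at hE
    exact binary E F .times (· * ·) (fun _ _ _ => rfl) hE.1 hE.2 (ihe hE.1) (ihf hE.2) d
  | quot E F ihe ihf =>
    simp only [Term.avoids, Bool.and_eq_true] at hE
    exact binary E F RealExpr.over (· / ·) (fun _ _ _ => rfl) hE.1 hE.2 (ihe hE.1) (ihf hE.2) d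
  | ite c E F ihe ihf =>
    simp only [Term.avoids, Bool.and_eq_true] at hE
    rintro s _ rfl
    simp only [Term.compile, exec_branch, Term.eval]
    split_ifs
    exacts [ihe hE.1.2 d s _ rfl, ihf hE.2 d s _ rfl]
  | sum x e E ih =>
    simp only [Term.avoids, Bool.and_eq_true, decide_eq_true_eq] at hE
    obtain ⟨⟨hx, he⟩, hE⟩ := hE
    rintro s w hw
    obtain ⟨_, rfl, hw⟩ := of_eq_seq hw
    obtain ⟨s1, hs1, hw⟩ := of_eq_seq hw
    rw [exec_setReg] at hs1
    have a1 : Agree [scratch] s1 s := by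
      rw [hs1]
      refine (exec_scratchSet_agree eig _ hs d _ _).trans ⟨fun y hy => ?_, fun _ _ => rfl⟩
      rw [Memory.setReg_reg, if_neg (by omega)]
    have r1 : ∀ i, s1.reg (regBound + i) = if i = d then s.reg x else s.reg (regBound + i) := by
      intro i
      simp only [hs1, scratchSet, exec_setMem, Memory.setMem_reg, Memory.setReg_reg,
        IndexExpr.eval, Nat.add_left_cancel_iff]
    have m1 : ∀ i, s1.mem scratch i 0 0 = if i = d then 0 else s.mem scratch i 0 0 := by
      intro i
      rw [hs1, exec_scratchSet_mem]
      simp [RealExpr.eval]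
    -- The register `x` is exempt from the invariant, since the loop overwrites it; the last
    -- instruction restores it from the saved copy.
    obtain ⟨u, hw, u1, u2, u3, u4, u5⟩ := of_eq_loop_seq hw
      (fun k t => (∀ y < regBound, y ≠ x → t.reg y = s.reg y) ∧
        (∀ a, a ∉ [scratch] → t.mem a = s.mem a) ∧
        (∀ i < d, t.mem scratch i 0 0 = s.mem scratch i 0 0) ∧
        (∀ i < d + 1, t.reg (regBound + i) = s1.reg (regBound + i)) ∧
        t.mem scratch d 0 0 = ∑ j ∈ range k, E.eval (s.setReg x j))
      ⟨fun y hy _ => a1.1 y hy, fun a ha => a1.2 a ha,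
        fun i hi => by rw [m1, if_neg (by omega)], fun _ _ => rfl, by rw [m1]; simp⟩ (by
      rintro k - t ⟨t1, t2, t3, t4, t5⟩ _ rfl
      obtain ⟨k1, k2, k3, k4⟩ := ih hE (d + 1) (t.setReg x k) _ rfl
      have ag : Agree [scratch] (t.setReg x k) (s.setReg x k) := by
        refine ⟨fun y hy => ?_, fun a ha => t2 a ha⟩
        simp only [Memory.setReg_reg]
        split_ifs with h
        · rfl
        · exact t1 y hy h
      refine ⟨fun y hy hyx => ?_, fun a ha => ?_, fun i hi => ?_, fun i hi => ?_, ?_⟩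
      · rw [exec_seq, (exec_scratchSet_agree eig _ hs d _ _).1 y hy, k1.1 y hy,
          Memory.setReg_reg, if_neg hyx, t1 y hy hyx]
      · rw [exec_seq, (exec_scratchSet_agree eig _ hs d _ _).2 a ha, k1.2 a ha]
        exact t2 a ha
      · rw [exec_seq, exec_scratchSet_mem, if_neg (by omega), k2 i (by omega)]
        exact t3 i hi
      · rw [← t4 i hi]
        refine (k3 i (by omega)).trans ?_
        rw [Memory.setReg_reg, if_neg (by omega)]
      · rw [exec_seq, exec_scratchSet_mem, if_pos rfl]
        simp only [scratchGet, RealExpr.eval, IndexExpr.eval]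
        rw [k2 d (by omega), k4, Finset.sum_range_succ, Memory.setReg_mem, t5,
          Term.eval_congr E hE (hsub ag)])
    rw [hw, exec_setReg]
    refine ⟨⟨fun y hy => ?_, u2⟩, u3, fun i hi => ?_, ?_⟩
    · rw [Memory.setReg_reg]
      split_ifs with h
      · rw [IndexExpr.eval, u4 d (by omega), r1, if_pos rfl, h]
      · exact u1 y hy h
    · rw [Memory.setReg_reg, if_neg (by omega), u4 i (by omega), r1, if_neg (by omega)]
    · rw [Memory.setReg_mem, u5, Term.eval_sum, IndexExpr.eval_congr (hsub a1) e he]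

/-! ### Simultaneous assignments -/

/-- The registers that run over the box in a simultaneous assignment. -/
abbrev regI : ℕ := 30
abbrev regJ : ℕ := 31
abbrev regK : ℕ := 32

/-- Registers from `30` on are loop counters and bound variables. Offsets and sizes built from lower
ones keep their values during an assignment. -/
def IndexExpr.fixed : IndexExpr → Bool
  | .reg x => decide (x < 30)
  | .lit _ => true
  | .plus e f => e.fixed && f.fixed
  | .minus e f => e.fixed && f.fixed

theorem IndexExpr.eval_fixed (e : IndexExpr) (he : e.fixed = true) {s t : Memory}
    (h : ∀ x < 30, s.reg x = t.reg x) : e.eval s = e.eval t := by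
  induction e with
  | reg x => exact h x (by simpa [IndexExpr.fixed] using he)
  | lit c => rfl
  | plus e f ihe ihf | minus e f ihe ihf =>
    simp only [IndexExpr.fixed, Bool.and_eq_true] at he
    simp only [IndexExpr.eval, ihe he.1, ihf he.2]

/-- Store `E` in the entries `(I + i, J + j, L + l)` of the array `a`, for `i < e`, `j < f`,
`l < g`; the term `E` refers to `i, j, l` by the registers `regI`, `regJ`, `regK`. -/
def assign (a : ℕ) (I e J f L g : IndexExpr) (E : Term) : Prog :=
  .loop regI e (.loop regJ f (.loop regK g ((E.compile 0).seq
    (.setMem a (I + .reg regI) (J + .reg regJ) (L + .reg regK) (scratchGet 0)))))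

/-- The memory in which the loop registers of a simultaneous assignment have given values. -/
def Memory.at (s : Memory) (i j l : ℕ) : Memory :=
  ((s.setReg regI i).setReg regJ j).setReg regK l

theorem Memory.at_reg (s : Memory) (i j l x : ℕ) : (s.at i j l).reg x =
    if x = regK then l else if x = regJ then j else if x = regI then i else s.reg x := by
  simp only [Memory.at, Memory.setReg_reg]

@[simp] theorem Memory.at_mem (s : Memory) (i j l : ℕ) : (s.at i j l).mem = s.mem := rfl

/-- The state in the middle of a simultaneous assignment. -/
structure PartlyAssigned (s : Memory) (a I J L : ℕ) (E : Term) (D : ℕ → ℕ → ℕ → Prop)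
    (t : Memory) : Prop where
  reg : ∀ x < regBound, x ≠ regI → x ≠ regJ → x ≠ regK → t.reg x = s.reg x
  other : ∀ a', a' ≠ a → a' ≠ scratch → t.mem a' = s.mem a'
  done : ∀ i j l, D i j l → t.mem a (I + i) (J + j) (L + l) = E.eval (s.at i j l)
  rest : ∀ p q u, (∀ i j l, D i j l → ¬ (p = I + i ∧ q = J + j ∧ u = L + l)) →
    t.mem a p q u = s.mem a p q u

theorem PartlyAssigned.weaken {s : Memory} {a I J L : ℕ} {E : Term} {D D' : ℕ → ℕ → ℕ → Prop}
    {t : Memory} (h : PartlyAssigned s a I J L E D t) (hD : ∀ i j l, D i j l ↔ D' i j l) :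
    PartlyAssigned s a I J L E D' t := by
  have : D = D' := by funext i j l; exact propext (hD i j l)
  rwa [← this]

theorem PartlyAssigned.setReg {s : Memory} {a I J L : ℕ} {E : Term} {D : ℕ → ℕ → ℕ → Prop}
    {t : Memory} (h : PartlyAssigned s a I J L E D t) (x k : ℕ)
    (hx : x = regI ∨ x = regJ ∨ x = regK) :
    PartlyAssigned s a I J L E D (t.setReg x k) := by
  refine ⟨fun y hy h1 h2 h3 => ?_, h.other, h.done, h.rest⟩
  rw [Memory.setReg_reg, if_neg (by rintro rfl; tauto), h.reg y hy h1 h2 h3]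

/-- The term reads neither the target array nor the scratch array, so evaluating it in the middle of
the loops gives the same as evaluating it in the initial memory. This makes the sequential loops a
simultaneous assignment. -/
theorem assign_spec (eig : EigenSolver) (s : Memory) (a : ℕ) (I e J f L g : IndexExpr) (E : Term)
    (hE : E.avoids [a, scratch] = true) (ha : a ≠ scratch)
    (hI : I.fixed = true ∧ e.fixed = true ∧ J.fixed = true ∧ f.fixed = true ∧ L.fixed = true ∧
      g.fixed = true) :
    PartlyAssigned s a (I.eval s) (J.eval s) (L.eval s) E
      (fun i j l => i < e.eval s ∧ j < f.eval s ∧ l < g.eval s)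
      ((assign a I e J f L g E).exec eig s) := by
  obtain ⟨hI, he, hJ, hf, hL, hg⟩ := hI
  let P := PartlyAssigned s a (I.eval s) (J.eval s) (L.eval s) E
  let c := (E.compile 0).seq
    (.setMem a (I + .reg regI) (J + .reg regJ) (L + .reg regK) (scratchGet 0))
  have hreg : ∀ {D : ℕ → ℕ → ℕ → Prop} {t : Memory},
      P D t →
      ∀ x < 30, t.reg x = s.reg x := fun h x hx =>
    h.reg x (show x < 1000 by omega) (show x ≠ 30 by omega) (show x ≠ 31 by omega)
      (show x ≠ 32 by omega)
  -- The predicate `D` describes the positions already written; the three loops extend it by an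
  -- entry, a line, and a layer.
  have step : ∀ (D : ℕ → ℕ → ℕ → Prop) (i j l : ℕ) (t : Memory), ¬ D i j l →
      P D t →
      t.reg regI = i → t.reg regJ = j → t.reg regK = l →
      P (fun i' j' l' => D i' j' l' ∨ (i' = i ∧ j' = j ∧ l' = l))
        (c.exec eig t) := by
    intro D i j l t hD h hi hj hl
    obtain ⟨k1, -, -, k4⟩ := Term.compile_spec eig [a, scratch] (by simp) E hE 0 t _ rfl
    have e1 : E.eval t = E.eval (s.at i j l) := by
      refine Term.eval_congr E hE ⟨fun x hx => ?_, fun a' ha' => ?_⟩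
      · rw [Memory.at_reg]
        split_ifs with h1 h2 h3
        · rw [h1, hl]
        · rw [h2, hj]
        · rw [h3, hi]
        · exact h.reg x hx h3 h2 h1
      · rw [Memory.at_mem]
        simp only [List.mem_cons, List.not_mem_nil, or_false, not_or] at ha'
        exact h.other a' ha'.1 ha'.2
    set t' := (E.compile 0).exec eig t with ht'
    have hr : ∀ x < 30, t'.reg x = s.reg x := fun x hx =>
      (k1.1 x (show x < 1000 by omega)).trans (hreg h x hx)
    have addr : (I + .reg regI).eval t' = I.eval s + i ∧ (J + .reg regJ).eval t' = J.eval s + j ∧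
        (L + .reg regK).eval t' = L.eval s + l := by
      simp only [IndexExpr.eval_fixed I hI hr, IndexExpr.eval_fixed J hJ hr,
        IndexExpr.eval_fixed L hL hr, IndexExpr.eval]
      rw [k1.1 regI (by norm_num), k1.1 regJ (by norm_num), k1.1 regK (by norm_num), hi, hj, hl]
      exact ⟨rfl, rfl, rfl⟩
    have hval : (scratchGet 0).eval t' = E.eval (s.at i j l) := by
      rw [← e1, ← k4]; rfl
    have hma : t'.mem a = t.mem a := k1.2 a (by simpa using ha)
    rw [exec_seq, ← ht', exec_setMem, addr.1, addr.2.1, addr.2.2, hval]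
    refine ⟨fun x hx h1 h2 h3 => (k1.1 x hx).trans (h.reg x hx h1 h2 h3), fun a' h1 h2 => ?_,
      fun i' j' l' h' => ?_, fun p q u h' => ?_⟩
    · funext p q u
      rw [Memory.setMem_mem, if_neg (fun h3 => h1 h3.1), k1.2 a' (by simpa using h2),
        h.other a' h1 h2]
    · rw [Memory.setMem_mem]
      split_ifs with h3
      · obtain ⟨rfl, rfl, rfl⟩ : i' = i ∧ j' = j ∧ l' = l := by omega
        rfl
      · rw [hma]
        refine h.done i' j' l' (h'.resolve_right fun h4 => h3 ?_)
        simp [h4]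
    · rw [Memory.setMem_mem, if_neg, hma]
      · exact h.rest p q u fun i' j' l' h3 => h' i' j' l' (Or.inl h3)
      · rintro ⟨-, h3⟩
        exact h' i j l (Or.inr ⟨rfl, rfl, rfl⟩) h3
  have inner : ∀ (D : ℕ → ℕ → ℕ → Prop) (i j : ℕ) (t : Memory), (∀ l, ¬ D i j l) →
      P D t →
      t.reg regI = i → t.reg regJ = j →
      P (fun i' j' l' => D i' j' l' ∨ (i' = i ∧ j' = j ∧ l' < g.eval s))
        ((Prog.loop regK g c).exec eig t) ∧
        ((Prog.loop regK g c).exec eig t).reg regI = i := by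
    intro D i j t hD h hi hj
    have hge : g.eval t = g.eval s := IndexExpr.eval_fixed g hg (hreg h)
    have := exec_loop_induction eig (s := t) (x := regK) (e := g)
      (c := c)
      (fun k t' => P (fun i' j' l' => D i' j' l' ∨ (i' = i ∧ j' = j ∧ l' < k)) t' ∧ t'.reg regI = i ∧
          t'.reg regJ = j)
      ⟨h.weaken fun i' j' l' => by simp, hi, hj⟩ (by
        rintro k - t' ⟨h1, h2, h3⟩
        refine ⟨(step _ i j k (t'.setReg regK k) ?_ (h1.setReg regK k (by simp)) ?_ ?_ ?_).weaken ?_,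
          ?_, ?_⟩
        · grind
        · rw [Memory.setReg_reg, if_neg (by norm_num), h2]
        · rw [Memory.setReg_reg, if_neg (by norm_num), h3]
        · rw [Memory.setReg_reg, if_pos rfl]
        · grind
        · refine ((Term.compile_spec eig [a, scratch] (by simp) E hE 0 _ _ rfl).1.1 regI
            (by norm_num)).trans ?_
          rw [Memory.setReg_reg, if_neg (by norm_num), h2]
        · refine ((Term.compile_spec eig [a, scratch] (by simp) E hE 0 _ _ rfl).1.1 regJ
            (by norm_num)).trans ?_
          rw [Memory.setReg_reg, if_neg (by norm_num), h3])
    rw [hge] at this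
    exact ⟨this.1, this.2.1⟩
  have middle : ∀ (D : ℕ → ℕ → ℕ → Prop) (i : ℕ) (t : Memory), (∀ j l, ¬ D i j l) →
      P D t → t.reg regI = i →
      P (fun i' j' l' => D i' j' l' ∨ (i' = i ∧ j' < f.eval s ∧ l' < g.eval s))
        ((Prog.loop regJ f (Prog.loop regK g c)).exec eig t) := by
    intro D i t hD h hi
    have hfe : f.eval t = f.eval s := IndexExpr.eval_fixed f hf (hreg h)
    have := exec_loop_induction eig (s := t) (x := regJ) (e := f)
      (c := Prog.loop regK g c)
      (fun k t' => P (fun i' j' l' => D i' j' l' ∨ (i' = i ∧ j' < k ∧ l' < g.eval s)) t' ∧ t'.reg regI = i)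
      ⟨h.weaken fun i' j' l' => by simp, hi⟩ (by
        rintro k - t' ⟨h1, h2⟩
        obtain ⟨h3, h4⟩ := inner _ i k (t'.setReg regJ k) (by
          rintro l (h4 | h4)
          · exact hD k l h4
          · omega) (h1.setReg regJ k (by simp)) (by
          rw [Memory.setReg_reg, if_neg (by norm_num), h2]) (by
          rw [Memory.setReg_reg, if_pos rfl])
        refine ⟨h3.weaken fun i' j' l' => ?_, h4⟩
        clear * -
        grind)
    rw [hfe] at this
    exact this.1
  have := exec_loop_induction eig (s := s) (x := regI) (e := e)
    (c := Prog.loop regJ f (Prog.loop regK g c))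
    (fun k t' => P (fun i' j' l' => i' < k ∧ j' < f.eval s ∧ l' < g.eval s) t')
    ⟨fun _ _ _ _ _ => rfl, fun _ _ _ => rfl, fun i j l h => by omega, fun _ _ _ _ => rfl⟩ (by
      rintro k - t' h1
      refine (middle _ k (t'.setReg regI k) (by rintro j l h4; omega)
        (h1.setReg regI k (by simp)) (by rw [Memory.setReg_reg, if_pos rfl])).weaken
        fun i' j' l' => ?_
      omega)
  exact this

section assign
variable (eig : EigenSolver) (s : Memory) {a : ℕ} {I e J f L g : IndexExpr} {E : Term}

/-- The side conditions for a simultaneous assignment. -/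
def assignOk (a : ℕ) (I e J f L g : IndexExpr) (E : Term) : Bool :=
  E.avoids [a, scratch] && decide (a ≠ scratch) && (I.fixed && e.fixed && J.fixed && f.fixed &&
    L.fixed && g.fixed)

theorem assign_spec' (h : assignOk a I e J f L g E = true) :
    PartlyAssigned s a (I.eval s) (J.eval s) (L.eval s) E
      (fun i j l => i < e.eval s ∧ j < f.eval s ∧ l < g.eval s)
      ((assign a I e J f L g E).exec eig s) := by
  simp only [assignOk, Bool.and_eq_true, decide_eq_true_eq] at h
  exact assign_spec eig s a I e J f L g E h.1.1 h.1.2 ⟨h.2.1.1.1.1.1, h.2.1.1.1.1.2, h.2.1.1.1.2,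
    h.2.1.1.2, h.2.1.2, h.2.2⟩

theorem assign_reg (h : assignOk a I e J f L g E = true) (x : ℕ) (hx : x < 30) :
    ((assign a I e J f L g E).exec eig s).reg x = s.reg x :=
  (assign_spec' eig s h).reg x (show x < 1000 by omega) (show x ≠ 30 by omega)
    (show x ≠ 31 by omega) (show x ≠ 32 by omega)

theorem assign_mem_ne (h : assignOk a I e J f L g E = true) (a' : ℕ) (h1 : a' ≠ a)
    (h2 : a' ≠ scratch) : ((assign a I e J f L g E).exec eig s).mem a' = s.mem a' :=
  (assign_spec' eig s h).other a' h1 h2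

theorem assign_mem (h : assignOk a I e J f L g E = true) (p q u : ℕ) :
    ((assign a I e J f L g E).exec eig s).mem a p q u =
      if (I.eval s ≤ p ∧ p < I.eval s + e.eval s) ∧ (J.eval s ≤ q ∧ q < J.eval s + f.eval s) ∧
        (L.eval s ≤ u ∧ u < L.eval s + g.eval s)
      then E.eval (s.at (p - I.eval s) (q - J.eval s) (u - L.eval s)) else s.mem a p q u := by
  have := assign_spec' eig s h
  split_ifs with h'
  · have h3 := this.done (p - I.eval s) (q - J.eval s) (u - L.eval s) (by omega)
    rwa [show I.eval s + (p - I.eval s) = p by omega, show J.eval s + (q - J.eval s) = q by omega,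
      show L.eval s + (u - L.eval s) = u by omega] at h3
  · refine this.rest p q u fun i j l h1 h2 => h' (by omega)

end assign

/-! ### Bounds for the number of steps -/

/-- A test on the nesting of loops: every loop bound (and every size of a spectral decomposition)
is a literal or a register below `B` which is never written, and for every simple instruction
the list of the registers which bound the enclosing loops passes the test `dom`. -/
def Prog.fits (B : ℕ) (dom : List ℕ → Bool) : Prog → List ℕ → Bool
  | .skip, Γ => dom Γ
  | .seq c c', Γ => c.fits B dom Γ && c'.fits B dom Γ
  | .setReg x _, Γ => dom Γ && decide (B ≤ x)
  | .setMem _ _ _ _ _, Γ => dom Γ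
  | .branch _ c c', Γ => dom Γ && c.fits B dom Γ && c'.fits B dom Γ
  | .loop x (.reg y) c, Γ => decide (B ≤ x) && decide (y < B) && dom Γ && dom (y :: Γ) &&
      c.fits B dom (y :: Γ)
  | .loop x (.lit _) c, Γ => decide (B ≤ x) && dom Γ && c.fits B dom Γ
  | .loop _ _ _, _ => false
  | .eigen (.reg y) _ _ _, Γ => decide (y < B) && dom Γ && dom (y :: y :: y :: Γ)
  | .eigen _ _ _ _, _ => false

theorem runLoop_cost {f : ℕ → Memory → Memory × ℕ} (P : Memory → Prop)
    (C k : ℕ) (s : Memory) (hs : P s) (h : ∀ j t, P t → P (f j t).1 ∧ (f j t).2 ≤ C) :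
    P (runLoop f k s).1 ∧ (runLoop f k s).2 ≤ k * (C + 1) := by
  induction k with
  | zero => exact ⟨hs, by simp [runLoop]⟩
  | succ k ih =>
    obtain ⟨h1, h2⟩ := h k _ ih.1
    refine ⟨h1, ?_⟩
    simp only [runLoop]
    nlinarith [ih.2]

/-- The cost is weighted by the product of the bounds of the enclosing loops. A loop then only moves
its own bound from the cost of its body into the weight, and the claim for a simple instruction is
the test `dom`. The constant depends on the program and on `K₀`, but not on the values in `V`, which
may involve an unbounded number of iterations. -/
theorem exists_cost_le {B : ℕ} {dom : List ℕ → Bool} {V : Set ((ℕ → ℕ) × ℕ)} {K₀ : ℕ}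
    (hV : ∀ v ∈ V, ∀ Γ : List ℕ, dom Γ = true → (Γ.map v.1).prod ≤ K₀ * v.2)
    (c : Prog) (Γ : List ℕ) (hc : c.fits B dom Γ = true) :
    ∃ K, ∀ v ∈ V, ∀ (eig : EigenSolver) (s : Memory), (∀ x < B, s.reg x = v.1 x) →
      (∀ x < B, (c.run eig s).1.reg x = v.1 x) ∧
        (Γ.map v.1).prod * (c.run eig s).2 ≤ K * v.2 := by
  induction c generalizing Γ with
  | skip =>
    refine ⟨K₀, fun v hv eig s hs => ⟨hs, ?_⟩⟩
    simpa [Prog.run] using hV v hv Γ hc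
  | seq c c' ih ih' =>
    simp only [Prog.fits, Bool.and_eq_true] at hc
    obtain ⟨K, hK⟩ := ih Γ hc.1
    obtain ⟨K', hK'⟩ := ih' Γ hc.2
    refine ⟨K + K', fun v hv eig s hs => ?_⟩
    obtain ⟨h1, h2⟩ := hK v hv eig s hs
    obtain ⟨h3, h4⟩ := hK' v hv eig _ h1
    refine ⟨h3, ?_⟩
    simp only [Prog.run, mul_add, add_mul]
    exact add_le_add h2 h4
  | setReg x e =>
    simp only [Prog.fits, Bool.and_eq_true, decide_eq_true_eq] at hc
    refine ⟨K₀ * (e.cost + 1), fun v hv eig s hs => ⟨fun y hy => ?_, ?_⟩⟩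
    · simp only [Prog.run, Memory.setReg_reg]
      rw [if_neg (by omega), hs y hy]
    · simp only [Prog.run]
      calc _ ≤ K₀ * v.2 * (e.cost + 1) := Nat.mul_le_mul_right _ (hV v hv Γ hc.1)
        _ = _ := by ring
  | setMem a i j l e =>
    simp only [Prog.fits] at hc
    refine ⟨K₀ * (i.cost + j.cost + l.cost + e.cost + 1), fun v hv eig s hs => ⟨hs, ?_⟩⟩
    simp only [Prog.run]
    calc _ ≤ K₀ * v.2 * (i.cost + j.cost + l.cost + e.cost + 1) :=
          Nat.mul_le_mul_right _ (hV v hv Γ hc)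
      _ = _ := by ring
  | branch t c c' ih ih' =>
    simp only [Prog.fits, Bool.and_eq_true] at hc
    obtain ⟨K, hK⟩ := ih Γ hc.1.2
    obtain ⟨K', hK'⟩ := ih' Γ hc.2
    refine ⟨K + K' + K₀ * t.cost, fun v hv eig s hs => ?_⟩
    obtain ⟨h1, h2⟩ := hK v hv eig s hs
    obtain ⟨h3, h4⟩ := hK' v hv eig s hs
    have h5 : (Γ.map v.1).prod * t.cost ≤ K₀ * t.cost * v.2 := by
      calc _ ≤ K₀ * v.2 * t.cost := Nat.mul_le_mul_right _ (hV v hv Γ hc.1.1)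
        _ = _ := by ring
    simp only [Prog.run]
    grind
  | loop x e c ih =>
    -- Common to both kinds of loop: `Γ'` is the list seen by the body and `m v` the number of
    -- rounds. A register bound enters the list; a literal bound enters the constant.
    have main : ∀ (Γ' : List ℕ) (m : (ℕ → ℕ) × ℕ → ℕ) (K' : ℕ), B ≤ x →
        c.fits B dom Γ' = true →
        dom Γ = true → (∀ v ∈ V, (Γ.map v.1).prod * m v ≤ K' * (Γ'.map v.1).prod) →
        (∀ v ∈ V, (Γ.map v.1).prod * m v ≤ K' * v.2) →
        (∀ v ∈ V, ∀ s : Memory, (∀ x < B, s.reg x = v.1 x) → e.eval s = m v) →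
        ∃ K, ∀ v ∈ V, ∀ (eig : EigenSolver) (s : Memory), (∀ x < B, s.reg x = v.1 x) →
        (∀ y < B, ((Prog.loop x e c).run eig s).1.reg y = v.1 y) ∧
        (Γ.map v.1).prod * ((Prog.loop x e c).run eig s).2 ≤ K * v.2 := by
      intro Γ' m K' hx hc hΓ hm1 hm2 hem
      obtain ⟨K, hK⟩ := ih Γ' hc
      refine ⟨K' * K + K' + K₀ * (e.cost + 1), fun v hv eig s hs => ?_⟩
      classical
      -- a uniform bound for the cost of the body
      have hC : ∃ C, (Γ'.map v.1).prod * C ≤ K * v.2 ∧ (0 < (Γ'.map v.1).prod →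
          ∀ t : Memory, (∀ x < B, t.reg x = v.1 x) → (c.run eig t).2 ≤ C) := by
        -- If an enclosing bound is zero the weighted estimate says nothing about the body, but then
        -- the loop is empty or the weight outside it is zero.
        rcases Nat.eq_zero_or_pos (Γ'.map v.1).prod with h0 | h0
        · exact ⟨0, by simp, fun h => absurd h (by omega)⟩
        · refine ⟨K * v.2 / (Γ'.map v.1).prod, Nat.mul_div_le _ _, fun _ t ht => ?_⟩
          rw [Nat.le_div_iff_mul_le h0, mul_comm]
          exact (hK v hv eig t ht).2
      obtain ⟨C, hC1, hC2⟩ := hC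
      have hinv : ∀ (j : ℕ) (t : Memory), (∀ x < B, t.reg x = v.1 x) →
          ∀ y < B, (t.setReg x j).reg y = v.1 y := fun j t ht y hy => by
        rw [Memory.setReg_reg, if_neg (by omega), ht y hy]
      have hregs : ∀ y < B, ((Prog.loop x e c).run eig s).1.reg y = v.1 y := by
        have := exec_loop_induction eig (s := s) (x := x) (e := e) (c := c)
          (fun _ (t : Memory) => ∀ y < B, t.reg y = v.1 y) hs
          (fun (k : ℕ) _ (t : Memory) ht => (hK v hv eig _ (hinv k t ht)).1)
        exact this
      refine ⟨hregs, ?_⟩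
      have he := hem v hv s hs
      have hb : (Γ.map v.1).prod * (runLoop (fun k s' => c.run eig (s'.setReg x k))
          (e.eval s) s).2 ≤ (K' * K + K') * v.2 := by
        rcases Nat.eq_zero_or_pos (Γ'.map v.1).prod with h0 | h0
        · have h1 : (Γ.map v.1).prod * m v = 0 := by
            have := hm1 v hv
            rw [h0] at this
            omega
          rcases Nat.mul_eq_zero.1 h1 with h2 | h2
          · rw [h2]; simp
          · rw [he, h2]; simp [runLoop]
        · have := (runLoop_cost (f := fun k s' => c.run eig (s'.setReg x k))
            (fun t : Memory => ∀ y < B, t.reg y = v.1 y) C (e.eval s) s hs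
            (fun (j : ℕ) (t : Memory) ht => ⟨(hK v hv eig _ (hinv j t ht)).1,
              hC2 h0 _ (hinv j t ht)⟩)).2
          calc _ ≤ (Γ.map v.1).prod * (m v * (C + 1)) := by
                rw [← he]; exact Nat.mul_le_mul_left _ this
            _ = (Γ.map v.1).prod * m v * C + (Γ.map v.1).prod * m v := by ring
            _ ≤ K' * (Γ'.map v.1).prod * C + K' * v.2 :=
                add_le_add (Nat.mul_le_mul_right _ (hm1 v hv)) (hm2 v hv)
            _ = K' * ((Γ'.map v.1).prod * C) + K' * v.2 := by ring
            _ ≤ K' * (K * v.2) + K' * v.2 :=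
                Nat.add_le_add_right (Nat.mul_le_mul_left _ hC1) _
            _ = _ := by ring
      have h5 : (Γ.map v.1).prod * (e.cost + 1) ≤ K₀ * (e.cost + 1) * v.2 := by
        calc _ ≤ K₀ * v.2 * (e.cost + 1) := Nat.mul_le_mul_right _ (hV v hv Γ hΓ)
          _ = _ := by ring
      have : ((Prog.loop x e c).run eig s).2 = (runLoop (fun k s' => c.run eig (s'.setReg x k))
          (e.eval s) s).2 + (e.cost + 1) := by simp only [Prog.run]; ring
      rw [this, mul_add, add_mul]
      exact add_le_add hb h5
    cases e with
    | reg y =>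
      simp only [Prog.fits, Bool.and_eq_true, decide_eq_true_eq] at hc
      refine main (y :: Γ) (fun v => v.1 y) (max 1 K₀) hc.1.1.1.1 hc.2 hc.1.1.2
        (fun v hv => ?_) (fun v hv => ?_) (fun v hv s hs => hs y hc.1.1.1.2)
      · simp only [List.map_cons, List.prod_cons]
        rw [mul_comm]
        exact Nat.le_mul_of_pos_left _ (by simp)
      grind
    | lit q =>
      simp only [Prog.fits, Bool.and_eq_true, decide_eq_true_eq] at hc
      refine main Γ (fun _ => q) (q * max 1 K₀) hc.1.1 hc.2 hc.1.2 (fun v hv => ?_)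
        (fun v hv => ?_) (fun v hv s hs => rfl)
      · rw [mul_comm]
        exact Nat.mul_le_mul_right _ (Nat.le_mul_of_pos_right _ (by simp))
      · calc _ ≤ (K₀ * v.2) * q := Nat.mul_le_mul_right _ (hV v hv _ hc.1.2)
          _ = q * K₀ * v.2 := by ring
          _ ≤ _ := Nat.mul_le_mul_right _ (Nat.mul_le_mul_left _ (le_max_right _ _))
    | plus e f => simp [Prog.fits] at hc
    | minus e f => simp [Prog.fits] at hc
  | eigen d a v w =>
    cases d with
    | reg y =>
      simp only [Prog.fits, Bool.and_eq_true, decide_eq_true_eq] at hc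
      refine ⟨K₀ + K₀ * 2, fun v hv eig s hs => ⟨hs, ?_⟩⟩
      have h1 := hV v hv _ hc.2
      have h2 := hV v hv _ hc.1.2
      simp only [List.map_cons, List.prod_cons] at h1
      simp only [Prog.run, IndexExpr.eval, IndexExpr.cost]
      rw [hs y hc.1.1]
      nlinarith
    | lit q => simp [Prog.fits] at hc
    | plus e f => simp [Prog.fits] at hc
    | minus e f => simp [Prog.fits] at hc

/-! ### Building blocks for terms -/

/-- `1` if `e ≤ f`, else `0`. -/
def indLe (e f : IndexExpr) : Term := .ite (.indexLe e f) 1 0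

/-- `1` if `p` and `q` differ by at most `w`, else `0`. -/
def indNear (w p q : IndexExpr) : Term := indLe p (q + w) * indLe q (p + w)

def indOr (E F : Term) : Term := E + F - E * F

def indBand (b k p q : IndexExpr) : Term :=
  indOr (indNear b p q) (indOr (indNear b p k) (indNear b q k))

theorem Term.eval_ite (t : Test) (E F : Term) (s : Memory) [Decidable (t.Holds s)] :
    (Term.ite t E F).eval s = if t.Holds s then E.eval s else F.eval s := by
  simp only [Term.eval]
  split_ifs <;> rfl

theorem indLe_eval (e f : IndexExpr) (s : Memory) :
    (indLe e f).eval s = if e.eval s ≤ f.eval s then 1 else 0 := by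
  have : Decidable ((Test.indexLe e f).Holds s) := Nat.decLe _ _
  rw [indLe, Term.eval_ite, Term.eval_ofNat, Term.eval_ofNat, Nat.cast_one, Nat.cast_zero]
  by_cases h : e.eval s ≤ f.eval s
  · rw [if_pos h]
    exact if_pos h
  · rw [if_neg h]
    exact if_neg h

open Classical in
theorem indNear_eval (w p q : IndexExpr) (s : Memory) :
    (indNear w p q).eval s = if Near (w.eval s) (p.eval s) (q.eval s) then 1 else 0 := by
  rw [indNear, Term.eval_mul, indLe_eval, indLe_eval, IndexExpr.eval_add, IndexExpr.eval_add]
  grind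

theorem indOr_eval {E F : Term} {s : Memory} {P Q : Prop} [Decidable P] [Decidable Q]
    (hE : E.eval s = if P then 1 else 0) (hF : F.eval s = if Q then 1 else 0) :
    (indOr E F).eval s = if P ∨ Q then 1 else 0 := by
  rw [indOr, Term.eval_sub, Term.eval_add, Term.eval_mul, hE, hF]
  grind

theorem indBand_eval (b k p q : IndexExpr) (s : Memory) :
    (indBand b k p q).eval s =
      if InBand (b.eval s) (k.eval s) (p.eval s) (q.eval s) then 1 else 0 :=
  indOr_eval (indNear_eval _ _ _ _) (indOr_eval (indNear_eval _ _ _ _) (indNear_eval _ _ _ _))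

/-- Choose among five terms according to the value of a register. -/
def case5 (x : ℕ) (E : ℕ → Term) : Term :=
  .ite (.indexLe (.reg x) (.lit 0)) (E 0) (.ite (.indexLe (.reg x) (.lit 1)) (E 1)
    (.ite (.indexLe (.reg x) (.lit 2)) (E 2) (.ite (.indexLe (.reg x) (.lit 3)) (E 3) (E 4))))

theorem case5_eval (x : ℕ) (E : ℕ → Term) (s : Memory) (h : s.reg x < 5) :
    (case5 x E).eval s = (E (s.reg x)).eval s := by
  have hd : ∀ c, Decidable ((Test.indexLe (.reg x) (.lit c)).Holds s) := fun c => Nat.decLe _ _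
  simp only [case5, Term.eval_ite]
  have hh : ∀ c, (Test.indexLe (.reg x) (.lit c)).Holds s ↔ s.reg x ≤ c := fun c => Iff.rfl
  grind

/-! ### Frames -/

/-- All registers that the program writes pass the test. -/
def Prog.writesReg (p : ℕ → Bool) : Prog → Bool
  | .skip => true
  | .seq c c' => c.writesReg p && c'.writesReg p
  | .setReg x _ => p x
  | .setMem _ _ _ _ _ => true
  | .branch _ c c' => c.writesReg p && c'.writesReg p
  | .loop x _ c => p x && c.writesReg p
  | .eigen _ _ _ _ => true

/-- All arrays that the program writes belong to the list. -/
def Prog.writesArr (A : List ℕ) : Prog → Bool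
  | .skip => true
  | .seq c c' => c.writesArr A && c'.writesArr A
  | .setReg _ _ => true
  | .setMem a _ _ _ _ => A.contains a
  | .branch _ c c' => c.writesArr A && c'.writesArr A
  | .loop _ _ c => c.writesArr A
  | .eigen _ _ v w => A.contains v && A.contains w

theorem exec_frame_reg (eig : EigenSolver) {p : ℕ → Bool} {c : Prog} (h : c.writesReg p = true)
    (s : Memory) {x : ℕ} (hx : p x = false) : (c.exec eig s).reg x = s.reg x := by
  induction c generalizing s with
  | skip => rfl
  | seq c c' ih ih' =>
    simp only [Prog.writesReg, Bool.and_eq_true] at h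
    rw [exec_seq, ih' h.2, ih h.1]
  | setReg y e =>
    simp only [Prog.writesReg] at h
    rw [exec_setReg, Memory.setReg_reg, if_neg]
    rintro rfl
    simp [h] at hx
  | setMem a i j l e => rfl
  | branch t c c' ih ih' =>
    simp only [Prog.writesReg, Bool.and_eq_true] at h
    rw [exec_branch]
    split_ifs
    · exact ih h.1 s
    · exact ih' h.2 s
  | loop y e c ih =>
    simp only [Prog.writesReg, Bool.and_eq_true] at h
    refine exec_loop_induction eig (fun _ t => t.reg x = s.reg x) rfl fun k _ t ht => ?_
    rw [ih h.2, Memory.setReg_reg, if_neg, ht]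
    rintro rfl
    simp [h.1] at hx
  | eigen d a v w => rfl

theorem exec_frame_arr (eig : EigenSolver) {A : List ℕ} {c : Prog} (h : c.writesArr A = true)
    (s : Memory) {a : ℕ} (ha : A.contains a = false) : (c.exec eig s).mem a = s.mem a := by
  induction c generalizing s with
  | skip => rfl
  | seq c c' ih ih' =>
    simp only [Prog.writesArr, Bool.and_eq_true] at h
    rw [exec_seq, ih' h.2, ih h.1]
  | setReg y e => rfl
  | setMem a' i j l e =>
    simp only [Prog.writesArr] at h
    funext p q u
    rw [exec_setMem, Memory.setMem_mem, if_neg]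
    grind
  | branch t c c' ih ih' =>
    simp only [Prog.writesArr, Bool.and_eq_true] at h
    rw [exec_branch]
    split_ifs
    · exact ih h.1 s
    · exact ih' h.2 s
  | loop y e c ih =>
    simp only [Prog.writesArr] at h
    refine exec_loop_induction eig (fun _ t => t.mem a = s.mem a) rfl fun k _ t ht => ?_
    rw [ih h]
    exact ht
  | eigen d a' v w =>
    simp only [Prog.writesArr, Bool.and_eq_true] at h
    have hv : a ≠ v := by
      grind
    have hw : a ≠ w := by
      grind
    funext p q u
    simp only [exec_eigen, Memory.setEigen]
    grind

/-! ### Solving a consistent system of linear equations -/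

/-- The invariant of the solution of the equations `R i ⬝ᵥ x = h i` by successive projections:
`P` is an orthogonal projection which annihilates the rows processed so far, and the error of
the approximate solution `y` is in its range. -/
structure ProjInv {m : ℕ} (R : Fin m → Fin m → ℝ) (x : Fin m → ℝ) (e : ℕ)
    (P : Mat m m) (y : Fin m → ℝ) : Prop where
  symm : Pᵀ = P
  idem : P * P = P
  err : P *ᵥ (x - y) = x - y
  row : ∀ i : Fin m, (i : ℕ) < e → P *ᵥ R i = 0

theorem ProjInv.init {m : ℕ} (R : Fin m → Fin m → ℝ) (x : Fin m → ℝ) :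
    ProjInv R x 0 1 0 := ⟨by simp, by simp, by simp, fun i hi => by omega⟩

/-- The vector `u` is the part of the new row orthogonal to the earlier rows. Moving `y` along `u`
meets the new equation without disturbing the old ones, and subtracting the projection onto `u` from
`P` makes it annihilate the new row too. -/
theorem ProjInv.step {m : ℕ} {R : Fin m → Fin m → ℝ} {x : Fin m → ℝ} {e : ℕ}
    {P : Mat m m} {y : Fin m → ℝ} (h : ProjInv R x e P y) (he : e < m)
    (u : Fin m → ℝ) (hu : u = P *ᵥ R ⟨e, he⟩) (d c : ℝ) (hd : d = R ⟨e, he⟩ ⬝ᵥ u)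
    (hc : c = (R ⟨e, he⟩ ⬝ᵥ x - R ⟨e, he⟩ ⬝ᵥ y) / d) :
    ProjInv R x (e + 1) (Matrix.of fun i j => P i j - u i * u j / d)
      (fun i => y i + u i * c) := by
  set ρ := R ⟨e, he⟩
  have hsw : ∀ v w : Fin m → ℝ, v ⬝ᵥ (P *ᵥ w) = (P *ᵥ v) ⬝ᵥ w := by
    intro v w
    rw [dotProduct_mulVec, ← mulVec_transpose, h.symm]
  have hPu : P *ᵥ u = u := by rw [hu, mulVec_mulVec, h.idem]
  have hdu : d = u ⬝ᵥ u := by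
    grind
  have hrow : ∀ i : Fin m, (i : ℕ) < e + 1 → (i : ℕ) < e ∨ i = ⟨e, he⟩ := fun i hi => by
    grind
  -- The new row depends on the earlier ones. As `x` solves all equations, the new equation already
  -- holds for `y`; since `u = 0` the formulas change nothing, so the program needs no case
  -- distinction.
  by_cases hd0 : d = 0
  · have hu0 : u = 0 := by
      rw [hdu] at hd0
      exact dotProduct_self_eq_zero.1 hd0
    have h1 : (Matrix.of fun i j => P i j - u i * u j / d) = P := by
      ext i j; simp [hd0]
    have h2 : (fun i => y i + u i * c) = y := by
      ext i; simp [hu0]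
    rw [h1, h2]
    refine ⟨h.symm, h.idem, h.err, fun i hi => ?_⟩
    rcases hrow i hi with h' | rfl
    · exact h.row i h'
    · exact hu.symm.trans hu0
  · have h1 : (Matrix.of fun i j => P i j - u i * u j / d) =
        P - d⁻¹ • vecMulVec u u := by
      ext i j
      simp [Matrix.vecMulVec_apply, div_eq_inv_mul]
    have h2 : (fun i => y i + u i * c) = y + c • u := by
      ext i; simp [mul_comm]
    rw [h1, h2]
    have hvm : ∀ w : Fin m → ℝ, vecMulVec u u *ᵥ w = (u ⬝ᵥ w) • u := by
      intro w
      rw [Matrix.vecMulVec_mulVec]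
      simp
    have hcd : c * d = u ⬝ᵥ (x - y) := by
      have : u ⬝ᵥ (x - y) = ρ ⬝ᵥ (x - y) := by rw [hu, ← hsw, h.err]
      simp_all
    refine ⟨?_, ?_, ?_, fun i hi => ?_⟩
    · rw [transpose_sub, h.symm, transpose_smul, Matrix.transpose_vecMulVec]
    · have e1 : P * vecMulVec u u = vecMulVec u u := by
        rw [Matrix.mul_vecMulVec, hPu]
      have e2 : vecMulVec u u * P = vecMulVec u u := by
        rw [Matrix.vecMulVec_mul, ← mulVec_transpose, h.symm, hPu]
      have e3 : vecMulVec u u * vecMulVec u u = d • vecMulVec u u := by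
        rw [Matrix.vecMulVec_mul_vecMulVec, ← hdu]
        ext i j
        simp [Matrix.vecMulVec_apply]
        try ring
      rw [sub_mul, mul_sub, mul_sub, h.idem]
      simp_all
    · have e1 : u ⬝ᵥ (x - (y + c • u)) = 0 := by
        simp_all
      rw [sub_mulVec, smul_mulVec, hvm, e1, ← sub_sub, Matrix.mulVec_sub, h.err,
        Matrix.mulVec_smul, hPu]
      simp
    · rw [sub_mulVec, smul_mulVec, hvm]
      rcases hrow i hi with h' | rfl
      · have : u ⬝ᵥ R i = 0 := by
          rw [hu, ← hsw, h.row i h', dotProduct_zero]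
        rw [h.row i h', this]
        simp
      · rw [show R ⟨e, he⟩ = ρ from rfl, ← hu, dotProduct_comm, ← hd, smul_smul,
          inv_mul_cancel₀ hd0, one_smul, sub_self]

theorem ProjInv.solves {m : ℕ} {R : Fin m → Fin m → ℝ} {x : Fin m → ℝ} 
    {P : Mat m m} {y : Fin m → ℝ} (h : ProjInv R x m P y) (i : Fin m) :
    R i ⬝ᵥ y = R i ⬝ᵥ x := by
  have : R i ⬝ᵥ (x - y) = 0 := by
    rw [← h.err, dotProduct_mulVec, ← mulVec_transpose, h.symm, h.row i i.2,
      zero_dotProduct]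
  rw [dotProduct_sub] at this
  linarith

/-- `1` if `e = f`, else `0`. -/
def indEq (e f : IndexExpr) : Term := indLe e f * indLe f e

theorem indEq_eval (e f : IndexExpr) (s : Memory) :
    (indEq e f).eval s = if e.eval s = f.eval s then 1 else 0 := by
  rw [indEq, Term.eval_mul, indLe_eval, indLe_eval]
  split_ifs <;> first | omega | simp

/-- The entry `(reg x, 0, 0)` of an array. -/
def vecGet (a x : ℕ) : Term := .get a (.reg x) (.lit 0) (.lit 0)

/-- The entry `(reg x, reg y, 0)` of an array. -/
def matGet (a x y : ℕ) : Term := .get a (.reg x) (.reg y) (.lit 0)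

@[simp] theorem Term.eval_one (s : Memory) : (1 : Term).eval s = 1 := by
  rw [Term.eval_ofNat, Nat.cast_one]

@[simp] theorem Term.eval_zero (s : Memory) : (0 : Term).eval s = 0 := by
  rw [Term.eval_ofNat, Nat.cast_zero]

@[simp] theorem IndexExpr.eval_zero (s : Memory) : (0 : IndexExpr).eval s = 0 := rfl

@[simp] theorem IndexExpr.eval_one (s : Memory) : (1 : IndexExpr).eval s = 1 := rfl

attribute [simp] Term.eval Term.eval_add Term.eval_sub Term.eval_mul Term.eval_div Term.eval_ofNat
  Term.eval_sum IndexExpr.eval IndexExpr.eval_add IndexExpr.eval_sub IndexExpr.eval_ofNat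
  vecGet matGet Memory.setReg_reg Memory.at_reg indEq_eval

/-- Assign to a vector, a matrix, a scalar; the sizes are given by registers. -/
abbrev assignVec (a m : ℕ) (E : Term) : Prog := assign a 0 (.reg m) 0 1 0 1 E
abbrev assignMat (a m m' : ℕ) (E : Term) : Prog := assign a 0 (.reg m) 0 (.reg m') 0 1 E
abbrev assignScalar (a : ℕ) (E : Term) : Prog := assign a 0 1 0 1 0 1 E

theorem of_eq_assign {eig : EigenSolver} {s u : Memory} {a : ℕ} {e f g : IndexExpr} {E : Term}
    (hu : u = (assign a 0 e 0 f 0 g E).exec eig s) (h : assignOk a 0 e 0 f 0 g E = true) :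
    (∀ x < 30, u.reg x = s.reg x) ∧ (∀ a', a' ≠ a → a' ≠ 20 → u.mem a' = s.mem a') ∧
      ∀ p q v, p < e.eval s → q < f.eval s → v < g.eval s →
        u.mem a p q v = E.eval (s.at p q v) := by
  subst hu
  refine ⟨assign_reg eig s h, assign_mem_ne eig s h, fun p q v hp hq hv => ?_⟩
  rw [assign_mem eig s h, if_pos (by simpa using ⟨hp, hq, hv⟩)]
  rfl

theorem of_eq_assign_seq {eig : EigenSolver} {s u : Memory} {a : ℕ} {e f g : IndexExpr} {E : Term}
    {c : Prog} (hu : u = ((assign a 0 e 0 f 0 g E).seq c).exec eig s)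
    (h : assignOk a 0 e 0 f 0 g E = true) : ∃ t, u = c.exec eig t ∧
      (∀ x < 30, t.reg x = s.reg x) ∧ (∀ a', a' ≠ a → a' ≠ 20 → t.mem a' = s.mem a') ∧
      ∀ p q v, p < e.eval s → q < f.eval s → v < g.eval s →
        t.mem a p q v = E.eval (s.at p q v) :=
  ⟨_, hu, of_eq_assign rfl h⟩

theorem of_eq_assign_offset {eig : EigenSolver} {s u : Memory} {a : ℕ} {I e J f L g : IndexExpr}
    {E : Term} (hu : u = (assign a I e J f L g E).exec eig s)
    (h : assignOk a I e J f L g E = true) :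
    (∀ x < 30, u.reg x = s.reg x) ∧ (∀ a', a' ≠ a → a' ≠ 20 → u.mem a' = s.mem a') ∧
      ∀ p q v, u.mem a p q v =
        if (I.eval s ≤ p ∧ p < I.eval s + e.eval s) ∧ (J.eval s ≤ q ∧ q < J.eval s + f.eval s) ∧
          (L.eval s ≤ v ∧ v < L.eval s + g.eval s)
        then E.eval (s.at (p - I.eval s) (q - J.eval s) (v - L.eval s)) else s.mem a p q v :=
  hu ▸ ⟨assign_reg eig s h, assign_mem_ne eig s h, assign_mem eig s h⟩

/-- Process the equation whose number is in the register `29`: the coefficients are in the array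
`10`, the right-hand sides in the array `11`, the projection in the array `12` and the solution
in the array `13`. -/
def solveStep (m : ℕ) : Prog :=
  (assignVec 14 m (.sum 33 (.reg m) (matGet 12 regI 33 * matGet 10 29 33))).seq <|
  (assignScalar 15 (.sum 33 (.reg m) (matGet 10 29 33 * vecGet 14 33))).seq <|
  (assignScalar 18 ((vecGet 11 29 - .sum 33 (.reg m) (matGet 10 29 33 * vecGet 13 33)) /
    .get 15 (.lit 0) (.lit 0) (.lit 0))).seq <|
  (assignVec 17 m (vecGet 13 regI + vecGet 14 regI * .get 18 (.lit 0) (.lit 0) (.lit 0))).seq <|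
  (assignVec 13 m (vecGet 17 regI)).seq <|
  (assignMat 16 m m (matGet 12 regI regJ - vecGet 14 regI * vecGet 14 regJ /
    .get 15 (.lit 0) (.lit 0) (.lit 0))).seq <|
  assignMat 12 m m (matGet 16 regI regJ)

/-- Solve the system with the matrix in the array `10` and the right-hand side in the array
`11`. -/
def solve (m : ℕ) : Prog :=
  (assignMat 12 m m (indEq (.reg regI) (.reg regJ))).seq <|
  (assignVec 13 m (.lit 0)).seq <|
  .loop 29 (.reg m) (solveStep m)

/-- The registers that hold the size of a system. -/
abbrev sizeRegs : List ℕ := [1, 5, 11]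

set_option maxHeartbeats 1000000 in
theorem solveStep_spec (eig : EigenSolver) (m : ℕ) (hm : m ∈ sizeRegs) (s t : Memory)
    (e k : ℕ) (u : ℕ → ℝ) (d c : ℝ) (ht : t = (solveStep m).exec eig s) (he : e = s.reg 29)
    (hk : k = s.reg m) (hu : ∀ i, u i = ∑ w ∈ range k, s.mem 12 i w 0 * s.mem 10 e w 0)
    (hd : d = ∑ w ∈ range k, s.mem 10 e w 0 * u w)
    (hc : c = (s.mem 11 e 0 0 - ∑ w ∈ range k, s.mem 10 e w 0 * s.mem 13 w 0 0) / d) :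
    (∀ i < k, t.mem 13 i 0 0 = s.mem 13 i 0 0 + u i * c) ∧
    ∀ i < k, ∀ j < k, t.mem 12 i j 0 = s.mem 12 i j 0 - u i * u j / d := by
  have hm30 : m < 30 := by
    grind
  have hm' : m ≠ 30 ∧ m ≠ 31 ∧ m ≠ 32 ∧ m ≠ 33 := by omega
  obtain ⟨s1, ht, r1, f1, v1⟩ := of_eq_assign_seq ht (by clear * - hm; revert m; decide)
  obtain ⟨s2, ht, r2, f2, v2⟩ := of_eq_assign_seq ht (by clear * - hm; revert m; decide)
  obtain ⟨s3, ht, r3, f3, v3⟩ := of_eq_assign_seq ht (by clear * - hm; revert m; decide)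
  obtain ⟨s4, ht, r4, f4, v4⟩ := of_eq_assign_seq ht (by clear * - hm; revert m; decide)
  obtain ⟨s5, ht, r5, f5, v5⟩ := of_eq_assign_seq ht (by clear * - hm; revert m; decide)
  obtain ⟨s6, ht, r6, f6, v6⟩ := of_eq_assign_seq ht (by clear * - hm; revert m; decide)
  obtain ⟨-, f7, v7⟩ := of_eq_assign ht (by clear * - hm; revert m; decide)
  simp only [IndexExpr.eval, r1 m hm30, r2 m hm30, r3 m hm30, r4 m hm30, r5 m hm30, r6 m hm30,
    ← hk] at v1 v2 v3 v4 v5 v6 v7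
  have w1 : ∀ i < k, s1.mem 14 i 0 0 = u i := fun i hi => by
    simp [v1 i 0 0 hi Nat.one_pos Nat.one_pos, hm', hu, hk, he]
  have w2 : s2.mem 15 0 0 0 = d := by
    simp [v2 0 0 0, hm', r1 m hm30, r1 29, f1 10, hd, ← hk, ← he]
    exact sum_congr rfl fun w hw => by rw [w1 w (mem_range.1 hw)]
  have w3 : s3.mem 18 0 0 0 = c := by
    simp [v3 0 0 0, hm', r2 m hm30, r1 m hm30, r2 29, r1 29, f2, f1, w2, hc, ← hk, ← he]
  have w4 : ∀ i < k, s4.mem 17 i 0 0 = s.mem 13 i 0 0 + u i * c := fun i hi => by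
    simp [v4 i 0 0 hi Nat.one_pos Nat.one_pos, f3, f2, f1, w3, w1 i hi]
  refine ⟨fun i hi => ?_, fun i hi j hj => ?_⟩
  · rw [f7 13 (by norm_num) (by norm_num), f6 13 (by norm_num) (by norm_num),
      v5 i 0 0 hi Nat.one_pos Nat.one_pos]
    simp [w4 i hi]
  · simp [v7 i j 0 hi hj Nat.one_pos, v6 i j 0 hi hj Nat.one_pos, f5, f4, f3, f2, f1, w2, w1 i hi,
      w1 j hj]

theorem solve_spec (eig : EigenSolver) (m : ℕ) (hm : m ∈ sizeRegs) (s : Memory)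
    (hcons : ∃ x : ℕ → ℝ, ∀ i < s.reg m,
      ∑ w ∈ range (s.reg m), s.mem 10 i w 0 * x w = s.mem 11 i 0 0) :
    ∀ i < s.reg m, ∑ w ∈ range (s.reg m), s.mem 10 i w 0 *
      ((solve m).exec eig s).mem 13 w 0 0 = s.mem 11 i 0 0 := by
  obtain ⟨x, hx⟩ := hcons
  have hm30 : m < 29 := by
    grind
  set k := s.reg m with hk
  set R : Fin k → Fin k → ℝ := fun i w => s.mem 10 i w 0 with hR
  set x' : Fin k → ℝ := fun w => x w with hx'
  obtain ⟨u, hu⟩ : ∃ u, u = (solve m).exec eig s := ⟨_, rfl⟩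
  rw [← hu]
  obtain ⟨s1, hu, r1, f1, v1⟩ := of_eq_assign_seq hu (by clear * - hm; revert m; decide)
  obtain ⟨s2, hu, r2, f2, v2⟩ := of_eq_assign_seq hu (by clear * - hm; revert m; decide)
  simp only [IndexExpr.eval, r1 m (by omega), ← hk] at v1 v2
  have hk2 : s2.reg m = k := by rw [r2 m (by omega), r1 m (by omega)]
  have key := exec_loop_induction eig (s := s2) (x := 29) (e := .reg m) (c := solveStep m)
    (fun e t => t.reg m = k ∧ t.mem 10 = s.mem 10 ∧ t.mem 11 = s.mem 11 ∧
      ProjInv R x' e (Matrix.of fun i j => t.mem 12 i j 0) (fun i => t.mem 13 i 0 0))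
    (by
      refine ⟨hk2, by rw [f2, f1] <;> norm_num, by rw [f2, f1] <;> norm_num, ?_⟩
      convert ProjInv.init R x' using 1
      · ext i j
        simp [f2, v1 i j 0 i.2 j.2, Fin.ext_iff, one_apply]
      · ext i
        simp [v2 i 0 0 i.2])
    (by
      rintro e he t ⟨t1, t2, t3, t4⟩
      have he' : e < k := he.trans_eq hk2
      refine ⟨?_, ?_, ?_, ?_⟩
      · rw [exec_frame_reg eig (p := fun x => decide (29 < x)) rfl _ (by simp; omega),
          Memory.setReg_reg, if_neg (by omega), t1]
      · rwa [exec_frame_arr eig (A := [12, 13, 14, 15, 16, 17, 18, 20]) rfl _ rfl]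
      · rwa [exec_frame_arr eig (A := [12, 13, 14, 15, 16, 17, 18, 20]) rfl _ rfl]
      · have hs := solveStep_spec eig m hm (t.setReg 29 e)
        simp only [Memory.setReg_reg, if_true, Memory.setReg_mem, if_neg (show m ≠ 29 by omega),
          t1, t2, t3] at hs
        replace hs := hs _ _ _ _ _ _ rfl rfl rfl (fun _ => rfl) rfl rfl
        convert t4.step he' _ (by
            ext i
            simp only [mulVec, dotProduct, of_apply, hR]
            exact sum_range (fun w => t.mem 12 i w 0 * s.mem 10 e w 0))
          (∑ w ∈ range k, s.mem 10 e w 0 *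
            ∑ w' ∈ range k, t.mem 12 w w' 0 * s.mem 10 e w' 0)
          ((s.mem 11 e 0 0 - ∑ w ∈ range k, s.mem 10 e w 0 * t.mem 13 w 0 0) / _)
          (by rw [sum_range]; rfl)
          (by
            rw [← hx e he', sum_range, sum_range (fun w =>
              s.mem 10 e w 0 * t.mem 13 w 0 0)]
            rfl) using 1
        · ext i j
          exact hs.2 i i.2 j j.2
        · ext i
          exact hs.1 i i.2)
  rw [show (IndexExpr.reg m).eval s2 = k from hk2, ← hu] at key
  intro i hi
  rw [← hx i hi, sum_range, sum_range (fun w => s.mem 10 i w 0 * x w)]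
  exact key.2.2.2.solves ⟨i, hi⟩

/-- `AᵀA` and `Aᵀ` have equal rank, hence equal range. Normal equations are thus always consistent,
even with linearly dependent columns, as the projection method demands. -/
theorem exists_normal_solution {ι κ : Type*} [Fintype ι] [Fintype κ] (A : Matrix ι κ ℝ)
    (b : ι → ℝ) : ∃ x, Aᵀ *ᵥ (A *ᵥ x) = Aᵀ *ᵥ b := by
  classical
  have h1 : LinearMap.range (mulVecLin (Aᵀ * A)) ≤ LinearMap.range (mulVecLin Aᵀ) := by
    rintro _ ⟨x, rfl⟩
    simp_all
  have h2 := Submodule.eq_of_le_of_finrank_eq h1 (by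
    have := Matrix.rank_transpose_mul_self A
    rw [← Matrix.rank_transpose A] at this
    exact this)
  have h3 : Aᵀ *ᵥ b ∈ LinearMap.range (mulVecLin (Aᵀ * A)) := by
    rw [h2]
    exact ⟨b, rfl⟩
  obtain ⟨x, hx⟩ := h3
  exact ⟨x, by rw [mulVec_mulVec]; exact hx⟩

/-- Solve, in the sense of least squares, the system with the coefficients `(j, q, t)` in the
array `8` and the right-hand sides `(j, q)` in the array `9`, for `j < J` and `q < n`. -/
def leastSquares (J m : ℕ) : Prog :=
  (assignMat 10 m m (.sum 34 (.lit J) (.sum 35 (.reg 0)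
    (.get 8 (.reg 34) (.reg 35) (.reg regI) * .get 8 (.reg 34) (.reg 35) (.reg regJ))))).seq <|
  (assignVec 11 m (.sum 34 (.lit J) (.sum 35 (.reg 0)
    (.get 8 (.reg 34) (.reg 35) (.reg regI) * .get 9 (.reg 34) (.reg 35) (.lit 0))))).seq <|
  solve m

theorem leastSquares_spec (eig : EigenSolver) (J m : ℕ) (hJ : J ∈ [2, 3, 5]) (hm : m ∈ sizeRegs)
    (s : Memory) :
    ∀ t < s.reg m, ∑ j ∈ range J, ∑ q ∈ range (s.reg 0), s.mem 8 j q t *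
      ((∑ t' ∈ range (s.reg m), s.mem 8 j q t' *
        ((leastSquares J m).exec eig s).mem 13 t' 0 0) - s.mem 9 j q 0) = 0 := by
  have hm30 : m < 30 := by
    grind
  set k := s.reg m with hk
  set n := s.reg 0 with hn
  obtain ⟨u, hu⟩ : ∃ u, u = (leastSquares J m).exec eig s := ⟨_, rfl⟩
  rw [← hu]
  obtain ⟨s1, hu, r1, f1, v1⟩ := of_eq_assign_seq hu
    (by clear * - hm hJ; revert m; revert J; decide)
  obtain ⟨s2, hu, r2, f2, v2⟩ := of_eq_assign_seq hu
    (by clear * - hm hJ; revert m; revert J; decide)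
  simp only [IndexExpr.eval, r1 m hm30, ← hk] at v1 v2
  have w1 : ∀ t < k, ∀ t' < k, s2.mem 10 t t' 0 = ∑ j ∈ range J, ∑ q ∈ range n,
      s.mem 8 j q t * s.mem 8 j q t' := fun t ht t' ht' => by
    simp [f2, v1 t t' 0 ht ht' Nat.one_pos, ← hn]
  have w2 : ∀ t < k, s2.mem 11 t 0 0 = ∑ j ∈ range J, ∑ q ∈ range n,
      s.mem 8 j q t * s.mem 9 j q 0 := fun t ht => by
    simp [v2 t 0 0 ht Nat.one_pos Nat.one_pos, r1, f1, ← hn]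
  have hswap : ∀ (t : ℕ) (x : ℕ → ℝ), ∑ w ∈ range k, (∑ j ∈ range J,
      ∑ q ∈ range n, s.mem 8 j q t * s.mem 8 j q w) * x w =
      ∑ j ∈ range J, ∑ q ∈ range n, s.mem 8 j q t *
        ∑ w ∈ range k, s.mem 8 j q w * x w := by
    intro t x
    simp only [sum_mul, mul_sum]
    rw [sum_comm]
    refine sum_congr rfl fun j _ => ?_
    rw [sum_comm]
    exact sum_congr rfl fun q _ => sum_congr rfl fun w _ => by ring
  have key := solve_spec eig m hm s2 (by
    obtain ⟨x, hx⟩ := exists_normal_solution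
      (Matrix.of fun (i : Fin J × Fin n) (t : Fin k) => s.mem 8 i.1 i.2 t)
      (fun i => s.mem 9 i.1 i.2 0)
    refine ⟨fun w => if h : w < k then x ⟨w, h⟩ else 0, fun i hi => ?_⟩
    rw [r2 m hm30, r1 m hm30, ← hk] at hi ⊢
    have h3 := congrFun hx ⟨i, hi⟩
    simp only [mulVec, dotProduct, transpose_apply, of_apply,
      Fintype.sum_prod_type] at h3
    rw [w2 i hi, sum_congr rfl fun w hw => by
      rw [w1 i hi w (mem_range.1 hw)], hswap]
    simp only [sum_range]
    simpa using h3)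
  rw [r2 m hm30, r1 m hm30, ← hk, ← hu] at key
  intro t ht
  have h4 := key t ht
  rw [w2 t ht, sum_congr rfl fun w hw => by
      rw [w1 t ht w (mem_range.1 hw)], hswap] at h4
  simp only [mul_sub, sum_sub_distrib]
  linarith

theorem leastSquares_reg (eig : EigenSolver) (J m : ℕ) (s : Memory) {x : ℕ} (hx : x < 29) :
    ((leastSquares J m).exec eig s).reg x = s.reg x :=
  exec_frame_reg eig (p := fun x => decide (29 ≤ x)) rfl _ (by simpa using hx)

theorem leastSquares_frame (eig : EigenSolver) (J m : ℕ) (s : Memory) {a : ℕ}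
    (ha : [10, 11, 12, 13, 14, 15, 16, 17, 18, 20].contains a = false) :
    ((leastSquares J m).exec eig s).mem a = s.mem a :=
  exec_frame_arr eig rfl _ ha

/-! ### Genericity on the set of triples with orthonormal columns -/

section generic
variable {n r : ℕ}

/-- Polynomial functions of the entries of a triple of matrices. -/
def PolyFun (g : (Fin 3 → Mat n r) → ℝ) : Prop :=
  ∃ f : MvPolynomial (Fin 3 × Fin n × Fin r) ℝ,
    ∀ F, MvPolynomial.eval (fun x => F x.1 x.2.1 x.2.2) f = g F

theorem PolyFun.const (c : ℝ) : PolyFun (n := n) (r := r) fun _ => c :=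
  ⟨MvPolynomial.C c, fun F => by simp⟩

theorem PolyFun.entry (c : Fin 3) (i : Fin n) (k : Fin r) :
    PolyFun (n := n) (r := r) fun F => F c i k :=
  ⟨MvPolynomial.X (c, i, k), fun F => by simp⟩

theorem PolyFun.add {g h : (Fin 3 → Mat n r) → ℝ} (hg : PolyFun g)
    (hh : PolyFun h) : PolyFun fun F => g F + h F := by
  obtain ⟨f, hf⟩ := hg
  obtain ⟨f', hf'⟩ := hh
  exact ⟨f + f', fun F => by simp [hf, hf']⟩

theorem PolyFun.mul {g h : (Fin 3 → Mat n r) → ℝ} (hg : PolyFun g)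
    (hh : PolyFun h) : PolyFun fun F => g F * h F := by
  obtain ⟨f, hf⟩ := hg
  obtain ⟨f', hf'⟩ := hh
  exact ⟨f * f', fun F => by simp [hf, hf']⟩

theorem PolyFun.sub {g h : (Fin 3 → Mat n r) → ℝ} (hg : PolyFun g)
    (hh : PolyFun h) : PolyFun fun F => g F - h F := by
  simpa [sub_eq_add_neg] using hg.add ((PolyFun.const (-1)).mul hh)

theorem PolyFun.sum {ι : Type*} (s : Finset ι) {g : ι → (Fin 3 → Mat n r) → ℝ}
    (hg : ∀ i ∈ s, PolyFun (g i)) : PolyFun fun F => ∑ i ∈ s, g i F := by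
  classical
  induction s using induction_on with
  | empty => simpa using PolyFun.const 0
  | insert i s hi ih =>
    simp only [sum_insert hi]
    exact (hg i (by simp)).add (ih fun j hj => hg j (by simp [hj]))

theorem PolyFun.prod {ι : Type*} (s : Finset ι) {g : ι → (Fin 3 → Mat n r) → ℝ}
    (hg : ∀ i ∈ s, PolyFun (g i)) : PolyFun fun F => ∏ i ∈ s, g i F := by
  classical
  induction s using induction_on with
  | empty => simpa using PolyFun.const 1
  | insert i s hi ih =>
    simp only [Finset.prod_insert hi]
    exact (hg i (by simp)).mul (ih fun j hj => hg j (by simp [hj]))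

theorem PolyFun.ite {g h : (Fin 3 → Mat n r) → ℝ} (p : Prop) [Decidable p]
    (hg : PolyFun g) (hh : PolyFun h) : PolyFun fun F => if p then g F else h F := by
  split_ifs
  · exact hg
  · exact hh

theorem PolyFun.det {ι : Type*} [Fintype ι] [DecidableEq ι]
    {g : ι → ι → (Fin 3 → Mat n r) → ℝ} (hg : ∀ i j, PolyFun (g i j)) :
    PolyFun fun F => (Matrix.of fun i j => g i j F).det := by
  simp only [Matrix.det_apply', of_apply]
  exact PolyFun.sum _ fun σ _ => (PolyFun.const _).mul (PolyFun.prod _ fun i _ => hg _ _)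

theorem GenericOrth.mono {P Q : (A B C : Mat n r) → Prop}
    (h : GenericOrth n r P)
    (hPQ : ∀ A B C : Mat n r, Aᵀ * A = 1 → Bᵀ * B = 1 → P A B C → Q A B C) :
    GenericOrth n r Q := by
  obtain ⟨f, h1, h2⟩ := h
  exact ⟨f, h1, fun F hF hf => hPQ _ _ _ hF.1 hF.2 (h2 F hF hf)⟩

theorem continuous_eval_entries (f : MvPolynomial (Fin 3 × Fin n × Fin r) ℝ) :
    Continuous fun F : Fin 3 → Mat n r =>
      MvPolynomial.eval (fun x => F x.1 x.2.1 x.2.2) f := by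
  refine (MvPolynomial.continuous_eval f).comp (continuous_pi fun x => ?_)
  exact (continuous_apply x.2.2).comp ((continuous_apply x.2.1).comp (continuous_apply x.1))

/-- A point where the first polynomial is nonzero has a whole neighbourhood with this property, and
density of the second condition is applied inside it. -/
theorem GenericOrth.and {P Q : (A B C : Mat n r) → Prop}
    (hP : GenericOrth n r P) (hQ : GenericOrth n r Q) :
    GenericOrth n r fun A B C => P A B C ∧ Q A B C := by
  obtain ⟨f, h1, h2⟩ := hP
  obtain ⟨g, k1, k2⟩ := hQ
  refine ⟨f * g, fun F hF => ?_, fun F hF hfg => ?_⟩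
  · rw [mem_closure_iff]
    intro o ho hFo
    obtain ⟨F1, hF1o, hF1, hF1f⟩ := mem_closure_iff.1 (h1 hF) o ho hFo
    have hop : IsOpen (o ∩ {F | MvPolynomial.eval (fun x => F x.1 x.2.1 x.2.2) f ≠ 0}) :=
      ho.inter (isOpen_ne_fun (continuous_eval_entries f) continuous_const)
    obtain ⟨F2, hF2o, hF2, hF2g⟩ := mem_closure_iff.1 (k1 hF1) _ hop ⟨hF1o, hF1f⟩
    exact ⟨F2, hF2o.1, hF2, by grind⟩
  grind

theorem GenericOrth.trivial : GenericOrth n r fun _ _ _ => True :=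
  ⟨1, fun F hF => subset_closure ⟨hF, by simp⟩, fun _ _ _ => True.intro⟩

theorem GenericOrth.forall {ι : Type*} [Finite ι]
    {P : ι → (A B C : Mat n r) → Prop} (h : ∀ i, GenericOrth n r (P i)) :
    GenericOrth n r fun A B C => ∀ i, P i A B C := by
  classical
  have := Fintype.ofFinite ι
  have key : ∀ s : Finset ι, GenericOrth n r fun A B C => ∀ i ∈ s, P i A B C := by
    intro s
    induction s using induction_on with
    | empty => exact GenericOrth.trivial.mono fun _ _ _ _ _ _ => by simp
    | insert i s hi ih =>
      exact ((h i).and ih).mono fun _ _ _ _ _ h' => by simpa using h'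
  exact (key univ).mono fun _ _ _ _ _ h' i => h' i (mem_univ i)

theorem GenericOrth.exists {P : (A B C : Mat n r) → Prop}
    (h : GenericOrth n r P) (hne : (orthFactors n r).Nonempty) :
    ∃ A B C : Mat n r, Aᵀ * A = 1 ∧ Bᵀ * B = 1 ∧ P A B C := by
  obtain ⟨f, h1, h2⟩ := h
  obtain ⟨F, hF⟩ := hne
  obtain ⟨F', hF', hf⟩ := closure_nonempty_iff.1 ⟨F, h1 hF⟩
  exact ⟨F' 0, F' 1, F' 2, hF'.1, hF'.2, h2 F' hF' hf⟩

/-! #### Reflections -/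

/-- Reflect all columns of a matrix in the hyperplane orthogonal to `v`. -/
noncomputable def reflectCols (v : Fin n → ℝ) (A : Mat n r) :
    Mat n r :=
  Matrix.of fun i k => A i k - 2 * (v ⬝ᵥ fun j => A j k) / (v ⬝ᵥ v) * v i

theorem reflectCols_col (v : Fin n → ℝ) (A : Mat n r) (k : Fin r) :
    (fun i => reflectCols v A i k) =
      (fun i => A i k) - (2 * (v ⬝ᵥ fun j => A j k) / (v ⬝ᵥ v)) • v := by
  ext i
  simp [reflectCols]

theorem orth_iff (A : Mat n r) : Aᵀ * A = 1 ↔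
    ∀ k l, (fun i => A i k) ⬝ᵥ (fun i => A i l) = if k = l then 1 else 0 := by
  constructor
  · intro h k l
    have := congrFun (congrFun h k) l
    rwa [mul_apply, one_apply] at this
  · intro h
    ext k l
    rw [mul_apply, one_apply]
    exact h k l

theorem reflectCols_dot (v : Fin n → ℝ) (A : Mat n r) (k l : Fin r) :
    (fun i => reflectCols v A i k) ⬝ᵥ (fun i => reflectCols v A i l) =
      (fun i => A i k) ⬝ᵥ (fun i => A i l) := by
  rw [reflectCols_col, reflectCols_col]
  set a := fun i => A i k
  set b := fun i => A i l
  simp only [sub_dotProduct, dotProduct_sub, smul_dotProduct, dotProduct_smul, smul_eq_mul]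
  rw [dotProduct_comm a v]
  grind

theorem reflectCols_orth (v : Fin n → ℝ) {A : Mat n r} (hA : Aᵀ * A = 1) :
    (reflectCols v A)ᵀ * reflectCols v A = 1 := by
  rw [orth_iff] at hA ⊢
  intro k l
  rw [reflectCols_dot, hA]

theorem reflectCols_reflectCols (v : Fin n → ℝ) (A : Mat n r) :
    reflectCols v (reflectCols v A) = A := by
  have : ∀ k, (fun i => reflectCols v (reflectCols v A) i k) = fun i => A i k := by
    intro k
    rw [reflectCols_col, reflectCols_col]
    set a := fun i => A i k
    by_cases hv : v ⬝ᵥ v = 0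
    · simp [hv]
    · rw [dotProduct_sub, dotProduct_smul, sub_sub, ← add_smul, smul_eq_mul]
      have : 2 * (v ⬝ᵥ a) / (v ⬝ᵥ v) +
          2 * (v ⬝ᵥ a - 2 * (v ⬝ᵥ a) / (v ⬝ᵥ v) * (v ⬝ᵥ v)) / (v ⬝ᵥ v) = 0 := by
        field_simp
        ring
      rw [this, zero_smul, sub_zero]
  ext i k
  exact congrFun (this k) i

theorem reflectCols_neg (v : Fin n → ℝ) (A : Mat n r) :
    reflectCols (-v) A = reflectCols v A := by
  ext i k
  simp [reflectCols, neg_div]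

theorem continuous_reflectCols (v : Fin n → ℝ) :
    Continuous (reflectCols v : Mat n r → _) := by
  refine continuous_matrix fun i k => ?_
  simp only [reflectCols, of_apply, dotProduct]
  fun_prop

/-! #### Sets of triples on which a polynomial vanishes locally -/

/-- The triples near which the function `g` vanishes. -/
def localZeros (g : (Fin 3 → Mat n r) → ℝ) :
    Set (Fin 3 → Mat n r) :=
  {F | F ∈ orthFactors n r ∧ ∀ᶠ F' in nhdsWithin F (orthFactors n r), g F' = 0}

open Topology Filter in
/-- Local zeros are transported along analytic families of transformations. -/
theorem localZeros_transport {g : (Fin 3 → Mat n r) → ℝ} (hg : PolyFun g)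
    (Φ : ℝ → (Fin 3 → Mat n r) → (Fin 3 → Mat n r))
    (Ψ : (Fin 3 → Mat n r) → (Fin 3 → Mat n r))
    (h1 : ∀ t, ∀ F ∈ orthFactors n r, Φ t F ∈ orthFactors n r) (h2 : ∀ F, Φ 0 F = F)
    (h3 : ∀ F c i k, AnalyticOnNhd ℝ (fun t => Φ t F c i k) (Set.Icc 0 1))
    (h4 : Continuous Ψ) (h5 : ∀ F ∈ orthFactors n r, Ψ F ∈ orthFactors n r)
    (h6 : ∀ F, Φ 1 (Ψ F) = F) (h7 : ∀ F, Ψ (Φ 1 F) = F)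
    {F : Fin 3 → Mat n r} (hF : F ∈ localZeros g) : Φ 1 F ∈ localZeros g := by
  obtain ⟨hF, hev⟩ := hF
  refine ⟨h1 1 F hF, ?_⟩
  obtain ⟨f, hf⟩ := hg
  -- For `F'` near `F` the analytic function `t ↦ g (Φ t F')` vanishes for small `t`, because `Φ 0`
  -- is the identity; by the identity theorem it vanishes up to `t = 1`.
  have key : ∀ᶠ F' in 𝓝[orthFactors n r] F, g (Φ 1 F') = 0 := by
    filter_upwards [eventually_eventually_nhdsWithin.2 hev, self_mem_nhdsWithin] with F' hF' hF'o
    have han : AnalyticOnNhd ℝ (fun t => g (Φ t F')) (Set.Icc 0 1) := by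
      simp only [← hf]
      intro t ht
      have := AnalyticAt.aeval_mvPolynomial (𝕜 := ℝ) (z := t)
        (f := fun (t : ℝ) (x : Fin 3 × Fin n × Fin r) => Φ t F' x.1 x.2.1 x.2.2)
        (fun x => h3 F' x.1 x.2.1 x.2.2 t ht) f
      exact this
    have hcont : ContinuousAt (fun t => Φ t F') 0 := by
      refine continuousAt_pi.2 fun c => ?_
      refine continuousAt_pi.2 fun i => ?_
      refine continuousAt_pi.2 fun k => ?_
      exact (h3 F' c i k 0 (by simp)).continuousAt
    have h0 : (fun t => g (Φ t F')) =ᶠ[𝓝 0] 0 := by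
      have ht : Tendsto (fun t => Φ t F') (𝓝 0) (𝓝[orthFactors n r] F') := by
        refine tendsto_nhdsWithin_iff.2 ⟨?_, Eventually.of_forall fun t => h1 t F' hF'o⟩
        have := hcont.tendsto
        rwa [h2] at this
      exact ht.eventually hF'
    exact han.eqOn_zero_of_preconnected_of_eventuallyEq_zero isPreconnected_Icc
      (by simp : (0 : ℝ) ∈ Set.Icc (0 : ℝ) 1) h0 (by simp : (1 : ℝ) ∈ Set.Icc (0 : ℝ) 1)
  -- The continuous inverse `Ψ` of `Φ 1` carries a neighbourhood of `Φ 1 F` into the one just found.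
  have ht : Tendsto Ψ (𝓝[orthFactors n r] (Φ 1 F)) (𝓝[orthFactors n r] F) := by
    refine tendsto_nhdsWithin_iff.2 ⟨?_, ?_⟩
    · have := (h4.tendsto (Φ 1 F)).mono_left
        (nhdsWithin_le_nhds (s := orthFactors n r))
      rwa [h7] at this
    · filter_upwards [self_mem_nhdsWithin] with F' hF'
      exact h5 F' hF'
  filter_upwards [ht.eventually key] with F' hF'
  rwa [h6] at hF'

theorem mem_orth_update {F : Fin 3 → Mat n r} (hF : F ∈ orthFactors n r)
    (c : Fin 3) {A : Mat n r} (hA : c ≠ 2 → Aᵀ * A = 1) :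
    Function.update F c A ∈ orthFactors n r := by
  fin_cases c
  · exact ⟨by simpa using hA, by simpa using hF.2⟩
  · exact ⟨by simpa using hF.1, by simpa using hA⟩
  · exact ⟨by simpa using hF.1, by simpa using hF.2⟩

theorem orth_of_mem {F : Fin 3 → Mat n r} (hF : F ∈ orthFactors n r)
    {c : Fin 3} (hc : c ≠ 2) : (F c)ᵀ * F c = 1 := by
  fin_cases c
  · exact hF.1
  · exact hF.2
  · exact absurd rfl hc

/-- The reflections in `u + t (v - u)`, composed with that in `u`, join the identity to the product
in question. The segment avoids zero if `u ⬝ᵥ v ≥ 0`, and otherwise `v` may be replaced by `-v`,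
which defines the same reflection. -/
theorem localZeros_reflect_two {g : (Fin 3 → Mat n r) → ℝ} (hg : PolyFun g)
    {c : Fin 3} (hc : c ≠ 2) {u v : Fin n → ℝ} (hu : u ≠ 0) (hv : v ≠ 0)
    {F : Fin 3 → Mat n r} (hF : F ∈ localZeros g) :
    Function.update F c (reflectCols v (reflectCols u (F c))) ∈ localZeros g := by
  have main : ∀ v : Fin n → ℝ, v ≠ 0 → 0 ≤ u ⬝ᵥ v →
      Function.update F c (reflectCols v (reflectCols u (F c))) ∈ localZeros g := by
    intro v hv huv
    have hpos : ∀ w : Fin n → ℝ, w ≠ 0 → 0 < w ⬝ᵥ w := fun w hw =>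
      lt_of_le_of_ne (sum_nonneg fun i _ => mul_self_nonneg (w i)) fun h => hw (dotProduct_self_eq_zero.1 h.symm)
    have hnz : ∀ t ∈ Set.Icc (0 : ℝ) 1,
        (fun i => u i + t * (v i - u i)) ⬝ᵥ (fun i => u i + t * (v i - u i)) ≠ 0 := by
      intro t ht
      have e : (fun i => u i + t * (v i - u i)) = (1 - t) • u + t • v := by
        ext i
        simp
        ring
      rw [e]
      simp only [dotProduct_add, add_dotProduct, smul_dotProduct, dotProduct_smul, smul_eq_mul]
      rw [dotProduct_comm v u]
      rcases eq_or_lt_of_le ht.1 with h | h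
      · grind
      · have h1 := mul_pos h (mul_pos h (hpos v hv))
        have h2 := mul_nonneg (sub_nonneg.2 ht.2) (mul_nonneg (sub_nonneg.2 ht.2)
          (hpos u hu).le)
        have h3 := mul_nonneg h.le (mul_nonneg (sub_nonneg.2 ht.2) huv)
        nlinarith
    have := localZeros_transport hg
      (fun t F => Function.update F c
        (reflectCols (fun i => u i + t * (v i - u i)) (reflectCols u (F c))))
      (fun F => Function.update F c (reflectCols u (reflectCols v (F c))))
      (fun t F hF => mem_orth_update hF c fun hc =>
        reflectCols_orth _ (reflectCols_orth _ (orth_of_mem hF hc)))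
      (fun F => by simp [reflectCols_reflectCols])
      (by
        intro F c' i k
        by_cases h : c' = c
        · subst h
          intro t ht
          simp only [Function.update_self]
          have e : ∀ i, AnalyticAt ℝ (fun t : ℝ => u i + t * (v i - u i)) t := fun i =>
            analyticAt_const.add (analyticAt_id.mul analyticAt_const)
          have h1 : AnalyticAt ℝ (fun t : ℝ => (fun i => u i + t * (v i - u i)) ⬝ᵥ
              fun j => reflectCols u (F c') j k) t := by
            simp only [dotProduct]
            exact Finset.analyticAt_fun_sum _ fun i _ => (e i).mul analyticAt_const
          have h2 : AnalyticAt ℝ (fun t : ℝ => (fun i => u i + t * (v i - u i)) ⬝ᵥ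
              fun i => u i + t * (v i - u i)) t := by
            simp only [dotProduct]
            exact Finset.analyticAt_fun_sum _ fun i _ => (e i).mul (e i)
          exact analyticAt_const.sub (((analyticAt_const.mul h1).div h2 (hnz t ht)).mul (e i))
        · simp only [Function.update_of_ne h]
          exact fun t _ => analyticAt_const)
      (by
        refine Continuous.update continuous_id c ?_
        exact (continuous_reflectCols u).comp ((continuous_reflectCols v).comp
          (continuous_apply c)))
      (fun F hF => mem_orth_update hF c fun hc =>
        reflectCols_orth _ (reflectCols_orth _ (orth_of_mem hF hc)))
      (fun F => by simp [reflectCols_reflectCols])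
      (fun F => by simp [reflectCols_reflectCols]) hF
    simpa using this
  rcases le_total 0 (u ⬝ᵥ v) with h | h
  · exact main v hv h
  · have := main (-v) (neg_ne_zero.2 hv) (by rw [dotProduct_neg]; linarith)
    rwa [reflectCols_neg] at this

theorem localZeros_translate {g : (Fin 3 → Mat n r) → ℝ} (hg : PolyFun g)
    (C : Mat n r) {F : Fin 3 → Mat n r}
    (hF : F ∈ localZeros g) : Function.update F 2 C ∈ localZeros g := by
  have := localZeros_transport hg
    (fun t F' => Function.update F' 2 (F' 2 + t • (C - F 2)))
    (fun F' => Function.update F' 2 (F' 2 - (C - F 2)))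
    (fun t F hF => mem_orth_update hF 2 fun h => absurd rfl h) (fun F => by simp)
    (by
      intro F' c' i k
      by_cases h : c' = 2
      · subst h
        intro t ht
        simp only [Function.update_self, Matrix.add_apply, Matrix.smul_apply, smul_eq_mul]
        exact analyticAt_const.add (analyticAt_id.mul analyticAt_const)
      · simp only [Function.update_of_ne h]
        exact fun t _ => analyticAt_const)
    (Continuous.update continuous_id 2 ((continuous_apply 2).sub continuous_const))
    (fun F hF => mem_orth_update hF 2 fun h => absurd rfl h)
    (fun F => by simp) (fun F => by simp) hF
  simpa using this

/-- Multiply the first column by `e`. -/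
def scaleFirst (e : ℝ) (A : Mat n r) : Mat n r :=
  Matrix.of fun i k => (if (k : ℕ) = 0 then e else 1) * A i k

/-- Householder's construction carries `F c` to `A` by at most one reflection per column. Only
products of two reflections are available, so an odd number leaves one over; it is spent on changing
the sign of the first column. -/
theorem localZeros_move {g : (Fin 3 → Mat n r) → ℝ} (hg : PolyFun g)
    (hr : 0 < r) {c : Fin 3} (hc : c ≠ 2) {A : Mat n r} (hA : Aᵀ * A = 1)
    {F : Fin 3 → Mat n r} (hF : F ∈ localZeros g) :
    ∃ e : ℝ, (e = 1 ∨ e = -1) ∧ Function.update F c (scaleFirst e A) ∈ localZeros g := by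
  set W : Set (Mat n r) := {A' | Function.update F c A' ∈ localZeros g} with hW
  have hW2 : ∀ A' ∈ W, ∀ u v : Fin n → ℝ, u ≠ 0 → v ≠ 0 →
      reflectCols v (reflectCols u A') ∈ W := by
    intro A' hA' u v hu hv
    have := localZeros_reflect_two hg hc hu hv (F := Function.update F c A') hA'
    simpa [hW] using this
  -- The first `j` columns are already right. The disjunction records the parity: either `A'` is
  -- reached, or every further reflection of `A'` is.
  have key : ∀ j ≤ r, ∃ A' : Mat n r, A'ᵀ * A' = 1 ∧
      (∀ k : Fin r, (k : ℕ) < j → ∀ i, A' i k = A i k) ∧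
      (A' ∈ W ∨ ∀ v : Fin n → ℝ, v ≠ 0 → reflectCols v A' ∈ W) := by
    intro j
    induction j with
    | zero =>
      intro _
      exact ⟨F c, orth_of_mem hF.1 hc, fun k hk => by omega, Or.inl (by simpa [hW] using hF)⟩
    | succ j ih =>
      intro hj
      obtain ⟨A', h1, h2, h3⟩ := ih (by omega)
      set a := fun i => A' i ⟨j, hj⟩ with ha
      set b := fun i => A i ⟨j, hj⟩ with hb
      have hk : ∀ k : Fin r, (k : ℕ) < j + 1 → (k : ℕ) < j ∨ k = ⟨j, hj⟩ := fun k hk => by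
        grind
      by_cases hab : a = b
      · refine ⟨A', h1, fun k hk' i => ?_, h3⟩
        rcases hk k hk' with h | rfl
        · exact h2 k h i
        · exact congrFun hab i
      -- The reflection in `a - b` takes `a` to `b` when both are unit vectors, and it fixes the
      -- earlier columns, which are orthogonal to `a` and to `b`.
      · set v := a - b with hv
        have hv0 : v ≠ 0 := sub_ne_zero.2 hab
        refine ⟨reflectCols v A', reflectCols_orth v h1, fun k hk' i => ?_, ?_⟩
        · rw [orth_iff] at h1 hA
          have hcol := congrFun (reflectCols_col v A' k) i
          simp only [] at hcol
          rw [hcol]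
          rcases hk k hk' with h | rfl
          · have hne : k ≠ ⟨j, hj⟩ := by
              rintro rfl
              simp at h
            have e2 : (fun i => A' i k) = fun i => A i k := funext (h2 k h)
            have e1 : v ⬝ᵥ (fun i => A' i k) = 0 := by
              rw [hv, sub_dotProduct, h1, e2, hA, if_neg hne.symm]
              simp
            rw [e1]
            simp [h2 k h i]
          · have n1 : a ⬝ᵥ a = 1 := by rw [ha, h1]; simp
            have n2 : b ⬝ᵥ b = 1 := by rw [hb, hA]; simp
            have e1 : 2 * (v ⬝ᵥ a) = v ⬝ᵥ v := by
              rw [hv]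
              simp only [sub_dotProduct, dotProduct_sub, n1, n2]
              rw [dotProduct_comm b a]
              ring
            have e3 : v ⬝ᵥ v ≠ 0 := fun h => hv0 (dotProduct_self_eq_zero.1 h)
            change (a - (2 * (v ⬝ᵥ a) / (v ⬝ᵥ v)) • v) i = b i
            rw [e1, div_self e3, one_smul, hv, sub_sub_cancel]
        grind
  obtain ⟨A', h1, h2, h3⟩ := key r le_rfl
  have hAA : A' = A := by
    ext i k
    exact h2 k k.2 i
  subst hAA
  rcases h3 with h | h
  · refine ⟨1, Or.inl rfl, ?_⟩
    have : scaleFirst 1 A' = A' := by ext i k; simp [scaleFirst]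
    rwa [this]
  · refine ⟨-1, Or.inr rfl, ?_⟩
    rw [orth_iff] at h1
    have n1 := h1 ⟨0, hr⟩ ⟨0, hr⟩
    rw [if_pos rfl] at n1
    have := h (fun i => A' i ⟨0, hr⟩) (by
      intro h0
      rw [h0] at n1
      simp at n1)
    have e : scaleFirst (-1) A' = reflectCols (fun i => A' i ⟨0, hr⟩) A' := by
      ext i k
      have hcol := congrFun (reflectCols_col (fun i => A' i ⟨0, hr⟩) A' k) i
      simp only [] at hcol
      rw [hcol, n1, h1]
      by_cases hk : k = ⟨0, hr⟩
      · subst hk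
        simp [scaleFirst]
        ring
      · have hk' : (k : ℕ) ≠ 0 := fun h => hk (Fin.ext h)
        simp [scaleFirst, hk', Ne.symm hk]
    rwa [e]

/-- A condition given by a polynomial is generic as soon as it is satisfiable together with its
variants in which the first columns have the other sign. -/
theorem genericOrth_of_poly {g : (Fin 3 → Mat n r) → ℝ} (hg : PolyFun g)
    (hr : 0 < r) {A B : Mat n r} (hA : Aᵀ * A = 1) (hB : Bᵀ * B = 1)
    (hw : ∀ e e' : ℝ, (e = 1 ∨ e = -1) → (e' = 1 ∨ e' = -1) →
      ∃ C, g ![scaleFirst e A, scaleFirst e' B, C] ≠ 0) :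
    GenericOrth n r fun A B C => g ![A, B, C] ≠ 0 := by
  have hg' := hg
  obtain ⟨f, hf⟩ := hg'
  refine ⟨f, fun F hF => ?_, fun F hF hne => ?_⟩
  · by_contra hcl
    have hz : F ∈ localZeros g := by
      refine ⟨hF, ?_⟩
      rw [mem_closure_iff_frequently, Filter.not_frequently] at hcl
      filter_upwards [nhdsWithin_le_nhds hcl, self_mem_nhdsWithin] with F' h1 h2
      grind
    obtain ⟨e, he, h1⟩ := localZeros_move hg hr (c := 0) (by decide) hA hz
    obtain ⟨e', he', h2⟩ := localZeros_move hg hr (c := 1) (by decide) hB h1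
    obtain ⟨C, hC⟩ := hw e e' he he'
    have h3 := localZeros_translate hg C h2
    refine hC ?_
    have h4 := h3.2.self_of_nhdsWithin h3.1
    convert h4 using 2
    funext c
    fin_cases c <;> simp
  · rw [hf] at hne
    convert hne using 2
    funext c
    fin_cases c <;> rfl

/-- The injectivity of a linear system whose coefficients are polynomials is generic. -/
theorem genericOrth_of_injective {ι κ : Type*} [Fintype ι] [Fintype κ]
    {g : ι → κ → (Fin 3 → Mat n r) → ℝ} (hg : ∀ i k, PolyFun (g i k))
    (hr : 0 < r) {A B : Mat n r} (hA : Aᵀ * A = 1) (hB : Bᵀ * B = 1)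
    (hw : ∀ e e' : ℝ, (e = 1 ∨ e = -1) → (e' = 1 ∨ e' = -1) →
      ∃ C, ∀ x : κ → ℝ, (∀ i, ∑ k, g i k ![scaleFirst e A, scaleFirst e' B, C] * x k = 0) →
        x = 0) :
    GenericOrth n r fun A B C => ∀ x : κ → ℝ, (∀ i, ∑ k, g i k ![A, B, C] * x k = 0) → x = 0 := by
  classical
  -- The Gram determinant expresses injectivity by a single polynomial, however many equations there
  -- are.
  have hdet : ∀ F, (∀ x : κ → ℝ, (∀ i, ∑ k, g i k F * x k = 0) → x = 0) ↔
      (Matrix.of fun k k' => ∑ i, g i k F * g i k' F).det ≠ 0 := by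
    intro F
    set L : Matrix ι κ ℝ := Matrix.of fun i k => g i k F with hL
    have e1 : (Matrix.of fun k k' => ∑ i, g i k F * g i k' F) = Lᵀ * L := by
      ext k k'
      simp [mul_apply, hL]
    have e2 : ∀ x : κ → ℝ, (∀ i, ∑ k, g i k F * x k = 0) ↔ L *ᵥ x = 0 := by
      intro x
      rw [funext_iff]
      rfl
    rw [e1, Ne, ← Matrix.exists_mulVec_eq_zero_iff]
    constructor
    · rintro h ⟨v, hv, hv'⟩
      refine hv (h v ((e2 v).2 ?_))
      rw [← mulVec_mulVec] at hv'
      have : (L *ᵥ v) ⬝ᵥ (L *ᵥ v) = 0 := by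
        rw [dotProduct_mulVec, ← mulVec_transpose, hv', zero_dotProduct]
      exact dotProduct_self_eq_zero.1 this
    · intro h x hx
      by_contra hx0
      refine h ⟨x, hx0, ?_⟩
      rw [← mulVec_mulVec, (e2 x).1 hx, Matrix.mulVec_zero]
  have := genericOrth_of_poly (g := fun F => (Matrix.of fun k k' => ∑ i, g i k F * g i k' F).det)
    (PolyFun.det fun k k' => PolyFun.sum _ fun i _ => (hg i k).mul (hg i k')) hr hA hB
    (fun e e' he he' => by
      simp_all)
  exact this.mono fun A B C _ _ h => (hdet _).2 h

end generic

/-! ### Witnesses for generic conditions -/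

section witnesses
variable {n r : ℕ}

/-- The injectivity of a linear map which depends polynomially on the triple is generic. -/
theorem genericOrth_of_linear {V ι : Type*} [AddCommGroup V] [Module ℝ V] [FiniteDimensional ℝ V]
    [Fintype ι] {Λ : (Fin 3 → Mat n r) → V → ι → ℝ}
    (hadd : ∀ F x y i, Λ F (x + y) i = Λ F x i + Λ F y i)
    (hsmul : ∀ F (c : ℝ) x i, Λ F (c • x) i = c * Λ F x i)
    (hpoly : ∀ x i, PolyFun fun F => Λ F x i)
    (hr : 0 < r) {A B : Mat n r} (hA : Aᵀ * A = 1) (hB : Bᵀ * B = 1)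
    (hw : ∀ e e' : ℝ, (e = 1 ∨ e = -1) → (e' = 1 ∨ e' = -1) →
      ∃ C, ∀ x, (∀ i, Λ ![scaleFirst e A, scaleFirst e' B, C] x i = 0) → x = 0) :
    GenericOrth n r fun A B C => ∀ x, (∀ i, Λ ![A, B, C] x i = 0) → x = 0 := by
  set v := Module.finBasis ℝ V
  have hsum : ∀ F (c : Fin (Module.finrank ℝ V) → ℝ) i,
      ∑ k, Λ F (v k) i * c k = Λ F (∑ k, c k • v k) i := by
    intro F c i
    let L : V →ₗ[ℝ] ℝ := ⟨⟨fun x => Λ F x i, fun x y => hadd F x y i⟩, fun c x => hsmul F c x i⟩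
    change _ = L _
    rw [map_sum]
    refine sum_congr rfl fun k _ => ?_
    rw [map_smul, smul_eq_mul, mul_comm]
    rfl
  have hz : ∀ F, (∀ x, (∀ i, Λ F x i = 0) → x = 0) ↔ ∀ c : Fin (Module.finrank ℝ V) → ℝ,
      (∀ i, ∑ k, Λ F (v k) i * c k = 0) → c = 0 := by
    intro F
    simp only [hsum]
    constructor
    · intro h c hc
      have := h _ hc
      ext k
      exact Fintype.linearIndependent_iff.1 v.linearIndependent c this k
    · intro h x hx
      have h1 := h (fun k => v.repr x k) (by rw [v.sum_repr]; exact hx)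
      rw [← v.sum_repr x]
      exact sum_eq_zero fun k _ => by rw [congrFun h1 k, Pi.zero_apply, zero_smul]
  refine (genericOrth_of_injective (g := fun i k F => Λ F (v k) i) (fun i k => hpoly _ _) hr hA hB
    fun e e' he he' => ?_).mono fun A B C _ _ h => (hz _).2 h
  obtain ⟨C, hC⟩ := hw e e' he he'
  exact ⟨C, (hz _).1 hC⟩

/-- Extension of an orthonormal family. -/
theorem exists_orth_extension (hrn : r ≤ n) (v : Fin r → Fin n → ℝ) (s : Set (Fin r))
    (h : ∀ k ∈ s, ∀ l ∈ s, v k ⬝ᵥ v l = if k = l then 1 else 0) :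
    ∃ A : Mat n r, Aᵀ * A = 1 ∧ ∀ k ∈ s, ∀ i, A i k = v k i := by
  set E := EuclideanSpace ℝ (Fin n)
  set v' : Fin n → E := fun i => if h : (i : ℕ) < r then WithLp.toLp 2 (v ⟨i, h⟩) else 0 with hv'
  set s' : Set (Fin n) := {i | ∃ h : (i : ℕ) < r, (⟨i, h⟩ : Fin r) ∈ s} with hs'
  have horth : Orthonormal ℝ (s'.domRestrict v') := by
    rw [orthonormal_iff_ite]
    rintro ⟨i, hi, hi'⟩ ⟨j, hj, hj'⟩
    have e : ∀ (i : Fin n) (hi : (i : ℕ) < r), v' i = WithLp.toLp 2 (v ⟨i, hi⟩) := fun i hi => by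
      simp only [hv', dif_pos hi]
    rw [Set.domRestrict_apply, Set.domRestrict_apply, e i hi, e j hj,
      EuclideanSpace.inner_eq_star_dotProduct]
    simp only [star_trivial]
    grind
  obtain ⟨b, hb⟩ := horth.exists_orthonormalBasis_extension_of_card_eq (by simp [E])
  have hbb : ∀ i j, (b i).ofLp ⬝ᵥ (b j).ofLp = if i = j then (1 : ℝ) else 0 := by
    intro i j
    have := orthonormal_iff_ite.1 b.orthonormal j i
    rw [EuclideanSpace.inner_eq_star_dotProduct] at this
    simp only [star_trivial] at this
    rw [this]
    simp [eq_comm]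
  refine ⟨Matrix.of fun i k => (b (Fin.castLE hrn k)).ofLp i, ?_, fun k hk i => ?_⟩
  · rw [orth_iff]
    simp_all
  simp_all

/-- The matrix whose columns are the unit vectors with the numbers `φ k`. -/
def unitCols (φ : Fin r → Fin n) : Mat n r :=
  Matrix.of fun i k => if i = φ k then 1 else 0

theorem unitCols_orth {φ : Fin r → Fin n} (hφ : Function.Injective φ) :
    (unitCols φ)ᵀ * unitCols φ = 1 := by
  rw [orth_iff]
  intro k l
  simp [unitCols, dotProduct, hφ.eq_iff, eq_comm]

/-- All minors of the matrix are nonzero. -/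
def AllMinors (B : Mat n r) : Prop :=
  ∀ (m : ℕ) (ρ : Fin m → Fin n) (κ : Fin m → Fin r), Function.Injective ρ →
    Function.Injective κ → (B.submatrix ρ κ).det ≠ 0

theorem exists_perm_extending {m : ℕ} {ρ κ : Fin m → Fin n} (hρ : Function.Injective ρ)
    (hκ : Function.Injective κ) : ∃ σ : Equiv.Perm (Fin n), ∀ i, σ (κ i) = ρ i := by
  have := Equiv.Perm.isMultiplyPretransitive (Fin n) m
  obtain ⟨σ, hσ⟩ := MulAction.exists_smul_eq (Equiv.Perm (Fin n)) (⟨κ, hκ⟩ : Fin m ↪ Fin n)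
    ⟨ρ, hρ⟩
  refine ⟨σ, fun i => ?_⟩
  have := congrArg (fun f : Fin m ↪ Fin n => f i) hσ
  simpa using this

/-- There are finitely many minors, and each is nonzero for a permutation-like matrix whose
submatrix in question is diagonal with entries `1` or `-1`. As each condition is generic, one matrix
satisfies them all. -/
theorem exists_allMinors (hr : 0 < r) (hrn : r ≤ n) :
    ∃ B : Mat n r, Bᵀ * B = 1 ∧ AllMinors B := by
  have h0 := unitCols_orth (Fin.castLE_injective hrn)
  have key : GenericOrth n r fun _ B _ => ∀ x : (m : Fin (r + 1)) × ((Fin m → Fin n) ×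
      (Fin m → Fin r)), Function.Injective x.2.1 → Function.Injective x.2.2 →
      (B.submatrix x.2.1 x.2.2).det ≠ 0 := by
    refine GenericOrth.forall fun x => ?_
    obtain ⟨m, ρ, κ⟩ := x
    by_cases hρ : Function.Injective ρ
    swap
    · exact GenericOrth.trivial.mono fun _ _ _ _ _ _ h => absurd h hρ
    by_cases hκ : Function.Injective κ
    swap
    · exact GenericOrth.trivial.mono fun _ _ _ _ _ _ _ h => absurd h hκ
    obtain ⟨σ, hσ⟩ := exists_perm_extending hρ ((Fin.castLE_injective hrn).comp hκ)
    have hinj : Function.Injective fun k => σ (Fin.castLE hrn k) :=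
      σ.injective.comp (Fin.castLE_injective hrn)
    refine (genericOrth_of_poly (g := fun F => (Matrix.of fun i j => F 1 (ρ i) (κ j)).det)
      (PolyFun.det fun i j => PolyFun.entry _ _ _) hr h0 (unitCols_orth hinj)
      fun e e' he he' => ⟨0, ?_⟩).mono fun _ _ _ _ _ h _ _ => h
    have : (Matrix.of fun i j => (![scaleFirst e (unitCols (Fin.castLE hrn)), scaleFirst e'
        (unitCols fun k => σ (Fin.castLE hrn k)), 0] : Fin 3 → Mat n r) 1
          (ρ i) (κ j)) = diagonal fun j => if (κ j : ℕ) = 0 then e' else 1 := by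
      ext i j
      have h1 := hσ j
      simp only [Function.comp] at h1
      change (if (κ j : ℕ) = 0 then e' else 1) *
        (if ρ i = σ (Fin.castLE hrn (κ j)) then 1 else 0) = _
      simp only [h1, hρ.eq_iff, Matrix.diagonal_apply]
      by_cases hij : i = j <;> simp [hij]
    rw [this, Matrix.det_diagonal]
    refine Finset.prod_ne_zero_iff.2 fun j _ => ?_
    grind
  obtain ⟨A, B, C, -, hB, h⟩ := key.exists ⟨![_, _, 0], h0, h0⟩
  refine ⟨B, hB, fun m ρ κ hρ hκ => ?_⟩
  have hm : m ≤ r := by simpa using Fintype.card_le_of_injective κ hκ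
  exact h ⟨⟨m, by omega⟩, ρ, κ⟩ hρ hκ

/-- As many equations as there are possibly nonzero entries form a square system with a nonzero
minor. This is how a sparse row of the unknowns is shown to vanish. -/
theorem AllMinors.rows {B : Mat n r} (hB : AllMinors B) {R : Finset (Fin n)}
    {K : Finset (Fin r)} (hRK : R.card ≤ K.card) {v : Fin n → ℝ} (hv : ∀ q, q ∉ R → v q = 0)
    (h : ∀ k ∈ K, ∑ q, v q * B q k = 0) : v = 0 := by
  obtain ⟨K', hK', hc⟩ := Finset.exists_subset_card_eq hRK
  set ρ := R.orderEmbOfFin rfl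
  set κ := K'.orderEmbOfFin hc
  have hdet := hB _ ρ κ ρ.injective κ.injective
  have h0 : (fun i => v (ρ i)) ᵥ* (B.submatrix ρ κ) = 0 := by
    ext j
    have h1 := h (κ j) (hK' (K'.orderEmbOfFin_mem hc j))
    rw [← Finset.sum_subset (subset_univ R)
      (fun q _ hq => by rw [hv q hq, zero_mul])] at h1
    rw [Pi.zero_apply, ← h1, Matrix.vecMul, dotProduct]
    refine Finset.sum_bij (fun i _ => ρ i) (fun i _ => R.orderEmbOfFin_mem rfl i)
      (fun i _ j _ h => ρ.injective h) (fun q hq => ?_) fun i _ => rfl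
    have : q ∈ Set.range ρ := by rw [Finset.range_orderEmbOfFin]; exact hq
    grind
  have h2 := Matrix.eq_zero_of_vecMul_eq_zero hdet h0
  ext q
  by_cases hq : q ∈ R
  · have : q ∈ Set.range ρ := by rw [Finset.range_orderEmbOfFin]; exact hq
    obtain ⟨i, hi⟩ := this
    rw [← hi]
    exact congrFun h2 i
  · exact hv q hq

theorem AllMinors.cols {B : Mat n r} (hB : AllMinors B) {R : Finset (Fin n)}
    {K : Finset (Fin r)} (hRK : K.card ≤ R.card) {y : Fin r → ℝ} (hy : ∀ k, k ∉ K → y k = 0)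
    (h : ∀ q ∈ R, ∑ k, B q k * y k = 0) : y = 0 := by
  have hBt : AllMinors Bᵀ := fun m ρ κ hρ hκ => by
    have := hB m κ ρ hκ hρ
    rwa [← Matrix.det_transpose] at this
  exact hBt.rows hRK hy fun q hq => by
    rw [← h q hq]
    exact sum_congr rfl fun k _ => mul_comm _ _

/-! #### The linear systems -/

/-- The linear part of `(Mᵢ - Xᵢ) (Mⱼ - Xⱼ)ᵀ = (Mⱼ - Xⱼ) (Mᵢ - Xᵢ)ᵀ`. -/
def sylv {m : ℕ} (M X : Stack m n) (i j : Fin m) : Mat n n :=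
  X i * (M j)ᵀ - M j * (X i)ᵀ + M i * (X j)ᵀ - X j * (M i)ᵀ

/-- The transposed matrices. -/
def flipStack {m : ℕ} (M : Stack m n) : Stack m n := fun i => (M i)ᵀ

/-- The slices of the second stage. -/
def evenSlices (b : ℕ) (S : Tensor n) : Stack 3 n := fun i => slice S (center b (2 * i))

/-- The entries which are unknown in the first stage. -/
abbrev IsOuter (b i p q : ℕ) : Prop := ¬ Near (2 * b) p (center b i) ∧ InBand b (center b i) p q

/-- The entries which are unknown in the second stage. -/
abbrev IsInner (b i p q : ℕ) : Prop :=
  Near (2 * b) p (center b (2 * i)) ∧ InBand b (center b (2 * i)) p q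

/-- The first linear system has at most one solution. -/
def Injective₁ (b : ℕ) (T : Tensor n) : Prop :=
  ∀ X : Stack 5 n, (∀ (i : Fin 5) (p q : Fin n), ¬ IsOuter b i p q → X i p q = 0) →
    (∀ (i j : Fin 5) (p q : Fin n), ¬ InQuad b (center b i) (center b j) p q → sylv (fiveSlices b T) X i j p q = 0) →
    X = 0

/-- The second linear system has at most one solution. -/
def Injective₂ (b : ℕ) (T : Tensor n) : Prop :=
  ∀ Z : Stack 3 n, (∀ (i : Fin 3) (p q : Fin n), ¬ IsInner b i p q → Z i p q = 0) →
    (∀ i j p q, sylv (flipStack (evenSlices b T)) (flipStack Z) i j p q = 0) → Z = 0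

/-- In the coordinates `u = X B` the equation splits over the rank-one terms: each contributes a `2
× 2` minor of the coefficients `c` against `u`. With well-chosen `A` single minors can be isolated.
-/
theorem sylv_apply {m : ℕ} {M X : Stack m n} {A B : Mat n r}
    {c : Fin m → Fin r → ℝ} (hM : ∀ i p q, M i p q = ∑ k, A p k * B q k * c i k)
    {u : Fin m → Fin n → Fin r → ℝ} (hu : ∀ i p k, u i p k = ∑ s, X i p s * B s k) (i j : Fin m)
    (p q : Fin n) :
    sylv M X i j p q = ∑ k, (c j k * u i p k - c i k * u j p k) * A q k -
      ∑ k, (c j k * u i q k - c i k * u j q k) * A p k := by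
  have h : ∀ i j p q, (X i * (M j)ᵀ) p q = ∑ k, c j k * u i p k * A q k := by
    intro i j p q
    simp only [mul_apply, transpose_apply, hM, hu, mul_sum, sum_mul]
    rw [sum_comm]
    grind
  have h' : ∀ i j p q, (M j * (X i)ᵀ) p q = (X i * (M j)ᵀ) q p := by
    intro i j p q
    simp only [mul_apply, transpose_apply]
    grind
  simp only [sylv, Matrix.sub_apply, Matrix.add_apply, h', h, sub_mul, sum_sub_distrib]
  ring

theorem sylv_add {m : ℕ} (M X Y : Stack m n) (i j : Fin m) :
    sylv M (X + Y) i j = sylv M X i j + sylv M Y i j := by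
  simp only [sylv, Pi.add_apply, transpose_add, add_mul, mul_add]
  abel

theorem sylv_smul {m : ℕ} (M X : Stack m n) (c : ℝ) (i j : Fin m) :
    sylv M (c • X) i j = c • sylv M X i j := by
  simp only [sylv, Pi.smul_apply, transpose_smul, smul_mul, Matrix.mul_smul,
    smul_add, smul_sub]

theorem PolyFun.cpTensor (i j l : Fin n) :
    PolyFun (n := n) (r := r) fun F => _root_.cpTensor (F 0) (F 1) (F 2) i j l :=
  PolyFun.sum _ fun k _ => ((PolyFun.entry 0 i k).mul (PolyFun.entry 1 j k)).mul
    (PolyFun.entry 2 l k)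

theorem PolyFun.slice (k : ℕ) (p q : Fin n) :
    PolyFun (n := n) (r := r) fun F => _root_.slice (_root_.cpTensor (F 0) (F 1) (F 2)) k p q := by
  by_cases h : k < n
  · simp only [_root_.slice, of_apply, dif_pos h]
    exact PolyFun.cpTensor _ _ _
  · simp only [_root_.slice, of_apply, dif_neg h]
    exact PolyFun.const 0

theorem PolyFun.sylv {m : ℕ} {M : (Fin 3 → Mat n r) → Stack m n}
    (hM : ∀ i p q, PolyFun fun F => M F i p q) (X : Stack m n) (i j : Fin m) (p q : Fin n) :
    PolyFun fun F => _root_.sylv (M F) X i j p q := by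
  simp only [_root_.sylv, Matrix.sub_apply, Matrix.add_apply, mul_apply,
    transpose_apply]
  exact (((PolyFun.sum _ fun k _ => (PolyFun.const _).mul (hM _ _ _)).sub
    (PolyFun.sum _ fun k _ => (hM _ _ _).mul (PolyFun.const _))).add
    (PolyFun.sum _ fun k _ => (hM _ _ _).mul (PolyFun.const _))).sub
    (PolyFun.sum _ fun k _ => (PolyFun.const _).mul (hM _ _ _))

/-- `C` absorbs the signs of the first columns of `A` and `B`. A single example for a condition on
the tensor therefore supplies all four variants required for genericity. -/
theorem cpTensor_scaleFirst {e e' : ℝ} (he : e = 1 ∨ e = -1) (he' : e' = 1 ∨ e' = -1)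
    (A B C : Mat n r) :
    cpTensor (scaleFirst e A) (scaleFirst e' B) (scaleFirst (e * e') C) = cpTensor A B C := by
  have h : e * e' * (e * e') = 1 := by
    grind
  funext i j l
  refine sum_congr rfl fun k _ => ?_
  simp only [scaleFirst, of_apply]
  grind

/-- The equations of the first linear system, including those for the support. -/
def system₁ (b : ℕ) (T : Tensor n) (X : Stack 5 n) :
    (Fin 5 × Fin n × Fin n) ⊕ (Fin 5 × Fin 5 × Fin n × Fin n) → ℝ
  | .inl (i, p, q) => if IsOuter b i p q then 0 else X i p q
  | .inr (i, j, p, q) => if InQuad b (center b i) (center b j) p q then 0 else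
      sylv (fiveSlices b T) X i j p q

/-- The equations of the second linear system, including those for the support. -/
def system₂ (b : ℕ) (T : Tensor n) (Z : Stack 3 n) :
    (Fin 3 × Fin n × Fin n) ⊕ (Fin 3 × Fin 3 × Fin n × Fin n) → ℝ
  | .inl (i, p, q) => if IsInner b i p q then 0 else Z i p q
  | .inr (i, j, p, q) => sylv (flipStack (evenSlices b T)) (flipStack Z) i j p q

theorem injective₁_iff (b : ℕ) (T : Tensor n) :
    Injective₁ b T ↔ ∀ X, (∀ x, system₁ b T X x = 0) → X = 0 := by
  refine forall_congr' fun X => ?_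
  rw [← and_imp]
  refine imp_congr_left ⟨?_, fun h => ⟨fun i p q hi => ?_, fun i j p q hi => ?_⟩⟩
  · rintro ⟨h1, h2⟩ (⟨i, p, q⟩ | ⟨i, j, p, q⟩)
    · rw [system₁]
      grind
    · rw [system₁]
      grind
  · have := h (.inl (i, p, q))
    rwa [system₁, if_neg hi] at this
  · have := h (.inr (i, j, p, q))
    rwa [system₁, if_neg hi] at this

theorem injective₂_iff (b : ℕ) (T : Tensor n) :
    Injective₂ b T ↔ ∀ X, (∀ x, system₂ b T X x = 0) → X = 0 := by
  refine forall_congr' fun X => ?_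
  rw [← and_imp]
  refine imp_congr_left ⟨?_, fun h => ⟨fun i p q hi => ?_, fun i j p q => ?_⟩⟩
  · rintro ⟨h1, h2⟩ (⟨i, p, q⟩ | ⟨i, j, p, q⟩)
    · rw [system₂]
      grind
    · exact h2 i j p q
  · have := h (.inl (i, p, q))
    rwa [system₂, if_neg hi] at this
  · exact h (.inr (i, j, p, q))

theorem genericOrth_injective₁ {b : ℕ} (hr : 0 < r) {A B C : Mat n r}
    (hA : Aᵀ * A = 1) (hB : Bᵀ * B = 1) (h : Injective₁ b (cpTensor A B C)) :
    GenericOrth n r fun A B C => Injective₁ b (cpTensor A B C) := by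
  have hp : ∀ i p q, PolyFun (n := n) (r := r) fun F =>
    fiveSlices b (cpTensor (F 0) (F 1) (F 2)) i p q := fun i p q => PolyFun.slice _ p q
  have key := genericOrth_of_linear
    (Λ := fun F X x => system₁ b (cpTensor (F 0) (F 1) (F 2)) X x) (A := A) (B := B)
    (fun F X Y x => by
      rcases x with ⟨i, p, q⟩ | ⟨i, j, p, q⟩
      · simp only [system₁, Pi.add_apply, Matrix.add_apply]
        split_ifs <;> simp
      · simp only [system₁, sylv_add, Matrix.add_apply]
        split_ifs <;> simp)
    (fun F c X x => by
      rcases x with ⟨i, p, q⟩ | ⟨i, j, p, q⟩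
      · simp only [system₁, Pi.smul_apply, Matrix.smul_apply, smul_eq_mul]
        split_ifs <;> simp
      · simp only [system₁, sylv_smul, Matrix.smul_apply, smul_eq_mul]
        split_ifs <;> simp)
    (fun X x => by
      rcases x with ⟨i, p, q⟩ | ⟨i, j, p, q⟩
      · exact PolyFun.const _
      · simp only [system₁]
        split_ifs
        · exact PolyFun.const _
        · exact PolyFun.sylv hp X i j p q) hr hA hB
    (fun e e' he he' => ⟨scaleFirst (e * e') C, (injective₁_iff b _).1 (by
      have := cpTensor_scaleFirst he he' A B C
      exact this.symm ▸ h)⟩)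
  exact key.mono fun A B C _ _ h => (injective₁_iff b _).2 h

theorem genericOrth_injective₂ {b : ℕ} (hr : 0 < r) {A B C : Mat n r}
    (hA : Aᵀ * A = 1) (hB : Bᵀ * B = 1) (h : Injective₂ b (cpTensor A B C)) :
    GenericOrth n r fun A B C => Injective₂ b (cpTensor A B C) := by
  have hp : ∀ i p q, PolyFun (n := n) (r := r) fun F =>
    flipStack (evenSlices b (cpTensor (F 0) (F 1) (F 2))) i p q := fun i p q => PolyFun.slice _ q p
  have fadd : ∀ X Y : Stack 3 n, flipStack (X + Y) = flipStack X + flipStack Y := fun X Y => rfl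
  have fsmul : ∀ (c : ℝ) (X : Stack 3 n), flipStack (c • X) = c • flipStack X := fun c X => rfl
  have key := genericOrth_of_linear
    (Λ := fun F X x => system₂ b (cpTensor (F 0) (F 1) (F 2)) X x) (A := A) (B := B)
    (fun F X Y x => by
      rcases x with ⟨i, p, q⟩ | ⟨i, j, p, q⟩
      · simp only [system₂, Pi.add_apply, Matrix.add_apply]
        split_ifs <;> simp
      · simp only [system₂, fadd, sylv_add, Matrix.add_apply])
    (fun F c X x => by
      rcases x with ⟨i, p, q⟩ | ⟨i, j, p, q⟩
      · simp only [system₂, Pi.smul_apply, Matrix.smul_apply, smul_eq_mul]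
        split_ifs <;> simp
      · simp only [system₂, fsmul, sylv_smul, Matrix.smul_apply, smul_eq_mul])
    (fun X x => by
      rcases x with ⟨i, p, q⟩ | ⟨i, j, p, q⟩
      · exact PolyFun.const _
      · exact PolyFun.sylv hp (flipStack X) i j p q) hr hA hB
    (fun e e' he he' => ⟨scaleFirst (e * e') C, (injective₂_iff b _).1 (by
      have := cpTensor_scaleFirst he he' A B C
      exact this.symm ▸ h)⟩)
  exact key.mono fun A B C _ _ h => (injective₂_iff b _).2 h

end witnesses

/-! ### Generic injectivity of the first linear system -/

section witnesses₁
variable {n r b : ℕ}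

theorem card_near_le (w c : ℕ) :
    (univ.filter fun q : Fin n => Near w q c).card ≤ 2 * w + 1 := by
  rw [← card_map Fin.valEmbedding]
  refine (card_le_card (t := Icc (c - w) (c + w)) fun x hx => ?_).trans ?_
  · simp only [mem_map, mem_filter, mem_univ, true_and,
      Fin.valEmbedding_apply] at hx
    grind
  · rw [Nat.card_Icc]
    omega

theorem le_card_of_injOn {K : Finset (Fin r)} {m : ℕ} (f : ℕ → ℕ)
    (hf : ∀ t < m, ∃ h : f t < r, (⟨f t, h⟩ : Fin r) ∈ K)
    (hi : ∀ t < m, ∀ t' < m, f t = f t' → t = t') : m ≤ K.card := by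
  rw [← card_map Fin.valEmbedding]
  refine Finset.le_card_of_inj_on_range f (fun t ht => ?_) hi
  obtain ⟨h, h'⟩ := hf t ht
  exact mem_map.2 ⟨_, h', rfl⟩

/-- Each class modulo `5` has `2b + 1` members below `10b + 5`. Two classes thus match the at most
`4b + 2` unknown entries of a row. -/
theorem le_card_of_two_types (hr : 10 * b + 5 ≤ r) {j j' : ℕ} (hj : j < 5) (hj' : j' < 5)
    (hne : j ≠ j') {K : Finset (Fin r)}
    (hK : ∀ k : Fin r, (k : ℕ) < 10 * b + 5 → ((k : ℕ) % 5 = j ∨ (k : ℕ) % 5 = j') → k ∈ K) :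
    4 * b + 2 ≤ K.card := by
  refine le_card_of_injOn (fun t => 5 * (t / 2) + if t % 2 = 0 then j else j')
    (fun t ht => ?_) (fun t ht t' ht' h => ?_)
  · grind
  · split_ifs at h <;> omega

theorem le_card_of_four_types (hr : 10 * b + 5 ≤ r) {m : ℕ} {K : Finset (Fin r)}
    (hK : ∀ k : Fin r, (k : ℕ) < 10 * b + 5 → (k : ℕ) % 5 ≠ m → k ∈ K) :
    8 * b + 4 ≤ K.card := by
  refine le_card_of_injOn (fun t => 5 * (t / 4) + if t % 4 < m then t % 4 else t % 4 + 1)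
    (fun t ht => ?_) (fun t ht t' ht' h => ?_)
  · grind
  · split_ifs at h <;> omega

/-- Slice `i` has coefficient zero in the three types `i + 1`, `i + 2`, `i + 3`. Consecutive centers
are `2b + 1` apart, so a row is within `2b` of at most two of them, and at most one of the three
types has both its slices near the row. -/
theorem exists_two_good_types (b p : ℕ) {i : ℕ} (hi : i < 5) : ∃ j < 5, ∃ j' < 5, j ≠ j' ∧
    ∀ l, l = j ∨ l = j' → i ≠ l ∧ i ≠ (l + 1) % 5 ∧
      (¬ Near (2 * b) p (center b l) ∨ ¬ Near (2 * b) p (center b ((l + 1) % 5))) := by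
  by_cases h1 : Near (2 * b) p (center b ((i + 1) % 5)) ∧ Near (2 * b) p (center b ((i + 2) % 5))
  · refine ⟨(i + 2) % 5, by omega, (i + 3) % 5, by omega, by omega, ?_⟩
    rintro l (rfl | rfl) <;> interval_cases i <;> simp [center] at h1 ⊢ <;> omega
  by_cases h2 : Near (2 * b) p (center b ((i + 2) % 5)) ∧ Near (2 * b) p (center b ((i + 3) % 5))
  · refine ⟨(i + 1) % 5, by omega, (i + 3) % 5, by omega, by omega, ?_⟩
    rintro l (rfl | rfl) <;> interval_cases i <;> simp [center] at h1 h2 ⊢ <;> omega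
  · refine ⟨(i + 1) % 5, by omega, (i + 2) % 5, by omega, by omega, ?_⟩
    grind

theorem exists_two_other_types {m i : ℕ} (hm : m < 5) (hi : i < 5) (h : i ≠ m)
    (h' : i ≠ (m + 1) % 5) : ∃ j < 5, ∃ j' < 5, j ≠ j' ∧ (j ≠ m ∧ i ≠ j ∧ i ≠ (j + 1) % 5) ∧
      (j' ≠ m ∧ i ≠ j' ∧ i ≠ (j' + 1) % 5) := by
  have key : ∀ m i : Fin 5, (i : ℕ) ≠ m → (i : ℕ) ≠ (m + 1 : ℕ) % 5 → ∃ j j' : Fin 5,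
      (j : ℕ) ≠ j' ∧ ((j : ℕ) ≠ m ∧ (i : ℕ) ≠ j ∧ (i : ℕ) ≠ (j + 1 : ℕ) % 5) ∧
      ((j' : ℕ) ≠ m ∧ (i : ℕ) ≠ j' ∧ (i : ℕ) ≠ (j' + 1 : ℕ) % 5) := by decide
  obtain ⟨j, j', hj⟩ := key ⟨m, hm⟩ ⟨i, hi⟩ h h'
  exact ⟨j, j.2, j', j'.2, hj⟩

/-- Distinct cyclic pairs `{j, j + 1}` and `{m, m + 1}` modulo `5` differ, so the first has a member
outside the second. -/
theorem exists_mem_type_diff {m j : ℕ} (hm : m < 5) (hj : j < 5) (h : j ≠ m) :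
    ∃ l < 5, (l = j ∨ l = (j + 1) % 5) ∧ l ≠ m ∧ l ≠ (m + 1) % 5 := by
  have key : ∀ m j : Fin 5, (j : ℕ) ≠ m → ∃ l : Fin 5, ((l : ℕ) = j ∨ (l : ℕ) = (j + 1 : ℕ) % 5) ∧
    (l : ℕ) ≠ m ∧ (l : ℕ) ≠ (m + 1 : ℕ) % 5 := by decide
  obtain ⟨l, hl⟩ := key ⟨m, hm⟩ ⟨j, hj⟩ h
  exact ⟨l, l.2, hl⟩

theorem not_near_center_succ {b q m : ℕ} (hm : m < 5) (h : Near b q (center b m)) :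
    ¬ Near b q (center b ((m + 1) % 5)) := by
  interval_cases m <;> simp [center] at h ⊢ <;> omega

set_option maxHeartbeats 2000000 in
-- Each of the first `10b + 5` columns of `A` is spread over two twin rows `10b + 5` apart, beyond
-- the reach of all centers, and its coefficient is one in exactly two cyclically adjacent
-- distinguished slices, given by its type, the class modulo `5`. A pair of rows in the equations
-- then singles out one column each, and of two twins one is always far enough from a given row. The
-- rows of `X` are shown to vanish one kind after another, each time since a sparse row annihilates
-- enough columns of `B`.
theorem injective₁_of_twins (hn : 32 * b + 16 ≤ n) (hr : 10 * b + 5 ≤ r)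
    {A B C : Mat n r} (hB : AllMinors B) {s : ℝ} (hs : s ≠ 0)
    (hA : ∀ (p : Fin n) (k : Fin r), (k : ℕ) < 10 * b + 5 →
      A p k = if (p : ℕ) = 12 * b + 5 + k ∨ (p : ℕ) = 22 * b + 10 + k then s else 0)
    (hC : ∀ (l : Fin n) (k : Fin r), C l k = if (k : ℕ) < 10 * b + 5 ∧
      ((l : ℕ) / (2 * b + 1) = (k : ℕ) % 5 ∨ (l : ℕ) / (2 * b + 1) = ((k : ℕ) % 5 + 1) % 5)
      then 1 else 0) :
    Injective₁ b (cpTensor A B C) := by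
  intro X hX hsys
  set c : Fin 5 → Fin r → ℝ := fun i k => if (k : ℕ) < 10 * b + 5 ∧
    ((i : ℕ) = (k : ℕ) % 5 ∨ (i : ℕ) = ((k : ℕ) % 5 + 1) % 5) then 1 else 0 with hc
  have hM : ∀ (i : Fin 5) p q, fiveSlices b (cpTensor A B C) i p q =
      ∑ k, A p k * B q k * c i k := by
    intro i p q
    have hi : center b i < n := by
      have := i.2
      have : center b i ≤ (2 * b + 1) * 4 := Nat.mul_le_mul_left _ (by omega)
      omega
    simp only [fiveSlices, slice, of_apply, dif_pos hi, cpTensor]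
    refine sum_congr rfl fun k _ => ?_
    rw [hC, hc]
    simp only [center]
    rw [Nat.mul_div_cancel_left _ (by omega)]
  set u : Fin 5 → Fin n → Fin r → ℝ := fun i p k => ∑ t, X i p t * B t k with hu
  have hc0 : ∀ i (k : Fin r), 10 * b + 5 ≤ (k : ℕ) → c i k = 0 := fun i k hk => by
    grind
  have hS1 : ∀ (w : Fin r → ℝ) (_ : ∀ k : Fin r, 10 * b + 5 ≤ (k : ℕ) → w k = 0) (q : Fin n)
      (k : Fin r), (k : ℕ) < 10 * b + 5 → ((q : ℕ) = 12 * b + 5 + k ∨ (q : ℕ) = 22 * b + 10 + k) →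
      ∑ k', w k' * A q k' = w k * s := by
    intro w hw q k hk hq
    rw [sum_eq_single k]
    · rw [hA q k hk, if_pos hq]
    · grind
    · simp
  have hS0 : ∀ (w : Fin r → ℝ) (_ : ∀ k : Fin r, 10 * b + 5 ≤ (k : ℕ) → w k = 0) (p : Fin n),
      ((p : ℕ) < 12 * b + 5 ∨ 32 * b + 15 ≤ (p : ℕ)) → ∑ k', w k' * A p k' = 0 := by
    intro w hw p hp
    refine sum_eq_zero fun k _ => ?_
    grind
  have hcen : ∀ i : Fin 5, center b i + 2 * b ≤ 10 * b + 4 := fun i => by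
    have := i.2
    have : center b i ≤ (2 * b + 1) * 4 := Nat.mul_le_mul_left _ (by omega)
    omega
  have hE : ∀ (i j : Fin 5) (p q : Fin n), ¬ InQuad b (center b i) (center b j) p q →
      ∑ k, (c j k * u i p k - c i k * u j p k) * A q k =
        ∑ k, (c j k * u i q k - c i k * u j q k) * A p k := by
    intro i j p q h
    have := hsys i j p q h
    rw [sylv_apply hM (fun _ _ _ => rfl)] at this
    linarith
  have hw0 : ∀ i j p (k : Fin r), 10 * b + 5 ≤ (k : ℕ) → c j k * u i p k - c i k * u j p k = 0 :=
    fun i j p k hk => by rw [hc0 _ k hk, hc0 _ k hk]; ring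
  -- If row `p` of `A` is zero in the relevant columns and `q` is a twin row of `k`, only one minor
  -- survives.
  have E1 : ∀ (i j : Fin 5) (p q : Fin n) (k : Fin r), (k : ℕ) < 10 * b + 5 →
      ((q : ℕ) = 12 * b + 5 + k ∨ (q : ℕ) = 22 * b + 10 + k) →
      ((p : ℕ) < 12 * b + 5 ∨ 32 * b + 15 ≤ (p : ℕ)) → ¬ Near (2 * b) p q →
      ¬ Near (2 * b) p (center b i) → ¬ Near (2 * b) p (center b j) →
      c j k * u i p k - c i k * u j p k = 0 := by
    intro i j p q k hk hq hp hpq hi hj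
    have h1 := hcen i
    have h2 := hcen j
    have := hE i j p q (by
      simp only [InQuad, not_or]
      exact ⟨hpq, hi, by omega, hj, by omega⟩)
    rw [hS1 _ (hw0 i j p) q k hk hq, hS0 _ (hw0 i j q) p hp] at this
    exact (mul_eq_zero.1 this).resolve_right hs
  -- If both are twin rows, one minor on each side survives.
  have E2 : ∀ (i j : Fin 5) (p q : Fin n) (k k' : Fin r), (k : ℕ) < 10 * b + 5 →
      (k' : ℕ) < 10 * b + 5 → ((p : ℕ) = 12 * b + 5 + k ∨ (p : ℕ) = 22 * b + 10 + k) →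
      ((q : ℕ) = 12 * b + 5 + k' ∨ (q : ℕ) = 22 * b + 10 + k') → ¬ Near (2 * b) p q →
      c j k' * u i p k' - c i k' * u j p k' = c j k * u i q k - c i k * u j q k := by
    intro i j p q k k' hk hk' hp hq hpq
    have h1 := hcen i
    have h2 := hcen j
    have := hE i j p q (by
      simp only [InQuad, not_or]
      exact ⟨hpq, by omega, by omega, by omega, by omega⟩)
    rw [hS1 _ (hw0 i j p) q k' hk' hq, hS1 _ (hw0 i j q) p k hk hp] at this
    exact mul_right_cancel₀ hs this
  have hsupp : ∀ (i : Fin 5) (p q : Fin n), ¬ Near b q p → ¬ Near b q (center b i) →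
      X i p q = 0 := by
    intro i p q h1 h2
    refine hX i p q ?_
    simp only [IsOuter, InBand, Near] at h1 h2 ⊢
    omega
  -- A row has unknown entries only in two windows of `2b + 1` columns, so `4b + 2` annihilated
  -- columns of `B` suffice.
  have hz : ∀ (i : Fin 5) (p : Fin n) (K : Finset (Fin r)), 4 * b + 2 ≤ K.card →
      (∀ k ∈ K, u i p k = 0) → ∀ q, X i p q = 0 := by
    intro i p K hK h q
    refine congrFun (hB.rows (R := (univ.filter fun q : Fin n => Near b q p) ∪
      (univ.filter fun q : Fin n => Near b q (center b i))) ?_ (fun q hq => ?_) h) q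
    · have h1 := card_union_le (univ.filter fun q : Fin n => Near b q p)
        (univ.filter fun q : Fin n => Near b q (center b i))
      have h2 := card_near_le (n := n) b p
      have h3 := card_near_le (n := n) b (center b i)
      omega
    grind
  have c1 : ∀ (i : Fin 5) (k : Fin r), (k : ℕ) < 10 * b + 5 →
      ((i : ℕ) = (k : ℕ) % 5 ∨ (i : ℕ) = ((k : ℕ) % 5 + 1) % 5) → c i k = 1 := by
    intro i k hk hi
    simp only [hc]
    rw [if_pos ⟨hk, hi⟩]
  have c0 : ∀ (i : Fin 5) (k : Fin r), (i : ℕ) ≠ (k : ℕ) % 5 → (i : ℕ) ≠ ((k : ℕ) % 5 + 1) % 5 →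
      c i k = 0 := by
    intro i k h1 h2
    simp only [hc]
    rw [if_neg (by tauto)]
  -- rows which do not meet the columns of the twins
  have hrow0 : ∀ (i : Fin 5) (p : Fin n), ((p : ℕ) < 12 * b + 5 ∨ 32 * b + 15 ≤ (p : ℕ)) →
      ∀ q, X i p q = 0 := by
    intro i p hp
    by_cases hpi : Near (2 * b) p (center b i)
    · exact fun q => hX i p q fun h => h.1 hpi
    obtain ⟨j, hj, j', hj', hne, hgood⟩ := exists_two_good_types b p i.2
    refine hz i p (univ.filter fun k : Fin r => (k : ℕ) < 10 * b + 5 ∧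
      ((k : ℕ) % 5 = j ∨ (k : ℕ) % 5 = j')) (le_card_of_two_types hr hj hj' hne fun k hk h => by
        simp [hk, h]) fun k hk => ?_
    simp only [mem_filter, mem_univ, true_and] at hk
    obtain ⟨h1, h2, h3⟩ := hgood _ hk.2
    obtain ⟨q, hq, hpq⟩ : ∃ q : Fin n, ((q : ℕ) = 12 * b + 5 + k ∨ (q : ℕ) = 22 * b + 10 + k) ∧
        ¬ Near (2 * b) p q := by
      by_cases hp' : (p : ℕ) < 12 * b + 5
      · exact ⟨⟨22 * b + 10 + k, by omega⟩, Or.inr rfl, by simp only [Near]; omega⟩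
      · exact ⟨⟨12 * b + 5 + k, by omega⟩, Or.inl rfl, by simp only [Near]; omega⟩
    rcases h3 with h3 | h3
    · have := E1 i ⟨(k : ℕ) % 5, by omega⟩ p q k hk.1 hq hp hpq hpi h3
      rw [c1 _ k hk.1 (Or.inl rfl), c0 i k h1 h2] at this
      linarith
    · have := E1 i ⟨((k : ℕ) % 5 + 1) % 5, by omega⟩ p q k hk.1 hq hp hpq hpi h3
      rw [c1 _ k hk.1 (Or.inr rfl), c0 i k h1 h2] at this
      linarith
  have hfar : ∀ (p : Fin n) (k k' : Fin r), (k : ℕ) < 10 * b + 5 → (k' : ℕ) < 10 * b + 5 →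
      ((p : ℕ) = 12 * b + 5 + k ∨ (p : ℕ) = 22 * b + 10 + k) →
      ∃ q : Fin n, ((q : ℕ) = 12 * b + 5 + k' ∨ (q : ℕ) = 22 * b + 10 + k') ∧
        ¬ Near (2 * b) p q := by
    intro p k k' hk hk' hp
    by_cases h : Near (2 * b) p (12 * b + 5 + k')
    · exact ⟨⟨22 * b + 10 + k', by omega⟩, Or.inr rfl, by
        simp only [Near] at h ⊢; omega⟩
    · exact ⟨⟨12 * b + 5 + k', by omega⟩, Or.inl rfl, h⟩
  -- slices of other types
  have hrow1 : ∀ (p : Fin n) (k : Fin r), (k : ℕ) < 10 * b + 5 →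
      ((p : ℕ) = 12 * b + 5 + k ∨ (p : ℕ) = 22 * b + 10 + k) → ∀ i : Fin 5,
      (i : ℕ) ≠ (k : ℕ) % 5 → (i : ℕ) ≠ ((k : ℕ) % 5 + 1) % 5 → ∀ q, X i p q = 0 := by
    intro p k hk hp i hi hi'
    obtain ⟨j, hj, j', hj', hne, hg, hg'⟩ := exists_two_other_types (m := (k : ℕ) % 5) (by omega)
      i.2 hi hi'
    refine hz i p (univ.filter fun k : Fin r => (k : ℕ) < 10 * b + 5 ∧
      ((k : ℕ) % 5 = j ∨ (k : ℕ) % 5 = j')) (le_card_of_two_types hr hj hj' hne fun k hk h => by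
        simp [hk, h]) fun k' hk' => ?_
    simp only [mem_filter, mem_univ, true_and] at hk'
    have hgood : (k' : ℕ) % 5 ≠ (k : ℕ) % 5 ∧ (i : ℕ) ≠ (k' : ℕ) % 5 ∧
        (i : ℕ) ≠ ((k' : ℕ) % 5 + 1) % 5 := by
      rcases hk'.2 with h | h <;> rw [h] <;> assumption
    obtain ⟨l, hl, hl1, hl2, hl3⟩ := exists_mem_type_diff (m := (k : ℕ) % 5) (by omega)
      (j := (k' : ℕ) % 5) (by omega) hgood.1
    obtain ⟨q, hq, hpq⟩ := hfar p k k' hk hk'.1 hp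
    have := E2 i ⟨l, hl⟩ p q k k' hk hk'.1 hp hq hpq
    grind
  -- The slice `l` has coefficient one at `k'` and zero at `k`, and its row `p` is already zero, so
  -- `E2` reduces to two terms. The right-hand side does not depend on which of the two slices of
  -- `k` is taken for `i`.
  have hrow2 : ∀ (p q : Fin n) (k k' : Fin r), (k : ℕ) < 10 * b + 5 → (k' : ℕ) < 10 * b + 5 →
      ((p : ℕ) = 12 * b + 5 + k ∨ (p : ℕ) = 22 * b + 10 + k) →
      ((q : ℕ) = 12 * b + 5 + k' ∨ (q : ℕ) = 22 * b + 10 + k') → ¬ Near (2 * b) p q →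
      (k' : ℕ) % 5 ≠ (k : ℕ) % 5 → ∃ l : Fin 5, ((l : ℕ) = (k' : ℕ) % 5 ∨
        (l : ℕ) = ((k' : ℕ) % 5 + 1) % 5) ∧ ∀ i : Fin 5, ((i : ℕ) = (k : ℕ) % 5 ∨
        (i : ℕ) = ((k : ℕ) % 5 + 1) % 5) → u i p k' = - u l q k := by
    intro p q k k' hk hk' hp hq hpq hne
    obtain ⟨l, hl, hl1, hl2, hl3⟩ := exists_mem_type_diff (m := (k : ℕ) % 5) (by omega)
      (j := (k' : ℕ) % 5) (by omega) hne
    refine ⟨⟨l, hl⟩, hl1, fun i hi => ?_⟩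
    have := E2 i ⟨l, hl⟩ p q k k' hk hk' hp hq hpq
    have h0 : u ⟨l, hl⟩ p k' = 0 := by
      simp only [hu]
      exact sum_eq_zero fun t _ => by
        rw [hrow1 p k hk hp ⟨l, hl⟩ hl2 hl3, zero_mul]
    rw [c1 ⟨l, hl⟩ k' hk' hl1, c0 ⟨l, hl⟩ k hl2 hl3, c1 i k hk hi, h0] at this
    linarith
  have hm5 : ∀ k : ℕ, k % 5 < 5 ∧ (k % 5 + 1) % 5 < 5 := fun k => by omega
  -- Hence the difference of the two slices in row `p` annihilates the `8b + 4` columns of the other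
  -- four types, while its support lies in three windows, `6b + 3` columns.
  have hrow3 : ∀ (p : Fin n) (k : Fin r), (k : ℕ) < 10 * b + 5 →
      ((p : ℕ) = 12 * b + 5 + k ∨ (p : ℕ) = 22 * b + 10 + k) → ∀ q,
      X ⟨(k : ℕ) % 5, (hm5 k).1⟩ p q = X ⟨((k : ℕ) % 5 + 1) % 5, (hm5 k).2⟩ p q := by
    intro p k hk hp q
    set i : Fin 5 := ⟨(k : ℕ) % 5, (hm5 k).1⟩
    set i' : Fin 5 := ⟨((k : ℕ) % 5 + 1) % 5, (hm5 k).2⟩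
    refine sub_eq_zero.1 (congrFun (hB.rows (v := fun q => X i p q - X i' p q)
      (R := (univ.filter fun q : Fin n => Near b q p) ∪
      ((univ.filter fun q : Fin n => Near b q (center b i)) ∪
      (univ.filter fun q : Fin n => Near b q (center b i'))))
      (K := univ.filter fun k' : Fin r => (k' : ℕ) < 10 * b + 5 ∧
        (k' : ℕ) % 5 ≠ (k : ℕ) % 5) ?_ (fun q hq => ?_) fun k' hk' => ?_) q)
    · have h1 := card_union_le (univ.filter fun q : Fin n => Near b q p)
        ((univ.filter fun q : Fin n => Near b q (center b i)) ∪
      (univ.filter fun q : Fin n => Near b q (center b i')))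
      have h1' := card_union_le (univ.filter fun q : Fin n => Near b q (center b i))
        (univ.filter fun q : Fin n => Near b q (center b i'))
      have h2 := card_near_le (n := n) b p
      have h3 := card_near_le (n := n) b (center b i)
      have h3' := card_near_le (n := n) b (center b i')
      have h4 := le_card_of_four_types (b := b) hr (m := (k : ℕ) % 5)
        (K := univ.filter fun k' : Fin r => (k' : ℕ) < 10 * b + 5 ∧
        (k' : ℕ) % 5 ≠ (k : ℕ) % 5) fun k' h h' => by simp [h, h']
      omega
    · grind
    · simp only [mem_filter, mem_univ, true_and] at hk'
      obtain ⟨q, hq, hpq⟩ := hfar p k k' hk hk'.1 hp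
      obtain ⟨l, hl, h⟩ := hrow2 p q k k' hk hk'.1 hp hq hpq hk'.2
      have h1 := h i (Or.inl rfl)
      have h2 := h i' (Or.inr rfl)
      simp only [hu] at h1 h2
      simp only [sub_mul, sum_sub_distrib]
      linarith
  -- The windows around the two centers are disjoint, so equal rows can be nonzero only around `p`.
  have hrow4 : ∀ (p : Fin n) (k : Fin r), (k : ℕ) < 10 * b + 5 →
      ((p : ℕ) = 12 * b + 5 + k ∨ (p : ℕ) = 22 * b + 10 + k) → ∀ q : Fin n, ¬ Near b q p →
      X ⟨(k : ℕ) % 5, (hm5 k).1⟩ p q = 0 := by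
    intro p k hk hp q hpq
    by_cases h : Near b q (center b ((k : ℕ) % 5))
    · rw [hrow3 p k hk hp q]
      exact hsupp _ p q hpq (not_near_center_succ (hm5 k).1 h)
    · exact hsupp _ p q hpq h
  have hrow5 : ∀ (p q : Fin n) (k k' : Fin r), (k : ℕ) < 10 * b + 5 → (k' : ℕ) < 10 * b + 5 →
      ((p : ℕ) = 12 * b + 5 + k ∨ (p : ℕ) = 22 * b + 10 + k) →
      ((q : ℕ) = 12 * b + 5 + k' ∨ (q : ℕ) = 22 * b + 10 + k') → ¬ Near (2 * b) p q →
      (k' : ℕ) % 5 ≠ (k : ℕ) % 5 →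
      u ⟨(k : ℕ) % 5, (hm5 k).1⟩ p k' = - u ⟨(k' : ℕ) % 5, (hm5 k').1⟩ q k := by
    intro p q k k' hk hk' hp hq hpq hne
    obtain ⟨l, hl, h⟩ := hrow2 p q k k' hk hk' hp hq hpq hne
    rw [h _ (Or.inl rfl)]
    rcases hl with hl | hl
    · congr 2
      exact Fin.ext hl
    · have e : l = ⟨((k' : ℕ) % 5 + 1) % 5, (hm5 k').2⟩ := Fin.ext hl
      rw [e]
      simp only [hu]
      rw [sum_congr rfl fun t _ => by rw [← hrow3 q k' hk' hq t]]
  -- Both twin rows of `k` are compared with a common row `q` far from both. Excluding the at most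
  -- `4b + 1` columns near `k` leaves at least `4b + 3` equations for a difference supported in `4b
  -- + 2` columns.
  have hrow6 : ∀ k : Fin r, (k : ℕ) < 10 * b + 5 → ∀ (p p' : Fin n), (p : ℕ) = 12 * b + 5 + k →
      (p' : ℕ) = 22 * b + 10 + k → ∀ q,
      X ⟨(k : ℕ) % 5, (hm5 k).1⟩ p q = X ⟨(k : ℕ) % 5, (hm5 k).1⟩ p' q := by
    intro k hk p p' hp hp' q
    set i : Fin 5 := ⟨(k : ℕ) % 5, (hm5 k).1⟩ with hi
    refine sub_eq_zero.1 (congrFun (hB.rows (v := fun q => X i p q - X i p' q)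
      (R := (univ.filter fun q : Fin n => Near b q p) ∪
      (univ.filter fun q : Fin n => Near b q p'))
      (K := univ.filter fun k' : Fin r => (k' : ℕ) < 10 * b + 5 ∧
        (k' : ℕ) % 5 ≠ (k : ℕ) % 5 ∧ ¬ Near (2 * b) k' k) ?_ (fun q hq => ?_) fun k' hk' => ?_) q)
    · have h1 := card_union_le (univ.filter fun q : Fin n => Near b q p)
        (univ.filter fun q : Fin n => Near b q p')
      have h2 := card_near_le (n := n) b p
      have h3 := card_near_le (n := n) b p'
      have h4 := le_card_of_four_types (b := b) hr (m := (k : ℕ) % 5)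
        (K := (univ.filter fun k' : Fin r => (k' : ℕ) < 10 * b + 5 ∧
        (k' : ℕ) % 5 ≠ (k : ℕ) % 5 ∧ ¬ Near (2 * b) k' k) ∪
          (univ.filter fun q : Fin r => Near (2 * b) q k)) fun k' h h' => by
            simp only [mem_union, mem_filter, mem_univ, true_and]
            tauto
      have h5 := card_union_le (univ.filter fun k' : Fin r => (k' : ℕ) < 10 * b + 5 ∧
        (k' : ℕ) % 5 ≠ (k : ℕ) % 5 ∧ ¬ Near (2 * b) k' k)
          (univ.filter fun q : Fin r => Near (2 * b) q k)
      have h6 := card_near_le (n := r) (2 * b) k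
      omega
    · simp only [mem_union, mem_filter, mem_univ, true_and, not_or] at hq
      rw [hrow4 p k hk (Or.inl hp) q hq.1, hrow4 p' k hk (Or.inr hp') q hq.2, sub_zero]
    · simp only [mem_filter, mem_univ, true_and] at hk'
      obtain ⟨q, hq, hpq, hpq'⟩ : ∃ q : Fin n, ((q : ℕ) = 12 * b + 5 + k' ∨
          (q : ℕ) = 22 * b + 10 + k') ∧ ¬ Near (2 * b) p q ∧ ¬ Near (2 * b) p' q := by
        have h3 := hk'.2.2
        by_cases hkk : (k' : ℕ) < k
        · exact ⟨⟨12 * b + 5 + k', by omega⟩, Or.inl rfl, by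
            simp only [Near] at h3 ⊢; omega, by simp only [Near] at h3 ⊢; omega⟩
        · exact ⟨⟨22 * b + 10 + k', by omega⟩, Or.inr rfl, by
            simp only [Near] at h3 ⊢; omega, by simp only [Near] at h3 ⊢; omega⟩
      have h1 := hrow5 p q k k' hk hk'.1 (Or.inl hp) hq hpq hk'.2.1
      have h2 := hrow5 p' q k k' hk hk'.1 (Or.inr hp') hq hpq' hk'.2.1
      have h3 := h1.trans h2.symm
      simp only [hu] at h3
      simp only [sub_mul, sum_sub_distrib]
      exact sub_eq_zero.2 h3
  -- The two equal rows have disjoint supports, hence vanish.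
  have hrow7 : ∀ (p : Fin n) (k : Fin r), (k : ℕ) < 10 * b + 5 →
      ((p : ℕ) = 12 * b + 5 + k ∨ (p : ℕ) = 22 * b + 10 + k) → ∀ q,
      X ⟨(k : ℕ) % 5, (hm5 k).1⟩ p q = 0 := by
    intro p k hk hp q
    by_cases hpq : Near b q p
    · rcases hp with hp | hp
      · rw [hrow6 k hk p ⟨22 * b + 10 + k, by omega⟩ hp rfl q]
        exact hrow4 _ k hk (Or.inr rfl) q (by simp only [Near] at hpq ⊢; omega)
      · rw [← hrow6 k hk ⟨12 * b + 5 + k, by omega⟩ p rfl hp q]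
        exact hrow4 _ k hk (Or.inl rfl) q (by simp only [Near] at hpq ⊢; omega)
    · exact hrow4 p k hk hp q hpq
  funext i
  ext p q
  by_cases hp : (p : ℕ) < 12 * b + 5 ∨ 32 * b + 15 ≤ (p : ℕ)
  · exact hrow0 i p hp q
  obtain ⟨k, hk, hp⟩ : ∃ k : Fin r, (k : ℕ) < 10 * b + 5 ∧
      ((p : ℕ) = 12 * b + 5 + k ∨ (p : ℕ) = 22 * b + 10 + k) := by
    by_cases h : (p : ℕ) < 22 * b + 10
    · exact ⟨⟨p - (12 * b + 5), by omega⟩, by dsimp only; omega, by dsimp only; omega⟩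
    · exact ⟨⟨p - (22 * b + 10), by omega⟩, by dsimp only; omega, by dsimp only; omega⟩
  by_cases h1 : (i : ℕ) = (k : ℕ) % 5
  · rw [show i = ⟨(k : ℕ) % 5, (hm5 k).1⟩ from Fin.ext h1]
    exact hrow7 p k hk hp q
  by_cases h2 : (i : ℕ) = ((k : ℕ) % 5 + 1) % 5
  · rw [show i = ⟨((k : ℕ) % 5 + 1) % 5, (hm5 k).2⟩ from Fin.ext h2, ← hrow3 p k hk hp q]
    exact hrow7 p k hk hp q
  exact hrow1 p k hk hp i h1 h2 q

theorem generic_injective₁ (hn : 8 * (4 * b + 2) ≤ n) (hr : 3 * (4 * b + 2) ≤ r) (hrn : r ≤ n) :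
    GenericOrth n r fun A B C => Injective₁ b (cpTensor A B C) := by
  obtain ⟨B, hB, hBm⟩ := exists_allMinors (n := n) (r := r) (by omega) hrn
  set s : ℝ := 1 / Real.sqrt 2 with hs
  have hs2 : s * s + s * s = 1 := by
    grind
  have hs0 : s ≠ 0 := by
    grind
  obtain ⟨A, hA, hA'⟩ := exists_orth_extension hrn
    (fun k p => if (p : ℕ) = 12 * b + 5 + k ∨ (p : ℕ) = 22 * b + 10 + k then s else 0)
    {k | (k : ℕ) < 10 * b + 5} (fun k hk l hl => by
      simp only [Set.mem_ofPred_eq] at hk hl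
      by_cases hkl : k = l
      · subst hkl
        rw [if_pos rfl, ← hs2, dotProduct]
        have h1 : 12 * b + 5 + (k : ℕ) < n := by omega
        have h2 : 22 * b + 10 + (k : ℕ) < n := by omega
        rw [Finset.sum_eq_add ⟨12 * b + 5 + (k : ℕ), h1⟩ ⟨22 * b + 10 + (k : ℕ), h2⟩]
        · simp
        · simp [Fin.ext_iff]; omega
        · grind
        · simp
        · simp
      · rw [if_neg hkl]
        have hkl' : (k : ℕ) ≠ l := fun h => hkl (Fin.ext h)
        refine sum_eq_zero fun p _ => ?_
        grind)
  exact genericOrth_injective₁ (by omega) hA hB (injective₁_of_twins (by omega) (by omega) hBm hs0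
    (fun p k hk => hA' k hk p) (C := Matrix.of fun l k => _) fun l k => rfl)

end witnesses₁

/-! ### Generic injectivity of the second linear system, distinct squares, and the probing rows -/

section witnesses₂
variable {n r b : ℕ}

/-- The components of the cross product of `(1, t', t' ^ 2)` and `(1, t, t ^ 2)`, where
`t = k + 1` and `t' = k' + 1`; the row number `s` tells which component. -/
noncomputable def crossComp (b k k' s : ℕ) : ℝ :=
  if s ≤ 2 * b + 1 then ((k' : ℝ) + 1) * (k + 1) * ((k : ℝ) - k')
  else if s ≤ 6 * b + 3 then ((k' : ℝ) + 1) ^ 2 - ((k : ℝ) + 1) ^ 2 else (k : ℝ) - k'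

theorem crossComp_ne_zero {b k k' s : ℕ} (h : k' ≠ k) : crossComp b k k' s ≠ 0 := by
  have h1 : (k : ℝ) - k' ≠ 0 := sub_ne_zero.2 fun h' => h (by exact_mod_cast h'.symm)
  have h2 : (0 : ℝ) < (k : ℝ) + 1 := by positivity
  have h3 : (0 : ℝ) < (k' : ℝ) + 1 := by positivity
  rw [crossComp]
  split_ifs
  · exact mul_ne_zero (mul_ne_zero h3.ne' h2.ne') h1
  · have : ((k' : ℝ) + 1) ^ 2 - ((k : ℝ) + 1) ^ 2 = -((k : ℝ) - k') * (k + 1 + (k' + 1)) := by ring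
    rw [this]
    exact mul_ne_zero (neg_ne_zero.2 h1) (by positivity)
  · exact h1

/-- For fixed `k` this asks for injectivity of a system with `10b + 5` unknowns and `r - 1`
equations. It is generic in `A`, and a matrix of unit columns that makes the system diagonal is an
example; genericity then combines the conditions for all `k`. -/
theorem exists_crossComp_injective (hr : 3 * (4 * b + 2) ≤ r) (hrn : r ≤ n) :
    ∃ A : Mat n r, Aᵀ * A = 1 ∧ ∀ (k : Fin r) (ζ : Fin n → ℝ),
      (∀ s : Fin n, 10 * b + 5 ≤ (s : ℕ) → ζ s = 0) →
      (∀ k' : Fin r, k' ≠ k → ∑ s, ζ s * A s k' * crossComp b k k' s = 0) → ζ = 0 := by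
  have h0 := unitCols_orth (Fin.castLE_injective hrn)
  have key : GenericOrth n r fun A _ _ => ∀ (k : Fin r) (ζ : Fin n → ℝ),
      (∀ x : Fin n ⊕ Fin r, Sum.elim (fun s : Fin n => if 10 * b + 5 ≤ (s : ℕ) then ζ s else 0)
        (fun k' => if k' = k then 0 else ∑ s, ζ s * A s k' * crossComp b k k' s) x = 0) →
      ζ = 0 := by
    refine GenericOrth.forall fun k => ?_
    -- The omitted column `k` goes to row `r - 1`, which is beyond the unknowns; the others fill
    -- rows `0` to `r - 2` in order, so every unknown row is met.
    set φ : Fin r → Fin n := fun k' => ⟨if (k' : ℕ) < k then k' else if (k' : ℕ) = k then r - 1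
      else k' - 1, by split_ifs <;> omega⟩ with hφ
    have hφi : Function.Injective φ := by
      intro k₁ k₂ h
      grind
    have := genericOrth_of_linear (n := n) (r := r) (V := Fin n → ℝ) (ι := Fin n ⊕ Fin r)
      (Λ := fun F ζ x => Sum.elim (fun s : Fin n => if 10 * b + 5 ≤ (s : ℕ) then ζ s else 0)
        (fun k' => if k' = k then 0 else ∑ s, ζ s * F 0 s k' * crossComp b k k' s) x)
      (A := unitCols φ) (B := unitCols (Fin.castLE hrn))
      (fun F x y i => by
        rcases i with s | k'
        · simp only [Sum.elim_inl, Pi.add_apply]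
          split_ifs <;> simp
        · simp only [Sum.elim_inr, Pi.add_apply, add_mul, sum_add_distrib]
          split_ifs <;> simp)
      (fun F c x i => by
        rcases i with s | k'
        · simp only [Sum.elim_inl, Pi.smul_apply, smul_eq_mul]
          split_ifs <;> simp
        · simp only [Sum.elim_inr, Pi.smul_apply, smul_eq_mul, mul_assoc, ← mul_sum]
          split_ifs <;> simp)
      (fun x i => by
        rcases i with s | k'
        · exact PolyFun.const _
        · simp only [Sum.elim_inr]
          split_ifs
          · exact PolyFun.const _
          · exact PolyFun.sum _ fun s _ => ((PolyFun.const _).mul (PolyFun.entry _ _ _)).mul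
              (PolyFun.const _)) (by omega) (unitCols_orth hφi) h0
      (fun e e' he he' => ⟨0, fun ζ hζ => by
        ext s
        by_cases hs : 10 * b + 5 ≤ (s : ℕ)
        · have := hζ (Sum.inl s)
          rwa [Sum.elim_inl, if_pos hs] at this
        · obtain ⟨k', hk', hs'⟩ : ∃ k' : Fin r, k' ≠ k ∧ φ k' = s := by
            by_cases hsk : (s : ℕ) < k
            · refine ⟨⟨s, by omega⟩, fun h => ?_, ?_⟩
              · rw [← h] at hsk
                simp at hsk
              · simp only [hφ]
                ext
                simp [hsk]
            · refine ⟨⟨s + 1, by omega⟩, fun h => ?_, ?_⟩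
              · rw [← h] at hsk
                simp at hsk
              grind
          have h1 := hζ (Sum.inr k')
          rw [Sum.elim_inr, if_neg hk', sum_eq_single s] at h1
          · have h2 := crossComp_ne_zero (b := b) (s := s) (k := k) (k' := k')
              fun h => hk' (Fin.ext h)
            have h3 := (mul_eq_zero.1 h1).resolve_right h2
            refine (mul_eq_zero.1 h3).resolve_right ?_
            simp only [cons_val_zero, scaleFirst, unitCols, of_apply, hs', if_true]
            rcases he with rfl | rfl <;> split_ifs <;> norm_num
          · intro s' _ hne
            simp only [cons_val_zero, scaleFirst, unitCols, of_apply, hs']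
            rw [if_neg hne]
            ring
          · simp⟩)
    exact this
  obtain ⟨A, B, C, hA, -, h⟩ := key.exists ⟨![_, _, 0], h0, h0⟩
  refine ⟨A, hA, fun k ζ h1 h2 => h k ζ ?_⟩
  rintro (s | k')
  · simp only [Sum.elim_inl]
    split_ifs with hs
    · exact h1 s hs
    · rfl
  · simp only [Sum.elim_inr]
    split_ifs with hk
    · rfl
    · exact h2 k' hk

/-- In the example the coefficient vectors `c k` of the three slices lie on the moment curve and `B`
consists of unit vectors. The equations for `p` and `k'` then say that the cross products of `c k'`
with `v p k'` and of `c p` with `v k' p` are equal up to sign. Multiplying by `c p` removes the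
second unknown and leaves a triple product, linear in column `p` of the unknowns alone. -/
theorem generic_injective₂ (hr : 3 * (4 * b + 2) ≤ r) (hrn : r ≤ n) :
    GenericOrth n r fun A B C => Injective₂ b (cpTensor A B C) := by
  obtain ⟨A, hA, hinj⟩ := exists_crossComp_injective hr hrn
  set B : Mat n r := unitCols (Fin.castLE hrn) with hB
  set C : Mat n r :=
    Matrix.of fun l k => ((k : ℝ) + 1) ^ ((l : ℕ) / (4 * b + 2)) with hC
  refine genericOrth_injective₂ (C := C) (by omega) hA (unitCols_orth (Fin.castLE_injective hrn)) ?_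
  intro Z hZ hsys
  set c : Fin 3 → Fin r → ℝ := fun i k => ((k : ℝ) + 1) ^ (i : ℕ) with hc
  have hM : ∀ (i : Fin 3) p q, flipStack (evenSlices b (cpTensor A B C)) i p q =
      ∑ k, B p k * A q k * c i k := by
    intro i p q
    have hi : center b (2 * i) < n := by
      have := i.2
      have : center b (2 * i) ≤ (2 * b + 1) * 4 := Nat.mul_le_mul_left _ (by omega)
      omega
    simp only [flipStack, evenSlices, slice, transpose_apply, of_apply, dif_pos hi,
      cpTensor]
    refine sum_congr rfl fun k _ => ?_
    have e : center b (2 * i) / (4 * b + 2) = i := by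
      rw [center, ← mul_assoc, show (2 * b + 1) * 2 = 4 * b + 2 by ring,
        Nat.mul_div_cancel_left _ (by omega)]
    rw [hC, hc, of_apply]
    simp only [e]
    ring
  set v : Fin 3 → Fin n → Fin r → ℝ := fun i p k => ∑ s, flipStack Z i p s * A s k with hv
  have hE : ∀ i j p q, ∑ k, (c j k * v i p k - c i k * v j p k) * B q k =
      ∑ k, (c j k * v i q k - c i k * v j q k) * B p k := by
    intro i j p q
    have := hsys i j p q
    rw [sylv_apply hM (fun _ _ _ => rfl)] at this
    linarith
  have hB1 : ∀ (f : Fin r → ℝ) k, ∑ k', f k' * B (Fin.castLE hrn k) k' = f k := by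
    intro f k
    simp [hB, unitCols]
  -- For `p < r` the index is `p` itself. For other `p` the row of `B` is zero and the cross product
  -- vanishes outright, so any `k` serves.
  have key : ∀ p : Fin n, ∃ k : Fin r, ∀ k' : Fin r, k' ≠ k →
      c 0 k * (c 2 k' * v 1 p k' - c 1 k' * v 2 p k') +
      c 1 k * (c 0 k' * v 2 p k' - c 2 k' * v 0 p k') +
      c 2 k * (c 1 k' * v 0 p k' - c 0 k' * v 1 p k') = 0 := by
    intro p
    by_cases hp : (p : ℕ) < r
    · refine ⟨⟨p, hp⟩, fun k' hk' => ?_⟩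
      have e : ∀ i j, c j k' * v i p k' - c i k' * v j p k' =
          c j ⟨p, hp⟩ * v i (Fin.castLE hrn k') ⟨p, hp⟩ -
            c i ⟨p, hp⟩ * v j (Fin.castLE hrn k') ⟨p, hp⟩ := by
        intro i j
        have := hE i j p (Fin.castLE hrn k')
        rw [hB1] at this
        rw [this]
        exact hB1 (fun k => c j k * v i (Fin.castLE hrn k') k - c i k * v j (Fin.castLE hrn k') k)
          ⟨p, hp⟩
      rw [e, e, e]
      ring
    · refine ⟨⟨0, by omega⟩, fun k' hk' => ?_⟩
      have e : ∀ i j, c j k' * v i p k' - c i k' * v j p k' = 0 := by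
        intro i j
        have := hE i j p (Fin.castLE hrn k')
        rw [hB1] at this
        rw [this]
        refine sum_eq_zero fun k _ => ?_
        have : p ≠ Fin.castLE hrn k := by
          rintro rfl
          exact hp k.2
        simp [hB, unitCols, this]
      rw [e, e, e]
      ring
  have hZ0 : ∀ (i : Fin 3) (s p : Fin n), ¬ Near (2 * b) s (center b (2 * i)) → Z i s p = 0 :=
    fun i s p h => hZ i s p fun h' => h h'.1
  funext i
  ext s p
  obtain ⟨k, hk⟩ := key p
  -- The row windows of the three matrices are disjoint, separated by rows `2b + 1` and `6b + 3`, so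
  -- their columns number `p` can be merged into one vector.
  set ζ : Fin n → ℝ := fun s => Z (if (s : ℕ) ≤ 2 * b + 1 then 0 else if (s : ℕ) ≤ 6 * b + 3 then 1
    else 2) s p with hζ
  have hcen : center b (2 * (0 : Fin 3)) = 0 ∧ center b (2 * (1 : Fin 3)) = 4 * b + 2 ∧
      center b (2 * (2 : Fin 3)) = 8 * b + 4 := by
    refine ⟨by simp [center], ?_, ?_⟩ <;> simp [center] <;> omega
  have hζ0 : ζ = 0 := by
    refine hinj k ζ (fun s hs => ?_) fun k' hk' => ?_
    · grind
    · rw [← hk k' hk']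
      simp only [hv, flipStack, transpose_apply, mul_sum,
        ← sum_sub_distrib, ← sum_add_distrib]
      refine sum_congr rfl fun s _ => ?_
      simp only [hc, hζ, crossComp, Fin.val_zero, Fin.val_one, Fin.val_two, pow_zero, pow_one]
      grind
  by_cases h : Near (2 * b) s (center b (2 * i))
  · have := congrFun hζ0 s
    simp only [hζ] at this
    have hi : (if (s : ℕ) ≤ 2 * b + 1 then 0 else if (s : ℕ) ≤ 6 * b + 3 then 1
      else 2 : Fin 3) = i := by
      fin_cases i
      · grind
      · grind
      grind
    rwa [hi] at this
  · exact hZ0 i s p h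

/-- The coefficients of the first slice are nonzero and have distinct squares. -/
def DistinctSquares (C : Mat n r) : Prop :=
  ∀ l : Fin n, (l : ℕ) = 0 → (∀ k, C l k ≠ 0) ∧ ∀ k k', k ≠ k' → C l k ^ 2 ≠ C l k' ^ 2

theorem generic_distinctSquares (hr : 0 < r) (hrn : r ≤ n) :
    GenericOrth n r fun _ _ C => DistinctSquares C := by
  have h0 := unitCols_orth (Fin.castLE_injective hrn)
  set C : Mat n r := Matrix.of fun _ k => (k : ℝ) + 1 with hC
  have h1 : GenericOrth n r fun _ _ C => ∀ k, C ⟨0, by omega⟩ k ≠ 0 := GenericOrth.forall fun k =>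
    genericOrth_of_poly (g := fun F => F 2 ⟨0, by omega⟩ k) (PolyFun.entry _ _ _) hr h0 h0
      fun e e' _ _ => ⟨C, by simp [hC]; positivity⟩
  have h2 : GenericOrth n r fun _ _ C => ∀ x : {x : Fin r × Fin r // x.1 ≠ x.2},
      C ⟨0, by omega⟩ x.1.1 * C ⟨0, by omega⟩ x.1.1 - C ⟨0, by omega⟩ x.1.2 * C ⟨0, by omega⟩ x.1.2
        ≠ 0 := GenericOrth.forall fun x =>
    genericOrth_of_poly (g := fun F => F 2 ⟨0, by omega⟩ x.1.1 * F 2 ⟨0, by omega⟩ x.1.1 -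
      F 2 ⟨0, by omega⟩ x.1.2 * F 2 ⟨0, by omega⟩ x.1.2)
      (((PolyFun.entry _ _ _).mul (PolyFun.entry _ _ _)).sub
        ((PolyFun.entry _ _ _).mul (PolyFun.entry _ _ _))) hr h0 h0
      fun e e' _ _ => ⟨C, by
        obtain ⟨⟨k, k'⟩, hne⟩ := x
        have h3 : (k : ℝ) - k' ≠ 0 := sub_ne_zero.2 fun h => hne (Fin.ext (by exact_mod_cast h))
        simp only [hC, Matrix.cons_val, of_apply]
        have : ((k : ℝ) + 1) * (k + 1) - (k' + 1) * (k' + 1) = (k - k') * (k + 1 + (k' + 1)) := by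
          ring
        rw [this]
        exact mul_ne_zero h3 (by positivity)⟩
  refine (h1.and h2).mono ?_
  rintro A B C - - ⟨h3, h4⟩ l hl
  rw [show l = ⟨0, by omega⟩ from Fin.ext hl]
  refine ⟨h3, fun k k' hne h => h4 ⟨(k, k'), hne⟩ ?_⟩
  linear_combination h

/-- Two rows far from the row number `l`. -/
def probe (n l j : ℕ) : ℕ := if 2 * l < n then n - 1 - j else j

/-- In every slice, the entries in the known positions of two rows determine the coefficients. -/
def ProbeInjective (b : ℕ) (A B : Mat n r) : Prop :=
  ∀ (l : Fin n) (y : Fin r → ℝ), (∀ p q : Fin n, ((p : ℕ) = probe n l 0 ∨ (p : ℕ) = probe n l 1) →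
    ¬ InBand b l p q → ∑ k, A p k * B q k * y k = 0) → y = 0

/-- Two rows of an orthogonal `n × n` matrix can be prescribed; here they live on complementary
halves of the first `r` columns, and these columns are kept. -/
theorem exists_two_rows (hr : 2 ≤ r) (hrn : r ≤ n) {p₀ p₁ : Fin n} (hp : p₀ ≠ p₁) :
    ∃ (A : Mat n r) (α β : ℝ), Aᵀ * A = 1 ∧ α ≠ 0 ∧ β ≠ 0 ∧
      ∀ k : Fin r, (A p₀ k = if (k : ℕ) < r / 2 then α else 0) ∧
        A p₁ k = if (k : ℕ) < r / 2 then 0 else β := by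
  set f : Fin n → ℝ := fun k => if (k : ℕ) < r / 2 then 1 else 0 with hf
  set g : Fin n → ℝ := fun k => if (k : ℕ) < r ∧ ¬ (k : ℕ) < r / 2 then 1 else 0 with hg
  have hfpos : 0 < f ⬝ᵥ f := by
    refine sum_pos' (fun k _ => mul_self_nonneg _) ⟨⟨0, by omega⟩, mem_univ _, ?_⟩
    simp_all
  have hgpos : 0 < g ⬝ᵥ g := by
    refine sum_pos' (fun k _ => mul_self_nonneg _) ⟨⟨r - 1, by omega⟩, mem_univ _, ?_⟩
    simp only [hg]
    rw [if_pos (by omega)]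
    norm_num
  have hfg : f ⬝ᵥ g = 0 := by
    refine sum_eq_zero fun k _ => ?_
    grind
  have hnorm : ∀ x : ℝ, 0 < x → 1 / Real.sqrt x * (1 / Real.sqrt x * x) = 1 := by
    grind
  obtain ⟨Q, hQ, hQ'⟩ := exists_orth_extension le_rfl
    (fun p => if p = p₀ then (1 / Real.sqrt (f ⬝ᵥ f)) • f else (1 / Real.sqrt (g ⬝ᵥ g)) • g)
    {p | p = p₀ ∨ p = p₁} (by
      rintro k (rfl | rfl) l (rfl | rfl)
      · simp_all
      · rw [if_neg hp, if_pos rfl, if_neg hp.symm]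
        simp [hfg]
      · rw [if_neg hp.symm, if_pos rfl, if_neg hp.symm]
        simp [dotProduct_comm g f, hfg]
      · rw [if_neg hp.symm, if_pos rfl]
        simp_all)
  refine ⟨Matrix.of fun i k => Q (Fin.castLE hrn k) i, 1 / Real.sqrt (f ⬝ᵥ f),
    1 / Real.sqrt (g ⬝ᵥ g), ?_, by positivity, by positivity, fun k => ⟨?_, ?_⟩⟩
  · have h1 := mul_eq_one_comm.1 hQ
    rw [orth_iff]
    intro k l
    have := congrFun (congrFun h1 (Fin.castLE hrn k)) (Fin.castLE hrn l)
    rw [mul_apply, one_apply] at this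
    simp only [Fin.castLE_inj] at this
    exact this
  · rw [of_apply, hQ' p₀ (Or.inl rfl), if_pos rfl]
    simp [hf]
  · rw [of_apply, hQ' p₁ (Or.inr rfl), if_neg hp.symm]
    have := k.2
    by_cases h : (k : ℕ) < r / 2 <;> simp [hg, h]

/-- One row may have fewer than `r` known entries when `r` is close to `n`. In the example each of
the two rows of `A` sees one half of the coefficients, and at least `n - (4b + 2)` known entries
exceed `(r + 1) / 2`, so nonzero minors of `B` determine each half. -/
theorem generic_probeInjective (hn : 8 * (4 * b + 2) ≤ n) (hr : 3 * (4 * b + 2) ≤ r)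
    (hrn : r ≤ n) : GenericOrth n r fun A B _ => ProbeInjective b A B := by
  classical
  obtain ⟨B, hB, hBm⟩ := exists_allMinors (n := n) (r := r) (by omega) hrn
  refine GenericOrth.forall fun l => ?_
  have hl := l.2
  have hp0 : probe n l 0 < n := by rw [probe]; split_ifs <;> omega
  have hp1 : probe n l 1 < n := by rw [probe]; split_ifs <;> omega
  obtain ⟨A, α, β, hA, hα, hβ, hAr⟩ := exists_two_rows (r := r) (by omega) hrn
    (p₀ := ⟨probe n l 0, hp0⟩) (p₁ := ⟨probe n l 1, hp1⟩) (by
      intro h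
      simp only [Fin.mk.injEq, probe] at h
      split_ifs at h <;> omega)
  set P : Fin n × Fin n → Prop := fun x =>
    ((x.1 : ℕ) = probe n l 0 ∨ (x.1 : ℕ) = probe n l 1) ∧ ¬ InBand b l x.1 x.2 with hP
  have hwit : ∀ y : Fin r → ℝ, (∀ x, P x → ∑ k, A x.1 k * B x.2 k * y k = 0) → y = 0 := by
    intro y hy
    have half : ∀ (p : Fin n) (γ : ℝ) (K : Finset (Fin r)), γ ≠ 0 →
        ((p : ℕ) = probe n l 0 ∨ (p : ℕ) = probe n l 1) → K.card ≤ (r + 1) / 2 →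
        (∀ k, A p k = if k ∈ K then γ else 0) → ∀ k ∈ K, y k = 0 := by
      intro p γ K hγ hp hK hAp k hk
      have hpl : ¬ Near b p l := by
        have := l.2
        simp only [probe] at hp
        grind
      have h0 := hBm.cols (R := univ.filter fun q : Fin n => ¬ InBand b l p q) (K := K)
        (y := fun k => if k ∈ K then y k else 0) ?_ (fun k hk => if_neg hk) fun q hq => ?_
      · have := congrFun h0 k
        simpa [hk] using this
      · have h1 : (univ : Finset (Fin n)) ⊆
            (univ.filter fun q : Fin n => ¬ InBand b l p q) ∪
            ((univ.filter fun q : Fin n => Near b q p) ∪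
            (univ.filter fun q : Fin n => Near b q l)) := by
          grind
        have h2 := (card_le_card h1).trans (card_union_le _ _)
        have h3 := card_union_le (univ.filter fun q : Fin n => Near b q p)
            (univ.filter fun q : Fin n => Near b q l)
        have h4 := card_near_le (n := n) b p
        have h5 := card_near_le (n := n) b l
        rw [card_univ, Fintype.card_fin] at h2
        omega
      · simp only [mem_filter, mem_univ, true_and] at hq
        have := hy (p, q) ⟨hp, hq⟩
        have e : ∑ k, A p k * B q k * y k = γ * ∑ k, B q k * (if k ∈ K then y k else 0) := by
          rw [mul_sum]
          grind
        grind
    have hcard : ∀ (K : Finset (Fin r)) (c d : ℕ), (∀ k ∈ K, c ≤ (k : ℕ) ∧ (k : ℕ) < d) →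
        K.card ≤ d - c := by
      intro K c d h
      rw [← card_map Fin.valEmbedding, ← Nat.card_Ico]
      refine card_le_card fun x hx => ?_
      simp only [mem_map, Fin.valEmbedding_apply] at hx
      grind
    ext k
    by_cases hk : (k : ℕ) < r / 2
    · refine half ⟨probe n l 0, hp0⟩ α (univ.filter fun k : Fin r => (k : ℕ) < r / 2) hα
        (Or.inl rfl) ?_ (fun k => ?_) k (by simp [hk])
      · have := hcard (univ.filter fun k : Fin r => (k : ℕ) < r / 2) 0 (r / 2)
          fun k hk => by simpa using hk
        omega
      · simpa using (hAr k).1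
    · refine half ⟨probe n l 1, hp1⟩ β (univ.filter fun k : Fin r => ¬ (k : ℕ) < r / 2) hβ
        (Or.inr rfl) ?_ (fun k => ?_) k (by simpa using hk)
      · have := hcard (univ.filter fun k : Fin r => ¬ (k : ℕ) < r / 2) (r / 2) r
          fun k hk => by
            grind
        omega
      grind
  have := genericOrth_of_linear (n := n) (r := r) (V := Fin r → ℝ) (ι := Fin n × Fin n)
    (Λ := fun F y x => if P x then ∑ k, F 0 x.1 k * F 1 x.2 k * y k else 0) (A := A) (B := B)
    (fun F x y i => by
      simp only [Pi.add_apply, mul_add, sum_add_distrib]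
      split_ifs <;> simp)
    (fun F c x i => by
      simp only [Pi.smul_apply, smul_eq_mul, mul_left_comm _ c, ← mul_sum]
      split_ifs <;> simp)
    (fun x i => PolyFun.ite _ (PolyFun.sum _ fun k _ => ((PolyFun.entry _ _ _).mul
      (PolyFun.entry _ _ _)).mul (PolyFun.const _)) (PolyFun.const _)) (by omega) hA hB
    (fun e e' he he' => ⟨0, fun y hy => by
      -- The signs of the first columns are moved into the unknown coefficient of the first term.
      have h1 := hwit (fun k => (if (k : ℕ) = 0 then e * e' else 1) * y k) fun x hx => by
        have := hy x
        rw [if_pos hx] at this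
        rw [← this]
        refine sum_congr rfl fun k _ => ?_
        simp only [cons_val_zero, Matrix.cons_val_one, scaleFirst, of_apply]
        split_ifs <;> ring
      ext k
      have h2 := congrFun h1 k
      refine (mul_eq_zero.1 h2).resolve_left ?_
      rcases he with rfl | rfl <;> rcases he' with rfl | rfl <;> split_ifs <;> norm_num⟩)
  exact this.mono fun A B C _ _ h y hy => h y fun x => by
    split_ifs with hx
    · exact hy x.1 x.2 hx.1 hx.2
    · rfl

end witnesses₂

/-! ### The exact solution -/

section exactness
variable {n r b : ℕ}

/-- The matrix `A diag(w) Bᵀ`. -/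
def cpMat (A B : Mat n r) (w : Fin r → ℝ) : Mat n n :=
  A * diagonal w * Bᵀ

theorem cpMat_apply (A B : Mat n r) (w : Fin r → ℝ) (p q : Fin n) :
    cpMat A B w p q = ∑ k, A p k * B q k * w k := by
  rw [cpMat, mul_apply]
  refine sum_congr rfl fun k _ => ?_
  rw [mul_diagonal, transpose_apply]
  ring

theorem cpTensor_slice (A B C : Mat n r) (l : Fin n) :
    slice (cpTensor A B C) l = cpMat A B (C l) := by
  ext p q
  rw [cpMat_apply, slice, of_apply, dif_pos l.2]
  rfl

theorem cpMat_transpose (A B : Mat n r) (w : Fin r → ℝ) :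
    (cpMat A B w)ᵀ = cpMat B A w := by
  simp [cpMat, Matrix.transpose_mul, Matrix.mul_assoc]

theorem cpMat_mul_transpose {A B : Mat n r} (hB : Bᵀ * B = 1)
    (v w : Fin r → ℝ) : cpMat A B v * (cpMat A B w)ᵀ = cpMat A A (v * w) := by
  rw [cpMat_transpose, cpMat, cpMat, cpMat]
  calc _ = A * diagonal v * (Bᵀ * B) * diagonal w * Aᵀ := by
        simp only [Matrix.mul_assoc]
    _ = _ := by
        rw [hB, Matrix.mul_one, Matrix.mul_assoc A, diagonal_mul_diagonal]
        rfl

theorem cpMat_mul_cpMat {A B : Mat n r} (hA : Aᵀ * A = 1)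
    (v w : Fin r → ℝ) : cpMat A A v * cpMat A B w = cpMat A B (v * w) := by
  rw [cpMat, cpMat, cpMat]
  calc _ = A * diagonal v * (Aᵀ * A) * diagonal w * Bᵀ := by
        simp only [Matrix.mul_assoc]
    _ = _ := by
        rw [hA, Matrix.mul_one, Matrix.mul_assoc A, diagonal_mul_diagonal]
        rfl

theorem cpMat_comm {A B : Mat n r} (hB : Bᵀ * B = 1) (v w : Fin r → ℝ) :
    cpMat A B v * (cpMat A B w)ᵀ = cpMat A B w * (cpMat A B v)ᵀ := by
  rw [cpMat_mul_transpose hB, cpMat_mul_transpose hB, mul_comm]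

theorem cpMat_eq_zero {A B : Mat n r} (hA : Aᵀ * A = 1) (hB : Bᵀ * B = 1)
    {w : Fin r → ℝ} (h : cpMat A B w = 0) : w = 0 := by
  have h1 : Aᵀ * cpMat A B w * B = diagonal w := by
    rw [cpMat]
    calc _ = (Aᵀ * A) * diagonal w * (Bᵀ * B) := by simp only [Matrix.mul_assoc]
      _ = _ := by grind
  rw [h] at h1
  ext k
  have := congrFun (congrFun h1 k) k
  simpa using this.symm

/-- The residual in the linearized equations. -/
def res {m : ℕ} (M X : Stack m n) (i j : Fin m) : Mat n n :=
  sylv M X i j - (M i * (M j)ᵀ - M j * (M i)ᵀ)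

theorem residual₁_eq (M X : Stack 5 n) (i j : Fin 5) : residual₁ M X i j = res M X i j := rfl

/-- The linear residual differs from the true quadratic equation exactly by the commutator of the
unknowns, which vanishes where the supports do not meet. -/
theorem sub_mul_sub_transpose {m : ℕ} (M X : Stack m n) (i j : Fin m) :
    (M i - X i) * (M j - X j)ᵀ - (M j - X j) * (M i - X i)ᵀ =
      (X i * (X j)ᵀ - X j * (X i)ᵀ) - res M X i j := by
  simp only [res, sylv, transpose_sub, Matrix.sub_mul, Matrix.mul_sub]
  abel

theorem sylv_add_left {m : ℕ} (M N X : Stack m n) (i j : Fin m) :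
    sylv (M + N) X i j = sylv M X i j + sylv N X i j := by
  simp only [sylv, Pi.add_apply, transpose_add, add_mul, mul_add]
  abel

/-- The tuple is supported in the unknown entries of the first stage. -/
def IsOuterStack (b : ℕ) (X : Stack 5 n) : Prop :=
  ∀ (i : Fin 5) (p q : Fin n), ¬ IsOuter b i p q → X i p q = 0

/-- The tuple is supported in the unknown entries of the second stage. -/
def IsInnerStack (b : ℕ) (Z : Stack 3 n) : Prop :=
  ∀ (i : Fin 3) (p q : Fin n), ¬ IsInner b i p q → Z i p q = 0

theorem fiveSlices_add (b : ℕ) (S E : Tensor n) :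
    fiveSlices b (S + E) = fiveSlices b S + fiveSlices b E := by
  funext i
  ext p q
  simp only [fiveSlices, slice, of_apply, Pi.add_apply, Matrix.add_apply]
  split_ifs <;> simp

theorem fiveSlices_band {E : Tensor n} (hE : BandSupported b E) (i : Fin 5) (p q : Fin n)
    (h : ¬ InBand b (center b i) p q) : fiveSlices b E i p q = 0 := by
  simp only [fiveSlices, slice, of_apply]
  split_ifs with h'
  · exact hE p q ⟨_, h'⟩ h
  · rfl

theorem outerNoise_outer {E : Tensor n} (hE : BandSupported b E) : IsOuterStack b (outerNoise b E) := by
  intro i p q h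
  simp only [outerNoise, of_apply]
  split_ifs with h'
  · rfl
  · exact fiveSlices_band hE i p q fun h'' => h ⟨h', h''⟩

theorem not_near_centers {i j : ℕ} (h : i ≠ j) : ¬ Near (2 * b) (center b i) (center b j) := by
  simp only [Near, center]
  rcases Nat.lt_or_gt_of_ne h with h | h
  · have := Nat.mul_le_mul_left (2 * b + 1) (Nat.succ_le_of_lt h)
    grind
  · have := Nat.mul_le_mul_left (2 * b + 1) (Nat.succ_le_of_lt h)
    grind

/-- A nonzero term needs a column within `b` of one of `p`, `k` and of one of `q`, `k'`, or a row
within `b` of its center. Each case puts two of these numbers within `2b`, which is excluded. -/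
theorem sparse_mul_transpose {U V : Mat n n} {k k' : ℕ} {p q : Fin n}
    (hU : ∀ s : Fin n, U p s ≠ 0 → InBand b k p s) (hV : ∀ s : Fin n, V q s ≠ 0 → InBand b k' q s)
    (h1 : ¬ Near (2 * b) p q) (h2 : ¬ Near (2 * b) p k) (h3 : ¬ Near (2 * b) q k)
    (h4 : ¬ Near (2 * b) p k') (h5 : ¬ Near (2 * b) q k') (h6 : ¬ Near (2 * b) k k') :
    (U * Vᵀ) p q = 0 := by
  rw [mul_apply]
  refine sum_eq_zero fun s _ => ?_
  rw [transpose_apply]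
  by_contra h
  have hu := hU s (left_ne_zero_of_mul h)
  have hv := hV s (right_ne_zero_of_mul h)
  simp only [InBand, Near] at *
  omega

/-- Noise in the coefficients has the same band shape as the unknowns, so off `InQuad` it does not
enter the linear equations: injectivity for `T` gives injectivity for the noisy data. -/
theorem sylv_sparse {M X : Stack 5 n} (hX : IsOuterStack b X)
    (hM : ∀ (i : Fin 5) (p q : Fin n), ¬ InBand b (center b i) p q → M i p q = 0) {i j : Fin 5}
    {p q : Fin n} (h : ¬ InQuad b (center b i) (center b j) p q) : sylv M X i j p q = 0 := by
  by_cases hij : i = j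
  · subst hij
    simp [sylv]
  · have hij' : (i : ℕ) ≠ j := fun h => hij (Fin.ext h)
    have hX' : ∀ (i : Fin 5) (p s : Fin n), X i p s ≠ 0 → InBand b (center b i) p s :=
      fun i p s h => by
        by_contra h'
        exact h (hX i p s fun h'' => h' h''.2)
    have hM' : ∀ (i : Fin 5) (p s : Fin n), M i p s ≠ 0 → InBand b (center b i) p s :=
      fun i p s h => by
        grind
    have n1 := not_near_centers (b := b) hij'
    have n2 := not_near_centers (b := b) hij'.symm
    simp only [InQuad, not_or] at h
    obtain ⟨a1, a2, a3, a4, a5⟩ := h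
    simp only [sylv, Matrix.sub_apply, Matrix.add_apply]
    rw [sparse_mul_transpose (hX' i p) (hM' j q) a1 a2 a3 a4 a5 n1,
      sparse_mul_transpose (hM' j p) (hX' i q) a1 a4 a5 a2 a3 n2,
      sparse_mul_transpose (hM' i p) (hX' j q) a1 a2 a3 a4 a5 n1,
      sparse_mul_transpose (hX' j p) (hM' i q) a1 a4 a5 a2 a3 n2]
    ring

theorem sylv_outer {T E : Tensor n} (hE : BandSupported b E) {X : Stack 5 n} (hX : IsOuterStack b X)
    {i j : Fin 5} {p q : Fin n} (h : ¬ InQuad b (center b i) (center b j) p q) :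
    sylv (fiveSlices b (T + E)) X i j p q = sylv (fiveSlices b T) X i j p q := by
  rw [fiveSlices_add, sylv_add_left, Matrix.add_apply, sylv_sparse hX (fiveSlices_band hE) h,
    add_zero]

theorem fiveSlices_cpTensor (hn : 8 * (4 * b + 2) ≤ n) (A B C : Mat n r)
    (i : Fin 5) : ∃ w, fiveSlices b (cpTensor A B C) i = cpMat A B w := by
  have hi : center b i < n := by
    have := i.2
    have : center b i ≤ (2 * b + 1) * 4 := Nat.mul_le_mul_left _ (by omega)
    omega
  exact ⟨_, cpTensor_slice A B C ⟨_, hi⟩⟩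

/-- Off `InQuad` both rows are far from both centers, so subtracting the outer noise restores the
true rows there, for which the symmetry of `Tᵢ Tⱼᵀ` holds. -/
theorem res_outerNoise (hn : 8 * (4 * b + 2) ≤ n) {A B : Mat n r}
    (C : Mat n r) (hB : Bᵀ * B = 1) {E : Tensor n} (hE : BandSupported b E)
    {i j : Fin 5} {p q : Fin n} (h : ¬ InQuad b (center b i) (center b j) p q) :
    res (fiveSlices b (cpTensor A B C + E)) (outerNoise b E) i j p q = 0 := by
  set M := fiveSlices b (cpTensor A B C + E) with hM
  set X := outerNoise b E with hX
  have hXo : IsOuterStack b X := outerNoise_outer hE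
  have h' := h
  simp only [InQuad, not_or] at h'
  obtain ⟨a1, a2, a3, a4, a5⟩ := h'
  have e := congrFun (congrFun (sub_mul_sub_transpose M X i j) p) q
  have h1 : (X i * (X j)ᵀ - X j * (X i)ᵀ) p q = 0 := by
    by_cases hij : i = j
    · subst hij
      simp
    · have hij' : (i : ℕ) ≠ j := fun h => hij (Fin.ext h)
      have hX' : ∀ (i : Fin 5) (p s : Fin n), X i p s ≠ 0 → InBand b (center b i) p s :=
        fun i p s h => by
          by_contra h'
          exact h (hXo i p s fun h'' => h' h''.2)
      rw [Matrix.sub_apply, sparse_mul_transpose (hX' i p) (hX' j q) a1 a2 a3 a4 a5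
        (not_near_centers hij'), sparse_mul_transpose (hX' j p) (hX' i q) a1 a4 a5 a2 a3
        (not_near_centers hij'.symm), sub_zero]
  have hrow : ∀ (i : Fin 5) (p : Fin n), ¬ Near (2 * b) p (center b i) → ∀ s,
      (M i - X i) p s = fiveSlices b (cpTensor A B C) i p s := by
    intro i p hp s
    rw [Matrix.sub_apply, hM, fiveSlices_add, Pi.add_apply, Matrix.add_apply, hX, outerNoise,
      of_apply, if_neg hp, add_sub_cancel_right]
  have h2 : ((M i - X i) * (M j - X j)ᵀ - (M j - X j) * (M i - X i)ᵀ) p q = 0 := by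
    obtain ⟨v, hv⟩ := fiveSlices_cpTensor hn A B C i
    obtain ⟨w, hw⟩ := fiveSlices_cpTensor hn A B C j
    have hc := congrFun (congrFun (cpMat_comm (A := A) hB v w) p) q
    rw [← hv, ← hw] at hc
    simp only [mul_apply, transpose_apply] at hc
    rw [Matrix.sub_apply, mul_apply, mul_apply, sub_eq_zero]
    simp_all
  rw [h2, Matrix.sub_apply, h1, zero_sub] at e
  linarith

/-- The noise in the three slices of the second stage, in the rows close to the slice. -/
def innerNoise (b : ℕ) (E : Tensor n) : Stack 3 n := fun i =>
  Matrix.of fun p q => if Near (2 * b) p (center b (2 * i)) then evenSlices b E i p q else 0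

/-- Every other matrix. -/
def evenPart (X : Stack 5 n) : Stack 3 n := ![X 0, X 2, X 4]

/-- The data of the second stage split into the true slices, the error left by the first stage, and
the noise still to be found. -/
theorem threeSlices_eq {T E : Tensor n} (X : Stack 5 n) :
    threeSlices b (T + E) X =
      (evenSlices b T + evenPart (outerNoise b E - X)) + innerNoise b E := by
  have key : ∀ (i : Fin 3) (i' : Fin 5), (i' : ℕ) = 2 * i →
      fiveSlices b (T + E) i' - X i' =
        evenSlices b T i + (outerNoise b E i' - X i') + innerNoise b E i := by
    intro i i' h
    have e : fiveSlices b E i' = evenSlices b E i := by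
      simp only [fiveSlices, evenSlices, h]
    have e' : fiveSlices b T i' = evenSlices b T i := by
      simp only [fiveSlices, evenSlices, h]
    ext p q
    simp only [fiveSlices_add, Pi.add_apply, Matrix.sub_apply, Matrix.add_apply, outerNoise,
      innerNoise, of_apply, h, e, e']
    split_ifs <;> ring
  funext i
  fin_cases i
  · exact key 0 0 rfl
  · exact key 1 2 rfl
  · exact key 2 4 rfl

theorem innerNoise_inner {E : Tensor n} (hE : BandSupported b E) : IsInnerStack b (innerNoise b E) := by
  intro i p q h
  simp only [innerNoise, of_apply]
  split_ifs with h'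
  · simp only [evenSlices, slice, of_apply]
    split_ifs with h''
    · exact hE p q ⟨_, h''⟩ fun h3 => h ⟨h', h3⟩
    · rfl
  · rfl

/-- The centers involved are at least `4b + 2` apart, so windows of radius `2b` around them share no
row. -/
theorem inner_mul_eq_zero {Y Z : Stack 3 n} (hY : IsInnerStack b Y) (hZ : IsInnerStack b Z) {i j : Fin 3}
    (hij : i ≠ j) : (Y i)ᵀ * Z j = 0 := by
  ext p q
  rw [mul_apply]
  refine sum_eq_zero fun s _ => ?_
  rw [transpose_apply]
  by_contra h
  have h1 : Near (2 * b) s (center b (2 * i)) := by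
    by_contra h'
    exact left_ne_zero_of_mul h (hY i s p fun h'' => h' h''.1)
  have h2 : Near (2 * b) s (center b (2 * j)) := by
    by_contra h'
    exact right_ne_zero_of_mul h (hZ j s q fun h'' => h' h''.1)
  have hij' : (i : ℕ) ≠ j := fun h => hij (Fin.ext h)
  simp only [Near, center] at h1 h2
  rcases Nat.lt_or_gt_of_ne hij' with h | h
  · have := Nat.mul_le_mul_left (2 * b + 1) (show 2 * (i : ℕ) + 2 ≤ 2 * j by omega)
    rw [mul_add] at this
    omega
  · have := Nat.mul_le_mul_left (2 * b + 1) (show 2 * (j : ℕ) + 2 ≤ 2 * i by omega)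
    rw [mul_add] at this
    omega

theorem flip_quadratic {Z : Stack 3 n} (hZ : IsInnerStack b Z) (i j : Fin 3) :
    flipStack Z i * (flipStack Z j)ᵀ - flipStack Z j * (flipStack Z i)ᵀ = 0 := by
  simp only [flipStack, transpose_transpose]
  by_cases hij : i = j
  · subst hij
    simp
  · rw [inner_mul_eq_zero hZ hZ hij, inner_mul_eq_zero hZ hZ (Ne.symm hij), sub_zero]

theorem objective₂_eq {M Z : Stack 3 n} (hZ : IsInnerStack b Z) :
    objective₂ M Z = ∑ i, ∑ j, ∑ p, ∑ q, res (flipStack M) (flipStack Z) i j p q ^ 2 := by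
  rw [objective₂]
  refine sum_congr rfl fun i _ => sum_congr rfl fun j _ =>
    sum_congr rfl fun p _ => sum_congr rfl fun q _ => ?_
  have e := sub_mul_sub_transpose (flipStack M) (flipStack Z) i j
  rw [flip_quadratic hZ, zero_sub] at e
  have e' : (M i - Z i)ᵀ * (M j - Z j) - (M j - Z j)ᵀ * (M i - Z i) =
      - res (flipStack M) (flipStack Z) i j := by
    rw [← e]
    rfl
  rw [e', Matrix.neg_apply, neg_sq]

/-- Products of noise with unknowns vanish as well, so the unknown noise `I` can be moved from the
data into the variable. The residual then has coefficients free of noise, which is what the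
injectivity for `T` and the perturbation argument need. -/
theorem res_flip_eq {T I Z : Stack 3 n} (hI : IsInnerStack b I) (hZ : IsInnerStack b Z) (i j : Fin 3) :
    res (flipStack (T + I)) (flipStack Z) i j =
      sylv (flipStack T) (flipStack (Z - I)) i j - ((T i)ᵀ * T j - (T j)ᵀ * T i) := by
  have hd : IsInnerStack b (Z - I) := fun i p q h => by
    rw [Pi.sub_apply, Matrix.sub_apply, hZ i p q h, hI i p q h, sub_zero]
  have e1 := sub_mul_sub_transpose (flipStack (T + I)) (flipStack Z) i j
  have e2 := sub_mul_sub_transpose (flipStack T) (flipStack (Z - I)) i j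
  rw [flip_quadratic hZ, zero_sub] at e1
  rw [flip_quadratic hd, zero_sub] at e2
  have e3 : ∀ i, flipStack (T + I) i - flipStack Z i = flipStack T i - flipStack (Z - I) i := by
    intro i
    simp only [flipStack, Pi.add_apply, Pi.sub_apply, transpose_add, transpose_sub]
    abel
  rw [e3, e3, e2, neg_inj] at e1
  rw [← e1]
  rfl

theorem evenSlices_comm (hn : 8 * (4 * b + 2) ≤ n) {A B : Mat n r}
    (C : Mat n r) (hA : Aᵀ * A = 1) (i j : Fin 3) :
    (evenSlices b (cpTensor A B C) i)ᵀ * evenSlices b (cpTensor A B C) j -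
      (evenSlices b (cpTensor A B C) j)ᵀ * evenSlices b (cpTensor A B C) i = 0 := by
  have h : ∀ i : Fin 3, ∃ w, evenSlices b (cpTensor A B C) i = (cpMat B A w)ᵀ := by
    intro i
    have hi : center b (2 * i) < n := by
      have := i.2
      have : center b (2 * i) ≤ (2 * b + 1) * 4 := Nat.mul_le_mul_left _ (by omega)
      omega
    exact ⟨_, (cpTensor_slice A B C ⟨_, hi⟩).trans (cpMat_transpose B A _).symm⟩
  obtain ⟨v, hv⟩ := h i
  obtain ⟨w, hw⟩ := h j
  rw [hv, hw, transpose_transpose, transpose_transpose, cpMat_comm hA, sub_self]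

/-- The difference of two solutions solves the homogeneous system, in which the noisy coefficients
may be replaced by those of `T`. -/
theorem outer_eq_of_res (hn : 8 * (4 * b + 2) ≤ n) {A B C : Mat n r}
    (hB : Bᵀ * B = 1) (hinj : Injective₁ b (cpTensor A B C)) {E : Tensor n}
    (hE : BandSupported b E) {X : Stack 5 n} (hX : IsOuterStack b X)
    (h : ∀ (i j : Fin 5) (p q : Fin n), ¬ InQuad b (center b i) (center b j) p q →
      res (fiveSlices b (cpTensor A B C + E)) X i j p q = 0) : X = outerNoise b E := by
  have hd : IsOuterStack b (X - outerNoise b E) := fun i p q h => by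
    rw [Pi.sub_apply, Matrix.sub_apply, hX i p q h, outerNoise_outer hE i p q h, sub_zero]
  refine sub_eq_zero.1 (hinj _ hd fun i j p q hq => ?_)
  rw [← sylv_outer hE hd hq]
  have h1 := h i j p q hq
  rw [← res_outerNoise hn C hB hE hq] at h1
  have h2 : sylv (fiveSlices b (cpTensor A B C + E)) X i j =
      sylv (fiveSlices b (cpTensor A B C + E)) (X - outerNoise b E) i j +
        sylv (fiveSlices b (cpTensor A B C + E)) (outerNoise b E) i j := by
    rw [← sylv_add, sub_add_cancel]
  simp only [res, Matrix.sub_apply] at h1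
  rw [h2, Matrix.add_apply] at h1
  linarith

theorem inner_eq_of_res (hn : 8 * (4 * b + 2) ≤ n) {A B C : Mat n r}
    (hA : Aᵀ * A = 1) (hinj : Injective₂ b (cpTensor A B C)) {E : Tensor n}
    (hE : BandSupported b E) {Z : Stack 3 n} (hZ : IsInnerStack b Z)
    (h : ∀ (i j : Fin 3) (p q : Fin n),
      res (flipStack (threeSlices b (cpTensor A B C + E) (outerNoise b E))) (flipStack Z) i j p q
        = 0) : Z = innerNoise b E := by
  have hI := innerNoise_inner (b := b) hE
  have hd : IsInnerStack b (Z - innerNoise b E) := fun i p q h => by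
    rw [Pi.sub_apply, Matrix.sub_apply, hZ i p q h, hI i p q h, sub_zero]
  refine sub_eq_zero.1 (hinj _ hd fun i j p q => ?_)
  have h1 := h i j p q
  have e : evenPart (outerNoise b E - outerNoise b E) = 0 := by
    rw [sub_self]
    funext i
    fin_cases i <;> rfl
  rw [threeSlices_eq, e, add_zero, res_flip_eq hI hZ, evenSlices_comm hn C hA, sub_zero] at h1
  exact h1

/-! #### Powers of a slice -/

/-- The matrices `(T Tᵀ) ^ k T`. -/
def krylov (T : Mat n n) : ℕ → Mat n n
  | 0 => T
  | k + 1 => T * Tᵀ * krylov T k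

theorem krylov_cpMat {A B : Mat n r} (hA : Aᵀ * A = 1) (hB : Bᵀ * B = 1)
    (d : Fin r → ℝ) (k : ℕ) : krylov (cpMat A B d) k = cpMat A B (d ^ (2 * k + 1)) := by
  induction k with
  | zero => simp [krylov]
  | succ k ih =>
    rw [krylov, ih, cpMat_mul_transpose hB, cpMat_mul_cpMat hA]
    congr 1
    ring

theorem cpMat_sum (A B : Mat n r) (y : Fin r → ℝ) (w : ℕ → Fin r → ℝ) :
    ∑ k : Fin r, y k • cpMat A B (w k) = cpMat A B (∑ k : Fin r, y k • w k) := by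
  ext p q
  simp only [Matrix.sum_apply, Matrix.smul_apply, cpMat_apply, Finset.sum_apply, Pi.smul_apply,
    smul_eq_mul, mul_sum]
  rw [sum_comm]
  grind

/-- After division by `d m` this is a Vandermonde system in the squares `d m ^ 2`. -/
theorem oddPowers_injective {d : Fin r → ℝ} (h0 : ∀ k, d k ≠ 0)
    (h : ∀ k k', k ≠ k' → d k ^ 2 ≠ d k' ^ 2) {y : Fin r → ℝ}
    (hy : ∑ k : Fin r, y k • d ^ (2 * (k : ℕ) + 1) = 0) : y = 0 := by
  have hdet : (vandermonde fun m => d m ^ 2).det ≠ 0 := by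
    rw [Matrix.det_vandermonde_ne_zero_iff]
    intro k k' hk
    by_contra hne
    exact h k k' hne hk
  refine Matrix.eq_zero_of_mulVec_eq_zero hdet ?_
  ext m
  have h1 := congrFun hy m
  simp only [Finset.sum_apply, Pi.smul_apply, Pi.pow_apply, smul_eq_mul, Pi.zero_apply] at h1
  have h2 : d m * ∑ k : Fin r, (d m ^ 2) ^ (k : ℕ) * y k = 0 := by
    rw [← h1, mul_sum]
    exact sum_congr rfl fun k _ => by ring
  simpa [mulVec, dotProduct, vandermonde] using (mul_eq_zero.1 h2).resolve_left (h0 m)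

/-- An injective endomorphism of `ℝ ^ r` is surjective. Independence is assumed for the matrices and
not for `d`, so that it can be transferred to another factorization of the same slice. -/
theorem exists_krylov_coeffs {A B : Mat n r} (hA : Aᵀ * A = 1) (hB : Bᵀ * B = 1)
    {d : Fin r → ℝ} (hinj : ∀ y : Fin r → ℝ, ∑ k : Fin r, y k • krylov (cpMat A B d) k = 0 → y = 0)
    (w : Fin r → ℝ) : ∃ y : Fin r → ℝ, ∑ k : Fin r, y k • krylov (cpMat A B d) k = cpMat A B w := by
  set L : (Fin r → ℝ) →ₗ[ℝ] (Fin r → ℝ) :=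
    { toFun := fun y => ∑ k : Fin r, y k • d ^ (2 * (k : ℕ) + 1)
      map_add' := fun x y => by simp only [Pi.add_apply, add_smul, sum_add_distrib]
      map_smul' := fun c x => by
        simp only [Pi.smul_apply, smul_eq_mul, mul_smul, smul_sum, RingHom.id_apply] }
    with hL
  have hs : ∀ y, ∑ k : Fin r, y k • krylov (cpMat A B d) k = cpMat A B (L y) := by
    intro y
    simp only [krylov_cpMat hA hB]
    exact cpMat_sum A B y fun k => d ^ (2 * k + 1)
  have hLi : Function.Injective L := by
    rw [← LinearMap.ker_eq_bot, LinearMap.ker_eq_bot']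
    intro y hy
    refine hinj y ?_
    rw [hs, hy]
    simp [cpMat]
  obtain ⟨y, hy⟩ := (LinearMap.injective_iff_surjective.1 hLi) w
  exact ⟨y, by rw [hs, hy]⟩

theorem krylov_injective {A B : Mat n r} (hA : Aᵀ * A = 1) (hB : Bᵀ * B = 1)
    {d : Fin r → ℝ} (h0 : ∀ k, d k ≠ 0) (h : ∀ k k', k ≠ k' → d k ^ 2 ≠ d k' ^ 2)
    (y : Fin r → ℝ) (hy : ∑ k : Fin r, y k • krylov (cpMat A B d) k = 0) : y = 0 := by
  refine oddPowers_injective h0 h (cpMat_eq_zero hA hB ?_)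
  rw [← hy, ← cpMat_sum A B y fun k => d ^ (2 * k + 1)]
  simp only [krylov_cpMat hA hB]

/-- A combination of the powers of a slice that agrees with another slice at the probed entries
is equal to it. -/
theorem krylov_eq_of_probe {A B : Mat n r} (hA : Aᵀ * A = 1) (hB : Bᵀ * B = 1)
    (hpr : ProbeInjective b A B) {d : Fin r → ℝ} (l : Fin n) (w y : Fin r → ℝ)
    (h : ∀ p q : Fin n, ((p : ℕ) = probe n l 0 ∨ (p : ℕ) = probe n l 1) → ¬ InBand b l p q →
      (∑ k : Fin r, y k • krylov (cpMat A B d) k) p q = cpMat A B w p q) :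
    ∑ k : Fin r, y k • krylov (cpMat A B d) k = cpMat A B w := by
  have hs : ∑ k : Fin r, y k • krylov (cpMat A B d) k =
      cpMat A B (∑ k : Fin r, y k • d ^ (2 * (k : ℕ) + 1)) := by
    rw [← cpMat_sum A B y fun k => d ^ (2 * k + 1)]
    simp only [krylov_cpMat hA hB]
  rw [hs] at h ⊢
  congr 1
  refine sub_eq_zero.1 (hpr l _ fun p q hp hq => ?_)
  have := h p q hp hq
  rw [cpMat_apply, cpMat_apply] at this
  simp only [Pi.sub_apply, mul_sub, sum_sub_distrib]
  linarith

theorem evenSlices_zero (S : Tensor n) : evenSlices b S 0 = slice S 0 := by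
  simp [evenSlices, center]

/-- The competing tensor is regarded as the given one plus noise `E`. Being of the required form
itself, it satisfies the equations of both stages with zero unknowns, so by uniqueness the noise in
the slices of the second stage is zero and the first slices agree. -/
theorem determinedOffBand (hn : 8 * (4 * b + 2) ≤ n) {A B C : Mat n r}
    (hA : Aᵀ * A = 1) (hB : Bᵀ * B = 1) (h1 : Injective₁ b (cpTensor A B C))
    (h2 : Injective₂ b (cpTensor A B C)) (h3 : DistinctSquares C) (h4 : ProbeInjective b A B) :
    DeterminedOffBand b A B C := by
  intro A' B' C' hA' hB' hT
  set E : Tensor n := cpTensor A' B' C' - cpTensor A B C with hEdef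
  have hE : BandSupported b E := fun i j l h => by
    have := hT i j l h
    simp [hEdef, this]
  have hS : cpTensor A B C + E = cpTensor A' B' C' := by rw [hEdef]; abel
  have hO : (0 : Stack 5 n) = outerNoise b E := by
    refine outer_eq_of_res hn hB h1 hE (fun _ _ _ _ => rfl) fun i j p q _ => ?_
    rw [hS]
    obtain ⟨v, hv⟩ := fiveSlices_cpTensor hn A' B' C' i
    obtain ⟨w, hw⟩ := fiveSlices_cpTensor hn A' B' C' j
    rw [res, hv, hw, cpMat_comm hB']
    simp [sylv]
  have hI : (0 : Stack 3 n) = innerNoise b E := by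
    refine inner_eq_of_res hn hA h2 hE (fun _ _ _ _ => rfl) fun i j p q => ?_
    rw [hS, ← hO]
    have e : threeSlices b (cpTensor A' B' C') 0 = evenSlices b (cpTensor A' B' C') := by
      funext i
      fin_cases i <;> exact sub_zero _
    have := congrFun (congrFun (evenSlices_comm hn C' hA' (B := B') i j) p) q
    rw [e, res, Matrix.sub_apply]
    simp only [flipStack, transpose_transpose]
    rw [this]
    simp [sylv, flipStack]
  have hn0 : 0 < n := by omega
  have hT0 : cpMat A' B' (C' ⟨0, hn0⟩) = cpMat A B (C ⟨0, hn0⟩) := by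
    have e1 := threeSlices_eq (b := b) (T := cpTensor A B C) (E := E) (outerNoise b E)
    rw [← hI, hS, ← hO] at e1
    have e2 := congrFun e1 0
    rw [Pi.add_apply, Pi.add_apply, evenSlices_zero] at e2
    have e3 := cpTensor_slice A B C ⟨0, hn0⟩
    have e4 := cpTensor_slice A' B' C' ⟨0, hn0⟩
    rw [← e3, ← e4]
    simpa [threeSlices, fiveSlices, center, evenPart] using e2
  obtain ⟨hd0, hd⟩ := h3 ⟨0, hn0⟩ rfl
  have key : ∀ l : Fin n, cpMat A' B' (C' l) = cpMat A B (C l) := by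
    intro l
    -- A slice of the competitor is a combination of powers of the common first slice, hence lies in
    -- the span belonging to `A` and `B`, where the probed entries decide.
    obtain ⟨y, hy⟩ := exists_krylov_coeffs hA' hB' (d := C' ⟨0, hn0⟩) (by
      rw [hT0]
      exact krylov_injective hA hB hd0 hd) (C' l)
    rw [← hy, hT0]
    refine krylov_eq_of_probe hA hB h4 l _ _ fun p q _ hq => ?_
    rw [← hT0, hy, cpMat_apply, cpMat_apply]
    exact hT p q l hq
  funext p q l
  have := congrFun (congrFun (key l) p) q
  rw [cpMat_apply, cpMat_apply] at this
  exact this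

end exactness

/-! ### Alternating least squares in inner product spaces -/

section alternating
open scoped RealInnerProductSpace

variable {V W : Type*} [NormedAddCommGroup V] [InnerProductSpace ℝ V] [FiniteDimensional ℝ V]
  [NormedAddCommGroup W] [InnerProductSpace ℝ W]

/-- The point `y` minimizes `‖L y - c‖` on `x + D`. -/
def BlockStep (L : V →ₗ[ℝ] W) (c : W) (D : Submodule ℝ V) (x y : V) : Prop :=
  y - x ∈ D ∧ ∀ δ ∈ D, ⟪L y - c, L δ⟫ = 0

/-- Consecutive minimization over a list of subspaces. -/
def BlockSweep (L : V →ₗ[ℝ] W) (c : W) : List (Submodule ℝ V) → V → V → Prop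
  | [], x, y => y = x
  | D :: l, x, y => ∃ w, BlockStep L c D x w ∧ BlockSweep L c l w y

variable {L : V →ₗ[ℝ] W} {c : W} {D U : Submodule ℝ V} {l : List (Submodule ℝ V)} {x y z : V}

theorem exists_blockStep (L : V →ₗ[ℝ] W) (c : W) (D : Submodule ℝ V) (x : V) :
    ∃ y, BlockStep L c D x y := by
  obtain ⟨δ, hδ, h⟩ := Submodule.mem_map.1 ((D.map L).starProjection_apply_mem (c - L x))
  refine ⟨x + δ, by simpa using hδ, fun η hη => ?_⟩
  have h1 := (D.map L).starProjection_inner_eq_zero (c - L x) (L η) (Submodule.mem_map_of_mem hη)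
  rw [← h] at h1
  have h2 : L (x + δ) - c = -(c - L x - L δ) := by rw [map_add]; abel
  rw [h2, inner_neg_left, h1, neg_zero]

theorem BlockStep.unique (hL : ∀ δ ∈ D, L δ = 0 → δ = 0) {y' : V} (h : BlockStep L c D x y)
    (h' : BlockStep L c D x y') : y = y' := by
  have hd : y - y' ∈ D := by
    have := D.sub_mem h.1 h'.1
    rwa [sub_sub_sub_cancel_right] at this
  have h1 := h.2 _ hd
  have h2 := h'.2 _ hd
  have h3 : ⟪L (y - y'), L (y - y')⟫ = 0 := by
    have e : L (y - y') = (L y - c) - (L y' - c) := by rw [map_sub]; abel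
    nth_rw 1 [e]
    rw [inner_sub_left, h1, h2, sub_zero]
  exact sub_eq_zero.1 (hL _ hd (inner_self_eq_zero.1 h3))

theorem BlockStep.sq_norm (h : BlockStep L c D x y) {z : V} (hz : z - x ∈ D) :
    ‖L z - c‖ ^ 2 = ‖L y - c‖ ^ 2 + ‖L (z - y)‖ ^ 2 := by
  have hd : z - y ∈ D := by
    have := D.sub_mem hz h.1
    simp_all
  have e : L z - c = (L y - c) + L (z - y) := by rw [map_sub]; abel
  rw [e, norm_add_sq_real, h.2 _ hd]
  ring

theorem blockStep_iff : BlockStep L c D x y ↔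
    y - x ∈ D ∧ ∀ z, z - x ∈ D → ‖L y - c‖ ^ 2 ≤ ‖L z - c‖ ^ 2 := by
  constructor
  · intro h
    refine ⟨h.1, fun z hz => ?_⟩
    rw [h.sq_norm hz]
    simp_all
  · rintro ⟨h1, h2⟩
    refine ⟨h1, fun δ hδ => ?_⟩
    obtain ⟨w, hw⟩ := exists_blockStep L c D x
    have h3 := h2 w hw.1
    rw [hw.sq_norm h1] at h3
    have h4 : L (y - w) = 0 := by
      simp_all
    have h5 : L y = L w := by rwa [map_sub, sub_eq_zero] at h4
    rw [h5]
    exact hw.2 δ hδ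

theorem BlockSweep.sub_mem (hU : ∀ D ∈ l, D ≤ U) (h : BlockSweep L c l x y) : y - x ∈ U := by
  induction l generalizing x with
  | nil =>
    rw [BlockSweep] at h
    simp [h]
  | cons D l ih =>
    obtain ⟨w, h1, h2⟩ := h
    have := U.add_mem (ih (fun D hD => hU D (List.mem_cons_of_mem _ hD)) h2)
      (hU D List.mem_cons_self h1.1)
    rwa [sub_add_sub_cancel] at this

theorem exists_blockSweep (L : V →ₗ[ℝ] W) (c : W) (l : List (Submodule ℝ V)) (x : V) :
    ∃ y, BlockSweep L c l x y := by
  induction l generalizing x with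
  | nil => exact ⟨x, rfl⟩
  | cons D l ih =>
    obtain ⟨w, hw⟩ := exists_blockStep L c D x
    obtain ⟨y, hy⟩ := ih w
    exact ⟨y, w, hw, hy⟩

theorem BlockSweep.unique (hU : ∀ D ∈ l, D ≤ U) (hL : ∀ δ ∈ U, L δ = 0 → δ = 0) {y' : V}
    (h : BlockSweep L c l x y) (h' : BlockSweep L c l x y') : y = y' := by
  induction l generalizing x with
  | nil =>
    rw [BlockSweep] at h h'
    rw [h, h']
  | cons D l ih =>
    obtain ⟨w, h1, h2⟩ := h
    obtain ⟨w', h1', h2'⟩ := h'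
    have := h1.unique (fun δ hδ => hL δ (hU D List.mem_cons_self hδ)) h1'
    grind

/-- The induction step of the Cauchy–Schwarz inequality for the sum of the step lengths of a sweep.
-/
theorem add_sq_le_of_sq_le {s t a b k : ℝ} (ha : s ^ 2 = a) (hb : t ^ 2 ≤ k * b) (hk : 0 ≤ k)
    (hb0 : 0 ≤ b) : (s + t) ^ 2 ≤ (k + 1) * (a + b) := by
  have h1 : (2 * (s * t)) ^ 2 ≤ (k * a + b) ^ 2 := by
    have : s ^ 2 * t ^ 2 ≤ s ^ 2 * (k * b) := mul_le_mul_of_nonneg_left hb (sq_nonneg s)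
    nlinarith [sq_nonneg (k * a - b)]
  have h0 : 0 ≤ k * a + b := by
    have : 0 ≤ k * a := mul_nonneg hk (ha ▸ sq_nonneg s)
    linarith
  have h2 := abs_le_of_sq_le_sq h1 h0
  grind

/-- `S` is the sum of the step lengths measured after `L`. By Pythagoras the squares of the lengths
add up to the drop of the objective. The gradient in a block is zero right after its own step, and
later steps change `L y` by at most `S`. -/
theorem BlockSweep.exists_bound (h : BlockSweep L c l x y) :
    ∃ S : ℝ, 0 ≤ S ∧ ‖L (y - x)‖ ≤ S ∧ ‖L y - c‖ ^ 2 ≤ ‖L x - c‖ ^ 2 ∧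
      S ^ 2 ≤ l.length * (‖L x - c‖ ^ 2 - ‖L y - c‖ ^ 2) ∧
      ∀ D ∈ l, ∀ δ ∈ D, |⟪L y - c, L δ⟫| ≤ S * ‖L δ‖ := by
  induction l generalizing x with
  | nil =>
    rw [BlockSweep] at h
    simp_all
  | cons D l ih =>
    obtain ⟨w, h1, h2⟩ := h
    obtain ⟨S, hS0, hS1, hS2, hS3, hS4⟩ := ih h2
    have e := h1.sq_norm (z := x) (by simp)
    refine ⟨‖L (x - w)‖ + S, by positivity, ?_, ?_, ?_, ?_⟩
    · have e1 : L (y - x) = L (y - w) - L (x - w) := by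
        rw [← map_sub, sub_sub_sub_cancel_right]
      rw [e1]
      exact (norm_sub_le _ _).trans (by linarith)
    · have := sq_nonneg ‖L (x - w)‖
      linarith
    · have := add_sq_le_of_sq_le (s := ‖L (x - w)‖) rfl hS3 (Nat.cast_nonneg _) (by linarith)
      rw [List.length_cons, Nat.cast_succ]
      refine this.trans (le_of_eq ?_)
      rw [e]
      ring
    · intro D' hD' δ hδ
      rcases List.mem_cons.1 hD' with rfl | hD'
      · have e1 : L y - c = L (y - w) + (L w - c) := by rw [map_sub]; abel
        rw [e1, inner_add_left, h1.2 δ hδ, add_zero]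
        refine (abs_real_inner_le_norm _ _).trans ?_
        gcongr
        have := norm_nonneg (L (x - w))
        linarith
      · refine (hS4 D' hD' δ hδ).trans ?_
        gcongr
        have := norm_nonneg (L (x - w))
        linarith

/-- A sweep contracts the distance to the minimizer, measured after `L`. -/
theorem BlockSweep.contraction {α β : ℝ} (hα : 0 < α) (hβ : 0 ≤ β)
    (hlow : ∀ δ ∈ U, α * ‖δ‖ ≤ ‖L δ‖) (hup : ∀ δ ∈ U, ‖L δ‖ ≤ β * ‖δ‖)
    (hU : ∀ D ∈ l, D ≤ U)
    (hdec : ∀ δ ∈ U, ∃ f : ℕ → V, (∀ (k : ℕ) (hk : k < l.length), f k ∈ l[k]) ∧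
      (∀ k, ‖f k‖ ≤ ‖δ‖) ∧ δ = ∑ k ∈ range l.length, f k)
    (hz : ∀ δ ∈ U, ⟪L z - c, L δ⟫ = 0) (hx : x - z ∈ U) (h : BlockSweep L c l x y) :
    ‖L (y - z)‖ ^ 2 * (1 + (l.length * β / α) ^ 2 * l.length) ≤
      (l.length * β / α) ^ 2 * l.length * ‖L (x - z)‖ ^ 2 := by
  have hy : y - z ∈ U := by
    have := U.add_mem (h.sub_mem hU) hx
    rwa [sub_add_sub_cancel] at this
  obtain ⟨S, hS0, -, -, hS3, hS4⟩ := h.exists_bound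
  have hpyth : ∀ w, w - z ∈ U → ‖L w - c‖ ^ 2 = ‖L z - c‖ ^ 2 + ‖L (w - z)‖ ^ 2 := fun w hw =>
    BlockStep.sq_norm (D := U) (x := z) ⟨by simp, hz⟩ hw
  rw [hpyth x hx, hpyth y hy] at hS3
  obtain ⟨f, hf1, hf2, hf3⟩ := hdec _ hy
  -- The error is tested against itself: `L z - c` is orthogonal to it, and after splitting `y - z`
  -- into block vectors each piece is controlled by a block gradient.
  have key : ‖L (y - z)‖ ^ 2 ≤ l.length * (S * (β * ‖y - z‖)) := by
    have e0 : L (y - z) = (L y - c) - (L z - c) := by rw [map_sub]; abel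
    have e1 : ‖L (y - z)‖ ^ 2 = ⟪L y - c, L (y - z)⟫ := by
      rw [← real_inner_self_eq_norm_sq]
      nth_rw 1 [e0]
      rw [inner_sub_left, hz _ hy, sub_zero]
    rw [e1]
    nth_rw 1 [hf3]
    rw [map_sum, inner_sum]
    have : ∀ k ∈ range l.length, ⟪L y - c, L (f k)⟫ ≤ S * (β * ‖y - z‖) := by
      intro k hk
      have hk' := mem_range.1 hk
      have hm := hf1 k hk'
      refine (le_abs_self _).trans ((hS4 _ (List.getElem_mem hk') _ hm).trans ?_)
      gcongr
      exact (hup _ (hU _ (List.getElem_mem hk') hm)).trans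
        (mul_le_mul_of_nonneg_left (hf2 k) hβ)
    refine (sum_le_sum this).trans (le_of_eq ?_)
    rw [sum_const, card_range, nsmul_eq_mul]
  set e := ‖L (y - z)‖ with he
  set m : ℝ := (l.length : ℝ) with hm
  have hm0 : 0 ≤ m := Nat.cast_nonneg _
  have h1 : ‖y - z‖ ≤ e / α := by
    rw [le_div_iff₀ hα, mul_comm]
    exact hlow _ hy
  have h2 : e ^ 2 ≤ m * β / α * S * e := by
    refine key.trans ?_
    calc m * (S * (β * ‖y - z‖)) ≤ m * (S * (β * (e / α))) := by gcongr
      _ = _ := by ring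
  have he0 : 0 ≤ e := norm_nonneg _
  have h3 : e ≤ m * β / α * S := by
    rcases he0.eq_or_lt with h0 | h0
    · rw [← h0]
      positivity
    · have : e * e ≤ m * β / α * S * e := by rw [← sq]; exact h2
      exact le_of_mul_le_mul_right this h0
  have h4 : e ^ 2 ≤ (m * β / α) ^ 2 * S ^ 2 := by
    rw [← mul_pow]
    gcongr
  have h5 : (m * β / α) ^ 2 * S ^ 2 ≤ (m * β / α) ^ 2 * (m * (‖L (x - z)‖ ^ 2 - e ^ 2)) := by
    refine mul_le_mul_of_nonneg_left (hS3.trans (le_of_eq ?_)) (sq_nonneg _)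
    ring
  linarith

end alternating

/-! ### Geometric decay -/

section decay
open Filter Asymptotics

/-- The sequence tends to zero at a geometric rate. -/
def GeometricDecay (f : ℕ → ℝ) : Prop :=
  ∃ ρ : ℝ, 0 < ρ ∧ ρ < 1 ∧ f =O[atTop] fun N => ρ ^ N

theorem isBigO_pow_of_le {ρ ρ' : ℝ} (h0 : 0 < ρ) (h : ρ ≤ ρ') :
    (fun N : ℕ => ρ ^ N) =O[atTop] fun N : ℕ => ρ' ^ N := by
  refine IsBigO.of_bound 1 (Eventually.of_forall fun N => ?_)
  rw [Real.norm_of_nonneg (pow_nonneg h0.le _), Real.norm_of_nonneg (pow_nonneg (h0.le.trans h) _),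
    one_mul]
  exact pow_le_pow_left₀ h0.le h _

theorem GeometricDecay.of_eventually_le {f g : ℕ → ℝ} (hg : GeometricDecay g)
    (h : ∀ᶠ N in atTop, |f N| ≤ g N) : GeometricDecay f := by
  obtain ⟨ρ, h0, h1, hO⟩ := hg
  refine ⟨ρ, h0, h1, IsBigO.trans (IsBigO.of_bound 1 ?_) hO⟩
  filter_upwards [h] with N hN
  rw [one_mul]
  exact hN.trans (le_abs_self _)

theorem GeometricDecay.of_le {f g : ℕ → ℝ} (hg : GeometricDecay g) (h : ∀ N, |f N| ≤ g N) :
    GeometricDecay f := hg.of_eventually_le (Eventually.of_forall h)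

theorem GeometricDecay.add {f g : ℕ → ℝ} (hf : GeometricDecay f) (hg : GeometricDecay g) :
    GeometricDecay fun N => f N + g N := by
  obtain ⟨ρ, h0, h1, hO⟩ := hf
  obtain ⟨ρ', h0', h1', hO'⟩ := hg
  exact ⟨max ρ ρ', lt_max_of_lt_left h0, max_lt h1 h1',
    (hO.trans (isBigO_pow_of_le h0 (le_max_left _ _))).add
      (hO'.trans (isBigO_pow_of_le h0' (le_max_right _ _)))⟩

theorem GeometricDecay.const_mul {f : ℕ → ℝ} (hf : GeometricDecay f) (a : ℝ) :
    GeometricDecay fun N => a * f N := by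
  obtain ⟨ρ, h0, h1, hO⟩ := hf
  exact ⟨ρ, h0, h1, hO.const_mul_left a⟩

theorem GeometricDecay.zero : GeometricDecay fun _ => 0 :=
  ⟨1 / 2, by norm_num, by norm_num, isBigO_zero _ _⟩

theorem GeometricDecay.mul {f g : ℕ → ℝ} (hf : GeometricDecay f) (hg : GeometricDecay g) :
    GeometricDecay fun N => f N * g N := by
  obtain ⟨ρ, h0, h1, hO⟩ := hf
  obtain ⟨ρ', h0', h1', hO'⟩ := hg
  refine ⟨ρ * ρ', mul_pos h0 h0', mul_lt_one_of_nonneg_of_lt_one_left h0.le h1 h1'.le, ?_⟩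
  simp only [mul_pow]
  exact hO.mul hO'

theorem GeometricDecay.sum {ι : Type*} {s : Finset ι} {f : ι → ℕ → ℝ}
    (h : ∀ i ∈ s, GeometricDecay (f i)) : GeometricDecay fun N => ∑ i ∈ s, f i N := by
  classical
  induction s using Finset.induction with
  | empty => simpa using GeometricDecay.zero
  | insert i s hi ih =>
    simp only [sum_insert hi]
    exact (h i (Finset.mem_insert_self i s)).add
      (ih fun j hj => h j (Finset.mem_insert_of_mem hj))

theorem GeometricDecay.abs {f : ℕ → ℝ} (hf : GeometricDecay f) : GeometricDecay fun N => |f N| := by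
  obtain ⟨ρ, h0, h1, hO⟩ := hf
  exact ⟨ρ, h0, h1, hO.norm_left⟩

theorem GeometricDecay.sqrt {f : ℕ → ℝ} (hf : GeometricDecay f) :
    GeometricDecay fun N => √(f N) := by
  obtain ⟨ρ, h0, h1, hO⟩ := hf
  refine ⟨√ρ, Real.sqrt_pos.2 h0, by rw [Real.sqrt_lt' one_pos]; simpa using h1, ?_⟩
  obtain ⟨C, hC⟩ := hO.bound
  refine IsBigO.of_bound √C ?_
  filter_upwards [hC] with N hN
  rw [Real.norm_of_nonneg (Real.sqrt_nonneg _),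
    Real.norm_of_nonneg (pow_nonneg (Real.sqrt_nonneg _) _)]
  rw [Real.norm_of_nonneg (pow_nonneg h0.le _)] at hN
  refine (Real.sqrt_le_sqrt ((le_abs_self _).trans hN)).trans ?_
  rcases le_total 0 C with h | h
  · rw [Real.sqrt_mul h]
    refine mul_le_mul_of_nonneg_left (le_of_eq ?_) (Real.sqrt_nonneg _)
    rw [Real.sqrt_eq_iff_mul_self_eq (pow_nonneg h0.le _) (pow_nonneg (Real.sqrt_nonneg _) _),
      ← mul_pow, Real.mul_self_sqrt h0.le]
  · rw [Real.sqrt_eq_zero'.2 (mul_nonpos_of_nonpos_of_nonneg h (pow_nonneg h0.le _))]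
    positivity

theorem GeometricDecay.eventually_lt {f : ℕ → ℝ} (hf : GeometricDecay f) {a : ℝ} (ha : 0 < a) :
    ∀ᶠ N in atTop, |f N| < a := by
  obtain ⟨ρ, h0, h1, hO⟩ := hf
  have h := hO.trans_tendsto (tendsto_pow_atTop_nhds_zero_of_lt_one h0.le h1)
  have := (tendsto_order.1 h.norm).2 a (by simpa using ha)
  simpa using this

theorem GeometricDecay.exists_forall_le {f g : ℕ → ℝ} (hf : GeometricDecay f)
    (hg : GeometricDecay g) :
    ∃ ρ c : ℝ, 0 ≤ ρ ∧ ρ < 1 ∧ ∀ N, f N ≤ c * ρ ^ N ∧ g N ≤ c * ρ ^ N := by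
  obtain ⟨ρ, h0, h1, hO⟩ := hf.abs.add hg.abs
  obtain ⟨C, -, hC⟩ := bound_of_isBigO_nat_atTop hO
  refine ⟨ρ, C, h0.le, h1, fun N => ?_⟩
  have := @hC N (pow_ne_zero _ h0.ne')
  rw [Real.norm_of_nonneg (pow_nonneg h0.le _), Real.norm_of_nonneg (by positivity)] at this
  grind

theorem geometricDecay_of_le_pow {f : ℕ → ℝ} {ρ C : ℝ} (h0 : 0 < ρ) (h1 : ρ < 1)
    (h : ∀ N, |f N| ≤ C * ρ ^ N) : GeometricDecay f :=
  ⟨ρ, h0, h1, IsBigO.of_bound C (Eventually.of_forall fun N => by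
    rw [Real.norm_of_nonneg (pow_nonneg h0.le _)]
    exact h N)⟩

end decay

/-! ### Rates of alternating minimization, uniform for nearby systems -/

section convergence
open scoped RealInnerProductSpace
open Filter

variable {V W : Type*} [NormedAddCommGroup V] [InnerProductSpace ℝ V] [FiniteDimensional ℝ V]
  [NormedAddCommGroup W] [InnerProductSpace ℝ W]

/-- Every vector of `U` is a sum of vectors, no longer than itself, of the subspaces in the list,
all of which are contained in `U`. -/
def Decomposes (l : List (Submodule ℝ V)) (U : Submodule ℝ V) : Prop :=
  (∀ D ∈ l, D ≤ U) ∧ ∀ δ ∈ U, ∃ f : ℕ → V, (∀ (k : ℕ) (hk : k < l.length), f k ∈ l[k]) ∧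
    (∀ k, ‖f k‖ ≤ ‖δ‖) ∧ δ = ∑ k ∈ range l.length, f k

/-- The number of steps enters the rate of convergence of the alternating minimization. -/
theorem exists_rate {l : List (Submodule ℝ V)} {U : Submodule ℝ V} (hdec : Decomposes l U)
    {α β : ℝ} (hα : 0 < α) (hβ : 0 ≤ β) :
    ∃ θ : ℝ, 0 < θ ∧ θ < 1 ∧ ∀ (L : V →ₗ[ℝ] W) (c : W) (z : V) (x : ℕ → V),
      (∀ δ ∈ U, α * ‖δ‖ ≤ ‖L δ‖) → (∀ δ ∈ U, ‖L δ‖ ≤ β * ‖δ‖) →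
      (∀ δ ∈ U, ⟪L z - c, L δ⟫ = 0) → x 0 - z ∈ U → (∀ t, BlockSweep L c l (x t) (x (t + 1))) →
      ∀ N, ‖x N - z‖ ≤ β / α * ‖x 0 - z‖ * θ ^ N := by
  -- The contraction factor is `q / (q + 1)`; the larger `(q + 1) / (q + 2)` stays positive even
  -- when `q = 0`. It depends only on the bounds `α`, `β` and the number of blocks.
  set q : ℝ := (l.length * β / α) ^ 2 * l.length with hq
  have hq0 : 0 ≤ q := by positivity
  set θ : ℝ := √((q + 1) / (q + 2)) with hθ
  have hθ0 : 0 < θ := Real.sqrt_pos.2 (by positivity)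
  have hθ2 : θ ^ 2 = (q + 1) / (q + 2) := Real.sq_sqrt (by positivity)
  refine ⟨θ, hθ0, ?_, fun L c z x hlow hup hz h0 hx N => ?_⟩
  · rw [hθ, Real.sqrt_lt' one_pos, div_lt_iff₀ (by positivity)]
    linarith
  have hmem : ∀ t, x t - z ∈ U := by
    intro t
    induction t with
    | zero => exact h0
    | succ t ih =>
      have := U.add_mem ((hx t).sub_mem hdec.1) ih
      rwa [sub_add_sub_cancel] at this
  have hL : ∀ t, ‖L (x t - z)‖ ≤ ‖L (x 0 - z)‖ * θ ^ t := by
    intro t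
    induction t with
    | zero => simp
    | succ t ih =>
      have h1 := (hx t).contraction hα hβ hlow hup hdec.1 hdec.2 hz (hmem t)
      rw [← hq] at h1
      have h2 : ‖L (x (t + 1) - z)‖ ^ 2 ≤ (‖L (x t - z)‖ * θ) ^ 2 := by
        rw [mul_pow, hθ2, mul_div_assoc', le_div_iff₀ (by positivity)]
        have h3 : ‖L (x (t + 1) - z)‖ ^ 2 ≤ ‖L (x t - z)‖ ^ 2 := by
          by_contra h4
          push Not at h4
          nlinarith [sq_nonneg ‖L (x t - z)‖]
        nlinarith
      have h3 := abs_le_of_sq_le_sq h2 (by positivity)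
      rw [abs_norm] at h3
      refine h3.trans ?_
      rw [pow_succ, ← mul_assoc]
      gcongr
  have h1 := hlow _ (hmem N)
  have h2 := hup _ h0
  rw [div_mul_eq_mul_div, div_mul_eq_mul_div, le_div_iff₀ hα, mul_comm]
  exact h1.trans ((hL N).trans (by gcongr))

theorem exists_lower_bound {U : Submodule ℝ V} {L : V →ₗ[ℝ] W} (hL : ∀ δ ∈ U, L δ = 0 → δ = 0) :
    ∃ α : ℝ, 0 < α ∧ ∀ δ ∈ U, α * ‖δ‖ ≤ ‖L δ‖ := by
  have hk : LinearMap.ker (L.domRestrict U) = ⊥ := by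
    rw [LinearMap.ker_eq_bot']
    simp_all
  obtain ⟨K, hK, h⟩ := LinearMap.exists_antilipschitzWith _ hk
  refine ⟨(K : ℝ)⁻¹, by positivity, fun δ hδ => ?_⟩
  have := h.le_mul_dist ⟨δ, hδ⟩ 0
  rw [map_zero, dist_zero_right, dist_zero_right] at this
  rw [inv_mul_le_iff₀ (by positivity)]
  exact this

theorem exists_upper_bound (L : V →ₗ[ℝ] W) : ∃ β : ℝ, 0 ≤ β ∧ ∀ δ, ‖L δ‖ ≤ β * ‖δ‖ :=
  ⟨‖LinearMap.toContinuousLinearMap L‖, norm_nonneg _,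
    fun δ => (LinearMap.toContinuousLinearMap L).le_opNorm δ⟩

/-- Alternating minimization for a consistent system with a unique solution. -/
theorem geometricDecay_sweeps {l : List (Submodule ℝ V)} {U : Submodule ℝ V}
    (hdec : Decomposes l U) {L : V →ₗ[ℝ] W} (hL : ∀ δ ∈ U, L δ = 0 → δ = 0) {c : W} {z : V}
    (hz : L z = c) {x : ℕ → V} (h0 : x 0 - z ∈ U) (hx : ∀ t, BlockSweep L c l (x t) (x (t + 1))) :
    GeometricDecay fun N => ‖x N - z‖ := by
  obtain ⟨α, hα, hlow⟩ := exists_lower_bound hL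
  obtain ⟨β, hβ, hup⟩ := exists_upper_bound L
  obtain ⟨θ, hθ0, hθ1, h⟩ := exists_rate (W := W) hdec hα hβ
  refine geometricDecay_of_le_pow (C := β / α * ‖x 0 - z‖) hθ0 hθ1 fun N => ?_
  rw [abs_norm]
  exact h L c z x hlow (fun δ _ => hup δ) (fun δ _ => by rw [hz, sub_self, inner_zero_left]) h0 hx N

/-- The same for a sequence of systems converging to one with a unique solution, if the `N`-th
system is treated with `N` sweeps. -/
theorem geometricDecay_diagonal {l : List (Submodule ℝ V)} {U : Submodule ℝ V}
    (hdec : Decomposes l U) {L : V →ₗ[ℝ] W} (hL : ∀ δ ∈ U, L δ = 0 → δ = 0)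
    {LL : ℕ → V →ₗ[ℝ] W} {c : ℕ → W} {z : V} (hzU : z ∈ U) {ε : ℕ → ℝ} (hε : GeometricDecay ε)
    (h1 : ∀ N, ∀ δ ∈ U, ‖LL N δ - L δ‖ ≤ ε N * ‖δ‖) (h2 : ∀ N, ‖c N - LL N z‖ ≤ ε N)
    {x : ℕ → ℕ → V} (h0 : ∀ N, x N 0 = 0)
    (hx : ∀ N t, BlockSweep (LL N) (c N) l (x N t) (x N (t + 1))) :
    GeometricDecay fun N => ‖x N N - z‖ := by
  obtain ⟨α, hα, hlow⟩ := exists_lower_bound hL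
  obtain ⟨β, hβ, hup⟩ := exists_upper_bound L
  -- As soon as `ε N < α / 2` the bounds `α / 2` and `β + α / 2` hold for the `N`-th system, so one
  -- rate `θ` serves all of them.
  obtain ⟨θ, hθ0, hθ1, h⟩ := exists_rate (W := W) hdec (half_pos hα)
    (add_nonneg hβ (half_pos hα).le)
  set K : ℝ := (β + α / 2) / (α / 2) with hK
  have hK0 : 0 ≤ K := by positivity
  have hsmall := hε.eventually_lt (half_pos hα)
  have hg : GeometricDecay fun N => K * (‖z‖ + 1) * θ ^ N + (2 / α) * |ε N| :=
    (geometricDecay_of_le_pow (C := K * (‖z‖ + 1)) hθ0 hθ1 fun N => by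
      rw [abs_of_nonneg (by positivity)]).add (hε.abs.const_mul _)
  refine hg.of_eventually_le ?_
  filter_upwards [hsmall] with N hN
  rw [abs_norm]
  have hεN : ε N ≤ α / 2 := (le_abs_self _).trans hN.le
  have hlow' : ∀ δ ∈ U, α / 2 * ‖δ‖ ≤ ‖LL N δ‖ := fun δ hδ => by
    have e1 := hlow δ hδ
    have e2 := h1 N δ hδ
    have e3 := norm_sub_norm_le (L δ) (LL N δ)
    rw [norm_sub_rev] at e3
    have e4 : ε N * ‖δ‖ ≤ α / 2 * ‖δ‖ := by gcongr
    linarith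
  have hup' : ∀ δ ∈ U, ‖LL N δ‖ ≤ (β + α / 2) * ‖δ‖ := fun δ hδ => by
    have e1 := hup δ
    have e2 := h1 N δ hδ
    have e3 := norm_sub_norm_le (LL N δ) (L δ)
    have e4 : ε N * ‖δ‖ ≤ α / 2 * ‖δ‖ := by gcongr
    linarith
  -- The minimizer `w` of the `N`-th system is within a multiple of `ε N` of `z`, and `N` sweeps
  -- bring `x N N` close to `w`.
  obtain ⟨w, hw⟩ := exists_blockStep (LL N) (c N) U z
  have hw0 : w ∈ U := by
    have := U.add_mem hw.1 hzU
    rwa [sub_add_cancel] at this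
  have hwz : ‖w - z‖ ≤ 2 / α * |ε N| := by
    have e1 := hw.sq_norm (z := z) (by simp)
    have e2 : ‖LL N (z - w)‖ ^ 2 ≤ ‖LL N z - c N‖ ^ 2 := by
      rw [e1]
      exact le_add_of_nonneg_left (sq_nonneg _)
    have e3 := abs_le_of_sq_le_sq e2 (norm_nonneg _)
    rw [abs_norm, norm_sub_rev (LL N z)] at e3
    have e4 := hlow' _ (U.sub_mem hzU hw0)
    rw [norm_sub_rev]
    have e5 := h2 N
    have e6 := le_abs_self (ε N)
    rw [div_mul_eq_mul_div, le_div_iff₀ hα]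
    linarith
  have hxw := h (LL N) (c N) w (x N) hlow' hup' hw.2 (by
    rw [h0, zero_sub]
    exact U.neg_mem hw0) (hx N) N
  rw [h0, zero_sub, norm_neg] at hxw
  have hwn : ‖w‖ ≤ ‖z‖ + 1 := by
    have e1 : ‖w‖ ≤ ‖z‖ + ‖w - z‖ := by
      have := norm_add_le z (w - z)
      rwa [add_sub_cancel] at this
    have e2 : 2 / α * |ε N| ≤ 1 := by
      rw [div_mul_eq_mul_div, div_le_iff₀ hα]
      linarith
    linarith
  have e : x N N - z = (x N N - w) + (w - z) := by abel
  rw [e]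
  refine (norm_add_le _ _).trans (add_le_add (hxw.trans ?_) hwz)
  gcongr

end convergence

/-! ### Alternating least squares for tuples of matrices -/

section stackVectors
open scoped RealInnerProductSpace

variable {m n : ℕ}

/-- Tuples of matrices as vectors of a Euclidean space. -/
def stackVec : Stack m n ≃ₗ[ℝ] EuclideanSpace ℝ (Fin m × Fin n × Fin n) where
  toFun X := WithLp.toLp 2 fun x => X x.1 x.2.1 x.2.2
  invFun v := fun i => Matrix.of fun p q => v (i, p, q)
  map_add' _ _ := rfl
  map_smul' _ _ := rfl
  left_inv _ := rfl
  right_inv _ := rfl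

theorem stackVec_apply (X : Stack m n) (x : Fin m × Fin n × Fin n) :
    stackVec X x = X x.1 x.2.1 x.2.2 := rfl

theorem stackNorm_eq (X : Stack m n) : stackNorm X = ‖stackVec X‖ := by
  rw [stackNorm, EuclideanSpace.norm_eq]
  simp only [Fintype.sum_prod_type, stackVec_apply, Real.norm_eq_abs, sq_abs]

/-- The vectors supported in `D`. -/
def supportedIn {ι : Type*} [Fintype ι] (D : Set ι) : Submodule ℝ (EuclideanSpace ℝ ι) where
  carrier := {v | ∀ x ∉ D, v x = 0}
  add_mem' hv hw x hx := by simp [hv x hx, hw x hx]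
  zero_mem' _ _ := rfl
  smul_mem' a v hv x hx := by simp [hv x hx]

theorem supportedIn_mono {ι : Type*} [Fintype ι] {D D' : Set ι} (h : D ⊆ D') :
    (supportedIn D : Submodule ℝ (EuclideanSpace ℝ ι)) ≤ supportedIn D' :=
  fun _ hv x hx => hv x fun h' => hx (h h')

open Classical in
-- The entries in the first block are split off and the rest is treated by the remaining blocks;
-- erasing coordinates never increases the norm, so overlapping blocks do no harm.
theorem exists_decomposition {ι : Type*} [Fintype ι] (l : List (Set ι)) (v : EuclideanSpace ℝ ι)
    (h : ∀ x, v x ≠ 0 → ∃ D ∈ l, x ∈ D) :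
    ∃ f : ℕ → EuclideanSpace ℝ ι,
      (∀ (k : ℕ) (hk : k < (l.map supportedIn).length), f k ∈ (l.map supportedIn)[k]) ∧
      (∀ k, ‖f k‖ ≤ ‖v‖) ∧ v = ∑ k ∈ range (l.map supportedIn).length, f k := by
  induction l generalizing v with
  | nil =>
    refine ⟨fun _ => 0, by simp, by simp, ?_⟩
    ext x
    simp_all
  | cons D l ih =>
    obtain ⟨f, hf1, hf2, hf3⟩ := ih (WithLp.toLp 2 fun x => if x ∈ D then 0 else v x) (by
      intro x hx
      grind)
    have hle : ∀ w : EuclideanSpace ℝ ι, (∀ x, w x = 0 ∨ w x = v x) → ‖w‖ ≤ ‖v‖ := by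
      intro w hw
      rw [EuclideanSpace.norm_eq, EuclideanSpace.norm_eq]
      refine Real.sqrt_le_sqrt (sum_le_sum fun x _ => ?_)
      rcases hw x with h | h <;> rw [h]
      rw [norm_zero, zero_pow two_ne_zero]
      positivity
    refine ⟨fun k => k.casesOn (WithLp.toLp 2 fun x => if x ∈ D then v x else 0) f, ?_, ?_, ?_⟩
    · rintro (_ | k) hk
      · intro x hx
        exact if_neg hx
      · simp only [List.map_cons, List.getElem_cons_succ]
        exact hf1 k (by simpa using hk)
    · rintro (_ | k)
      · refine hle _ fun x => ?_
        by_cases hx : x ∈ D <;> simp [hx]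
      grind
    · rw [List.map_cons, List.length_cons, Finset.sum_range_succ']
      change v = ∑ k ∈ range (l.map supportedIn).length, f k + _
      rw [← hf3]
      ext x
      by_cases hx : x ∈ D <;> simp [hx]

theorem decomposes_supportedIn {ι : Type*} [Fintype ι] {l : List (Set ι)} {P : Set ι}
    (h : ∀ D ∈ l, D ⊆ P) (h' : ∀ x ∈ P, ∃ D ∈ l, x ∈ D) :
    Decomposes (l.map supportedIn) (supportedIn P) := by
  constructor
  · intro D hD
    obtain ⟨D', h1, rfl⟩ := List.mem_map.1 hD
    exact supportedIn_mono (h D' h1)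
  · intro v hv
    refine exists_decomposition l v fun x hx => h' x ?_
    by_contra hP
    exact hx (hv x hP)

variable {W : Type*} [NormedAddCommGroup W] [InnerProductSpace ℝ W]
  {P D : Set (Fin m × Fin n × Fin n)} {f g : Stack m n → ℝ} {X Y : Stack m n}
  {L : EuclideanSpace ℝ (Fin m × Fin n × Fin n) →ₗ[ℝ] W} {c : W}

theorem sub_mem_supportedIn : stackVec Y - stackVec X ∈ supportedIn D ↔
    ∀ i p q, (i, p, q) ∉ D → Y i p q = X i p q := by
  constructor
  · intro h i p q hx
    exact sub_eq_zero.1 (h (i, p, q) hx)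
  · rintro h ⟨i, p, q⟩ hx
    exact sub_eq_zero.2 (h i p q hx)

/-- The objective needs to be a sum of squares of linear residuals only on tuples supported in `P`.
The second objective contains quadratic terms that vanish only there. -/
theorem isBlockMin_iff_blockStep (hD : D ⊆ P) (hX : stackVec X ∈ supportedIn P)
    (hf : ∀ X, stackVec X ∈ supportedIn P → f X = ‖L (stackVec X) - c‖ ^ 2) :
    IsBlockMin f D X Y ↔ BlockStep L c (supportedIn D) (stackVec X) (stackVec Y) := by
  have hP : ∀ Z : Stack m n, (∀ i p q, (i, p, q) ∉ D → Z i p q = X i p q) →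
      stackVec Z ∈ supportedIn P := by
    rintro Z hZ ⟨i, p, q⟩ hx
    rw [stackVec_apply, hZ i p q fun h => hx (hD h)]
    exact hX _ hx
  rw [blockStep_iff, IsBlockMin, sub_mem_supportedIn]
  refine and_congr_right fun h1 => ?_
  constructor
  · intro h z hz
    have hz' := (sub_mem_supportedIn (X := X) (Y := stackVec.symm z) (D := D)).1
      (by rwa [LinearEquiv.apply_symm_apply])
    have := h (stackVec.symm z) hz'
    rwa [hf _ (hP _ h1), hf _ (hP _ hz'), LinearEquiv.apply_symm_apply] at this
  · intro h Z hZ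
    rw [hf _ (hP _ h1), hf _ (hP _ hZ)]
    exact h _ (sub_mem_supportedIn.2 hZ)

theorem IsBlockMin.supported (hD : D ⊆ P) (hX : stackVec X ∈ supportedIn P)
    (h : IsBlockMin f D X Y) : stackVec Y ∈ supportedIn P := by
  rintro ⟨i, p, q⟩ hx
  rw [stackVec_apply, h.1 i p q fun h => hx (hD h)]
  exact hX _ hx

theorem isSweep_iff_blockSweep {l : List (Set (Fin m × Fin n × Fin n))} (hl : ∀ D ∈ l, D ⊆ P)
    (hX : stackVec X ∈ supportedIn P)
    (hf : ∀ X, stackVec X ∈ supportedIn P → f X = ‖L (stackVec X) - c‖ ^ 2) :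
    IsSweep f l X Y ↔ BlockSweep L c (l.map supportedIn) (stackVec X) (stackVec Y) := by
  induction l generalizing X with
  | nil =>
    rw [IsSweep, List.map_nil, BlockSweep, EmbeddingLike.apply_eq_iff_eq]
  | cons D l ih =>
    have hD := hl D List.mem_cons_self
    have hl' : ∀ D ∈ l, D ⊆ P := fun D h => hl D (List.mem_cons_of_mem _ h)
    rw [List.map_cons, IsSweep, BlockSweep]
    constructor
    · rintro ⟨w, h1, h2⟩
      exact ⟨stackVec w, (isBlockMin_iff_blockStep hD hX hf).1 h1,
        (ih hl' (h1.supported hD hX)).1 h2⟩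
    · rintro ⟨w, h1, h2⟩
      obtain ⟨w, rfl⟩ := stackVec.surjective w
      have h1' := (isBlockMin_iff_blockStep hD hX hf).2 h1
      exact ⟨w, h1', (ih hl' (h1'.supported hD hX)).2 h2⟩

theorem IsBlockMin.congr (hD : D ⊆ P) (hX : stackVec X ∈ supportedIn P)
    (hfg : ∀ X, stackVec X ∈ supportedIn P → f X = g X) (h : IsBlockMin f D X Y) :
    IsBlockMin g D X Y := by
  refine ⟨h.1, fun Z hZ => ?_⟩
  have hP : ∀ Z : Stack m n, (∀ i p q, (i, p, q) ∉ D → Z i p q = X i p q) →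
      stackVec Z ∈ supportedIn P := by
    rintro Z hZ ⟨i, p, q⟩ hx
    rw [stackVec_apply, hZ i p q fun h => hx (hD h)]
    exact hX _ hx
  rw [← hfg _ (hP _ h.1), ← hfg _ (hP _ hZ)]
  exact h.2 Z hZ

theorem isSweep_append {l l' : List (Set (Fin m × Fin n × Fin n))} :
    IsSweep f (l ++ l') X Y ↔ ∃ Z, IsSweep f l X Z ∧ IsSweep f l' Z Y := by
  induction l generalizing X with
  | nil =>
    simp only [List.nil_append, IsSweep]
    grind
  | cons D l ih =>
    simp only [List.cons_append, IsSweep, ih]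
    grind

theorem isBlockMin_empty : IsBlockMin f ∅ X Y ↔ Y = X := by
  constructor
  · rintro ⟨h, -⟩
    funext i
    ext p q
    exact h i p q (Set.notMem_empty _)
  · rintro rfl
    refine ⟨fun _ _ _ _ => rfl, fun Z hZ => le_of_eq (congrArg f ?_)⟩
    funext i
    ext p q
    grind

/-- The positions in `P` in the row `l` of the slice `i`. -/
def rowBlock (P : Set (Fin m × Fin n × Fin n)) (i : Fin m) (l : Fin n) :
    Set (Fin m × Fin n × Fin n) := {x | x.1 = i ∧ x.2.1 = l ∧ x ∈ P}

/-- All rows of all slices. -/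
def allRows (P : Set (Fin m × Fin n × Fin n)) : List (Set (Fin m × Fin n × Fin n)) :=
  (List.finRange m).flatMap fun i => (List.finRange n).map fun l => rowBlock P i l

theorem allRows_subset : ∀ D ∈ allRows P, D ⊆ P := by
  intro D hD x hx
  obtain ⟨i, -, h⟩ := List.mem_flatMap.1 hD
  obtain ⟨l, -, rfl⟩ := List.mem_map.1 h
  exact hx.2.2

theorem decomposes_allRows (P : Set (Fin m × Fin n × Fin n)) :
    Decomposes ((allRows P).map supportedIn) (supportedIn P) := by
  refine decomposes_supportedIn allRows_subset fun x hx => ?_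
  refine ⟨rowBlock P x.1 x.2.1, ?_, rfl, rfl, hx⟩
  exact List.mem_flatMap.2 ⟨x.1, List.mem_finRange _,
    List.mem_map.2 ⟨x.2.1, List.mem_finRange _, rfl⟩⟩

/-- Minimizing over an empty block changes nothing, so rows without unknowns may be included; the
program runs through all rows. -/
theorem isSweep_map_filter {ι : Type*} (l : List ι) (p : ι → Prop) [DecidablePred p]
    (F G : ι → Set (Fin m × Fin n × Fin n)) (h1 : ∀ i, p i → F i = G i) (h2 : ∀ i, ¬ p i → G i = ∅) :
    IsSweep f ((l.filter p).map F) X Y ↔ IsSweep f (l.map G) X Y := by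
  induction l generalizing X with
  | nil => rfl
  | cons i l ih =>
    by_cases hi : p i
    · rw [List.filter_cons_of_pos (by simpa using hi), List.map_cons, List.map_cons, h1 i hi]
      simp only [IsSweep, ih]
    · rw [List.filter_cons_of_neg (by simpa using hi), List.map_cons, h2 i hi]
      simp only [IsSweep, isBlockMin_empty, ih, exists_eq_left]

theorem isSweep_flatMap_congr {ι : Type*} (l : List ι)
    (F G : ι → List (Set (Fin m × Fin n × Fin n)))
    (h : ∀ i X Y, IsSweep f (F i) X Y ↔ IsSweep f (G i) X Y) :
    IsSweep f (l.flatMap F) X Y ↔ IsSweep f (l.flatMap G) X Y := by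
  induction l generalizing X with
  | nil => rfl
  | cons i l ih => simp only [List.flatMap_cons, isSweep_append, h, ih]

/-- The positions of the unknown entries in the first stage. -/
def outerSet (b n : ℕ) : Set (Fin 5 × Fin n × Fin n) := {x | IsOuter b x.1 x.2.1 x.2.2}

theorem rowBlocks_eq (b n : ℕ) : rowBlocks b n = (List.finRange 5).flatMap fun i : Fin 5 =>
    ((List.finRange n).filter fun l : Fin n => ¬ Near (2 * b) l (center b i)).map fun l : Fin n =>
      {x | (x.1 : ℕ) = i ∧ x.2.1 = l ∧ InBand b (center b i) x.2.1 x.2.2} := rfl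

theorem isSweep_rowBlocks {b : ℕ} {f : Stack 5 n → ℝ} {X Y : Stack 5 n} :
    IsSweep f (rowBlocks b n) X Y ↔ IsSweep f (allRows (outerSet b n)) X Y := by
  rw [rowBlocks_eq, allRows]
  refine isSweep_flatMap_congr _ _ _ fun (i : Fin 5) X Y =>
    isSweep_map_filter (List.finRange n) (fun l : Fin n => ¬ Near (2 * b) l (center b i)) _
      (fun l => rowBlock (outerSet b n) i l) ?_ ?_
  · intro l hl
    ext x
    constructor
    · rintro ⟨h, rfl, h'⟩
      obtain rfl := Fin.ext h
      exact ⟨rfl, rfl, hl, h'⟩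
    · rintro ⟨rfl, rfl, h⟩
      exact ⟨rfl, rfl, h.2⟩
  · intro l hl
    ext x
    constructor
    · rintro ⟨rfl, rfl, h⟩
      exact hl h.1
    · exact False.elim

/-! #### Transposition -/

/-- Transposition of positions. -/
def flipPos (x : Fin m × Fin n × Fin n) : Fin m × Fin n × Fin n := (x.1, x.2.2, x.2.1)

theorem flipStack_flipStack (X : Stack m n) : flipStack (flipStack X) = X := rfl

theorem isBlockMin_flip : IsBlockMin f (flipPos ⁻¹' D) X Y ↔
    IsBlockMin (fun X => f (flipStack X)) D (flipStack X) (flipStack Y) := by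
  constructor
  · rintro ⟨h1, h2⟩
    refine ⟨fun i p q h => h1 i q p h, fun Z hZ => h2 (flipStack Z) fun i p q h => hZ i q p h⟩
  · rintro ⟨h1, h2⟩
    refine ⟨fun i p q h => h1 i q p h, fun Z hZ => h2 (flipStack Z) fun i p q h => hZ i q p h⟩

theorem isSweep_flip {l : List (Set (Fin m × Fin n × Fin n))} :
    IsSweep f (l.map fun D => flipPos ⁻¹' D) X Y ↔
      IsSweep (fun X => f (flipStack X)) l (flipStack X) (flipStack Y) := by
  induction l generalizing X with
  | nil =>
    simp only [List.map_nil, IsSweep]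
    exact ⟨fun h => congrArg _ h, fun h => congrArg flipStack h⟩
  | cons D l ih =>
    simp only [List.map_cons, IsSweep, isBlockMin_flip, ih]
    exact ⟨fun ⟨w, h⟩ => ⟨flipStack w, h⟩, fun ⟨w, h⟩ => ⟨flipStack w, h⟩⟩

/-- The positions of the unknown entries in the second stage, transposed. -/
def innerSet (b n : ℕ) : Set (Fin 3 × Fin n × Fin n) := {x | IsInner b x.1 x.2.2 x.2.1}

/-- After transposition the column updates of the second stage are row updates, so one program and
one analysis serve both stages. -/
theorem columnBlocks_eq (b n : ℕ) :
    columnBlocks b n = (allRows (innerSet b n)).map fun D => flipPos ⁻¹' D := by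
  rw [columnBlocks, allRows, List.map_flatMap]
  simp only [List.map_map]
  congr 1
  funext i
  congr 1
  funext l
  ext x
  constructor
  · rintro ⟨h1, h2, h3⟩
    refine ⟨h1, h2, ?_⟩
    subst h1
    exact h3
  · rintro ⟨h1, h2, h3⟩
    refine ⟨h1, h2, ?_⟩
    have h1' : x.1 = i := h1
    subst h1'
    exact h3

end stackVectors

/-! ### Least squares for coupled Sylvester equations -/

section sylvester
open scoped RealInnerProductSpace

variable {m n : ℕ}

/-- The linear part of the weighted residuals. -/
def sylvVec (μ : Fin m → Fin m → Fin n → Fin n → ℝ) (M : Stack m n) :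
    EuclideanSpace ℝ (Fin m × Fin n × Fin n) →ₗ[ℝ]
      EuclideanSpace ℝ (Fin m × Fin m × Fin n × Fin n) where
  toFun v := WithLp.toLp 2 fun x => μ x.1 x.2.1 x.2.2.1 x.2.2.2 *
    sylv M (stackVec.symm v) x.1 x.2.1 x.2.2.1 x.2.2.2
  map_add' v w := by
    ext x
    simp only [map_add, sylv_add, Matrix.add_apply, mul_add, PiLp.add_apply]
  map_smul' a v := by
    ext x
    simp only [map_smul, sylv_smul, Matrix.smul_apply, smul_eq_mul, PiLp.smul_apply,
      RingHom.id_apply]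
    ring

/-- The constant part of the weighted residuals. -/
def sylvConst (μ : Fin m → Fin m → Fin n → Fin n → ℝ) (M : Stack m n) :
    EuclideanSpace ℝ (Fin m × Fin m × Fin n × Fin n) :=
  WithLp.toLp 2 fun x => μ x.1 x.2.1 x.2.2.1 x.2.2.2 *
    (M x.1 * (M x.2.1)ᵀ - M x.2.1 * (M x.1)ᵀ) x.2.2.1 x.2.2.2

/-- The weighted sum of squares of the residuals. -/
def sylvObj (μ : Fin m → Fin m → Fin n → Fin n → ℝ) (M X : Stack m n) : ℝ :=
  ∑ i, ∑ j, ∑ p, ∑ q, (μ i j p q * res M X i j p q) ^ 2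

/-- The weight is invariant under the symmetries of the equations. -/
def SymmetricWeight (μ : Fin m → Fin m → Fin n → Fin n → ℝ) : Prop :=
  ∀ i j p q, μ j i p q = μ i j p q ∧ μ i j q p = μ i j p q

variable {μ : Fin m → Fin m → Fin n → Fin n → ℝ} {M X Y : Stack m n}

theorem sylvVec_apply (X : Stack m n) (i j : Fin m) (p q : Fin n) :
    sylvVec μ M (stackVec X) (i, j, p, q) = μ i j p q * sylv M X i j p q := rfl

theorem sylvVec_sub_const (X : Stack m n) (i j : Fin m) (p q : Fin n) :
    (sylvVec μ M (stackVec X) - sylvConst μ M) (i, j, p, q) = μ i j p q * res M X i j p q := by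
  rw [res, Matrix.sub_apply, mul_sub]
  rfl

theorem sylvObj_eq (X : Stack m n) :
    sylvObj μ M X = ‖sylvVec μ M (stackVec X) - sylvConst μ M‖ ^ 2 := by
  rw [EuclideanSpace.norm_sq_eq]
  simp only [Fintype.sum_prod_type, sylvVec_sub_const, Real.norm_eq_abs, sq_abs]
  rfl

/-- This is the adjoint of `sylv`. For `g` antisymmetric in both pairs of indices the four terms of
`sylv` contribute equally, whence the factor `4`. -/
theorem sum_mul_sylv {g : Fin m → Fin m → Fin n → Fin n → ℝ}
    (h1 : ∀ i j p q, g j i p q = - g i j p q) (h2 : ∀ i j p q, g i j q p = - g i j p q)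
    (M X : Stack m n) :
    ∑ i, ∑ j, ∑ p, ∑ q, g i j p q * sylv M X i j p q =
      4 * ∑ i, ∑ p, ∑ s, X i p s * ∑ j, ∑ q, g i j p q * M j q s := by
  set F : Fin m → Fin m → Fin n → Fin n → ℝ := fun i j p q => g i j p q * (X i * (M j)ᵀ) p q
  have hT : ∀ i j p q, (M j * (X i)ᵀ) p q = (X i * (M j)ᵀ) q p := by
    intro i j p q
    simp only [mul_apply, transpose_apply]
    grind
  have hsw : ∀ F : Fin m → Fin m → Fin n → Fin n → ℝ,
      ∑ i, ∑ j, ∑ p, ∑ q, F i j q p = ∑ i, ∑ j, ∑ p, ∑ q, F i j p q := fun F =>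
    sum_congr rfl fun i _ => sum_congr rfl fun j _ => sum_comm
  have hsw' : ∀ F : Fin m → Fin m → Fin n → Fin n → ℝ,
      ∑ i, ∑ j, ∑ p, ∑ q, F j i p q = ∑ i, ∑ j, ∑ p, ∑ q, F i j p q := fun F =>
    sum_comm
  have e : ∀ i j p q, g i j p q * sylv M X i j p q =
      F i j p q + F i j q p + F j i q p + F j i p q := by
    intro i j p q
    simp only [sylv, Matrix.sub_apply, Matrix.add_apply, hT, F, h2 j i p q, h1 i j p q,
      h2 i j p q]
    ring
  have hA : ∑ i, ∑ j, ∑ p, ∑ q, F i j p q =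
      ∑ i, ∑ p, ∑ s, X i p s * ∑ j, ∑ q, g i j p q * M j q s := by
    refine sum_congr rfl fun i _ => ?_
    rw [sum_comm]
    refine sum_congr rfl fun p _ => ?_
    simp only [F, mul_apply, transpose_apply, mul_sum]
    calc _ = ∑ j, ∑ s, ∑ q, g i j p q * (X i p s * M j q s) :=
          sum_congr rfl fun j _ => sum_comm
      _ = ∑ s, ∑ j, ∑ q, g i j p q * (X i p s * M j q s) := sum_comm
      _ = _ := sum_congr rfl fun s _ => sum_congr rfl fun j _ =>
          sum_congr rfl fun q _ => by ring
  simp only [e, sum_add_distrib]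
  rw [hsw F, hsw' fun i j p q => F i j q p, hsw F, hsw' F, hA]
  ring

theorem res_antisymm (M X : Stack m n) (i j : Fin m) (p q : Fin n) :
    res M X j i p q = - res M X i j p q ∧ res M X i j q p = - res M X i j p q := by
  have hT : ∀ A B : Mat n n, (A * Bᵀ) q p = (B * Aᵀ) p q := by
    intro A B
    simp only [mul_apply, transpose_apply]
    grind
  constructor <;> simp only [res, sylv, Matrix.sub_apply, Matrix.add_apply, hT] <;> ring

theorem isBlockMin_of_gradient (hμ : SymmetricWeight μ) {P : Set (Fin m × Fin n × Fin n)}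
    {i : Fin m} {l : Fin n}
    (hY : ∀ i' p q, (i', p, q) ∉ rowBlock P i l → Y i' p q = X i' p q)
    (h : ∀ s, (i, l, s) ∈ P → ∑ j, ∑ q, μ i j l q ^ 2 * res M Y i j l q * M j q s = 0) :
    IsBlockMin (sylvObj μ M) (rowBlock P i l) X Y := by
  rw [isBlockMin_iff_blockStep (P := Set.univ) (Set.subset_univ _)
    (fun x hx => absurd (Set.mem_univ x) hx) fun X _ => sylvObj_eq X]
  refine ⟨sub_mem_supportedIn.2 hY, fun δ hδ => ?_⟩
  obtain ⟨δ, rfl⟩ := stackVec.surjective δ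
  have e : ⟪sylvVec μ M (stackVec Y) - sylvConst μ M, sylvVec μ M (stackVec δ)⟫ =
      ∑ i, ∑ j, ∑ p, ∑ q, (μ i j p q ^ 2 * res M Y i j p q) * sylv M δ i j p q := by
    rw [PiLp.inner_apply]
    simp only [Fintype.sum_prod_type, sylvVec_sub_const, sylvVec_apply]
    refine sum_congr rfl fun i _ => sum_congr rfl fun j _ =>
      sum_congr rfl fun p _ => sum_congr rfl fun q _ => ?_
    simp only [RCLike.inner_apply, conj_trivial]
    ring
  rw [e, sum_mul_sylv
    (fun i j p q => by rw [(hμ i j p q).1, (res_antisymm M Y i j p q).1, mul_neg])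
    (fun i j p q => by rw [(hμ i j p q).2, (res_antisymm M Y i j p q).2, mul_neg])]
  rw [mul_eq_zero]
  right
  refine sum_eq_zero fun i' _ => sum_eq_zero fun p _ =>
    sum_eq_zero fun s _ => ?_
  by_cases hx : (i', p, s) ∈ rowBlock P i l
  · obtain ⟨h1, h2, h3⟩ := hx
    simp_all
  · have := hδ (i', p, s) hx
    rw [stackVec_apply] at this
    simp only at this
    rw [this, zero_mul]

/-- When only one row of one matrix varies, a single one of the four terms is left at `j ≠ i`, `q ≠
l`, so the row update is a small least-squares problem. -/
theorem sylv_row {i j : Fin m} {l q : Fin n} (hX : ∀ i' p s, i' ≠ i ∨ p ≠ l → X i' p s = 0)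
    (hj : j ≠ i) (hq : q ≠ l) : sylv M X i j l q = ∑ s, X i l s * M j q s := by
  have hj' : X j = 0 := by
    ext p s
    exact hX j p s (Or.inl hj)
  have h0 : (M j * (X i)ᵀ) l q = 0 := by
    rw [mul_apply]
    simp_all
  simp only [sylv, Matrix.sub_apply, Matrix.add_apply, hj', h0, Matrix.transpose_zero,
    Matrix.mul_zero, Matrix.zero_mul, Matrix.zero_apply]
  simp [mul_apply]

theorem res_sub (M X Y : Stack m n) (i j : Fin m) : res M Y i j = res M X i j + sylv M (Y - X) i j := by
  have : sylv M Y i j = sylv M X i j + sylv M (Y - X) i j := by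
    rw [← sylv_add, add_sub_cancel]
  rw [res, res, this]
  abel

/-- A row update by the solution of a least-squares problem whose unknowns are listed in `slot`. -/
theorem isBlockMin_of_leastSquares (hμ : SymmetricWeight μ) {P : Set (Fin m × Fin n × Fin n)}
    {i : Fin m} {l : Fin n} {w : ℕ} {slot : ℕ → Option (Fin n)}
    (hslot : ∀ t < w, ∀ s, slot t = some s → (i, l, s) ∈ P)
    (hcov : ∀ s, (i, l, s) ∈ P → ∃ t < w, slot t = some s) {ν : Fin m → Fin n → ℝ}
    (hν : ∀ j q, ν j q = if j = i ∨ q = l then 0 else μ i j l q) {y : ℕ → ℝ}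
    (hY : ∀ i' p s, Y i' p s = X i' p s + if i' = i ∧ p = l then
      ∑ t ∈ range w, (if slot t = some s then y t else 0) else 0)
    (h : ∀ t < w, ∑ j, ∑ q, ν j q * (slot t).elim 0 (M j q) *
      ((∑ t' ∈ range w, ν j q * (slot t').elim 0 (M j q) * y t') -
        -(ν j q * res M X i j l q)) = 0) :
    IsBlockMin (sylvObj μ M) (rowBlock P i l) X Y := by
  refine isBlockMin_of_gradient hμ ?_ ?_
  · intro i' p s hx
    rw [hY]
    split_ifs with hc
    · obtain ⟨rfl, rfl⟩ := hc
      rw [sum_eq_zero, add_zero]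
      intro t ht
      rw [if_neg]
      intro hs
      exact hx ⟨rfl, rfl, hslot t (mem_range.1 ht) s hs⟩
    · rw [add_zero]
  · intro s hs
    obtain ⟨t, ht, hts⟩ := hcov s hs
    have ht' := h t ht
    rw [hts] at ht'
    rw [← ht']
    refine sum_congr rfl fun j _ => sum_congr rfl fun q _ => ?_
    rw [hν]
    -- There the residual is zero by antisymmetry, which justifies setting the weight `ν` to zero.
    by_cases hc : j = i ∨ q = l
    · rw [if_pos hc]
      have : res M Y i j l q = 0 := by
        rcases hc with rfl | rfl
        · have := (res_antisymm M Y j j l q).1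
          linarith
        · have := (res_antisymm M Y i j q q).2
          linarith
      rw [this]
      ring
    · rw [if_neg hc]
      push Not at hc
      have hr : res M Y i j l q = res M X i j l q +
          ∑ t' ∈ range w, (slot t').elim 0 (M j q) * y t' := by
        rw [res_sub M X Y, Matrix.add_apply, sylv_row (i := i) (l := l) _ hc.1 hc.2]
        · congr 1
          simp only [Pi.sub_apply, Matrix.sub_apply, hY i l, and_self, if_true,
            add_sub_cancel_left, sum_mul]
          rw [sum_comm]
          refine sum_congr rfl fun t' _ => ?_
          cases hst : slot t' with
          | none => simp
          | some s' =>
            simp only [Option.elim_some, Option.some.injEq, ite_mul, zero_mul]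
            rw [Finset.sum_ite_eq, if_pos (mem_univ _), mul_comm]
        · intro i' p s' hne
          rw [Pi.sub_apply, Matrix.sub_apply, hY, if_neg, add_zero, sub_self]
          grind
      rw [hr]
      simp only [mul_assoc, ← mul_sum, Option.elim_some]
      ring

end sylvester

/-! ### Arithmetic of geometrically convergent sequences -/

section limits

/-- Convergence at a geometric rate. -/
def GeometricLimit (f : ℕ → ℝ) (a : ℝ) : Prop := GeometricDecay fun N => f N - a

variable {f g : ℕ → ℝ} {a a' : ℝ}

theorem GeometricLimit.const (a : ℝ) : GeometricLimit (fun _ => a) a := by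
  simpa [GeometricLimit] using GeometricDecay.zero

theorem GeometricLimit.add (hf : GeometricLimit f a) (hg : GeometricLimit g a') :
    GeometricLimit (fun N => f N + g N) (a + a') := by
  refine (GeometricDecay.add hf hg).abs.of_le fun N => le_of_eq ?_
  congr 1
  ring

theorem GeometricLimit.const_mul (hf : GeometricLimit f a) (c : ℝ) :
    GeometricLimit (fun N => c * f N) (c * a) := by
  refine (GeometricDecay.const_mul hf c).abs.of_le fun N => le_of_eq ?_
  congr 1
  ring

theorem GeometricLimit.sub (hf : GeometricLimit f a) (hg : GeometricLimit g a') :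
    GeometricLimit (fun N => f N - g N) (a - a') := by
  refine (GeometricDecay.add hf (hg.const_mul (-1))).abs.of_le fun N => le_of_eq ?_
  congr 1
  ring

theorem GeometricLimit.mul (hf : GeometricLimit f a) (hg : GeometricLimit g a') :
    GeometricLimit (fun N => f N * g N) (a * a') := by
  refine ((GeometricDecay.mul hf hg).add
    ((GeometricDecay.const_mul hf a').add (GeometricDecay.const_mul hg a))).abs.of_le
    fun N => le_of_eq ?_
  congr 1
  ring

theorem GeometricLimit.sum {ι : Type*} {s : Finset ι} {f : ι → ℕ → ℝ} {a : ι → ℝ}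
    (h : ∀ i ∈ s, GeometricLimit (f i) (a i)) :
    GeometricLimit (fun N => ∑ i ∈ s, f i N) (∑ i ∈ s, a i) := by
  refine (GeometricDecay.sum h).abs.of_le fun N => le_of_eq ?_
  rw [sum_sub_distrib]

theorem geometricLimit_zero : GeometricLimit f 0 ↔ GeometricDecay f := by
  simp [GeometricLimit]

theorem geometricDecay_norm {ι : Type*} [Fintype ι] {v : ℕ → EuclideanSpace ℝ ι}
    (h : ∀ x, GeometricDecay fun N => v N x) : GeometricDecay fun N => ‖v N‖ := by
  simp only [EuclideanSpace.norm_eq, Real.norm_eq_abs, sq_abs]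
  refine GeometricDecay.sqrt (GeometricDecay.sum fun x _ => ?_)
  simp only [sq]
  exact (h x).mul (h x)

theorem geometricDecay_entry {ι : Type*} [Fintype ι] {v : ℕ → EuclideanSpace ℝ ι}
    (h : GeometricDecay fun N => ‖v N‖) (x : ι) : GeometricDecay fun N => v N x :=
  h.of_le fun N => PiLp.norm_apply_le (v N) x

end limits

/-! ### Convergence of the two stages -/

section stages
open scoped RealInnerProductSpace

variable {n r b : ℕ}

/-- The weight in the first objective. -/
def outerWeight (b n : ℕ) (i j : Fin 5) (p q : Fin n) : ℝ :=
  if InQuad b (center b i) (center b j) p q then 0 else 1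

theorem objective₁_eq (M X : Stack 5 n) : objective₁ b M X = sylvObj (outerWeight b n) M X := by
  rw [objective₁, sylvObj]
  refine sum_congr rfl fun i _ => sum_congr rfl fun j _ =>
    sum_congr rfl fun p _ => sum_congr rfl fun q _ => ?_
  rw [residual₁_eq, outerWeight]
  split_ifs <;> simp

theorem stackVec_mem_outerSet {X : Stack 5 n} :
    stackVec X ∈ supportedIn (outerSet b n) ↔ IsOuterStack b X :=
  ⟨fun h i p q => h (i, p, q), fun h x => h x.1 x.2.1 x.2.2⟩

theorem IsAlternating.outer {M : Stack 5 n} {X : ℕ → Stack 5 n}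
    (h : IsAlternating (objective₁ b M) (rowBlocks b n) X) (t : ℕ) : IsOuterStack b (X t) := by
  rw [← stackVec_mem_outerSet]
  induction t with
  | zero =>
    rw [h.1, map_zero]
    exact Submodule.zero_mem _
  | succ t ih =>
    have h1 := isSweep_rowBlocks.1 (h.2 t)
    rw [isSweep_iff_blockSweep allRows_subset ih
      fun X _ => (objective₁_eq M X).trans (sylvObj_eq X)] at h1
    have h2 := h1.sub_mem (decomposes_allRows _).1
    have := Submodule.add_mem _ h2 ih
    rwa [sub_add_cancel] at this

theorem outer_injective {T E : Tensor n} (hinj : Injective₁ b T) (hE : BandSupported b E) :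
    ∀ δ ∈ supportedIn (outerSet b n),
      sylvVec (outerWeight b n) (fiveSlices b (T + E)) δ = 0 → δ = 0 := by
  intro δ hδ h
  obtain ⟨X, rfl⟩ := stackVec.surjective δ
  have hX := stackVec_mem_outerSet.1 hδ
  rw [hinj X hX fun i j p q hq => ?_, map_zero]
  rw [← sylv_outer hE hX hq]
  have := congrArg (fun v => v (i, j, p, q)) h
  simpa [sylvVec_apply, outerWeight, hq] using this

/-- The first stage of alternating minimization is well defined and converges geometrically. -/
theorem exists_outer_sequence (hn : 8 * (4 * b + 2) ≤ n) {A B C : Mat n r}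
    (hB : Bᵀ * B = 1) (hinj : Injective₁ b (cpTensor A B C)) {E : Tensor n}
    (hE : BandSupported b E) :
    ∃ X : ℕ → Stack 5 n,
      IsAlternating (objective₁ b (fiveSlices b (cpTensor A B C + E))) (rowBlocks b n) X ∧
      (∀ Y, IsAlternating (objective₁ b (fiveSlices b (cpTensor A B C + E)))
        (rowBlocks b n) Y → Y = X) ∧
      GeometricDecay fun N => stackNorm (X N - outerNoise b E) := by
  set M := fiveSlices b (cpTensor A B C + E) with hM
  set L := sylvVec (outerWeight b n) M with hL
  set c := sylvConst (outerWeight b n) M with hc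
  have hf : ∀ X, stackVec X ∈ supportedIn (outerSet b n) →
      objective₁ b M X = ‖L (stackVec X) - c‖ ^ 2 :=
    fun X _ => (objective₁_eq M X).trans (sylvObj_eq X)
  have hiff : ∀ X Y, IsOuterStack b X → (IsSweep (objective₁ b M) (rowBlocks b n) X Y ↔
      BlockSweep L c ((allRows (outerSet b n)).map supportedIn) (stackVec X) (stackVec Y)) :=
    fun X Y hX => isSweep_rowBlocks.trans
      (isSweep_iff_blockSweep allRows_subset (stackVec_mem_outerSet.2 hX) hf)
  have hdec := decomposes_allRows (outerSet b n)
  have hLi := outer_injective hinj hE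
  choose F hF using exists_blockSweep L c ((allRows (outerSet b n)).map supportedIn)
  set X : ℕ → Stack 5 n := fun t => stackVec.symm (F^[t] 0) with hX
  have hFX : ∀ t, BlockSweep L c ((allRows (outerSet b n)).map supportedIn) (stackVec (X t))
      (stackVec (X (t + 1))) := by
    intro t
    simp only [hX, LinearEquiv.apply_symm_apply, Function.iterate_succ_apply']
    exact hF _
  have hX0 : X 0 = 0 := by simp [hX]
  have hXo : ∀ t, IsOuterStack b (X t) := by
    intro t
    rw [← stackVec_mem_outerSet]
    induction t with
    | zero =>
      rw [hX0, map_zero]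
      exact Submodule.zero_mem _
    | succ t ih =>
      have := Submodule.add_mem _ ((hFX t).sub_mem hdec.1) ih
      rwa [sub_add_cancel] at this
  refine ⟨X, ⟨hX0, fun t => (hiff _ _ (hXo t)).2 (hFX t)⟩, ?_, ?_⟩
  · intro Y hY
    funext t
    induction t with
    | zero => rw [hX0, hY.1]
    | succ t ih =>
      have h1 := (hiff _ _ (hY.outer t)).1 (hY.2 t)
      rw [ih] at h1
      exact stackVec.injective (h1.unique hdec.1 hLi (hFX t))
  · simp only [stackNorm_eq, map_sub]
    refine geometricDecay_sweeps hdec hLi (c := c) ?_ ?_ hFX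
    · refine sub_eq_zero.1 ?_
      ext ⟨i, j, p, q⟩
      change (sylvVec (outerWeight b n) M (stackVec (outerNoise b E)) -
        sylvConst (outerWeight b n) M) (i, j, p, q) = 0
      rw [sylvVec_sub_const, outerWeight]
      split_ifs with hq
      · rw [zero_mul]
      · rw [res_outerNoise hn C hB hE hq, mul_zero]
    · rw [hX0, map_zero, zero_sub]
      exact Submodule.neg_mem _ (stackVec_mem_outerSet.2 (outerNoise_outer hE))

theorem stackVec_mem_innerSet {X : Stack 3 n} :
    stackVec (flipStack X) ∈ supportedIn (innerSet b n) ↔ IsInnerStack b X :=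
  ⟨fun h i p q => h (i, q, p), fun h x => h x.1 x.2.2 x.2.1⟩

theorem objective₂_flip {M X : Stack 3 n} (hX : stackVec X ∈ supportedIn (innerSet b n)) :
    objective₂ M (flipStack X) = sylvObj (fun _ _ _ _ => 1) (flipStack M) X := by
  rw [objective₂_eq (Z := flipStack X) (stackVec_mem_innerSet.1 hX), sylvObj]
  simp only [one_mul, flipStack_flipStack]

theorem isSweep_columnBlocks {f : Stack 3 n → ℝ} {X Y : Stack 3 n} :
    IsSweep f (columnBlocks b n) X Y ↔
      IsSweep (fun X => f (flipStack X)) (allRows (innerSet b n)) (flipStack X) (flipStack Y) := by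
  rw [columnBlocks_eq, isSweep_flip]

/-- The map is bilinear in the data and the unknowns, so its norm is bounded by a multiple of the
norm of the data; applied to a difference of data this measures the perturbation. -/
theorem sylvVec_bound {m : ℕ} (μ : Fin m → Fin m → Fin n → Fin n → ℝ) :
    ∃ β : ℝ, 0 ≤ β ∧ ∀ (M : Stack m n) (v : EuclideanSpace ℝ (Fin m × Fin n × Fin n)),
      ‖sylvVec μ M v‖ ≤ β * stackNorm M * ‖v‖ := by
  set Φ : EuclideanSpace ℝ (Fin m × Fin n × Fin n) →ₗ[ℝ]
      (EuclideanSpace ℝ (Fin m × Fin n × Fin n) →L[ℝ]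
        EuclideanSpace ℝ (Fin m × Fin m × Fin n × Fin n)) :=
    { toFun := fun w => LinearMap.toContinuousLinearMap (sylvVec μ (stackVec.symm w))
      map_add' := fun v w => by
        ext x ⟨i, j, p, q⟩
        simp only [map_add, sylvVec, sylv_add_left, Matrix.add_apply, mul_add,
          LinearMap.coe_toContinuousLinearMap', LinearMap.coe_mk, AddHom.coe_mk,
          add_apply, PiLp.add_apply]
      map_smul' := fun a w => by
        ext x ⟨i, j, p, q⟩
        simp only [map_smul, sylvVec, sylv, Pi.smul_apply, transpose_smul, Matrix.mul_smul,
          smul_mul, ← smul_add, ← smul_sub, Matrix.smul_apply, smul_eq_mul,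
          LinearMap.coe_toContinuousLinearMap', LinearMap.coe_mk, AddHom.coe_mk,
          smul_apply, PiLp.smul_apply, RingHom.id_apply]
        ring } with hΦ
  refine ⟨‖LinearMap.toContinuousLinearMap Φ‖,
    (LinearMap.toContinuousLinearMap Φ).opNorm_nonneg, fun M v => ?_⟩
  have h1 := (LinearMap.toContinuousLinearMap Φ).le_opNorm (stackVec M)
  have h2 := (Φ (stackVec M)).le_opNorm v
  rw [stackNorm_eq]
  exact h2.trans (mul_le_mul_of_nonneg_right h1 (norm_nonneg _))

theorem inner_injective {T : Tensor n} (hinj : Injective₂ b T) :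
    ∀ δ ∈ supportedIn (innerSet b n),
      sylvVec (fun _ _ _ _ => 1) (flipStack (evenSlices b T)) δ = 0 → δ = 0 := by
  intro δ hδ h
  obtain ⟨X, rfl⟩ := stackVec.surjective δ
  have hX : IsInnerStack b (flipStack X) := stackVec_mem_innerSet.1 hδ
  have h0 := hinj (flipStack X) hX fun i j p q => by
    have := congrArg (fun v => v (i, j, p, q)) h
    simpa [sylvVec_apply, flipStack_flipStack] using this
  have h1 : X = 0 := by
    have := congrArg flipStack h0
    exact this
  rw [h1, map_zero]

theorem abs_evenPart_le (X : Stack 5 n) (i : Fin 3) (p q : Fin n) :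
    |evenPart X i p q| ≤ stackNorm X := by
  have h : ∀ i : Fin 5, |X i p q| ≤ stackNorm X := fun i => by
    rw [stackNorm_eq]
    exact PiLp.norm_apply_le (stackVec X) (i, p, q)
  fin_cases i
  · exact h 0
  · exact h 2
  · exact h 4

theorem geometricLimit_corrected {T : Tensor n} {E : Tensor n} {X : ℕ → Stack 5 n}
    (hX : GeometricDecay fun N => stackNorm (X N - outerNoise b E)) (i : Fin 3) (p q : Fin n) :
    GeometricLimit (fun N => (evenSlices b T + evenPart (outerNoise b E - X N)) i p q)
      (evenSlices b T i p q) := by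
  refine hX.of_le fun N => ?_
  have e : (evenSlices b T + evenPart (outerNoise b E - X N)) i p q - evenSlices b T i p q =
      evenPart (outerNoise b E - X N) i p q := add_sub_cancel_left _ _
  simp only [e]
  refine (abs_evenPart_le _ i p q).trans (le_of_eq ?_)
  rw [stackNorm_eq, stackNorm_eq, map_sub, map_sub, norm_sub_rev]

/-- The second stage of alternating minimization converges geometrically. -/
theorem geometricDecay_inner (hn : 8 * (4 * b + 2) ≤ n) {A B C : Mat n r}
    (hA : Aᵀ * A = 1) (hinj : Injective₂ b (cpTensor A B C)) {E : Tensor n}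
    (hE : BandSupported b E) {X' : ℕ → Stack 5 n}
    (hX : GeometricDecay fun N => stackNorm (X' N - outerNoise b E)) {Z : ℕ → ℕ → Stack 3 n}
    (hZ : ∀ N, IsAlternating (objective₂ (threeSlices b (cpTensor A B C + E) (X' N)))
      (columnBlocks b n) (Z N)) (i : Fin 3) (p q : Fin n) :
    GeometricLimit (fun N => Z N N i p q) (innerNoise b E i p q) := by
  set T := evenSlices b (cpTensor A B C) with hT
  set T' : ℕ → Stack 3 n := fun N => T + evenPart (outerNoise b E - X' N) with hT'
  set I := innerNoise b E with hI
  have hIi : IsInnerStack b I := innerNoise_inner hE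
  have hM : ∀ N, threeSlices b (cpTensor A B C + E) (X' N) = T' N + I := fun N => threeSlices_eq _
  have hlim : ∀ i p q, GeometricLimit (fun N => T' N i p q) (T i p q) := fun i p q =>
    geometricLimit_corrected hX i p q
  set L := sylvVec (fun _ _ _ _ => 1) (flipStack T) with hL
  set LL : ℕ → _ := fun N => sylvVec (fun _ _ _ _ => 1) (flipStack (T' N)) with hLL
  set κ : ℕ → EuclideanSpace ℝ (Fin 3 × Fin 3 × Fin n × Fin n) := fun N =>
    sylvConst (fun _ _ _ _ => 1) (flipStack (T' N)) with hκ
  -- With the noise `I` moved into the variable, the `N`-th objective is `‖LL N (Z - I) - κ N‖ ^ 2`,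
  -- up to transposition, so `κ N` is the inconsistency of the `N`-th system at the true noise.
  set c : ℕ → EuclideanSpace ℝ (Fin 3 × Fin 3 × Fin n × Fin n) := fun N =>
    LL N (stackVec (flipStack I)) + κ N with hc
  -- In the limit `κ` becomes the commutator of the true slices, which is zero.
  have hκd : GeometricDecay fun N => ‖κ N‖ := by
    refine geometricDecay_norm fun x => geometricLimit_zero.1 ?_
    obtain ⟨i, j, p, q⟩ := x
    have e0 := congrFun (congrFun (evenSlices_comm hn C hA (B := B) i j) p) q
    rw [Matrix.sub_apply, mul_apply, mul_apply, Matrix.zero_apply] at e0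
    rw [← e0]
    have e : ∀ N, κ N (i, j, p, q) = ∑ s, T' N i s p * T' N j s q - ∑ s, T' N j s p * T' N i s q := by
      intro N
      simp only [hκ, sylvConst, one_mul, flipStack, transpose_transpose, Matrix.sub_apply,
        mul_apply, transpose_apply]
    simp only [e]
    exact (GeometricLimit.sum fun s _ => (hlim i s p).mul (hlim j s q)).sub
      (GeometricLimit.sum fun s _ => (hlim j s p).mul (hlim i s q))
  obtain ⟨β, hβ, hbound⟩ := sylvVec_bound (n := n) (m := 3) fun _ _ _ _ => 1
  have hΔd : GeometricDecay fun N => stackNorm (flipStack (T' N - T)) := by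
    simp only [stackNorm_eq]
    refine geometricDecay_norm fun x => ?_
    exact hlim x.1 x.2.2 x.2.1
  have hf : ∀ N X, stackVec X ∈ supportedIn (innerSet b n) →
      objective₂ (threeSlices b (cpTensor A B C + E) (X' N)) (flipStack X) =
        ‖LL N (stackVec X) - c N‖ ^ 2 := by
    intro N Z hZ
    rw [objective₂_flip hZ, sylvObj, EuclideanSpace.norm_sq_eq]
    simp only [Fintype.sum_prod_type, Real.norm_eq_abs, sq_abs, one_mul]
    refine sum_congr rfl fun i _ => sum_congr rfl fun j _ =>
      sum_congr rfl fun p _ => sum_congr rfl fun q _ => ?_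
    congr 1
    have h1 := res_flip_eq (T := T' N) hIi (Z := flipStack Z) (stackVec_mem_innerSet.1 hZ) i j
    rw [← hM, flipStack_flipStack] at h1
    rw [h1]
    have h2 : LL N (stackVec Z) - c N = LL N (stackVec (flipStack (flipStack Z - I))) - κ N := by
      have h3 : flipStack (flipStack Z - I) = Z - flipStack I := rfl
      rw [h3, map_sub, map_sub]
      exact (sub_sub _ _ _).symm
    rw [h2, PiLp.sub_apply, Matrix.sub_apply]
    simp only [hLL, hκ, sylvVec_apply, sylvConst, one_mul, flipStack, transpose_transpose]
  have hdec := decomposes_allRows (innerSet b n)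
  have hsw : ∀ N t, stackVec (flipStack (Z N t)) ∈ supportedIn (innerSet b n) ∧
      BlockSweep (LL N) (c N) ((allRows (innerSet b n)).map supportedIn)
        (stackVec (flipStack (Z N t))) (stackVec (flipStack (Z N (t + 1)))) := by
    intro N t
    have step : ∀ t, stackVec (flipStack (Z N t)) ∈ supportedIn (innerSet b n) →
        BlockSweep (LL N) (c N) ((allRows (innerSet b n)).map supportedIn)
          (stackVec (flipStack (Z N t))) (stackVec (flipStack (Z N (t + 1)))) := fun t ht =>
      (isSweep_iff_blockSweep allRows_subset ht (hf N)).1 (isSweep_columnBlocks.1 ((hZ N).2 t))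
    induction t with
    | zero =>
      have h0 : stackVec (flipStack (Z N 0)) ∈ supportedIn (innerSet b n) := by
        rw [(hZ N).1]
        exact Submodule.zero_mem _
      exact ⟨h0, step 0 h0⟩
    | succ t ih =>
      have h0 := Submodule.add_mem _ (ih.2.sub_mem hdec.1) ih.1
      simp_all
  have key := geometricDecay_diagonal hdec (L := L) (inner_injective hinj) (LL := LL) (c := c)
    (z := stackVec (flipStack I)) (stackVec_mem_innerSet.2 hIi)
    (ε := fun N => β * stackNorm (flipStack (T' N - T)) + ‖κ N‖)
    ((hΔd.const_mul β).add hκd) (x := fun N t => stackVec (flipStack (Z N t)))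
    (fun N δ _ => by
      have e : LL N δ - L δ = sylvVec (fun _ _ _ _ => 1) (flipStack (T' N - T)) δ := by
        obtain ⟨Y, rfl⟩ := stackVec.surjective δ
        ext ⟨i, j, p, q⟩
        have e1 : flipStack (T' N) = flipStack (T' N - T) + flipStack T := by
          have e2 : T' N = (T' N - T) + T := (sub_add_cancel _ _).symm
          exact congrArg flipStack e2
        simp only [PiLp.sub_apply, hLL, hL, sylvVec_apply, one_mul]
        rw [e1, sylv_add_left, Matrix.add_apply, add_sub_cancel_right]
      rw [e]
      refine (hbound _ δ).trans (mul_le_mul_of_nonneg_right ?_ (norm_nonneg _))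
      exact le_add_of_nonneg_right (norm_nonneg _))
    (fun N => by
      rw [hc, add_sub_cancel_left]
      refine le_add_of_nonneg_left (mul_nonneg hβ ?_)
      exact Real.sqrt_nonneg _)
    (fun N => by
      have e : flipStack (Z N 0) = 0 := by
        rw [(hZ N).1]
        rfl
      simp only [e, map_zero])
    fun N t => (hsw N t).2
  exact geometricDecay_entry key (i, q, p)

end stages

/-! ### Perturbation of least squares and of eigenvectors -/

section perturbation
open Filter
open scoped RealInnerProductSpace

/-- The linear map with the given coefficients. -/
def coeffMap {ι κ : Type*} [Fintype ι] [Fintype κ] (a : ι → κ → ℝ) :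
    EuclideanSpace ℝ κ →ₗ[ℝ] EuclideanSpace ℝ ι where
  toFun y := WithLp.toLp 2 fun x => ∑ k, a x k * y k
  map_add' y y' := by
    ext x
    simp [mul_add, sum_add_distrib]
  map_smul' t y := by
    ext x
    simp only [PiLp.smul_apply, smul_eq_mul, RingHom.id_apply, mul_sum]
    grind

theorem coeffMap_bound {ι κ : Type*} [Fintype ι] [Fintype κ] (a : ι → κ → ℝ)
    (y : EuclideanSpace ℝ κ) : ‖coeffMap a y‖ ≤ (∑ x, ∑ k, |a x k|) * ‖y‖ := by
  classical
  have h : coeffMap a y = ∑ x, (∑ k, a x k * y k) • EuclideanSpace.single x (1 : ℝ) := by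
    ext x
    simp [coeffMap, PiLp.single_apply, Pi.single_apply]
  rw [h, sum_mul]
  refine (norm_sum_le _ _).trans (sum_le_sum fun x _ => ?_)
  rw [norm_smul, PiLp.norm_single, norm_one, mul_one, sum_mul]
  refine (norm_sum_le _ _).trans (sum_le_sum fun k _ => ?_)
  rw [norm_mul, Real.norm_eq_abs]
  exact mul_le_mul_of_nonneg_left (PiLp.norm_apply_le y k) (abs_nonneg _)

/-- The solutions of least-squares problems that converge to a consistent one with a unique
solution converge to this solution. -/
theorem geometricLimit_leastSquares {ι κ : Type*} [Fintype ι] [Fintype κ] {a : ℕ → ι → κ → ℝ}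
    {a₀ : ι → κ → ℝ} (ha : ∀ x k, GeometricLimit (fun N => a N x k) (a₀ x k))
    (hinj : ∀ y : κ → ℝ, (∀ x, ∑ k, a₀ x k * y k = 0) → y = 0) {z : κ → ℝ} {s : ι → ℝ}
    (hz : ∀ x, ∑ k, a₀ x k * z k = s x) {y : ℕ → κ → ℝ}
    (hy : ∀ N k, ∑ x, a N x k * (∑ k', a N x k' * y N k' - s x) = 0) (k : κ) :
    GeometricLimit (fun N => y N k) (z k) := by
  set Z : EuclideanSpace ℝ κ := WithLp.toLp 2 z with hZ
  set Y : ℕ → EuclideanSpace ℝ κ := fun N => WithLp.toLp 2 (y N) with hY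
  have hdiff : ∀ N v, coeffMap (a N) v - coeffMap a₀ v = coeffMap (fun x k => a N x k - a₀ x k) v := by
    intro N v
    ext x
    simp [coeffMap, sub_mul, sum_sub_distrib]
  have hd : GeometricDecay fun N => ∑ x, ∑ k, |a N x k - a₀ x k| :=
    GeometricDecay.sum fun x _ => GeometricDecay.sum fun k _ => GeometricDecay.abs (ha x k)
  have h0 : ∀ N, 0 ≤ ∑ x, ∑ k, |a N x k - a₀ x k| := fun N =>
    sum_nonneg fun _ _ => sum_nonneg fun _ _ => abs_nonneg _
  have hstep : ∀ N x, BlockStep (coeffMap (a N)) (coeffMap a₀ Z) ⊤ x (Y N) := by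
    intro N x
    refine ⟨Submodule.mem_top, fun δ _ => ?_⟩
    have e : ⟪coeffMap (a N) (Y N) - coeffMap a₀ Z, coeffMap (a N) δ⟫ =
        ∑ k, δ k * ∑ x, a N x k * (∑ k', a N x k' * y N k' - s x) := by
      rw [PiLp.inner_apply]
      simp only [coeffMap, LinearMap.coe_mk, AddHom.coe_mk, PiLp.sub_apply, RCLike.inner_apply,
        conj_trivial, hY, hZ, hz, sum_mul, mul_sum]
      rw [sum_comm]
      grind
    rw [e]
    exact sum_eq_zero fun k _ => by rw [hy, mul_zero]
  -- A single block consisting of the whole space: every sweep solves the problem completely. The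
  -- iterate at `N = 0` is the prescribed zero, hence the restriction to `N ≥ 1` below.
  have key := geometricDecay_diagonal (l := [⊤]) (U := ⊤) (L := coeffMap a₀)
    (LL := fun N => coeffMap (a N)) (c := fun _ => coeffMap a₀ Z) (z := Z)
    (ε := fun N => (∑ x, ∑ k, |a N x k - a₀ x k|) * (1 + ‖Z‖))
    (x := fun N t => if t = 0 then 0 else Y N)
    ⟨fun _ _ => le_top, fun δ _ => ⟨fun _ => δ, by simp, fun _ => le_rfl, by simp⟩⟩
    (fun δ _ h => by
      have := hinj (fun k => δ k) fun x => congrArg (fun v => v x) h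
      ext k
      exact congrFun this k)
    Submodule.mem_top (by simpa [mul_comm] using hd.const_mul (1 + ‖Z‖))
    (fun N δ _ => by
      rw [hdiff]
      refine (coeffMap_bound _ δ).trans ?_
      gcongr
      exact le_mul_of_one_le_right (h0 N) (by linarith [norm_nonneg Z]))
    (fun N => by
      rw [norm_sub_rev, hdiff]
      refine (coeffMap_bound _ Z).trans ?_
      exact mul_le_mul_of_nonneg_left (by linarith) (h0 N))
    (fun N => if_pos rfl)
    (fun N t => ⟨Y N, hstep N _, by simp [BlockSweep]⟩)
  have h2 := geometricDecay_entry key k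
  refine h2.abs.of_eventually_le ?_
  filter_upwards [eventually_ge_atTop 1] with N hN
  rw [if_neg (by omega)]
  rfl

theorem abs_near_zero_or_one {e D : ℝ} (h : |e ^ 2 - e| ≤ D) : |e| ≤ 2 * D ∨ |e - 1| ≤ 2 * D := by
  have h1 : |e| * |e - 1| ≤ D := by
    rw [← abs_mul]
    grind
  rcases le_total (1 / 2 : ℝ) |e| with h2 | h2
  · right
    nlinarith [abs_nonneg (e - 1)]
  · left
    have h3 : (1 / 2 : ℝ) ≤ |e - 1| := by
      grind
    nlinarith [abs_nonneg e]

variable {n r : ℕ}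

/-- The vectors of an orthonormal basis of approximate eigenvectors that are close to the given
eigenvectors. -/
theorem exists_unique_eigenvalue_near_one {V Q : ℕ → Mat n n}
    (hV : ∀ N, (V N)ᵀ * V N = 1) {e : ℕ → Fin n → ℝ}
    (hQ : ∀ N, Q N = V N * diagonal (e N) * (V N)ᵀ) {a : Fin n → ℝ}
    (hlim : ∀ p q, GeometricLimit (fun N => Q N p q) (a p * a q)) (ha : ∑ p, a p * a p = 1) :
    ∃ κ : ℕ → Fin n, ∀ p q,
      GeometricLimit (fun N => V N p (κ N) * V N q (κ N)) (a p * a q) := by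
  have hn : Nonempty (Fin n) := by
    by_contra h
    simp_all
  have hV1 : ∀ N p k, |V N p k| ≤ 1 := by
    intro N p k
    have h := congrFun (congrFun (hV N) k) k
    rw [mul_apply, one_apply_eq] at h
    have h2 : V N p k * V N p k ≤ 1 := by
      rw [← h]
      exact Finset.single_le_sum (f := fun p => (V N)ᵀ k p * V N p k)
        (fun p _ => mul_self_nonneg _) (mem_univ p)
    exact abs_le_one_iff_mul_self_le_one.2 h2
  have hQe : ∀ N p q, Q N p q = ∑ k, e N k * (V N p k * V N q k) := by
    intro N p q
    rw [hQ, mul_apply]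
    refine sum_congr rfl fun k _ => ?_
    rw [mul_diagonal, transpose_apply]
    ring
  have hsq : ∀ N, Q N * Q N = V N * diagonal (e N * e N) * (V N)ᵀ := by
    intro N
    rw [hQ]
    calc _ = V N * diagonal (e N) * ((V N)ᵀ * V N) * diagonal (e N) * (V N)ᵀ := by
          simp only [Matrix.mul_assoc]
      _ = _ := by
          rw [hV, Matrix.mul_one, Matrix.mul_assoc (V N), diagonal_mul_diagonal]
          rfl
  -- The limit of `Q` is the projection onto `a`, so `Q ^ 2 - Q` tends to zero and every eigenvalue
  -- of `Q N` is close to `0` or to `1`.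
  have hee : ∀ N k, e N k ^ 2 - e N k =
      ∑ p, ∑ q, V N p k * V N q k * ((Q N * Q N) p q - Q N p q) := by
    intro N k
    have h1 : (V N)ᵀ * (Q N * Q N - Q N) * V N = diagonal (e N * e N) - diagonal (e N) := by
      rw [hsq, hQ, Matrix.mul_sub, Matrix.sub_mul]
      grind
    have h2 := congrFun (congrFun h1 k) k
    simp only [Matrix.sub_apply, Matrix.diagonal_apply_eq, Pi.mul_apply, mul_apply,
      transpose_apply] at h2
    rw [sq, ← h2]
    simp only [sum_mul]
    rw [sum_comm]
    refine sum_congr rfl fun p _ => sum_congr rfl fun q _ => ?_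
    simp only [mul_apply]
    ring
  set D : ℕ → ℝ := fun N => ∑ p, ∑ q, |(Q N * Q N) p q - Q N p q| with hD
  have hDd : GeometricDecay D := by
    refine GeometricDecay.sum fun p _ => GeometricDecay.sum fun q _ => GeometricDecay.abs ?_
    refine geometricLimit_zero.1 ?_
    have h0 : ∑ s, (a p * a s) * (a s * a q) - a p * a q = 0 := by
      have : ∑ s, (a p * a s) * (a s * a q) = (∑ s, a s * a s) * (a p * a q) := by
        rw [sum_mul]
        grind
      rw [this, ha, one_mul, sub_self]
    rw [← h0]
    simp only [mul_apply]
    exact (GeometricLimit.sum fun s _ => (hlim p s).mul (hlim s q)).sub (hlim p q)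
  have hD0 : ∀ N, 0 ≤ D N := fun N =>
    sum_nonneg fun _ _ => sum_nonneg fun _ _ => abs_nonneg _
  have hebound : ∀ N k, |e N k ^ 2 - e N k| ≤ D N := by
    intro N k
    rw [hee]
    refine (abs_sum_le_sum_abs _ _).trans (sum_le_sum fun p _ => ?_)
    refine (abs_sum_le_sum_abs _ _).trans (sum_le_sum fun q _ => ?_)
    rw [abs_mul, abs_mul]
    refine mul_le_of_le_one_left (abs_nonneg _) ?_
    exact mul_le_one₀ (hV1 N p k) (abs_nonneg _) (hV1 N q k)
  -- The trace tends to `1`, so in the end exactly one eigenvalue is close to `1`.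
  have htr : GeometricLimit (fun N => ∑ k, e N k) 1 := by
    have h1 : ∀ N, ∑ k, e N k = ∑ p, Q N p p := by
      intro N
      simp only [hQe]
      rw [sum_comm]
      refine sum_congr rfl fun k _ => ?_
      rw [← mul_sum]
      have h := congrFun (congrFun (hV N) k) k
      rw [mul_apply, one_apply_eq] at h
      simp only [transpose_apply] at h
      rw [h, mul_one]
    simp only [h1]
    rw [← ha]
    exact GeometricLimit.sum fun p _ => hlim p p
  classical
  have hnD : GeometricDecay fun N => 2 * n * D N := hDd.const_mul _
  have hex : ∀ᶠ N in atTop, ∃ k₀, ∀ k, |e N k - if k = k₀ then 1 else 0| ≤ 2 * D N := by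
    filter_upwards [hnD.eventually_lt (show (0 : ℝ) < 1 / 4 by norm_num),
      GeometricDecay.eventually_lt htr (show (0 : ℝ) < 1 / 4 by norm_num)] with N h1 h2
    set K : Finset (Fin n) := univ.filter fun k => |e N k - 1| ≤ 2 * D N with hK
    have hk : ∀ k, |e N k - if k ∈ K then 1 else 0| ≤ 2 * D N := by
      intro k
      split_ifs with h
      · exact (mem_filter.1 h).2
      · rcases abs_near_zero_or_one (hebound N k) with h' | h'
        · rwa [sub_zero]
        grind
    have hsum : |∑ k, e N k - (K.card : ℝ)| ≤ 2 * n * D N := by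
      have h3 : (K.card : ℝ) = ∑ k, if k ∈ K then (1 : ℝ) else 0 := by simp
      rw [h3, ← sum_sub_distrib]
      refine (abs_sum_le_sum_abs _ _).trans ((sum_le_sum fun k _ => hk k).trans ?_)
      rw [sum_const, card_univ, Fintype.card_fin, nsmul_eq_mul]
      exact le_of_eq (by ring)
    have hcard : K.card = 1 := by
      have h4 := (le_abs_self _).trans_lt h1
      rw [abs_lt] at h2
      rw [abs_le] at hsum
      have h5 : (K.card : ℝ) < 2 := by linarith
      have h6 : (0 : ℝ) < K.card := by linarith
      have h7 : K.card < 2 := by exact_mod_cast h5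
      have h8 : 0 < K.card := by exact_mod_cast h6
      omega
    obtain ⟨k₀, hk₀⟩ := Finset.card_eq_one.1 hcard
    refine ⟨k₀, fun k => ?_⟩
    have := hk k
    simpa only [hk₀, Finset.mem_singleton] using this
  -- An index is needed for every `N`; where no eigenvalue stands out the choice is arbitrary.
  have hch : ∀ N, ∃ k₀, (∃ k₁, ∀ k, |e N k - if k = k₁ then 1 else 0| ≤ 2 * D N) →
      ∀ k, |e N k - if k = k₀ then 1 else 0| ≤ 2 * D N := by
    intro N
    by_cases h : ∃ k₁, ∀ k, |e N k - if k = k₁ then 1 else 0| ≤ 2 * D N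
    · exact ⟨h.choose, fun _ => h.choose_spec⟩
    · exact ⟨hn.some, fun h' => absurd h' h⟩
  choose κ hκ using hch
  refine ⟨κ, fun p q => ?_⟩
  have h1 : GeometricDecay fun N => V N p (κ N) * V N q (κ N) - Q N p q := by
    refine hnD.of_eventually_le ?_
    filter_upwards [hex] with N hN
    have h2 := hκ N hN
    have h3 : V N p (κ N) * V N q (κ N) - Q N p q =
        ∑ k, ((if k = κ N then 1 else 0) - e N k) * (V N p k * V N q k) := by
      simp only [sub_mul, sum_sub_distrib, ite_mul, one_mul, zero_mul,
        sum_ite_eq', mem_univ, if_true, hQe]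
    rw [h3]
    have h4 : ∀ k, |((if k = κ N then 1 else 0) - e N k) * (V N p k * V N q k)| ≤ 2 * D N := by
      intro k
      rw [abs_mul, abs_mul, abs_sub_comm]
      refine (mul_le_of_le_one_right (abs_nonneg _) ?_).trans (h2 k)
      exact mul_le_one₀ (hV1 N p k) (abs_nonneg _) (hV1 N q k)
    refine (abs_sum_le_sum_abs _ _).trans ((sum_le_sum fun k _ => h4 k).trans ?_)
    rw [sum_const, card_univ, Fintype.card_fin, nsmul_eq_mul]
    exact le_of_eq (by ring)
  have := (geometricLimit_zero.2 h1).add (hlim p q)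
  simpa using this

end perturbation

/-! ### Eigenvectors for the largest eigenvalues under perturbation -/

section topVectors
open Filter

variable {n r : ℕ}

theorem GeometricLimit.matrix_pow {H : ℕ → Mat n n}
    {H₀ : Mat n n} (h : ∀ p q, GeometricLimit (fun N => H N p q) (H₀ p q))
    (m : ℕ) (p q : Fin n) : GeometricLimit (fun N => (H N ^ m) p q) ((H₀ ^ m) p q) := by
  induction m generalizing p q with
  | zero =>
    simp only [pow_zero]
    exact GeometricLimit.const _
  | succ m ih =>
    simp only [pow_succ, mul_apply]
    exact GeometricLimit.sum fun s _ => (ih p s).mul (h s q)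

theorem conj_diagonal_pow {V : Mat n n} (hV : Vᵀ * V = 1) (w : Fin n → ℝ) (m : ℕ) :
    (V * diagonal w * Vᵀ) ^ m = V * diagonal (w ^ m) * Vᵀ := by
  have hV' : V * Vᵀ = 1 := mul_eq_one_comm.1 hV
  induction m with
  | zero =>
    simp_all
  | succ m ih =>
    rw [pow_succ, ih]
    calc _ = V * diagonal (w ^ m) * (Vᵀ * V) * diagonal w * Vᵀ := by
          simp only [Matrix.mul_assoc]
      _ = _ := by
          rw [hV, Matrix.mul_one, Matrix.mul_assoc V, diagonal_mul_diagonal]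
          rfl

theorem sum_mul_col {A : Mat n r} (hA : Aᵀ * A = 1) (j j' : Fin r) :
    ∑ p, A p j * A p j' = if j = j' then 1 else 0 := by
  have := congrFun (congrFun hA j) j'
  rwa [mul_apply, one_apply] at this

theorem cpMat_single (A B : Mat n r) (j : Fin r) (p q : Fin n) :
    cpMat A B (Pi.single j 1) p q = A p j * B q j := by
  rw [cpMat_apply, sum_eq_single j]
  · simp
  · intro k _ hk
    simp [hk]
  · simp

theorem conj_diagonal_apply (V : Mat n n) (w : Fin n → ℝ) (p q : Fin n) :
    (V * diagonal w * Vᵀ) p q = ∑ k, w k * (V p k * V q k) := by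
  rw [mul_apply]
  refine sum_congr rfl fun k _ => ?_
  rw [mul_diagonal, transpose_apply]
  ring

theorem trace_eq_sum {H V : Mat n n} (hV : Vᵀ * V = 1) {w : Fin n → ℝ}
    (hw : H = V * diagonal w * Vᵀ) : ∑ p, H p p = ∑ k, w k := by
  have h : ∀ p q, H p q = ∑ k, w k * (V p k * V q k) := fun p q => by
    rw [hw, conj_diagonal_apply]
  simp only [h]
  rw [sum_comm]
  refine sum_congr rfl fun k _ => ?_
  rw [← mul_sum, sum_mul_col hV, if_pos rfl, mul_one]

theorem eigenvalue_eq_sum {H V : Mat n n} (hV : Vᵀ * V = 1) {w : Fin n → ℝ}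
    (hw : H = V * diagonal w * Vᵀ) (k : Fin n) :
    w k = ∑ p, ∑ q, H p q * (V p k * V q k) := by
  have h2 : Vᵀ * H * V = diagonal w := by
    grind
  have h3 := congrFun (congrFun h2 k) k
  rw [Matrix.diagonal_apply_eq] at h3
  rw [← h3]
  simp only [mul_apply, transpose_apply, sum_mul]
  rw [sum_comm]
  exact sum_congr rfl fun p _ => sum_congr rfl fun q _ => by ring

/-- The eigenvectors for the largest eigenvalues of matrices that converge to a matrix of
rank `r` with distinct nonzero eigenvalues. -/
theorem exists_top_vectors {H V : ℕ → Mat n n} (hV : ∀ N, (V N)ᵀ * V N = 1)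
    {w : ℕ → Fin n → ℝ} (hw : ∀ N, H N = V N * diagonal (w N) * (V N)ᵀ)
    (hw0 : ∀ N k, 0 ≤ w N k) {A : Mat n r} (hA : Aᵀ * A = 1) {ev : Fin r → ℝ}
    (hev : ∀ j, 0 < ev j) {y : Fin r → Fin r → ℝ}
    (hy : ∀ j, ∑ m : Fin r, y j m • cpMat A A ev ^ ((m : ℕ) + 1) = cpMat A A (Pi.single j 1))
    (hH : ∀ p q, GeometricLimit (fun N => H N p q) (cpMat A A ev p q)) :
    ∃ κ : ℕ → Fin r → Fin n,
      (∀ j p q, GeometricLimit (fun N => V N p (κ N j) * V N q (κ N j)) (A p j * A q j)) ∧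
      ∀ᶠ N in atTop, Function.Injective (κ N) ∧
        ∀ k, (∀ j, κ N j ≠ k) → ∀ j, w N k < w N (κ N j) := by
  have h1 : ∀ j : Fin r, ∃ κ : ℕ → Fin n, ∀ p q,
      GeometricLimit (fun N => V N p (κ N) * V N q (κ N)) (A p j * A q j) := by
    intro j
    -- The polynomial with coefficients `y j` sends the limit of `H N` to the projection onto `a j`,
    -- and it acts on `H N` without changing the eigenvectors.
    refine exists_unique_eigenvalue_near_one
      (Q := fun N => ∑ m : Fin r, y j m • H N ^ ((m : ℕ) + 1)) hV
      (e := fun N => ∑ m : Fin r, y j m • w N ^ ((m : ℕ) + 1)) ?_ ?_ ?_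
    · intro N
      ext p q
      rw [conj_diagonal_apply]
      simp only [hw N, conj_diagonal_pow (hV N), Matrix.sum_apply, Matrix.smul_apply,
        conj_diagonal_apply, Finset.sum_apply, Pi.smul_apply, smul_eq_mul, mul_sum,
        sum_mul]
      rw [sum_comm]
      exact sum_congr rfl fun k _ => sum_congr rfl fun m _ => by ring
    · intro p q
      rw [← cpMat_single, ← hy]
      simp only [Matrix.sum_apply, Matrix.smul_apply, smul_eq_mul]
      exact GeometricLimit.sum fun m _ => (GeometricLimit.matrix_pow hH _ p q).const_mul _
    · rw [sum_mul_col hA, if_pos rfl]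
  choose κ hκ using h1
  refine ⟨fun N j => κ j N, hκ, ?_⟩
  have hinj : ∀ᶠ N in atTop, ∀ j j', j ≠ j' → κ j N ≠ κ j' N := by
    rw [eventually_all]
    intro j
    rw [eventually_all]
    intro j'
    by_cases hj : j = j'
    · exact Eventually.of_forall fun N h => absurd hj h
    · obtain ⟨p, q, hpq⟩ : ∃ p q, A p j * A q j ≠ A p j' * A q j' := by
        by_contra hcon
        push Not at hcon
        have e1 : ∑ p, ∑ q, (A p j * A p j) * (A q j * A q j) = 1 := by
          rw [← sum_mul_sum, sum_mul_col hA, if_pos rfl, one_mul]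
        have e2 : ∑ p, ∑ q, (A p j * A p j') * (A q j * A q j') = 0 := by
          rw [← sum_mul_sum, sum_mul_col hA, if_neg hj, zero_mul]
        grind
      have hpos : 0 < |A p j * A q j - A p j' * A q j'| := abs_pos.2 (sub_ne_zero.2 hpq)
      filter_upwards [GeometricDecay.eventually_lt (hκ j p q) (half_pos hpos),
        GeometricDecay.eventually_lt (hκ j' p q) (half_pos hpos)] with N e1 e2 _ e3
      grind
  have hwl : ∀ j, GeometricLimit (fun N => w N (κ j N)) (ev j) := by
    intro j
    have e0 : ev j = ∑ p, ∑ q, cpMat A A ev p q * (A p j * A q j) := by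
      simp only [cpMat_apply, sum_mul]
      have e1 : ∀ p, ∑ q, ∑ k, A p k * A q k * ev k * (A p j * A q j) =
          ∑ k, ev k * (A p k * A p j) * ∑ q, A q k * A q j := by
        intro p
        rw [sum_comm]
        refine sum_congr rfl fun k _ => ?_
        rw [mul_sum]
        exact sum_congr rfl fun q _ => by ring
      simp only [e1, sum_mul_col hA, mul_ite, mul_one, mul_zero, sum_ite_eq',
        mem_univ, if_true]
      rw [← mul_sum, sum_mul_col hA, if_pos rfl, mul_one]
    rw [e0]
    simp only [fun N => eigenvalue_eq_sum (hV N) (hw N)]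
    exact GeometricLimit.sum fun p _ => GeometricLimit.sum fun q _ => (hH p q).mul (hκ j p q)
  have htr : GeometricLimit (fun N => ∑ k, w N k) (∑ j, ev j) := by
    have e0 : ∑ j, ev j = ∑ p, cpMat A A ev p p := by
      simp only [cpMat_apply]
      rw [sum_comm]
      refine sum_congr rfl fun k _ => ?_
      rw [← sum_mul, sum_mul_col hA, if_pos rfl, one_mul]
    rw [e0]
    simp only [fun N => (trace_eq_sum (hV N) (hw N)).symm]
    exact GeometricLimit.sum fun p _ => hH p p
  -- The trace exceeds the sum of the selected eigenvalues by a vanishing amount. As all eigenvalues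
  -- are nonnegative, every other eigenvalue is small.
  have hrest : GeometricDecay fun N => ∑ k, w N k - ∑ j, w N (κ j N) := by
    refine geometricLimit_zero.1 ?_
    have := htr.sub (GeometricLimit.sum fun j (_ : j ∈ univ) => hwl j)
    rwa [sub_self] at this
  have hlarge : ∀ᶠ N in atTop, ∀ j, ev j / 2 < w N (κ j N) := by
    rw [eventually_all]
    intro j
    filter_upwards [GeometricDecay.eventually_lt (hwl j) (half_pos (hev j))] with N h
    rw [abs_lt] at h
    linarith
  have hsmall : ∀ᶠ N in atTop, ∀ j, ∑ k, w N k - ∑ j, w N (κ j N) < ev j / 2 := by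
    rw [eventually_all]
    intro j
    filter_upwards [hrest.eventually_lt (half_pos (hev j))] with N h
    exact (le_abs_self _).trans_lt h
  filter_upwards [hinj, hlarge, hsmall] with N e1 e2 e3
  have hi : Function.Injective fun j => κ j N := by
    intro j j' h
    by_contra hne
    exact e1 j j' hne h
  refine ⟨hi, fun k hk j => ?_⟩
  classical
  have e4 : ∑ j, w N (κ j N) + w N k ≤ ∑ k, w N k := by
    have e5 : ∑ j, w N (κ j N) = ∑ k ∈ univ.image fun j => κ j N, w N k := by
      rw [Finset.sum_image fun a _ b _ h => hi h]
    rw [e5, add_comm, ← sum_insert (f := w N)]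
    · exact Finset.sum_le_sum_of_subset_of_nonneg (subset_univ _) fun k _ _ => hw0 N k
    · intro hmem
      obtain ⟨j', -, hj'⟩ := mem_image.1 hmem
      exact hk j' hj'
  have e6 := e2 j
  have e7 := e3 j
  linarith

end topVectors

/-! ### Convergence of the computed factors -/

section output
open Filter

variable {n r b : ℕ}

/-- The position of `k` in the order by decreasing value. -/
noncomputable def rank (w : Fin n → ℝ) (k : Fin n) : ℕ :=
  (univ.filter fun k' => w k < w k' ∨ (w k' = w k ∧ k' < k)).card

theorem rank_lt {w : Fin n → ℝ} {k k' : Fin n} (h : w k < w k' ∨ (w k' = w k ∧ k' < k)) :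
    rank w k' < rank w k := by
  refine Finset.card_lt_card ((Finset.ssubset_iff_of_subset ?_).2 ⟨k', ?_, ?_⟩)
  · grind
  · simpa using h
  · simp

theorem rank_injective (w : Fin n → ℝ) : Function.Injective (rank w) := by
  intro k k' h
  by_contra hne
  rcases lt_trichotomy (w k) (w k') with h1 | h1 | h1
  · exact (rank_lt (Or.inl h1)).ne' h
  · rcases lt_or_gt_of_ne hne with h2 | h2
    · exact (rank_lt (Or.inr ⟨h1, h2⟩)).ne h
    · exact (rank_lt (Or.inr ⟨h1.symm, h2⟩)).ne' h
  · exact (rank_lt (Or.inl h1)).ne h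

/-- Whatever precedes a top index is itself a top index, and there are only `r` of them; ties are
broken by the index. -/
theorem rank_lt_of_top {w : Fin n → ℝ} {κ : Fin r → Fin n} (hκ : Function.Injective κ)
    (h : ∀ k, (∀ j, κ j ≠ k) → ∀ j, w k < w (κ j)) (j : Fin r) : rank w (κ j) < r := by
  have h1 : (univ.filter fun k' => w (κ j) < w k' ∨ (w k' = w (κ j) ∧ k' < κ j)) ⊆
      (univ.image κ).erase (κ j) := by
    intro k hk
    simp only [mem_filter, mem_univ, true_and] at hk
    refine Finset.mem_erase.2 ⟨?_, ?_⟩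
    · rintro rfl
      simp at hk
    · by_contra hmem
      have := h k (fun j' hj' => hmem (mem_image.2 ⟨j', mem_univ _, hj'⟩)) j
      grind
  have h2 := card_le_card h1
  rw [Finset.card_erase_of_mem (Finset.mem_image_of_mem κ (mem_univ j)),
    Finset.card_image_of_injective _ hκ, card_univ, Fintype.card_fin] at h2
  have := j.2
  rw [rank]
  omega

theorem krylov_mul_transpose (T : Mat n n) (k : ℕ) :
    krylov T k * Tᵀ = (T * Tᵀ) ^ (k + 1) := by
  induction k with
  | zero => simp [krylov]
  | succ k ih => rw [krylov, Matrix.mul_assoc, ih, pow_succ' _ (k + 1)]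

/-- Multiplying `(T Tᵀ) ^ k T` by `Tᵀ` gives a power of `T Tᵀ`. The Krylov coefficients for the
weight `(d j)⁻¹` at `j` thus produce the projection onto `a j`. -/
theorem exists_projection_coeffs {A B : Mat n r} (hA : Aᵀ * A = 1)
    (hB : Bᵀ * B = 1) {d : Fin r → ℝ} (h0 : ∀ k, d k ≠ 0)
    (h : ∀ k k', k ≠ k' → d k ^ 2 ≠ d k' ^ 2) (j : Fin r) :
    ∃ y : Fin r → ℝ, ∑ m : Fin r, y m • cpMat A A (d * d) ^ ((m : ℕ) + 1) =
      cpMat A A (Pi.single j 1) := by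
  obtain ⟨y, hy⟩ := exists_krylov_coeffs hA hB (krylov_injective hA hB h0 h)
    (Pi.single j (d j)⁻¹)
  refine ⟨y, ?_⟩
  have h1 := congrArg (· * (cpMat A B d)ᵀ) hy
  simp only [sum_mul, smul_mul, krylov_mul_transpose,
    cpMat_mul_transpose hB] at h1
  rw [h1]
  congr 1
  ext k
  by_cases hk : k = j
  · subst hk
    simp [h0]
  · simp [hk]

/-- The factors computed from an approximation of the first slice, together with the
least-squares fits of the other slices, converge at the same rate. -/
theorem geometricLimit_output {T : ℕ → Mat n n}
    {V : ℕ → Mat n n} (hV : ∀ N, (V N)ᵀ * V N = 1) {w : ℕ → Fin n → ℝ}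
    (hw : ∀ N, T N * (T N)ᵀ = V N * diagonal (w N) * (V N)ᵀ)
    {A B C : Mat n r} (hA : Aᵀ * A = 1) (hB : Bᵀ * B = 1) {d : Fin r → ℝ}
    (hd0 : ∀ k, d k ≠ 0) (hd : ∀ k k', k ≠ k' → d k ^ 2 ≠ d k' ^ 2)
    (hT : ∀ p q, GeometricLimit (fun N => T N p q) (cpMat A B d p q))
    {A' B' C' : ℕ → Mat n r}
    (hA' : ∀ N p c, A' N p c = ∑ k, if rank (w N) k = c then V N p k else 0)
    (hB' : ∀ N q c, B' N q c = ∑ p, T N p q * A' N p c)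
    (hpr : ProbeInjective b A B) {pr : Fin n → Fin 2 → Fin n}
    (hprobe : ∀ l j, (pr l j : ℕ) = probe n l j) {S : Tensor n}
    (hS : ∀ i j l : Fin n, ¬ InBand b l i j → S i j l = cpTensor A B C i j l)
    {m : Fin n → Fin 2 → Fin n → ℝ}
    (hm : ∀ l j q, m l j q = if InBand b l (pr l j) q then 0 else 1)
    (hC : ∀ N l c, ∑ j, ∑ q, m l j q * (A' N (pr l j) c * B' N q c) *
      (∑ c', m l j q * (A' N (pr l j) c' * B' N q c') * C' N l c' - m l j q * S (pr l j) q l) = 0)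
    (i q l : Fin n) :
    GeometricLimit (fun N => cpTensor (A' N) (B' N) (C' N) i q l) (cpTensor A B C i q l) := by
  have hw0 : ∀ N k, 0 ≤ w N k := by
    intro N k
    rw [eigenvalue_eq_sum (hV N) (hw N)]
    have : ∑ p, ∑ q, (T N * (T N)ᵀ) p q * (V N p k * V N q k) =
        ∑ s, (∑ p, T N p s * V N p k) ^ 2 := by
      simp only [mul_apply, transpose_apply, sum_mul]
      calc _ = ∑ p, ∑ s, ∑ q, T N p s * T N q s * (V N p k * V N q k) :=
            sum_congr rfl fun p _ => sum_comm
        _ = ∑ s, ∑ p, ∑ q, T N p s * T N q s * (V N p k * V N q k) := sum_comm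
        _ = _ := sum_congr rfl fun s _ => by
            rw [sq, sum_mul_sum]
            grind
    rw [this]
    exact sum_nonneg fun s _ => sq_nonneg _
  choose y hy using exists_projection_coeffs hA hB hd0 hd
  obtain ⟨κ, hκ, hκ'⟩ := exists_top_vectors hV hw hw0 hA (ev := d * d)
    (fun j => mul_self_pos.2 (hd0 j)) hy (fun p q => by
      rw [← cpMat_mul_transpose hB]
      simp only [mul_apply, transpose_apply]
      exact GeometricLimit.sum fun s _ => (hT p s).mul (hT q s))
  -- The order of the eigenvectors may differ from that of the `a j` and may change with `N`; the
  -- final sums over all terms are insensitive to this permutation.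
  have hσ : ∀ N, ∃ σ : Equiv.Perm (Fin r), (Function.Injective (κ N) ∧
      ∀ k, (∀ j, κ N j ≠ k) → ∀ j, w N k < w N (κ N j)) →
      ∀ p j, A' N p (σ j) = V N p (κ N j) := by
    intro N
    by_cases hN : Function.Injective (κ N) ∧ ∀ k, (∀ j, κ N j ≠ k) → ∀ j, w N k < w N (κ N j)
    · have hi : Function.Injective fun j : Fin r =>
          (⟨rank (w N) (κ N j), rank_lt_of_top hN.1 hN.2 j⟩ : Fin r) := by
        intro j j' h
        exact hN.1 (rank_injective _ (Fin.ext_iff.1 h))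
      refine ⟨Equiv.ofBijective _ (Finite.injective_iff_bijective.1 hi), fun _ p j => ?_⟩
      rw [hA', sum_eq_single (κ N j)]
      · simp
      · intro k _ hk
        rw [if_neg]
        intro h
        exact hk (rank_injective _ h)
      · simp
    · exact ⟨1, fun h => absurd h hN⟩
  choose σ hσ using hσ
  -- The eigenvector enters twice, so its sign cancels. The column of `B'` approximates `d j * b j`,
  -- which is why the fitted coefficients tend to `C l j / d j`.
  have hG : ∀ (p q : Fin n) (j : Fin r),
      GeometricLimit (fun N => A' N p (σ N j) * B' N q (σ N j)) (A p j * (d j * B q j)) := by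
    intro p q j
    have e0 : A p j * (d j * B q j) = ∑ s, cpMat A B d s q * (A p j * A s j) := by
      have e1 : ∑ s, cpMat A B d s q * A s j = d j * B q j := by
        simp only [cpMat_apply, sum_mul]
        rw [sum_comm]
        have e2 : ∀ k, ∑ s, A s k * B q k * d k * A s j = B q k * d k * ∑ s, A s k * A s j := by
          intro k
          rw [mul_sum]
          grind
        simp only [e2, sum_mul_col hA, mul_ite, mul_one, mul_zero, sum_ite_eq',
          mem_univ, if_true]
        ring
      rw [← e1, mul_sum]
      exact sum_congr rfl fun s _ => by ring
    have e3 : GeometricLimit (fun N => ∑ s, T N s q * (V N p (κ N j) * V N s (κ N j)))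
        (A p j * (d j * B q j)) := by
      rw [e0]
      exact GeometricLimit.sum fun s _ => (hT s q).mul (hκ j p s)
    refine GeometricDecay.of_eventually_le (GeometricDecay.abs e3) ?_
    filter_upwards [hκ'] with N hN
    refine le_of_eq ?_
    rw [hB', hσ N hN]
    congr 2
    rw [mul_sum]
    refine sum_congr rfl fun s _ => ?_
    rw [hσ N hN]
    ring
  have hlim : ∀ l j, GeometricLimit (fun N => C' N l (σ N j)) (C l j / d j) := by
    intro l
    refine geometricLimit_leastSquares (ι := Fin 2 × Fin n)
      (a := fun N x j => m l x.1 x.2 * (A' N (pr l x.1) (σ N j) * B' N x.2 (σ N j)))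
      (a₀ := fun x j => m l x.1 x.2 * (A (pr l x.1) j * (d j * B x.2 j)))
      (s := fun x => m l x.1 x.2 * S (pr l x.1) x.2 l)
      (fun x j => (hG _ _ j).const_mul _) ?_ ?_ ?_
    · intro u hu
      have h1 := hpr l (d * u) fun p q hp hq => by
        obtain ⟨j', hj'⟩ : ∃ j' : Fin 2, p = pr l j' := by
          rcases hp with hp | hp
          · exact ⟨0, Fin.ext (hp.trans (hprobe l 0).symm)⟩
          · exact ⟨1, Fin.ext (hp.trans (hprobe l 1).symm)⟩
        have h2 := hu (j', q)
        simp only [hm] at h2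
        rw [← hj', if_neg hq] at h2
        rw [← h2]
        refine sum_congr rfl fun k _ => ?_
        rw [Pi.mul_apply]
        ring
      ext j
      have h3 := congrFun h1 j
      exact (mul_eq_zero.1 h3).resolve_left (hd0 j)
    · rintro ⟨j', q⟩
      simp only [hm]
      split_ifs with hq
      · simp
      · rw [hS _ _ _ hq, cpTensor, one_mul]
        grind
    · intro N k
      rw [Fintype.sum_prod_type, ← hC N l (σ N k)]
      refine sum_congr rfl fun j _ => sum_congr rfl fun q _ => ?_
      simp only
      rw [Equiv.sum_comp (σ N) fun c' => m l j q * (A' N (pr l j) c' * B' N q c') * C' N l c']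
  have hsum : ∀ N, cpTensor (A' N) (B' N) (C' N) i q l =
      ∑ j, A' N i (σ N j) * B' N q (σ N j) * C' N l (σ N j) := fun N =>
    (Equiv.sum_comp (σ N) fun c => A' N i c * B' N q c * C' N l c).symm
  have hfin : cpTensor A B C i q l = ∑ j, A i j * (d j * B q j) * (C l j / d j) := by
    rw [cpTensor]
    grind
  rw [hfin]
  simp only [hsum]
  exact GeometricLimit.sum fun j _ => (hG i q j).mul (hlim l j)

end output

/-! ### Exact solution in a Krylov space -/

section krylovSpace
open scoped RealInnerProductSpace

/-- On `U` the operator is invertible, so its characteristic polynomial has nonzero constant term,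
and Cayley–Hamilton expresses `z` by its images under the positive powers. Only these are
computable, since `T z` is the known right-hand side while `z` is not. -/
theorem exists_krylov_combination {V : Type*} [NormedAddCommGroup V] [InnerProductSpace ℝ V]
    [FiniteDimensional ℝ V] {U : Submodule ℝ V} {T : V →ₗ[ℝ] V} (hT : ∀ x, T x ∈ U)
    (hinj : ∀ x ∈ U, T x = 0 → x = 0) {z : V} (hz : z ∈ U) {D : ℕ}
    (hD : Module.finrank ℝ V ≤ D) :
    ∃ y : ℕ → ℝ, ∑ t ∈ range D, y t • (T ^ (t + 1)) z = z := by
  set S : U →ₗ[ℝ] U := T.restrict fun x _ => hT x with hS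
  have hSpow : ∀ (k : ℕ) (x : U), (((S ^ k) x : U) : V) = (T ^ k) x := by
    intro k x
    induction k with
    | zero => rfl
    | succ k ih =>
      rw [pow_succ', pow_succ', Module.End.mul_apply, Module.End.mul_apply, ← ih]
      rfl
  have hker : LinearMap.ker S = ⊥ := by
    rw [LinearMap.ker_eq_bot']
    intro x hx
    exact Subtype.ext (hinj x x.2 (congrArg Subtype.val hx))
  have hc0 : S.charpoly.coeff 0 ≠ 0 := by
    intro h
    have h1 := LinearMap.det_eq_sign_charpoly_coeff S
    rw [h, mul_zero] at h1
    have h2 := LinearMap.bot_lt_ker_of_det_eq_zero h1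
    grind
  have hCH := LinearMap.aeval_self_charpoly S
  have hdeg : S.charpoly.natDegree ≤ D := by
    rw [LinearMap.charpoly_natDegree]
    exact (Submodule.finrank_le U).trans hD
  rw [Polynomial.aeval_eq_sum_range' (n := D + 1) (by omega), Finset.sum_range_succ'] at hCH
  refine ⟨fun t => -(S.charpoly.coeff 0)⁻¹ * S.charpoly.coeff (t + 1), ?_⟩
  have h1 := congrArg (fun F : U →ₗ[ℝ] U => ((F ⟨z, hz⟩ : U) : V)) hCH
  simp only [LinearMap.add_apply, LinearMap.sum_apply, LinearMap.smul_apply, pow_zero,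
    Module.End.one_apply, LinearMap.zero_apply, Submodule.coe_add, Submodule.coe_sum,
    Submodule.coe_smul, Submodule.coe_zero, hSpow] at h1
  simp only [mul_smul, ← smul_sum]
  rw [eq_neg_of_add_eq_zero_left h1, smul_neg, neg_smul, neg_neg, smul_smul,
    inv_mul_cancel₀ hc0, one_smul]

variable {m n : ℕ} {μ : Fin m → Fin m → Fin n → Fin n → ℝ} {M : Stack m n}
  {P : Set (Fin m × Fin n × Fin n)}

theorem sum_supported {δ : Stack m n} (hδ : stackVec δ ∈ supportedIn P) (G : Fin m → Fin n → Fin n → ℝ)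
    [DecidablePred (· ∈ P)] :
    ∑ i, ∑ p, ∑ s, δ i p s * (if (i, p, s) ∈ P then G i p s else 0) =
      ∑ i, ∑ p, ∑ s, δ i p s * G i p s := by
  refine sum_congr rfl fun i _ => sum_congr rfl fun p _ =>
    sum_congr rfl fun s _ => ?_
  split_ifs with h
  · rfl
  · have := hδ _ h
    rw [stackVec_apply] at this
    simp_all

/-- The solution of the coupled Sylvester equations is the combination of Krylov vectors
determined by the normal equations. -/
theorem krylov_solution [DecidablePred (· ∈ P)] (hμ : SymmetricWeight μ)
    (hinj : ∀ δ ∈ supportedIn P, sylvVec μ M δ = 0 → δ = 0) {z : Stack m n}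
    (hz : stackVec z ∈ supportedIn P) (hzc : sylvVec μ M (stackVec z) = sylvConst μ M)
    {K : ℕ → Stack m n}
    (hK0 : ∀ i p s, K 0 i p s = if (i, p, s) ∈ P then ∑ j, ∑ q, μ i j p q ^ 2 *
      (M i * (M j)ᵀ - M j * (M i)ᵀ) p q * M j q s else 0)
    (hKs : ∀ t i p s, K (t + 1) i p s = if (i, p, s) ∈ P then ∑ j, ∑ q, μ i j p q ^ 2 *
      sylv M (K t) i j p q * M j q s else 0) {D : ℕ} (hD : m * (n * n) ≤ D) :
    (∃ y : ℕ → ℝ, ∀ t < D,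
      ∑ t' ∈ range D, (∑ i, ∑ p, ∑ s, K t i p s * K (t' + 1) i p s) * y t' =
        ∑ i, ∑ p, ∑ s, K t i p s * K 0 i p s) ∧
    ∀ y : ℕ → ℝ, (∀ t < D,
      ∑ t' ∈ range D, (∑ i, ∑ p, ∑ s, K t i p s * K (t' + 1) i p s) * y t' =
        ∑ i, ∑ p, ∑ s, K t i p s * K 0 i p s) →
      ∀ i p s, ∑ t ∈ range D, y t * K t i p s = z i p s := by
  set T : EuclideanSpace ℝ (Fin m × Fin n × Fin n) →ₗ[ℝ]
      EuclideanSpace ℝ (Fin m × Fin n × Fin n) :=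
    { toFun := fun v => WithLp.toLp 2 fun x => if x ∈ P then ∑ j, ∑ q, μ x.1 j x.2.1 q ^ 2 *
        sylv M (stackVec.symm v) x.1 j x.2.1 q * M j q x.2.2 else 0
      map_add' := fun v w => by
        ext x
        simp only [map_add, sylv_add, Matrix.add_apply, mul_add, add_mul, sum_add_distrib,
          PiLp.add_apply]
        split_ifs <;> simp
      map_smul' := fun a v => by
        ext x
        simp only [map_smul, sylv_smul, Matrix.smul_apply, smul_eq_mul, PiLp.smul_apply,
          RingHom.id_apply]
        split_ifs
        · simp only [mul_sum]
          exact sum_congr rfl fun j _ => sum_congr rfl fun q _ => by ring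
        · rw [mul_zero] } with hTdef
  have hTU : ∀ v, T v ∈ supportedIn P := fun v x hx => if_neg hx
  -- `T` is the normal operator, compressed to the unknown positions; the factor `4` comes from the
  -- four equal terms of `sylv`. It is therefore definite on the supported vectors.
  have hTX : ∀ X δ : Stack m n, stackVec δ ∈ supportedIn P →
      4 * ⟪T (stackVec X), stackVec δ⟫ = ⟪sylvVec μ M (stackVec X), sylvVec μ M (stackVec δ)⟫ := by
    intro X δ hδ
    have hs : ∀ i j p q, sylv M X j i p q = - sylv M X i j p q ∧ sylv M X i j q p = - sylv M X i j p q := by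
      intro i j p q
      have hT : ∀ A B : Mat n n, (A * Bᵀ) q p = (B * Aᵀ) p q := by
        intro A B
        simp only [mul_apply, transpose_apply]
        exact sum_congr rfl fun s _ => mul_comm _ _
      constructor <;> simp only [sylv, Matrix.sub_apply, Matrix.add_apply, hT] <;> ring
    have e1 : ⟪sylvVec μ M (stackVec X), sylvVec μ M (stackVec δ)⟫ =
        ∑ i, ∑ j, ∑ p, ∑ q, (μ i j p q ^ 2 * sylv M X i j p q) * sylv M δ i j p q := by
      rw [PiLp.inner_apply]
      simp only [Fintype.sum_prod_type, sylvVec_apply, RCLike.inner_apply, conj_trivial]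
      exact sum_congr rfl fun i _ => sum_congr rfl fun j _ =>
        sum_congr rfl fun p _ => sum_congr rfl fun q _ => by ring
    rw [e1, sum_mul_sylv
      (fun i j p q => by rw [(hμ i j p q).1, (hs i j p q).1, mul_neg])
      (fun i j p q => by rw [(hμ i j p q).2, (hs i j p q).2, mul_neg]), PiLp.inner_apply]
    congr 1
    rw [← sum_supported hδ fun i p s => ∑ j, ∑ q, μ i j p q ^ 2 *
      sylv M X i j p q * M j q s]
    simp only [Fintype.sum_prod_type, RCLike.inner_apply, conj_trivial]
    rfl
  have hTinj : ∀ v ∈ supportedIn P, ⟪T v, v⟫ = 0 → v = 0 := by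
    intro v hv h
    obtain ⟨X, rfl⟩ := stackVec.surjective v
    have h1 := hTX X X hv
    rw [h, mul_zero] at h1
    exact hinj _ hv (inner_self_eq_zero.1 h1.symm)
  have hg : stackVec (K 0) = T (stackVec z) := by
    ext ⟨i, p, s⟩
    rw [stackVec_apply, hK0]
    simp only [hTdef, LinearMap.coe_mk, AddHom.coe_mk, LinearEquiv.symm_apply_apply]
    refine if_congr Iff.rfl (sum_congr rfl fun j _ => sum_congr rfl fun q _ => ?_) rfl
    have h1 : μ i j p q * sylv M z i j p q = μ i j p q * (M i * (M j)ᵀ - M j * (M i)ᵀ) p q :=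
      congrArg (fun v => v (i, j, p, q)) hzc
    linear_combination (- μ i j p q * M j q s) * h1
  have hK : ∀ t, stackVec (K t) = (T ^ (t + 1)) (stackVec z) := by
    intro t
    induction t with
    | zero => rw [hg, zero_add, pow_one]
    | succ t ih =>
      rw [pow_succ', Module.End.mul_apply, ← ih]
      ext ⟨i, p, s⟩
      rw [stackVec_apply, hKs]
      simp only [hTdef, LinearMap.coe_mk, AddHom.coe_mk, LinearEquiv.symm_apply_apply]
  have hKsucc : ∀ t, stackVec (K (t + 1)) = T (stackVec (K t)) := by
    intro t
    rw [hK, hK, pow_succ', Module.End.mul_apply]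
  have hKU : ∀ t, stackVec (K t) ∈ supportedIn P := by
    intro t
    rw [hK, pow_succ', Module.End.mul_apply]
    exact hTU _
  have hin : ∀ X Y : Stack m n, ∑ i, ∑ p, ∑ s, X i p s * Y i p s =
      ⟪stackVec Y, stackVec X⟫ := by
    intro X Y
    rw [PiLp.inner_apply]
    simp only [Fintype.sum_prod_type, RCLike.inner_apply, conj_trivial]
    rfl
  have hnorm : ∀ (y : ℕ → ℝ) (t : ℕ),
      (∑ t' ∈ range D, (∑ i, ∑ p, ∑ s, K t i p s * K (t' + 1) i p s) * y t' =
        ∑ i, ∑ p, ∑ s, K t i p s * K 0 i p s) ↔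
      ⟪T (∑ t' ∈ range D, y t' • stackVec (K t') - stackVec z), stackVec (K t)⟫ = 0 := by
    intro y t
    simp only [hin]
    rw [map_sub, inner_sub_left, sub_eq_zero, ← hg, map_sum, sum_inner]
    simp only [map_smul, inner_smul_left, ← hKsucc, conj_trivial, mul_comm]
  obtain ⟨y, hy⟩ := exists_krylov_combination (D := D) hTU
    (fun x hx h => hTinj x hx (by rw [h, inner_zero_left])) hz (by
      rw [finrank_euclideanSpace, Fintype.card_prod, Fintype.card_prod]
      simpa using hD)
  simp only [← hK] at hy
  refine ⟨⟨y, fun t _ => (hnorm y t).2 ?_⟩, fun y' hy' => ?_⟩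
  · rw [hy, sub_self, map_zero, inner_zero_left]
  -- The error lies in the span of the Krylov vectors, because `z` does, and its image under `T` is
  -- orthogonal to them; definiteness makes it zero. Dependent Krylov vectors are allowed.
  · have h1 : ∑ t ∈ range D, y' t • stackVec (K t) - stackVec z = 0 := by
      refine hTinj _ (Submodule.sub_mem _ (Submodule.sum_mem _ fun t _ =>
        Submodule.smul_mem _ _ (hKU t)) hz) ?_
      have h2 : ∑ t ∈ range D, y' t • stackVec (K t) - stackVec z =
          ∑ t ∈ range D, (y' t - y t) • stackVec (K t) := by
        simp only [sub_smul, sum_sub_distrib, hy]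
      nth_rw 2 [h2]
      rw [inner_sum]
      refine sum_eq_zero fun t ht => ?_
      rw [inner_smul_right, (hnorm y' t).1 (hy' t (mem_range.1 ht)), mul_zero]
    intro i p s
    have h2 := congrArg (fun v => v (i, p, s)) (sub_eq_zero.1 h1)
    simp only [stackVec_apply] at h2
    rw [← h2]
    simp [stackVec_apply]

end krylovSpace

/-! ### The noise as the unique solution of both linear systems -/

section exactSystems
variable {n r b : ℕ}

theorem outer_system (hn : 8 * (4 * b + 2) ≤ n) {A B : Mat n r}
    (C : Mat n r) (hB : Bᵀ * B = 1) {E : Tensor n} (hE : BandSupported b E) :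
    sylvVec (outerWeight b n) (fiveSlices b (cpTensor A B C + E)) (stackVec (outerNoise b E)) =
      sylvConst (outerWeight b n) (fiveSlices b (cpTensor A B C + E)) := by
  refine sub_eq_zero.1 ?_
  ext ⟨i, j, p, q⟩
  rw [sylvVec_sub_const, outerWeight]
  split_ifs with hq
  · simp
  · rw [res_outerNoise hn C hB hE hq]
    simp

theorem res_innerNoise (hn : 8 * (4 * b + 2) ≤ n) {A B : Mat n r}
    (C : Mat n r) (hA : Aᵀ * A = 1) {E : Tensor n} (hE : BandSupported b E)
    (i j : Fin 3) :
    res (flipStack (threeSlices b (cpTensor A B C + E) (outerNoise b E)))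
      (flipStack (innerNoise b E)) i j = 0 := by
  have e : evenPart (outerNoise b E - outerNoise b E) = 0 := by
    rw [sub_self]
    funext i
    fin_cases i <;> rfl
  have hI := innerNoise_inner (b := b) hE
  rw [threeSlices_eq, e, add_zero, res_flip_eq hI hI, evenSlices_comm hn C hA, sub_self]
  simp [sylv, flipStack]

theorem inner_system (hn : 8 * (4 * b + 2) ≤ n) {A B : Mat n r}
    (C : Mat n r) (hA : Aᵀ * A = 1) {E : Tensor n} (hE : BandSupported b E) :
    sylvVec (fun _ _ _ _ => 1)
      (flipStack (threeSlices b (cpTensor A B C + E) (outerNoise b E)))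
      (stackVec (flipStack (innerNoise b E))) =
    sylvConst (fun _ _ _ _ => 1)
      (flipStack (threeSlices b (cpTensor A B C + E) (outerNoise b E))) := by
  refine sub_eq_zero.1 ?_
  ext ⟨i, j, p, q⟩
  rw [sylvVec_sub_const, res_innerNoise hn C hA hE]
  simp

theorem inner_system_injective (hn : 8 * (4 * b + 2) ≤ n) {A B C : Mat n r}
    (hA : Aᵀ * A = 1) (hinj : Injective₂ b (cpTensor A B C)) {E : Tensor n}
    (hE : BandSupported b E) : ∀ δ ∈ supportedIn (innerSet b n),
      sylvVec (fun _ _ _ _ => 1)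
        (flipStack (threeSlices b (cpTensor A B C + E) (outerNoise b E))) δ = 0 → δ = 0 := by
  intro δ hδ h
  obtain ⟨X, rfl⟩ := stackVec.surjective δ
  have hX : IsInnerStack b (flipStack X) := stackVec_mem_innerSet.1 hδ
  have hI := innerNoise_inner (b := b) hE
  have h1 : innerNoise b E + flipStack X = innerNoise b E := by
    refine inner_eq_of_res hn hA hinj hE (fun i p q h => ?_) fun i j p q => ?_
    · rw [Pi.add_apply, Matrix.add_apply, hI i p q h, hX i p q h, add_zero]
    · rw [res_sub _ (flipStack (innerNoise b E)), res_innerNoise hn C hA hE, zero_add]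
      have e : flipStack (innerNoise b E + flipStack X) - flipStack (innerNoise b E) = X := by
        have : flipStack (innerNoise b E + flipStack X) = flipStack (innerNoise b E) + X := rfl
        rw [this, add_sub_cancel_left]
      rw [e]
      have := congrArg (fun v => v (i, j, p, q)) h
      simpa [sylvVec_apply] using this
  have h2 : flipStack X = 0 := by simpa using h1
  have h3 : X = 0 := congrArg flipStack h2
  rw [h3, map_zero]

end exactSystems

/-! ### Constants -/

/-- The values of the first registers after the initialization. -/
def constReg (n r b N x : ℕ) : ℕ :=
  [n, r, b, N, 2 * b + 1, 4 * b + 2, center b 0, center b 1, center b 2, center b 3, center b 4,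
    n * (5 * n), n * (5 * n) + 1].getD x 0

/-- The first registers hold the constants. -/
def Ready (n r b N : ℕ) (s : Memory) : Prop := ∀ x < 13, s.reg x = constReg n r b N x

/-- Five times an index. -/
def five (e : IndexExpr) : IndexExpr := e + e + e + e + e

@[simp] theorem five_eval (e : IndexExpr) (s : Memory) : (five e).eval s = 5 * e.eval s := by
  simp only [five, IndexExpr.eval_add]
  omega

/-- Compute the constants. -/
def initConst : Prog :=
  (Prog.setReg 4 (.reg 2 + .reg 2 + 1)).seq <| (Prog.setReg 5 (.reg 4 + .reg 4)).seq <|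
  (Prog.setReg 6 0).seq <| (Prog.setReg 7 (.reg 4)).seq <|
  (Prog.setReg 8 (.reg 7 + .reg 4)).seq <| (Prog.setReg 9 (.reg 8 + .reg 4)).seq <|
  (Prog.setReg 10 (.reg 9 + .reg 4)).seq <|
  (Prog.loop 20 (.reg 0) (.setReg 11 (.reg 11 + five (.reg 0)))).seq <|
  Prog.setReg 12 (.reg 11 + 1)

theorem initConst_mem (eig : EigenSolver) (s : Memory) (a : ℕ) :
    (initConst.exec eig s).mem a = s.mem a :=
  exec_frame_arr eig (A := []) rfl _ rfl

theorem initConst_ready (eig : EigenSolver) (n r b N : ℕ) (S : Tensor n) :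
    Ready n r b N (initConst.exec eig (input n r b N S)) := by
  simp only [initConst, exec_seq, exec_setReg]
  set t : Memory := (((((((input n r b N S).setReg 4 _).setReg 5 _).setReg 6 _).setReg 7 _).setReg
    8 _).setReg 9 _).setReg 10 _ with ht
  have h0 : t.reg 0 = n := by simp [ht, input]
  have := exec_loop_induction eig (s := t) (x := 20) (e := .reg 0)
    (c := .setReg 11 (.reg 11 + five (.reg 0)))
    (fun k u => u.reg 11 = k * (5 * n) ∧ ∀ x < 11, u.reg x = t.reg x)
    ⟨by simp [ht, input], fun _ _ => rfl⟩ (by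
      rintro k - u ⟨h1, h2⟩
      refine ⟨?_, fun x hx => ?_⟩
      · simp [exec_setReg, h1, h2 0, h0, add_mul]
      · rw [exec_setReg, Memory.setReg_reg, if_neg (by omega), Memory.setReg_reg,
          if_neg (by omega), h2 x hx])
  simp only [IndexExpr.eval, h0] at this
  intro x hx
  have hlow : ∀ x < 11, t.reg x = constReg n r b N x := by
    intro x hx
    interval_cases x <;> simp [ht, input, constReg, center] <;> omega
  rw [Memory.setReg_reg]
  split_ifs with h12
  · subst h12
    simp [this.1, constReg]
  · rcases Nat.lt_or_ge x 11 with h | h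
    · rw [this.2 x h, hlow x h]
    · obtain rfl : x = 11 := by omega
      exact this.1

section ready
variable {n r b N : ℕ} {s : Memory}

theorem Ready.setReg (h : Ready n r b N s) {x : ℕ} (hx : 13 ≤ x) (v : ℕ) :
    Ready n r b N (s.setReg x v) := fun y hy => by
  rw [Memory.setReg_reg, if_neg (by omega), h y hy]

theorem Ready.at (h : Ready n r b N s) (i j l : ℕ) : Ready n r b N (s.at i j l) :=
  ((h.setReg (by norm_num) _).setReg (by norm_num) _).setReg (by norm_num) _

theorem Ready.of_reg {t : Memory} (h : Ready n r b N s) (ht : ∀ x < 13, t.reg x = s.reg x) :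
    Ready n r b N t := fun x hx => (ht x hx).trans (h x hx)

theorem Ready.center (h : Ready n r b N s) {i : ℕ} (hi : i < 5) : s.reg (6 + i) = center b i := by
  rw [h _ (by omega)]
  interval_cases i <;> rfl

theorem Ready.exec (h : Ready n r b N s) (eig : EigenSolver) {c : Prog}
    (hc : c.writesReg (fun x => decide (13 ≤ x)) = true) : Ready n r b N (c.exec eig s) :=
  h.of_reg fun x hx => exec_frame_reg eig hc s (by simpa using hx)
end ready

/-! ### The two stages -/

/-- The parameters of a stage: the number of matrices, terms for the indicator function of the
unknown positions and for the weight, and the layout of the unknown entries of a row. -/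
structure Stage where
  J : ℕ
  sup : ℕ → IndexExpr → IndexExpr → Term
  wt : ℕ → ℕ → IndexExpr → IndexExpr → Term
  len : IndexExpr
  off : IndexExpr
  cen : ℕ → ℕ

/-- The `4b + 2` slots of a row form two windows of `2b + 1` columns, around the number of the row
and around the center. The offset `3b + 1` places slot `2b + 1` at column `center - b`. -/
def outerStage : Stage where
  J := 5
  sup x p c := case5 x fun i => (1 - indNear (.reg 2 + .reg 2) p (.reg (6 + i))) *
    indBand (.reg 2) (.reg (6 + i)) p c
  wt x y p q := case5 x fun i => case5 y fun j => 1 -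
    indOr (indNear (.reg 2 + .reg 2) p q) (indOr (indNear (.reg 2 + .reg 2) p (.reg (6 + i)))
      (indOr (indNear (.reg 2 + .reg 2) q (.reg (6 + i)))
        (indOr (indNear (.reg 2 + .reg 2) p (.reg (6 + j)))
          (indNear (.reg 2 + .reg 2) q (.reg (6 + j))))))
  len := .reg 4
  off := .reg 2 + .reg 4
  cen i := 6 + i

/-- The matrices are stored transposed, so `p` is a column and `c` a row of the original. All slots
form one window around the center, whose `4b + 1` positions fit into `4b + 2` slots; the centers are
those with even numbers. -/
def innerStage : Stage where
  J := 3
  sup x p c := case5 x fun i => indNear (.reg 2 + .reg 2) c (.reg (6 + (i + i))) *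
    indBand (.reg 2) (.reg (6 + (i + i))) c p
  wt _ _ _ _ := 1
  len := 0
  off := .reg 2 + .reg 2
  cen i := 6 + (i + i)

/-- The column in the slot number `t` of the row `l` of the matrix `i`. -/
def Stage.column (σ : Stage) (s : Memory) (i l t : ℕ) : ℕ :=
  if t < σ.len.eval s then l + t - s.reg 2 else s.reg (σ.cen i) + t - σ.off.eval s

open Classical in
/-- The terms compute the unknown positions `Q` and the weight `m`. -/
structure Stage.Sound (σ : Stage) (n r b N : ℕ) (Q : ℕ → ℕ → ℕ → Prop)
    (m : ℕ → ℕ → ℕ → ℕ → ℝ) : Prop where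
  eq : σ = outerStage ∨ σ = innerStage
  sup : ∀ s, Ready n r b N s → ∀ x p c, s.reg x < σ.J →
    (σ.sup x p c).eval s = if Q (s.reg x) (p.eval s) (c.eval s) then 1 else 0
  wt : ∀ s, Ready n r b N s → ∀ x y p q, s.reg x < σ.J → s.reg y < σ.J →
    (σ.wt x y p q).eval s = m (s.reg x) (s.reg y) (p.eval s) (q.eval s)
  cover : ∀ s, Ready n r b N s → ∀ i < σ.J, ∀ l c, Q i l c →
    ∃ t < 4 * b + 2, σ.column s i l t = c
  symm : ∀ i j p q, m j i p q = m i j p q ∧ m i j q p = m i j p q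

open Classical in
theorem ind_mul_ind (P Q : Prop) [Decidable P] [Decidable Q] :
    ((if P then 1 else 0) * (if Q then 1 else 0) : ℝ) = if P ∧ Q then 1 else 0 := by
  grind

open Classical in
theorem sub_ind_mul_ind (P Q : Prop) [Decidable P] [Decidable Q] :
    ((1 - if P then 1 else 0) * (if Q then 1 else 0) : ℝ) = if ¬ P ∧ Q then 1 else 0 := by
  grind

theorem outerStage_sound (n r b N : ℕ) : outerStage.Sound n r b N (IsOuter b)
    (fun i j p q => if InQuad b (center b i) (center b j) p q then 0 else 1) := by
  refine ⟨Or.inl rfl, fun s hs x p c hx => ?_, fun s hs x y p q hx hy => ?_,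
    fun s hs i hi l c h => ?_, fun i j p q => ?_⟩
  · change s.reg x < 5 at hx
    have h2 : s.reg 2 + s.reg 2 = 2 * b := by rw [hs 2 (by norm_num), two_mul]; rfl
    simp only [outerStage, case5_eval _ _ _ hx, Term.eval_mul, Term.eval_sub, indNear_eval,
      indBand_eval, IndexExpr.eval, IndexExpr.eval_add, hs.center hx, h2, Term.eval_one,
      sub_ind_mul_ind]
    rw [hs 2 (by norm_num)]
    congr
  · change s.reg x < 5 at hx
    change s.reg y < 5 at hy
    have h2 : s.reg 2 = b := hs 2 (by norm_num)
    have h3 : (IndexExpr.reg 2 + .reg 2).eval s = 2 * b := by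
      simp only [IndexExpr.eval_add, IndexExpr.eval, h2, two_mul]
    have hn := fun p q => indNear_eval (.reg 2 + .reg 2) p q s
    simp only [h3] at hn
    have h4 : ∀ i < 5, (IndexExpr.reg (6 + i)).eval s = center b i := fun i hi => hs.center hi
    simp only [outerStage, case5_eval _ _ _ hx, case5_eval _ _ _ hy, Term.eval_sub]
    rw [indOr_eval (hn _ _) (indOr_eval (hn _ _) (indOr_eval (hn _ _) (indOr_eval (hn _ _)
      (hn _ _)))), h4 _ hx, h4 _ hy, Term.eval_ofNat, Nat.cast_one]
    split_ifs <;> norm_num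
  · have h2 : s.reg 2 = b := hs 2 (by norm_num)
    have h4 : s.reg 4 = 2 * b + 1 := hs 4 (by norm_num)
    simp only [Stage.column, outerStage, IndexExpr.eval, IndexExpr.eval_add, h2, h4, hs.center hi]
    by_cases h1 : Near b l c
    · exact ⟨c + b - l, by simp only [Near] at h1; omega,
        by grind⟩
    · obtain ⟨h5, h6 | h6 | h6⟩ := h
      · exact absurd h6 h1
      · grind
      · refine ⟨c + (3 * b + 1) - center b i, by simp only [Near] at h6; omega, ?_⟩
        grind
  grind

theorem innerStage_sound (n r b N : ℕ) : innerStage.Sound n r b N (fun i p c => IsInner b i c p)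
    (fun _ _ _ _ => 1) := by
  refine ⟨Or.inr rfl, fun s hs x p c hx => ?_, fun s hs x y p q hx hy => by simp [innerStage],
    fun s hs i hi l c h => ?_, fun i j p q => ⟨rfl, rfl⟩⟩
  · change s.reg x < 3 at hx
    have h2 : s.reg 2 + s.reg 2 = 2 * b := by rw [hs 2 (by norm_num), two_mul]; rfl
    simp only [innerStage, case5_eval x _ s (by omega), Term.eval_mul, indNear_eval, indBand_eval,
      IndexExpr.eval, IndexExpr.eval_add, hs.center (show s.reg x + s.reg x < 5 by omega), h2,
      ind_mul_ind]
    rw [hs 2 (by norm_num), ← two_mul]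
    congr
  · change i < 3 at hi
    have h2 : s.reg 2 = b := hs 2 (by norm_num)
    simp only [Stage.column, innerStage, IndexExpr.eval, IndexExpr.eval_add, h2,
      hs.center (show i + i < 5 by omega), IndexExpr.eval_zero]
    rw [← two_mul, ← two_mul]
    have := h.1
    simp only [Near] at this
    exact ⟨c + 2 * b - center b (2 * i), by omega, by rw [if_neg] <;> omega⟩

/-! ### Alternating least squares -/

theorem Memory.stack_congr {s t : Memory} {J n a : ℕ} (h : s.mem a = t.mem a) :
    s.stack J n a = t.stack J n a := by
  funext i
  ext p q
  simp only [Memory.stack, of_apply, h]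

namespace Stage
variable (σ : Stage)

/-- The value of `F` at the column in the slot `t` of the row in the register `22` of the matrix
in the register `21`, and zero if this slot is empty. -/
def gather (t : IndexExpr) (F : IndexExpr → Term) : Term :=
  let G := fun c => .ite (.indexLe (c + 1) (.reg 0)) (σ.sup 21 (.reg 22) c * F c) 0
  .ite (.indexLe (t + 1) σ.len) (G (.reg 22 + t - .reg 2))
    (case5 21 fun i => G (.reg (σ.cen i) + t - σ.off))

/-- The weight in the least squares problem of a row. -/
def rowWeight : Term :=
  (1 - indOr (indEq (.reg regI) (.reg 21)) (indEq (.reg regJ) (.reg 22))) *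
    σ.wt 21 regI (.reg 22) (.reg regJ)

/-- Minimize over the row in the register `22` of the matrix in the register `21`. The data are
in the array `21`, the current matrices `X` in the array `24`, and the products
`(X i - M i / 2) * (M j)ᵀ` in the array `26`. -/
def block : Prog :=
  (assign 25 0 (.lit σ.J) 0 (.reg 0) 0 (.reg 5)
    (σ.gather (.reg regK) fun c => .get 21 (.reg regI) (.reg regJ) c)).seq <|
  (assign 8 0 (.lit σ.J) 0 (.reg 0) 0 (.reg 5)
    (σ.rowWeight * .get 25 (.reg regI) (.reg regJ) (.reg regK))).seq <|
  (assign 9 0 (.lit σ.J) 0 (.reg 0) 0 1 (0 - σ.rowWeight *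
    (.get 26 (five (.reg 21) + .reg regI) (.reg 22) (.reg regJ) -
      .get 26 (five (.reg 21) + .reg regI) (.reg regJ) (.reg 22) +
      .get 26 (five (.reg regI) + .reg 21) (.reg regJ) (.reg 22) -
      .get 26 (five (.reg regI) + .reg 21) (.reg 22) (.reg regJ)))).seq <|
  (leastSquares σ.J 5).seq <|
  (assign 27 0 (.lit σ.J) 0 (.reg 0) 0 1
    (.get 26 (five (.reg 21) + .reg regI) (.reg 22) (.reg regJ) +
      .sum 36 (.reg 5) (.get 25 (.reg regI) (.reg regJ) (.reg 36) * vecGet 13 36))).seq <|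
  (assign 26 (five (.reg 21)) (.lit σ.J) (.reg 22) 1 0 (.reg 0)
    (.get 27 (.reg regI) (.reg regK) 0)).seq <|
  (assign 28 0 (.reg 0) 0 1 0 1 (.get 24 (.reg 21) (.reg 22) (.reg regI) +
    .sum 36 (.reg 5) (σ.gather (.reg 36) (fun c => indEq c (.reg regI)) * vecGet 13 36))).seq <|
  assign 24 (.reg 21) 1 (.reg 22) 1 0 (.reg 0) (.get 28 (.reg regK) 0 0)

end Stage

namespace Stage.Sound
variable {σ : Stage} {n r b N : ℕ} {Q : ℕ → ℕ → ℕ → Prop} {m : ℕ → ℕ → ℕ → ℕ → ℝ}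

theorem column_eq (h : σ.Sound n r b N Q m) {s t : Memory} (hs : Ready n r b N s)
    (ht : Ready n r b N t) {i : ℕ} (hi : i < σ.J) (l u : ℕ) :
    σ.column s i l u = σ.column t i l u := by
  have hr : ∀ x < 13, s.reg x = t.reg x := fun x hx => (hs x hx).trans (ht x hx).symm
  rcases h.eq with rfl | rfl
  · change i < 5 at hi
    simp [Stage.column, outerStage, hr 2, hr 4, hr (6 + i) (by omega)]
  · change i < 3 at hi
    simp [Stage.column, innerStage, hr 2, hr (6 + (i + i)) (by omega)]

theorem le_five (h : σ.Sound n r b N Q m) : σ.J ≤ 5 := by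
  rcases h.eq with rfl | rfl <;> decide

open Classical in
theorem gather_eval (h : σ.Sound n r b N Q m) {s : Memory} (hs : Ready n r b N s)
    (hi : s.reg 21 < σ.J) (t : IndexExpr) {F : IndexExpr → Term} {f : ℕ → ℝ}
    (hF : ∀ e, (F e).eval s = f (e.eval s)) {c : ℕ}
    (hc : c = σ.column s (s.reg 21) (s.reg 22) (t.eval s)) : (σ.gather t F).eval s =
      if c < n ∧ Q (s.reg 21) (s.reg 22) c then f c else 0 := by
  have hG : ∀ e : IndexExpr, (Term.ite (.indexLe (e + 1) (.reg 0))
      (σ.sup 21 (.reg 22) e * F e) 0).eval s =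
      if e.eval s < n ∧ Q (s.reg 21) (s.reg 22) (e.eval s) then f (e.eval s) else 0 := by
    intro e
    have h0 : s.reg 0 = n := hs 0 (by norm_num)
    rw [Term.eval_ite, Term.eval_mul, h.sup s hs _ _ _ hi, hF, Term.eval_zero]
    simp only [Test.Holds, IndexExpr.eval_add, IndexExpr.eval_zero, IndexExpr.eval_one, IndexExpr.eval, h0,
      Nat.add_one_le_iff]
    grind
  rw [Stage.gather, Term.eval_ite, case5_eval _ _ _ (hi.trans_le h.le_five), hG, hG]
  simp only [Test.Holds, IndexExpr.eval_add, IndexExpr.eval_sub, IndexExpr.eval_zero, IndexExpr.eval_one,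
    IndexExpr.eval, Nat.add_one_le_iff]
  by_cases ht : t.eval s < σ.len.eval s
  · rw [if_pos ht, hc, Stage.column, if_pos ht]; congr
  · rw [if_neg ht, hc, Stage.column, if_neg ht]; congr

theorem rowWeight_eval (h : σ.Sound n r b N Q m) {s : Memory} (hs : Ready n r b N s)
    (hi : s.reg 21 < σ.J) (hj : s.reg regI < σ.J) : σ.rowWeight.eval s =
      if s.reg regI = s.reg 21 ∨ s.reg regJ = s.reg 22 then 0 else
        m (s.reg 21) (s.reg regI) (s.reg 22) (s.reg regJ) := by
  rw [Stage.rowWeight, Term.eval_mul, Term.eval_sub, h.wt s hs _ _ _ _ hi hj,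
    indOr_eval (indEq_eval _ _ _) (indEq_eval _ _ _), Term.eval_one]
  change (1 - if s.reg regI = s.reg 21 ∨ s.reg regJ = s.reg 22 then (1 : ℝ) else 0) *
    m (s.reg 21) (s.reg regI) (s.reg 22) (s.reg regJ) = _
  split_ifs <;> simp

/-- The array `26` holds the products `(X i - M i / 2) * (M j)ᵀ`. -/
def _root_.HoldsProducts (J n : ℕ) (s : Memory) : Prop := ∀ (i j : Fin J) (p q : Fin n),
  s.mem 26 (5 * i + j) p q = ∑ u : Fin n, (s.mem 24 i p u - s.mem 21 i p u / 2) * s.mem 21 j q u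

/-- The residual is `sylv` applied to `X - M / 2`, so four stored products give an entry of it. A
row update changes one line of these products for each `j`, with `4b + 2` terms per entry, which
keeps a sweep within `n ^ 2 (b + 1) ^ 2` steps up to a constant. -/
theorem _root_.HoldsProducts.res {J : ℕ} {s : Memory} (h : HoldsProducts J n s) (i j : Fin J)
    (p q : Fin n) : s.mem 26 (5 * i + j) p q - s.mem 26 (5 * i + j) q p +
      s.mem 26 (5 * j + i) q p - s.mem 26 (5 * j + i) p q =
      res (s.stack J n 21) (s.stack J n 24) i j p q := by
  rw [h i j p q, h i j q p, h j i q p, h j i p q]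
  simp only [_root_.res, sylv, Matrix.sub_apply, Matrix.add_apply, mul_apply,
    transpose_apply, Memory.stack, of_apply, ← sum_sub_distrib,
    ← sum_add_distrib]
  grind

set_option maxHeartbeats 1000000 in
-- The least-squares problem is set up from the old residuals and yields the increments of the row,
-- not the row itself. Adding them to `X` and adding their products with the data to the stored
-- products preserves the invariant.
theorem block_spec (h : σ.Sound n r b N Q m) (eig : EigenSolver) {s : Memory}
    (hs : Ready n r b N s) (i : Fin σ.J) (l : Fin n) (h21 : s.reg 21 = i) (h22 : s.reg 22 = l)
    (hY : HoldsProducts σ.J n s) :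
    IsBlockMin (sylvObj (fun i j p q => m i j p q) (s.stack σ.J n 21))
      (rowBlock {x | Q x.1 x.2.1 x.2.2} i l) (s.stack σ.J n 24)
      ((σ.block.exec eig s).stack σ.J n 24) ∧ HoldsProducts σ.J n (σ.block.exec eig s) := by
  classical
  have h0 : s.reg 0 = n := hs 0 (by norm_num)
  have h5 : s.reg 5 = 4 * b + 2 := hs 5 (by norm_num)
  have hi := i.2
  have hJ := h.le_five
  set col : ℕ → ℕ := σ.column s i l with hcol
  set ok : ℕ → Prop := fun t => col t < n ∧ Q i l (col t) with hok
  set M := s.stack σ.J n 21 with hM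
  set X := s.stack σ.J n 24 with hX
  set ν : ℕ → ℕ → ℝ := fun j q => if j = i ∨ q = l then 0 else m i j l q with hν
  obtain ⟨s8, hu⟩ : ∃ u, u = σ.block.exec eig s := ⟨_, rfl⟩
  rw [← hu]
  obtain ⟨s1, hu, r1, f1, w1⟩ := of_eq_assign_seq hu (by rcases h.eq with rfl | rfl <;> rfl)
  have hs1 : Ready n r b N s1 := hs.of_reg fun x hx => r1 x (by omega)
  have v1 : ∀ j < σ.J, ∀ q < n, ∀ t < 4 * b + 2,
      s1.mem 25 j q t = if ok t then s.mem 21 j q (col t) else 0 := by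
    intro j hj q hq t ht
    rw [w1 j q t hj (by simpa [h0]) (by simpa [h5]), h.gather_eval (hs.at _ _ _) (by simp [h21]) _
      (f := fun c => s.mem 21 j q c) (c := col t) (by intro e; simp)]
    · simp [h21, h22, hok]
    · rw [h.column_eq (hs.at j q t) hs (by simp [h21])]
      simp [h21, h22, hcol]
  obtain ⟨s2, hu, r2, f2, w2⟩ := of_eq_assign_seq hu (by rcases h.eq with rfl | rfl <;> rfl)
  have hs2 : Ready n r b N s2 := hs1.of_reg fun x hx => r2 x (by omega)
  have v2 : ∀ j < σ.J, ∀ q < n, ∀ t < 4 * b + 2,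
      s2.mem 8 j q t = ν j q * if ok t then s.mem 21 j q (col t) else 0 := by
    intro j hj q hq t ht
    rw [w2 j q t hj (by simpa [r1, h0]) (by simpa [r1, h5]), Term.eval_mul,
      h.rowWeight_eval (hs1.at _ _ _) (by simp [r1, h21]) (by simpa)]
    simp [r1, h21, h22, v1 j hj q hq t ht, hν]
  obtain ⟨s3, hu, r3, f3, w3⟩ := of_eq_assign_seq hu (by rcases h.eq with rfl | rfl <;> rfl)
  have v3 : ∀ (j : Fin σ.J) (q : Fin n), s3.mem 9 j q 0 = -(ν j q * res M X i j l q) := by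
    intro j q
    rw [w3 j q 0 j.2 (by simp [r2, r1, h0]) (by simp), Term.eval_sub, Term.eval_mul,
      h.rowWeight_eval (hs2.at _ _ _) (by simp [r2, r1, h21]) (by simp), ← hY.res]
    simp [r2, r1, h21, h22, f2, f1, hν]
  obtain ⟨s4, e4, hu⟩ := of_eq_seq hu
  have r4 : ∀ x < 29, s4.reg x = s.reg x := fun x hx => by
    rw [e4, leastSquares_reg eig _ _ _ hx, r3 x (by omega), r2 x (by omega), r1 x (by omega)]
  have f4 : ∀ a, [10, 11, 12, 13, 14, 15, 16, 17, 18, 20].contains a = false →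
      s4.mem a = s3.mem a := fun a ha => by rw [e4, leastSquares_frame eig _ _ _ ha]
  set y : ℕ → ℝ := fun t => s4.mem 13 t 0 0 with hy
  have v4 := leastSquares_spec eig σ.J 5 (by rcases h.eq with rfl | rfl <;> decide)
    (by decide) s3
  rw [← e4, r3, r3, r2, r2, r1, r1, h0, h5] at v4 <;> try norm_num
  obtain ⟨s5, hu, r5, f5, w5⟩ := of_eq_assign_seq hu rfl
  have v5 : ∀ j < σ.J, ∀ q < n, s5.mem 27 j q 0 = s.mem 26 (5 * i + j) l q +
      ∑ t ∈ range (4 * b + 2), (if ok t then s.mem 21 j q (col t) else 0) * y t := by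
    intro j hj q hq
    rw [w5 j q 0 hj (by simpa [r4, h0]) (by simp)]
    simp only [Term.eval_add, Term.eval_sum, Term.eval_mul, Term.eval, IndexExpr.eval_add,
      five_eval, IndexExpr.eval, vecGet, Memory.setReg_reg, Memory.at_reg, Memory.at_mem,
      Memory.setReg_mem]
    norm_num [r4, h21, h22, h5]
    rw [f4 26 rfl, f3 26 (by norm_num) (by norm_num), f2 26 (by norm_num) (by norm_num),
      f1 26 (by norm_num) (by norm_num), f4 25 rfl, f3 25 (by norm_num) (by norm_num),
      f2 25 (by norm_num) (by norm_num)]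
    congr 1
    exact sum_congr rfl fun t ht => by
      rw [v1 j hj q hq t (mem_range.1 ht)]; simp [hy]
  obtain ⟨s6, e6, hu⟩ := of_eq_seq hu
  obtain ⟨r6, f6, v6⟩ := of_eq_assign_offset e6 rfl
  obtain ⟨s7, hu, r7, f7, w7⟩ := of_eq_assign_seq hu (by rcases h.eq with rfl | rfl <;> rfl)
  have hr6 : ∀ x < 29, s6.reg x = s.reg x := fun x hx => by
    rw [r6 x (by omega), r5 x (by omega), r4 x hx]
  have hs6 : Ready n r b N s6 := hs.of_reg fun x hx => hr6 x (by omega)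
  have v7 : ∀ c < n, s7.mem 28 c 0 0 = s.mem 24 i l c +
      ∑ t ∈ range (4 * b + 2), if ok t ∧ col t = c then y t else 0 := by
    intro c hc
    rw [w7 c 0 0 (by simpa [hr6, h0]) (by simp) (by simp), Term.eval_add, Term.eval_sum]
    have hr5 : (IndexExpr.reg 5).eval (s6.at c 0 0) = 4 * b + 2 := by simp [hr6, h5]
    rw [hr5]
    congr 1
    · simp [hr6, h21, h22, f6, f5, f4, f3, f2, f1]
    · refine sum_congr rfl fun t _ => ?_
      have hrt : Ready n r b N ((s6.at c 0 0).setReg 36 t) :=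
        (hs6.at c 0 0).setReg (by norm_num) t
      rw [Term.eval_mul, h.gather_eval hrt (by simp [hr6, h21]) _
        (f := fun e => if e = c then 1 else 0) (c := col t) (by intro e; simp)]
      · have hyt : (vecGet 13 36).eval ((s6.at c 0 0).setReg 36 t) = y t := by
          simp [f6, f5, hy]
        rw [hyt]
        simp only [Memory.setReg_reg, Memory.at_reg]
        norm_num [hr6, h21, h22]
        by_cases h1 : ok t <;> by_cases h2 : col t = c <;> simp_all
      · rw [h.column_eq hrt hs (by simp [hr6, h21])]
        simp [h21, h22, hcol, hr6]
  obtain ⟨-, f8, v8⟩ := of_eq_assign_offset hu rfl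
  simp only [IndexExpr.eval, IndexExpr.eval_zero, IndexExpr.eval_one, five_eval, r7, hr6, r5, r4,
    h21, h22, h0, show (21 < 29) = True by simp, show (22 < 29) = True by simp,
    show (21 < 30) = True by simp, show (22 < 30) = True by simp, show (0 < 29) = True by simp,
    show (0 < 30) = True by simp] at v6 v8
  have w24 : ∀ i' : ℕ, ∀ p : ℕ, ∀ c < n, s8.mem 24 i' p c = s.mem 24 i' p c +
      if i' = i ∧ p = l then ∑ t ∈ range (4 * b + 2), (if ok t ∧ col t = c then y t else 0)
      else 0 := by
    intro i' p c hc
    rw [v8]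
    by_cases hc1 : i' = i ∧ p = l
    · rw [if_pos hc1, if_pos (by omega)]
      simp [hc1.1, hc1.2, v7 c hc]
    · rw [if_neg hc1, if_neg (by omega), add_zero, f7, f6, f5, f4, f3, f2, f1] <;>
        first | rfl | norm_num
  have m21 : s8.mem 21 = s.mem 21 := by
    rw [f8, f7, f6, f5, f4, f3, f2, f1] <;> first | rfl | norm_num
  have w26 : ∀ (i' j : Fin σ.J) (p q : Fin n), s8.mem 26 (5 * i' + j) p q =
      s.mem 26 (5 * i' + j) p q + if i' = i ∧ p = l then ∑ t ∈ range (4 * b + 2),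
        (if ok t then s.mem 21 j q (col t) else 0) * y t else 0 := by
    intro i' j p q
    have hj := j.2
    rw [f8 26 (by norm_num) (by norm_num), f7 26 (by norm_num) (by norm_num), v6]
    by_cases hc1 : i' = i ∧ p = l
    · have h1 := hc1.1
      have h2 := hc1.2
      rw [if_pos hc1, if_pos (by subst h1 h2; omega)]
      simp [hc1.1, hc1.2, v5 j j.2 q q.2]
    · rw [if_neg hc1, if_neg fun h1 => hc1 ⟨Fin.ext (by omega), Fin.ext (by omega)⟩, add_zero,
        f5, f4, f3, f2, f1] <;> first | rfl | norm_num
  -- Truncated subtraction and overlapping windows may put one column into several slots. This does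
  -- no harm: an entry changes by the sum of the values in its slots, only coverage is needed, and
  -- the normal equations stay consistent. Slots outside the matrix or at known entries are empty
  -- and have zero coefficients.
  refine ⟨isBlockMin_of_leastSquares (w := 4 * b + 2) (y := y)
    (slot := fun t => if hc : ok t then some ⟨col t, hc.1⟩ else none) (ν := fun j q => ν j q)
    (fun i j p q => h.symm i j p q) ?_ ?_ ?_ ?_ ?_, ?_⟩
  · intro t _ c hc
    by_cases h1 : ok t
    · rw [dif_pos h1, Option.some.injEq] at hc
      rw [← hc]
      exact h1.2
    · rw [dif_neg h1] at hc
      exact absurd hc (by simp)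
  · intro c hc
    obtain ⟨t, ht, htc⟩ := h.cover s hs i i.2 l c hc
    have h1 : ok t := ⟨by rw [hcol, htc]; exact c.2, by rw [hcol, htc]; exact hc⟩
    exact ⟨t, ht, by rw [dif_pos h1, Option.some.injEq]; exact Fin.ext htc⟩
  · intro j q
    simp only [hν, Fin.ext_iff]
  · intro i' p c
    change s8.mem 24 i' p c = s.mem 24 i' p c + _
    rw [w24 i' p c c.2]
    simp only [← Fin.ext_iff]
    congr 1
    refine if_congr Iff.rfl (sum_congr rfl fun t _ => ?_) rfl
    by_cases h1 : ok t
    · simp [h1, Fin.ext_iff]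
    · simp [h1]
  · intro t ht
    have := v4 t ht
    have hel : ∀ (t : ℕ) (j : Fin σ.J) (q : Fin n),
        ((if hc : ok t then some (⟨col t, hc.1⟩ : Fin n) else none).elim 0 (M j q)) =
          if ok t then s.mem 21 j q (col t) else 0 := by
      intro t j q
      by_cases h1 : ok t
      · rw [dif_pos h1, if_pos h1]; rfl
      · rw [dif_neg h1, if_neg h1]; rfl
    have hv8 : ∀ (j : Fin σ.J) (q : Fin n), ∀ t < 4 * b + 2, s3.mem 8 j q t =
        ν j q * if ok t then s.mem 21 j q (col t) else 0 := fun j q t ht => by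
      rw [f3 8 (by norm_num) (by norm_num), v2 j j.2 q q.2 t ht]
    rw [sum_range] at this
    simp only [hel]
    refine Eq.trans (sum_congr rfl fun j _ => ?_) this
    rw [sum_range (fun q => s3.mem 8 j q t * _)]
    refine sum_congr rfl fun q _ => ?_
    rw [hv8 j q t ht, v3 j q]
    congr 2
    refine sum_congr rfl fun t' ht' => ?_
    rw [hv8 j q t' (mem_range.1 ht')]
  · intro i' j p q
    rw [w26, m21, hY]
    simp only [w24 i' p _ (Fin.is_lt _), add_sub_right_comm, add_mul, sum_add_distrib]
    congr 1
    simp only [← Fin.ext_iff]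
    by_cases hc1 : i' = i ∧ p = l
    · simp only [if_pos hc1, sum_mul]
      rw [sum_comm]
      refine sum_congr rfl fun t _ => ?_
      by_cases h1 : ok t
      · simp only [h1, true_and, if_true]
        rw [sum_eq_single (⟨col t, h1.1⟩ : Fin n)]
        · simp [mul_comm]
        · intro u _ hu
          rw [if_neg fun h => hu (Fin.ext h.symm), zero_mul]
        · simp
      · simp [h1]
    · simp [if_neg hc1]

theorem _root_.take_succ_finRange {n k : ℕ} (hk : k < n) :
    (List.finRange n).take (k + 1) = (List.finRange n).take k ++ [⟨k, hk⟩] := by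
  rw [List.take_add_one, List.getElem?_eq_getElem (by simpa using hk)]
  simp

/-- The arrays that alternating least squares uses as work space. -/
abbrev _root_.workArrays : List ℕ :=
  [8, 9, 10, 11, 12, 13, 14, 15, 16, 17, 18, 20, 24, 25, 26, 27, 28]

theorem block_frames (h : σ.Sound n r b N Q m) : σ.block.writesArr workArrays = true ∧
    σ.block.writesReg (fun x => decide (29 ≤ x)) = true := by
  rcases h.eq with rfl | rfl <;> exact ⟨rfl, rfl⟩

/-- One sweep. -/
def _root_.Stage.sweep (σ : Stage) : Prog := .loop 21 (.lit σ.J) (.loop 22 (.reg 0) σ.block)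

theorem sweep_frames (h : σ.Sound n r b N Q m) : σ.sweep.writesArr workArrays = true ∧
    σ.sweep.writesReg (fun x => decide (21 ≤ x)) = true := by
  rcases h.eq with rfl | rfl <;> exact ⟨rfl, rfl⟩

theorem sweep_spec (h : σ.Sound n r b N Q m) (eig : EigenSolver) {s : Memory}
    (hs : Ready n r b N s) (hY : HoldsProducts σ.J n s) :
    IsSweep (sylvObj (fun i j p q => m i j p q) (s.stack σ.J n 21))
      (allRows {x | Q x.1 x.2.1 x.2.2}) (s.stack σ.J n 24)
      ((σ.sweep.exec eig s).stack σ.J n 24) ∧ HoldsProducts σ.J n (σ.sweep.exec eig s) := by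
  set f := sylvObj (fun i j p q => m i j p q) (s.stack σ.J n 21) with hf
  set P : Set (Fin σ.J × Fin n × Fin n) := {x | Q x.1 x.2.1 x.2.2} with hP
  have row : ∀ (i : Fin σ.J) (t : Memory), Ready n r b N t → t.mem 21 = s.mem 21 →
      t.reg 21 = i → HoldsProducts σ.J n t →
      IsSweep f ((List.finRange n).map fun l => rowBlock P i l) (t.stack σ.J n 24)
        (((Prog.loop 22 (.reg 0) σ.block).exec eig t).stack σ.J n 24) ∧
      Ready n r b N ((Prog.loop 22 (.reg 0) σ.block).exec eig t) ∧
      ((Prog.loop 22 (.reg 0) σ.block).exec eig t).mem 21 = s.mem 21 ∧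
      HoldsProducts σ.J n ((Prog.loop 22 (.reg 0) σ.block).exec eig t) := by
    intro i t ht h21 hi hYt
    have he : (IndexExpr.reg 0).eval t = n := ht 0 (by norm_num)
    have := exec_loop_induction eig (s := t) (x := 22) (e := .reg 0) (c := σ.block)
      (fun k u => IsSweep f (((List.finRange n).take k).map fun l => rowBlock P i l)
        (t.stack σ.J n 24) (u.stack σ.J n 24) ∧ Ready n r b N u ∧ u.mem 21 = s.mem 21 ∧
        u.reg 21 = i ∧ HoldsProducts σ.J n u) ⟨rfl, ht, h21, hi, hYt⟩ (by
      rintro k hk u ⟨u1, u2, u3, u4, u5⟩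
      rw [he] at hk
      obtain ⟨k1, k2⟩ := h.block_spec eig (s := u.setReg 22 k) (u2.setReg (by norm_num) k) i
        ⟨k, hk⟩ (by simp [u4]) (by simp) u5
      refine ⟨?_, (u2.setReg (by norm_num) k).of_reg fun x hx => exec_frame_reg eig
        h.block_frames.2 _ (by simp; omega), ?_, ?_, k2⟩
      · rw [take_succ_finRange hk, List.map_append, isSweep_append]
        refine ⟨_, u1, _, ?_, rfl⟩
        rwa [Memory.stack_congr (s := u.setReg 22 k) (t := s) u3] at k1
      · rw [exec_frame_arr eig h.block_frames.1 _ rfl, Memory.setReg_mem, u3]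
      · rw [exec_frame_reg eig h.block_frames.2 _ (by simp)]
        simp [u4])
    rw [he, List.take_of_length_le (by simp)] at this
    exact ⟨this.1, this.2.1, this.2.2.1, this.2.2.2.2⟩
  have := exec_loop_induction eig (s := s) (x := 21) (e := .lit σ.J)
    (c := .loop 22 (.reg 0) σ.block)
    (fun k u => IsSweep f (((List.finRange σ.J).take k).flatMap fun i =>
        (List.finRange n).map fun l => rowBlock P i l)
      (s.stack σ.J n 24) (u.stack σ.J n 24) ∧ Ready n r b N u ∧ u.mem 21 = s.mem 21 ∧
      HoldsProducts σ.J n u) ⟨rfl, hs, rfl, hY⟩ (by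
    rintro k hk u ⟨u1, u2, u3, u4⟩
    obtain ⟨k1, k2, k3, k4⟩ := row ⟨k, hk⟩ (u.setReg 21 k) (u2.setReg (by norm_num) k) u3
      (by simp) u4
    refine ⟨?_, k2, k3, k4⟩
    rw [take_succ_finRange (n := σ.J) hk, List.flatMap_append, isSweep_append]
    refine ⟨_, u1, ?_⟩
    rw [List.flatMap_singleton]
    exact k1)
  rw [show (IndexExpr.lit σ.J).eval s = σ.J from rfl,
    List.take_of_length_le (by simp)] at this
  exact ⟨this.1, this.2.2.2⟩

/-- Alternating least squares, with the number of sweeps in the register `3`. -/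
def _root_.Stage.als (σ : Stage) : Prog :=
  (assign 24 0 (.lit σ.J) 0 (.reg 0) 0 (.reg 0) 0).seq <|
  (Prog.loop 21 (.lit σ.J) (assign 26 (five (.reg 21)) (.lit σ.J) 0 (.reg 0) 0 (.reg 0)
    (.sum 36 (.reg 0) ((0 - .get 21 (.reg 21) (.reg regJ) (.reg 36) / .lit 2) *
      .get 21 (.reg regI) (.reg regK) (.reg 36))))).seq <|
  .loop 23 (.reg 3) σ.sweep

theorem als_spec (h : σ.Sound n r b N Q m) (eig : EigenSolver) {s : Memory}
    (hs : Ready n r b N s) : ∃ U : ℕ → Stack σ.J n, U 0 = 0 ∧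
      (∀ t, IsSweep (sylvObj (fun i j p q => m i j p q) (s.stack σ.J n 21))
        (allRows {x | Q x.1 x.2.1 x.2.2}) (U t) (U (t + 1))) ∧
      (σ.als.exec eig s).stack σ.J n 24 = U N := by
  have h0 : s.reg 0 = n := hs 0 (by norm_num)
  have hJ := h.le_five
  obtain ⟨u, hu⟩ : ∃ u, u = σ.als.exec eig s := ⟨_, rfl⟩
  rw [← hu]
  obtain ⟨s1, hu, r1, f1, v1⟩ := of_eq_assign_seq hu rfl
  obtain ⟨s2, hu, k1, k2, k3, k4⟩ := of_eq_loop_seq hu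
    (fun k u => (∀ i < k, ∀ j < σ.J, ∀ p < n, ∀ q < n, u.mem 26 (5 * i + j) p q =
        ∑ w ∈ range n, (0 - s.mem 21 i p w / 2) * s.mem 21 j q w) ∧
      Ready n r b N u ∧ u.mem 21 = s.mem 21 ∧ u.mem 24 = s1.mem 24)
    ⟨fun i hi => absurd hi (by omega), hs.of_reg fun x hx => r1 x (by omega),
      f1 _ (by norm_num) (by norm_num), rfl⟩ (by
    rintro k hk u ⟨u1, u2, u3, u4⟩ v hv
    have hu : Ready n r b N (u.setReg 21 k) := u2.setReg (by norm_num) k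
    have hu0 : u.reg 0 = n := u2 0 (by norm_num)
    obtain ⟨rv, fv, vv⟩ := of_eq_assign_offset hv rfl
    refine ⟨fun i hi j hj p hp q hq => ?_, hu.of_reg fun x hx => rv x (by omega),
      (fv _ (by norm_num) (by norm_num)).trans u3, (fv _ (by norm_num) (by norm_num)).trans u4⟩
    rw [vv]
    simp only [five_eval, IndexExpr.eval, IndexExpr.eval_zero, Memory.setReg_reg]
    simp only [zero_add, zero_le, true_and, hu0, hp, hq, if_true, ite_self, and_true,
      show (0 : ℕ) ≠ 21 by norm_num, if_false]
    rcases Nat.lt_succ_iff_lt_or_eq.1 hi with h1 | rfl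
    · rw [if_neg (by omega), Memory.setReg_mem, u1 i h1 j hj p hp q hq]
    · rw [if_pos (by omega)]
      simp [Memory.at_reg, hu0, u3])
  simp only [IndexExpr.eval, h0] at k1 v1
  have hY : HoldsProducts σ.J n s2 := by
    intro i j p q
    rw [k1 i i.2 j j.2 p p.2 q q.2, sum_range, k3]
    exact sum_congr rfl fun w _ => by
      simp [k4, v1 i p w i.2 p.2 w.2]
  set F : ℕ → Memory → Memory := fun k t => σ.sweep.exec eig (t.setReg 23 k) with hF
  have inv : ∀ k, Ready n r b N (iterFrom F k s2) ∧ (iterFrom F k s2).mem 21 = s.mem 21 ∧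
      HoldsProducts σ.J n (iterFrom F k s2) := by
    intro k
    induction k with
    | zero => exact ⟨k2, k3, hY⟩
    | succ k ih =>
      have hk : Ready n r b N ((iterFrom F k s2).setReg 23 k) := ih.1.setReg (by norm_num) k
      refine ⟨hk.of_reg fun x hx => exec_frame_reg eig h.sweep_frames.2 _ (by simp; omega), ?_,
        (h.sweep_spec eig hk ih.2.2).2⟩
      rw [iterFrom, hF, exec_frame_arr eig h.sweep_frames.1 _ rfl, Memory.setReg_mem, ih.2.1]
  refine ⟨fun k => (iterFrom F k s2).stack σ.J n 24, ?_, fun t => ?_, ?_⟩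
  · funext i
    ext p q
    change s2.mem 24 i p q = 0
    simp [k4, v1 i p q i.2 p.2 q.2]
  · have := (h.sweep_spec eig ((inv t).1.setReg (x := 23) (by norm_num) t) (inv t).2.2).1
    rwa [Memory.stack_congr (s := (iterFrom F t s2).setReg 23 t) (t := s) (inv t).2.1] at this
  · rw [hu, exec_loop]
    congr 2
    exact k2 3 (by norm_num)

end Stage.Sound

/-! ### Exact solution of the linear systems -/

open Classical in
/-- The iterates of the normal equations of a Sylvester-like system, started at `M / 2`. -/
noncomputable def normalIterate {m n : ℕ} (μ : Fin m → Fin m → Fin n → Fin n → ℝ)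
    (P : Set (Fin m × Fin n × Fin n)) (M : Stack m n) : ℕ → Stack m n
  | 0 => fun i => Matrix.of fun p q => M i p q / 2
  | t + 1 => fun i => Matrix.of fun p s => if (i, p, s) ∈ P then
      ∑ j, ∑ q, μ i j p q ^ 2 * sylv M (normalIterate μ P M t) i j p q * M j q s else 0

/-- The right-hand side of the system is `sylv` at `M / 2`. Starting there, one formula produces
both the right-hand side of the normal equations and the further Krylov vectors. -/
theorem sylv_half {m n : ℕ} (M : Stack m n) (i j : Fin m) :
    sylv M (fun i => Matrix.of fun p q => M i p q / 2) i j = M i * (M j)ᵀ - M j * (M i)ᵀ := by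
  have h : ∀ i, (Matrix.of fun p q => M i p q / 2) = (2⁻¹ : ℝ) • M i := fun i => by
    ext p q
    simp [div_eq_inv_mul]
  simp only [sylv, h, transpose_smul, smul_mul, Matrix.mul_smul]
  module

theorem Ready.lt {n r b N : ℕ} {s : Memory} (hs : Ready n r b N s) (p : Fin n) :
    (p : ℕ) < (IndexExpr.reg 0).eval s :=
  p.2.trans_eq (hs 0 (by norm_num)).symm

theorem Ready.assign_seq {n r b N : ℕ} {eig : EigenSolver} {s u : Memory} {a : ℕ}
    {e f g : IndexExpr} {E : Term} {c : Prog} (hs : Ready n r b N s)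
    (hu : u = ((assign a 0 e 0 f 0 g E).seq c).exec eig s)
    (h : assignOk a 0 e 0 f 0 g E = true) : ∃ t, u = c.exec eig t ∧ Ready n r b N t ∧
      (∀ a', a' ≠ a → a' ≠ 20 → t.mem a' = s.mem a') ∧
      ∀ p q v, p < e.eval s → q < f.eval s → v < g.eval s →
        t.mem a p q v = E.eval (s.at p q v) := by
  obtain ⟨t, ht, r, f, v⟩ := of_eq_assign_seq hu h
  exact ⟨t, ht, hs.of_reg fun x hx => r x (by omega), f, v⟩

namespace Stage
variable (σ : Stage)

/-- The array `30` holds the iterates, that of the number `t` of the matrix `i` as the slice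
`5 * t + i`. Compute the iterate after that whose number is in the register `21`. -/
def iterateStep : Prog :=
  (Prog.loop 22 (.lit σ.J) (assign 31 (five (.reg 22)) (.lit σ.J) 0 (.reg 0) 0 (.reg 0)
    (σ.wt 22 regI (.reg regJ) (.reg regK) * σ.wt 22 regI (.reg regJ) (.reg regK) *
      .sum 36 (.reg 0)
        (.get 30 (five (.reg 21) + .reg 22) (.reg regJ) (.reg 36) *
            .get 21 (.reg regI) (.reg regK) (.reg 36) -
          .get 21 (.reg regI) (.reg regJ) (.reg 36) *
            .get 30 (five (.reg 21) + .reg 22) (.reg regK) (.reg 36) +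
          .get 21 (.reg 22) (.reg regJ) (.reg 36) *
            .get 30 (five (.reg 21) + .reg regI) (.reg regK) (.reg 36) -
          .get 30 (five (.reg 21) + .reg regI) (.reg regJ) (.reg 36) *
            .get 21 (.reg 22) (.reg regK) (.reg 36))))).seq <|
  assign 30 (five (.reg 21 + 1)) (.lit σ.J) 0 (.reg 0) 0 (.reg 0)
    (σ.sup regI (.reg regJ) (.reg regK) * .sum 36 (.lit σ.J) (.sum 37 (.reg 0)
      (.get 31 (five (.reg regI) + .reg 36) (.reg regJ) (.reg 37) *
        .get 21 (.reg 36) (.reg 37) (.reg regK))))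

/-- Solve the system with the data in the array `21`, with the result in the array `24`. -/
def krylov : Prog :=
  (assign 30 0 (.lit σ.J) 0 (.reg 0) 0 (.reg 0)
    (.get 21 (.reg regI) (.reg regJ) (.reg regK) / .lit 2)).seq <|
  (Prog.loop 21 (.reg 12) σ.iterateStep).seq <|
  (assignMat 10 11 11 (.sum 36 (.lit σ.J) (.sum 37 (.reg 0) (.sum 38 (.reg 0)
    (.get 30 (five (.reg regI + 1) + .reg 36) (.reg 37) (.reg 38) *
      .get 30 (five (.reg regJ + 1 + 1) + .reg 36) (.reg 37) (.reg 38)))))).seq <|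
  (assignVec 11 11 (.sum 36 (.lit σ.J) (.sum 37 (.reg 0) (.sum 38 (.reg 0)
    (.get 30 (five (.reg regI + 1) + .reg 36) (.reg 37) (.reg 38) *
      .get 30 (five (0 + 1) + .reg 36) (.reg 37) (.reg 38)))))).seq <|
  (solve 11).seq <|
  assign 24 0 (.lit σ.J) 0 (.reg 0) 0 (.reg 0) (.sum 36 (.reg 11)
    (vecGet 13 36 * .get 30 (five (.reg 36 + 1) + .reg regI) (.reg regJ) (.reg regK)))

end Stage

namespace Stage.Sound
variable {σ : Stage} {n r b N : ℕ} {Q : ℕ → ℕ → ℕ → Prop} {m : ℕ → ℕ → ℕ → ℕ → ℝ}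

theorem iterateStep_spec (h : σ.Sound n r b N Q m) (eig : EigenSolver) {s : Memory}
    (hs : Ready n r b N s) {X : Stack σ.J n} {t : ℕ} (ht : s.reg 21 = t)
    (hX : ∀ (i : Fin σ.J) (p q : Fin n), s.mem 30 (5 * t + i) p q = X i p q) :
    let M := s.stack σ.J n 21
    let u := σ.iterateStep.exec eig s
    Ready n r b N u ∧ u.mem 21 = s.mem 21 ∧
      (∀ e < 5 * (t + 1), u.mem 30 e = s.mem 30 e) ∧
      ∀ (i : Fin σ.J) (p q : Fin n), u.mem 30 (5 * (t + 1) + i) p q =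
        (open Classical in if Q i p q then ∑ j : Fin σ.J, ∑ v : Fin n,
          m i j p v ^ 2 * sylv M X i j p v * M j v q else 0) := by
  classical
  intro M u
  have hJ := h.le_five
  obtain ⟨u', hu⟩ : ∃ u', u' = u := ⟨_, rfl⟩
  rw [← hu]
  obtain ⟨s1, hu, k1, k2, k3, k4, k5⟩ := of_eq_loop_seq hu
    (fun k u => (∀ i j : Fin σ.J, (i : ℕ) < k → ∀ p v : Fin n, u.mem 31 (5 * i + j) p v =
        m i j p v ^ 2 * sylv M X i j p v) ∧ Ready n r b N u ∧ u.reg 21 = t ∧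
        u.mem 21 = s.mem 21 ∧ u.mem 30 = s.mem 30)
    ⟨fun i j hi => absurd hi (by omega), hs, ht, rfl, rfl⟩ (by
    rintro k hk u ⟨u1, u2, u3, u4, u5⟩ v hv
    have hu : Ready n r b N (u.setReg 22 k) := u2.setReg (by norm_num) k
    have hu0 : u.reg 0 = n := u2 0 (by norm_num)
    obtain ⟨rv, fv, mv⟩ := of_eq_assign_offset hv (by rcases h.eq with rfl | rfl <;> rfl)
    refine ⟨fun i j hi p w => ?_, hu.of_reg fun x hx => rv x (by omega), ?_, ?_, ?_⟩
    · have hj := j.2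
      rw [mv]
      simp only [five_eval, IndexExpr.eval, IndexExpr.eval_zero, Memory.setReg_reg]
      simp only [zero_add, zero_le, true_and, hu0, Fin.is_lt, if_true, and_true,
        show (0 : ℕ) ≠ 22 by norm_num, if_false]
      rcases Nat.lt_succ_iff_lt_or_eq.1 hi with h1 | h1
      · rw [if_neg (by omega), Memory.setReg_mem, u1 i j h1 p w]
      · subst h1
        rw [if_pos (by omega), Term.eval_mul, Term.eval_mul,
          h.wt _ (hu.at _ _ _) _ _ _ _ (by simp) (by simp)]
        simp [hu0, u3, u4, u5, sum_range, hX, sylv, mul_apply,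
          Matrix.sub_apply, ← sum_sub_distrib, ← sum_add_distrib, M,
          Memory.stack, pow_two]
    · simp [rv, u3]
    · rw [fv 21 (by norm_num) (by norm_num), Memory.setReg_mem, u4]
    · rw [fv 30 (by norm_num) (by norm_num), Memory.setReg_mem, u5])
  obtain ⟨rv, fv, mv⟩ := of_eq_assign_offset hu (by rcases h.eq with rfl | rfl <;> rfl)
  have hk0 : s1.reg 0 = n := k2 0 (by norm_num)
  replace k1 := fun i j => k1 i j i.2
  have h5 : (five (.reg 21 + 1)).eval s1 = 5 * (t + 1) := by simp [k3]
  rw [h5] at mv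
  refine ⟨k2.of_reg fun x hx => rv x (by omega), ?_, fun e he => ?_, fun i p q => ?_⟩
  · rw [fv 21 (by norm_num) (by norm_num), k4]
  · funext p q
    rw [mv, if_neg (by omega), k5]
  · simp only [IndexExpr.eval_zero, zero_add, Nat.sub_zero] at mv
    rw [mv, if_pos (by simp [hk0]), Nat.add_sub_cancel_left, Term.eval_mul, h.sup _ (k2.at _ _ _) _ _ _ (by simp)]
    by_cases hQ : Q i p q
    · simp [hQ, hk0, sum_range, k1, k4, M, Memory.stack]
    · simp [hQ]

/-- The dimension bound is `D = 5 n ^ 2`, held in register `11`, which covers both stages since they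
have at most five matrices. The loop runs `D + 1` times because the equations pair the first `D`
Krylov vectors with the images of the same vectors. -/
theorem krylov_spec (h : σ.Sound n r b N Q m) (eig : EigenSolver) {s : Memory}
    (hs : Ready n r b N s) {z : Stack σ.J n}
    (hinj : ∀ δ ∈ supportedIn {x : Fin σ.J × Fin n × Fin n | Q x.1 x.2.1 x.2.2},
      sylvVec (fun i j p q => m i j p q) (s.stack σ.J n 21) δ = 0 → δ = 0)
    (hz : stackVec z ∈ supportedIn {x : Fin σ.J × Fin n × Fin n | Q x.1 x.2.1 x.2.2})
    (hzc : sylvVec (fun i j p q => m i j p q) (s.stack σ.J n 21) (stackVec z) =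
      sylvConst (fun i j p q => m i j p q) (s.stack σ.J n 21)) :
    (σ.krylov.exec eig s).stack σ.J n 24 = z := by
  classical
  have hJ := h.le_five
  have h0 : s.reg 0 = n := hs 0 (by norm_num)
  set M := s.stack σ.J n 21 with hM
  set P : Set (Fin σ.J × Fin n × Fin n) := {x | Q x.1 x.2.1 x.2.2} with hP
  set V := normalIterate (fun i j p q => m i j p q) P M with hV
  set D := n * (5 * n) with hD
  obtain ⟨u, hu⟩ : ∃ u, u = σ.krylov.exec eig s := ⟨_, rfl⟩
  rw [← hu]
  obtain ⟨s1, hu, r1, f1, v1⟩ := hs.assign_seq hu rfl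
  obtain ⟨s2, hu, v2, r2, -⟩ := of_eq_loop_seq hu
    (fun k u => (∀ t ≤ k, ∀ (i : Fin σ.J) (p q : Fin n), u.mem 30 (5 * t + i) p q = V t i p q) ∧
      Ready n r b N u ∧ u.mem 21 = s.mem 21)
    (by
      refine ⟨fun t ht i p q => ?_, r1, f1 _ (by norm_num) (by norm_num)⟩
      obtain rfl : t = 0 := by omega
      rw [mul_zero, zero_add, v1 i p q i.2 (hs.lt p) (hs.lt q)]
      simp [hV, normalIterate, hM, Memory.stack])
    (by
      rintro k - u ⟨u1, u2, u3⟩ _ rfl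
      obtain ⟨k1, k2, k3, k4⟩ := h.iterateStep_spec eig (s := u.setReg 21 k)
        (u2.setReg (by norm_num) k) (X := V k) (by simp) (u1 k le_rfl)
      refine ⟨fun t ht i p q => ?_, k1, k2.trans u3⟩
      rcases Nat.lt_succ_iff_lt_or_eq.1 (Nat.lt_succ_of_le ht) with h1 | rfl
      · have hi := i.2
        rw [k3 _ (by omega)]
        exact u1 t (by omega) i p q
      · rw [k4, Memory.stack_congr (s := u.setReg 21 k) (t := s) u3]
        simp only [hV, normalIterate, hP, of_apply, Set.mem_ofPred_eq]
        congr)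
  rw [show (IndexExpr.reg 12).eval s1 = D + 1 from r1 12 (by norm_num)] at v2
  have h11 : s2.reg 11 = D := r2 11 (by norm_num)
  have h20 : s2.reg 0 = n := r2 0 (by norm_num)
  obtain ⟨s3, hu, r3, f3, v3⟩ := of_eq_assign_seq hu (by rcases h.eq with rfl | rfl <;> rfl)
  replace v3 : ∀ t < D, ∀ t' < D, s3.mem 10 t t' 0 =
      ∑ i, ∑ p, ∑ q, V (t + 1) i p q * V (t' + 1 + 1) i p q := by
    intro t ht t' ht'
    rw [v3 t t' 0 (by simpa [h11]) (by simpa [h11]) (by simp)]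
    simp [h20, sum_range, v2 (t + 1) (by omega), v2 (t' + 1 + 1) (by omega)]
  obtain ⟨s4, hu, r4, f4, v4⟩ := of_eq_assign_seq hu (by rcases h.eq with rfl | rfl <;> rfl)
  replace v4 : ∀ t < D, s4.mem 11 t 0 0 =
      ∑ i, ∑ p, ∑ q, V (t + 1) i p q * V (0 + 1) i p q := by
    intro t ht
    rw [v4 t 0 0 (by simpa [r3, h11]) (by simp) (by simp)]
    have := v2 1 (by omega)
    norm_num at this
    simp [r3, h20, sum_range, f3, v2 (t + 1) (by omega), this]
  -- Iterate `0` is the auxiliary `M / 2`, so Krylov vector number `t` is iterate `t + 1`.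
  obtain ⟨hex, hsol⟩ := krylov_solution (P := P) (M := M) (K := fun t => V (t + 1)) (D := D)
    (fun i j p q => h.symm i j p q) hinj hz hzc
    (fun i p s => by
      simp only [hV, normalIterate, of_apply, sylv_half]) (fun t i p s => by
      simp only [hV, normalIterate, of_apply]) (by rw [hD]; nlinarith)
  have hm10 : ∀ t < D, ∀ x : ℕ → ℝ, ∑ t' ∈ range D, s4.mem 10 t t' 0 * x t' =
      ∑ t' ∈ range D, (∑ i, ∑ p, ∑ q, V (t + 1) i p q * V (t' + 1 + 1) i p q) * x t' :=
    fun t ht x => sum_congr rfl fun t' ht' => by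
      rw [f4 10 (by norm_num) (by norm_num), v3 t ht t' (mem_range.1 ht')]
  have hsv := solve_spec eig 11 (by decide) s4
  rw [r4 11 (by norm_num), r3 11 (by norm_num), h11] at hsv
  obtain ⟨x, hx⟩ := hex
  replace hsv := hsv ⟨x, fun t ht => by rw [hm10 t ht, hx t ht, v4 t ht]⟩
  obtain ⟨s5, e5, hu⟩ := of_eq_seq hu
  rw [← e5] at hsv
  have hy := hsol (fun t => s5.mem 13 t 0 0) fun t ht => by
    rw [← hm10 t ht, hsv t ht, v4 t ht]
  have r5 : ∀ x < 29, s5.reg x = s2.reg x := fun x hx => by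
    rw [e5, exec_frame_reg eig (p := fun x => decide (29 ≤ x)) rfl _ (by simpa using hx),
      r4 x (by omega), r3 x (by omega)]
  have f5 : s5.mem 30 = s2.mem 30 := by
    rw [e5, exec_frame_arr eig (A := [12, 13, 14, 15, 16, 17, 18, 20]) rfl _ rfl, f4, f3] <;>
      norm_num
  funext i
  ext p q
  rw [← hy i p q]
  refine ((of_eq_assign hu rfl).2.2 i p q i.2 (by simp [r5, h20]) (by simp [r5, h20])).trans ?_
  rw [Term.eval_sum, show (IndexExpr.reg 11).eval (s5.at i p q) = D by simp [r5, h11]]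
  refine sum_congr rfl fun t ht => ?_
  simp [f5, v2 (t + 1) (by have := mem_range.1 ht; omega)]

end Stage.Sound

/-! ### The programs -/

/-- The data of the first stage. -/
def outerData : Term := case5 regI fun i => .get 0 (.reg regJ) (.reg regK) (.reg (6 + i))

/-- The data of the second stage, transposed. -/
def innerData : Term := case5 regI fun i => .get 0 (.reg regK) (.reg regJ) (.reg (6 + (i + i))) -
  .get 4 (.reg regI + .reg regI) (.reg regK) (.reg regJ)

/-- Both stages with the method `f`: the outcomes are stored in the arrays `4` and `5`, the
denoised first slice `T` in the array `33`, and `T * Tᵀ` in the array `34`. -/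
def bothStages (f : Stage → Prog) : Prog :=
  (assign 21 0 5 0 (.reg 0) 0 (.reg 0) outerData).seq <|
  (f outerStage).seq <|
  (assign 4 0 5 0 (.reg 0) 0 (.reg 0) (.get 24 (.reg regI) (.reg regJ) (.reg regK))).seq <|
  (assign 21 0 3 0 (.reg 0) 0 (.reg 0) innerData).seq <|
  (f innerStage).seq <|
  (assign 5 0 3 0 (.reg 0) 0 (.reg 0) (.get 24 (.reg regI) (.reg regK) (.reg regJ))).seq <|
  (assign 33 0 (.reg 0) 0 (.reg 0) 0 1 (.get 0 (.reg regI) (.reg regJ) 0 -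
    .get 4 0 (.reg regI) (.reg regJ) - .get 5 0 (.reg regI) (.reg regJ))).seq <|
  assign 34 0 (.reg 0) 0 (.reg 0) 0 1 (.sum 36 (.reg 0)
    (.get 33 (.reg regI) (.reg 36) 0 * .get 33 (.reg regJ) (.reg 36) 0))

/-- The outcome of both stages. -/
structure StagesDone {n : ℕ} (r b N : ℕ) (S : Tensor n) (eig : EigenSolver) (f : Stage → Prog)
    (s : Memory) : Prop where
  ready : Ready n r b N s
  tensor : ∀ (p q : Fin n) (k : ℕ), s.mem 0 p q k = slice S k p q
  outer : ∃ t, Ready n r b N t ∧ t.stack 5 n 21 = fiveSlices b S ∧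
    s.stack 5 n 4 = ((f outerStage).exec eig t).stack 5 n 24
  inner : ∃ t, Ready n r b N t ∧
    t.stack 3 n 21 = flipStack (threeSlices b S (s.stack 5 n 4)) ∧
    flipStack (s.stack 3 n 5) = ((f innerStage).exec eig t).stack 3 n 24
  slice : ∀ p q : Fin n, s.mem 33 p q 0 = (fiveSlices b S 0 - s.stack 5 n 4 0 - s.stack 3 n 5 0) p q
  gram : ∀ p q : Fin n, s.mem 34 p q 0 = ∑ v : Fin n, s.mem 33 p v 0 * s.mem 33 q v 0

theorem bothStages_spec {n r b N : ℕ} {S : Tensor n} (eig : EigenSolver) {f : Stage → Prog}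
    {A : List ℕ} (hA : ∀ a ∈ [0, 4], A.contains a = false)
    (hf : ∀ σ ∈ [outerStage, innerStage], (f σ).writesArr A = true ∧
      (f σ).writesReg (fun x => decide (13 ≤ x)) = true) {s : Memory} (hs : Ready n r b N s)
    (h0 : ∀ (p q : Fin n) (k : ℕ), s.mem 0 p q k = slice S k p q) :
    StagesDone r b N S eig f ((bothStages f).exec eig s) := by
  obtain ⟨u, hu⟩ : ∃ u, u = (bothStages f).exec eig s := ⟨_, rfl⟩
  rw [← hu]
  obtain ⟨s1, hu, hs1, f1, v1⟩ := hs.assign_seq hu rfl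
  obtain ⟨s2, e2, hu⟩ := of_eq_seq hu
  have hs2 : Ready n r b N s2 := e2 ▸ hs1.exec eig (hf outerStage (by simp)).2
  obtain ⟨s3, hu, hs3, f3, v3⟩ := hs2.assign_seq hu rfl
  obtain ⟨s4, hu, hs4, f4, v4⟩ := hs3.assign_seq hu rfl
  obtain ⟨s5, e5, hu⟩ := of_eq_seq hu
  have hs5 : Ready n r b N s5 := e5 ▸ hs4.exec eig (hf innerStage (by simp)).2
  obtain ⟨s6, hu, hs6, f6, v6⟩ := hs5.assign_seq hu rfl
  obtain ⟨s7, hu, hs7, f7, v7⟩ := hs6.assign_seq hu rfl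
  obtain ⟨r8, f8, v8⟩ := of_eq_assign hu rfl
  have g2 : ∀ a ∈ [0, 4], s2.mem a = s1.mem a := fun a ha => by
    rw [e2, exec_frame_arr eig (hf outerStage (by simp)).1 _ (hA a ha)]
  have g5 : ∀ a ∈ [0, 4], s5.mem a = s4.mem a := fun a ha => by
    rw [e5, exec_frame_arr eig (hf innerStage (by simp)).1 _ (hA a ha)]
  have m3 : s3.mem 0 = s.mem 0 := by
    rw [f3, g2, f1] <;> norm_num
  have m6 : s6.mem 0 = s.mem 0 := by
    rw [f6, g5, f4, m3] <;> norm_num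
  have m4 : s6.mem 4 = s3.mem 4 := by
    rw [f6, g5, f4] <;> norm_num
  have m84 : u.mem 4 = s3.mem 4 := by
    rw [f8, f7, m4] <;> norm_num
  have m85 : u.mem 5 = s6.mem 5 := by
    rw [f8, f7] <;> norm_num
  have l5 : ∀ s : Memory, (5 : IndexExpr).eval s = 5 := fun _ => rfl
  have l3 : ∀ s : Memory, (3 : IndexExpr).eval s = 3 := fun _ => rfl
  refine ⟨hs7.of_reg fun x hx => r8 x (by omega), fun p q k => ?_, ⟨s1, hs1, ?_, ?_⟩,
    ⟨s4, hs4, ?_, ?_⟩, fun p q => ?_, fun p q => ?_⟩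
  · rw [f8, f7, m6, h0] <;> norm_num
  · funext i
    ext p q
    have hi := i.2
    refine (v1 i p q (by rw [l5]; omega) (hs.lt _) (hs.lt _)).trans ?_
    rw [outerData, case5_eval _ _ _ (by simp)]
    simp [Memory.at_reg, fiveSlices, h0, hs.center hi,
      show ¬ (6 + (i : ℕ) = 32) by omega, show ¬ (6 + (i : ℕ) = 31) by omega,
      show ¬ (6 + (i : ℕ) = 30) by omega]
  · funext i
    ext p q
    rw [Memory.stack_congr m84, ← e2]
    exact (v3 i p q (by rw [l5]; omega) (hs2.lt _) (hs2.lt _)).trans (by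
      simp [Memory.stack])
  · funext i
    ext p q
    have hi := i.2
    refine (v4 i p q (by rw [l3]; omega) (hs3.lt _) (hs3.lt _)).trans ?_
    rw [innerData, case5_eval _ _ _ (by simp; omega), Memory.stack_congr m84]
    simp only [Term.eval_sub, Term.eval, IndexExpr.eval, IndexExpr.eval_add, Memory.at_reg,
      Memory.at_mem]
    norm_num [m3, h0]
    rw [if_neg (by omega), if_neg (by omega), if_neg (by omega), hs3.center (by omega)]
    fin_cases i <;> rfl
  · funext i
    ext p q
    rw [flipStack, transpose_apply, Memory.stack, of_apply, m85, ← e5,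
      v6 i q p (by rw [l3]; omega) (hs5.lt _) (hs5.lt _)]
    simp [Memory.stack]
  · rw [f8 33 (by norm_num) (by norm_num), v7 p q 0 (hs6.lt _) (hs6.lt _)
      (by simp), Memory.stack_congr m84, Memory.stack_congr m85, ← Memory.stack_congr m4]
    have : (0 : ℕ) = center b 0 := by simp [center]
    simp [Memory.at_reg, m6, h0, fiveSlices, Memory.stack, center]
  · rw [v8 p q 0 (hs7.lt _) (hs7.lt _) (by simp), f8 33 (by norm_num) (by norm_num)]
    have := hs7 0 (by norm_num)
    simp [Memory.at_reg, sum_range, show s7.reg 0 = n from this]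

/-- The value of `F` at the position with the number in the register `regJ` of the probing row
with the number in the register `regI` of the slice with the number in the register `21`. -/
def probeTerm (F : IndexExpr → Term) : Term :=
  let G := fun p => (1 - indBand (.reg 2) (.reg 21) p (.reg regJ)) * F p
  .ite (.indexLe (.reg 21 + .reg 21 + 1) (.reg 0)) (G (.reg 0 - 1 - .reg regI)) (G (.reg regI))

theorem probeTerm_eval {n r b N : ℕ} {s : Memory} (hs : Ready n r b N s) {F : IndexExpr → Term}
    {f : ℕ → ℝ} (hF : ∀ e, (F e).eval s = f (e.eval s)) {p : ℕ}
    (hp : p = probe n (s.reg 21) (s.reg regI)) : (probeTerm F).eval s =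
      (if InBand b (s.reg 21) p (s.reg regJ) then 0 else 1) * f p := by
  have h0 : s.reg 0 = n := hs 0 (by norm_num)
  have h2 : s.reg 2 = b := hs 2 (by norm_num)
  have hG : ∀ e : IndexExpr, ((1 - indBand (.reg 2) (.reg 21) e (.reg regJ)) * F e).eval s =
      (if InBand b (s.reg 21) (e.eval s) (s.reg regJ) then 0 else 1) * f (e.eval s) := by
    intro e
    rw [Term.eval_mul, Term.eval_sub, Term.eval_one, hF, indBand_eval]
    simp only [IndexExpr.eval, h2]
    split_ifs <;> simp
  have : Decidable ((Test.indexLe (.reg 21 + .reg 21 + 1) (.reg 0)).Holds s) := Nat.decLe _ _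
  rw [probeTerm, Term.eval_ite, hG, hG, hp, probe]
  have hc : (Test.indexLe (.reg 21 + .reg 21 + 1) (.reg 0)).Holds s ↔ 2 * s.reg 21 < n := by
    simp only [Test.Holds, IndexExpr.eval_add, IndexExpr.eval, IndexExpr.eval_one, h0]
    omega
  by_cases h : 2 * s.reg 21 < n
  · simp_all
  · rw [if_neg fun h' => h (hc.1 h'), if_neg h]
    rfl

/-- Fit every slice of the given tensor by the matrices in the array `32`, and store the
coefficients in the array `3`. -/
def fit : Prog := .loop 21 (.reg 0) <|
  (assign 8 0 2 0 (.reg 0) 0 (.reg 1) (probeTerm fun p => .get 32 (.reg regK) p (.reg regJ))).seq <|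
  (assign 9 0 2 0 (.reg 0) 0 1 (probeTerm fun p => .get 0 p (.reg regJ) (.reg 21))).seq <|
  (leastSquares 2 1).seq <|
  assign 3 (.reg 21) 1 0 (.reg 1) 0 1 (vecGet 13 regJ)

theorem fit_spec {n r b N : ℕ} (eig : EigenSolver) {s : Memory} (hs : Ready n r b N s) :
    ∀ l : Fin n, ∀ k < r, ∑ j ∈ range 2, ∑ q ∈ range n,
      (if InBand b l (probe n l j) q then 0 else 1) * s.mem 32 k (probe n l j) q *
      (∑ c ∈ range r, (if InBand b l (probe n l j) q then 0 else 1) *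
        s.mem 32 c (probe n l j) q * (fit.exec eig s).mem 3 l c 0 -
        (if InBand b l (probe n l j) q then 0 else 1) * s.mem 0 (probe n l j) q l) = 0 := by
  obtain ⟨u, hu, -, -, -, key⟩ := of_eq_loop_seq (u := fit.exec eig s) (c' := .skip) rfl
    (fun m t => Ready n r b N t ∧ t.mem 32 = s.mem 32 ∧ t.mem 0 = s.mem 0 ∧
      ∀ l < m, ∀ k < r, ∑ j ∈ range 2, ∑ q ∈ range n,
      (if InBand b l (probe n l j) q then 0 else 1) * s.mem 32 k (probe n l j) q *
      (∑ c ∈ range r, (if InBand b l (probe n l j) q then 0 else 1) *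
        s.mem 32 c (probe n l j) q * t.mem 3 l c 0 -
        (if InBand b l (probe n l j) q then 0 else 1) * s.mem 0 (probe n l j) q l) = 0)
    ⟨hs, rfl, rfl, fun l hl => absurd hl (by omega)⟩ (by
    rintro m hm t ⟨t1, t2, t3, t4⟩ s4 e4
    have hm' : m < n := by simpa [show s.reg 0 = n from hs 0 (by norm_num)] using hm
    obtain ⟨u, hu⟩ : ∃ u, u = t.setReg 21 m := ⟨_, rfl⟩
    have hur : Ready n r b N u := hu ▸ t1.setReg (by norm_num) m
    have h0 : u.reg 0 = n := hur 0 (by norm_num)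
    have h1 : u.reg 1 = r := hur 1 (by norm_num)
    have hu21 : u.reg 21 = m := by simp [hu]
    have hum : u.mem = t.mem := by rw [hu, Memory.setReg_mem]
    have l2 : ∀ s : Memory, (2 : IndexExpr).eval s = 2 := fun _ => rfl
    rw [← hu] at e4
    obtain ⟨s1, e4, r1, f1, v1⟩ := of_eq_assign_seq e4 rfl
    obtain ⟨s2, e4, r2, f2, v2⟩ := of_eq_assign_seq e4 rfl
    have hs1 : Ready n r b N s1 := hur.of_reg fun x hx => r1 x (by omega)
    obtain ⟨s3, e3, e4⟩ := of_eq_seq e4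
    have r3 : ∀ x < 29, s3.reg x = u.reg x := fun x hx => by
      rw [e3, leastSquares_reg eig _ _ _ hx, r2 x (by omega), r1 x (by omega)]
    obtain ⟨r4, g4, v4⟩ := of_eq_assign_offset e4 rfl
    have f4 : ∀ a, a ∈ [0, 32] → s4.mem a = s.mem a := by
      intro a ha
      simp only [List.mem_cons, List.not_mem_nil, or_false] at ha
      rw [g4 _ (by omega) (show a ≠ 20 by omega), e3,
        leastSquares_frame eig _ _ _ (by rcases ha with rfl | rfl <;> rfl),
        f2 _ (by omega) (by omega), f1 _ (by omega) (by omega), hum]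
      rcases ha with rfl | rfl
      exacts [t3, t2]
    refine ⟨hur.of_reg fun x hx => ?_, f4 32 (by simp), f4 0 (by simp), fun l hl k hk => ?_⟩
    · rw [r4 x (by omega), r3 x (by omega)]
    have w3 : ∀ c < r, s4.mem 3 l c 0 = if l = m then s3.mem 13 c 0 0 else t.mem 3 l c 0 := by
      intro c hc
      rw [v4]
      simp only [IndexExpr.eval, IndexExpr.eval_zero, IndexExpr.eval_one, r3 21 (by norm_num),
        r3 1 (by norm_num), h1, hu21]
      by_cases h : l = m
      · rw [if_pos (by omega), if_pos h]
        simp [Memory.at_reg]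
      · rw [if_neg (by omega), if_neg h, e3, leastSquares_frame eig _ _ _ rfl,
          f2 _ (by norm_num) (by norm_num), f1 _ (by norm_num) (by norm_num), hum]
    by_cases h : l = m
    · subst h
      have hls := leastSquares_spec eig 2 1 (by decide) (by decide) s2
      rw [← e3, r2 0 (by norm_num), r2 1 (by norm_num), r1 0 (by norm_num), r1 1 (by norm_num),
        h0, h1] at hls
      have v8 : ∀ j < 2, ∀ q < n, ∀ c < r, s2.mem 8 j q c =
          (if InBand b l (probe n l j) q then 0 else 1) * s.mem 32 c (probe n l j) q := by
        intro j hj q hq c hc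
        rw [f2 8 (by norm_num) (by norm_num), v1 j q c (by rwa [l2]) (by simpa [h0])
          (by simpa [h1]), probeTerm_eval (hur.at _ _ _)
          (f := fun p => s.mem 32 c p q) (p := probe n l j) (by intro e; simp [hum, t2])
          (by simp [hu21])]
        simp [hu21]
      have v9 : ∀ j < 2, ∀ q < n, s2.mem 9 j q 0 =
          (if InBand b l (probe n l j) q then 0 else 1) * s.mem 0 (probe n l j) q l := by
        intro j hj q hq
        rw [v2 j q 0 (by rwa [l2]) (by simpa [r1, h0]) (by simp),
          probeTerm_eval (hs1.at _ _ _) (f := fun p => s.mem 0 p q l) (p := probe n l j)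
          (by intro e; simp [f1, hum, t3, r1, hu21]) (by simp [r1, hu21])]
        simp [r1, hu21]
      refine Eq.trans (sum_congr rfl fun j hj => sum_congr rfl fun q hq => ?_)
        (hls k hk)
      have hsum : ∑ c ∈ range r, (if InBand b l (probe n l j) q then 0 else 1) *
          s.mem 32 c (probe n l j) q * s4.mem 3 l c 0 =
          ∑ c ∈ range r, s2.mem 8 j q c * s3.mem 13 c 0 0 :=
        sum_congr rfl fun c hc => by
          grind
      grind
    · refine Eq.trans (sum_congr rfl fun j _ => sum_congr rfl fun q _ => ?_)
        (t4 l (by omega) k hk)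
      have hsum : ∀ g : ℕ → ℝ, ∑ c ∈ range r, g c * s4.mem 3 l c 0 =
          ∑ c ∈ range r, g c * t.mem 3 l c 0 := fun g =>
        sum_congr rfl fun c hc => by rw [w3 c (mem_range.1 hc), if_neg h]
      rw [hsum fun c => _ * _])
  rw [hu, exec_skip]
  rw [show (IndexExpr.reg 0).eval s = n from hs 0 (by norm_num)] at key
  exact fun l => key l l.2

theorem fit_normal_equations {n r b N : ℕ} {S : Tensor n} (eig : EigenSolver) {s : Memory}
    (hs : Ready n r b N s) (h0 : ∀ (p q : Fin n) (k : ℕ), s.mem 0 p q k = slice S k p q)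
    {pr : Fin n → Fin 2 → Fin n} (hpr : ∀ l j, (pr l j : ℕ) = probe n l j)
    {m : Fin n → Fin 2 → Fin n → ℝ}
    (hm : ∀ l j q, m l j q = if InBand b l (pr l j) q then 0 else 1) {K : ℕ → Mat n n}
    (hK : ∀ k < r, ∀ p q : Fin n, s.mem 32 k p q = K k p q) (l : Fin n) (k : Fin r) :
    ∑ j, ∑ q, m l j q * K k (pr l j) q * (∑ c : Fin r, m l j q * K c (pr l j) q *
      (fit.exec eig s).mem 3 l c 0 - m l j q * S (pr l j) q l) = 0 := by
  rw [← fit_spec eig hs l k k.2, sum_range]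
  refine sum_congr rfl fun j _ => ?_
  rw [sum_range]
  refine sum_congr rfl fun q _ => ?_
  rw [sum_range, ← hpr, hK k k.2, h0, hm]
  congr 3
  · funext c
    rw [hK c c.2]
  · simp [slice]

/-- Fit all slices by the matrices `T, (T * Tᵀ) * T, (T * Tᵀ) ^ 2 * T, …`. -/
def krylovTail : Prog :=
  (assign 32 0 1 0 (.reg 0) 0 (.reg 0) (.get 33 (.reg regJ) (.reg regK) 0)).seq <|
  (Prog.loop 21 (.reg 1) <|
    (assign 35 0 (.reg 0) 0 (.reg 0) 0 1 (.sum 36 (.reg 0)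
      (.get 34 (.reg regI) (.reg 36) 0 * .get 32 (.reg 21) (.reg 36) (.reg regJ)))).seq <|
    assign 32 (.reg 21 + 1) 1 0 (.reg 0) 0 (.reg 0) (.get 35 (.reg regJ) (.reg regK) 0)).seq <|
  fit.seq <|
  assign 1 0 (.reg 0) 0 (.reg 0) 0 (.reg 0) (.sum 36 (.reg 1)
    (.get 3 (.reg regK) (.reg 36) 0 * .get 32 (.reg 36) (.reg regI) (.reg regJ)))

theorem krylovTail_spec {n r b N : ℕ} {S : Tensor n} (eig : EigenSolver) {s : Memory}
    (hs : Ready n r b N s) (h0 : ∀ (p q : Fin n) (k : ℕ), s.mem 0 p q k = slice S k p q)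
    {T : Mat n n} (h33 : ∀ p q : Fin n, s.mem 33 p q 0 = T p q)
    (h34 : ∀ p q : Fin n, s.mem 34 p q 0 = (T * Tᵀ) p q)
    {pr : Fin n → Fin 2 → Fin n} (hpr : ∀ l j, (pr l j : ℕ) = probe n l j)
    {m : Fin n → Fin 2 → Fin n → ℝ}
    (hm : ∀ l j q, m l j q = if InBand b l (pr l j) q then 0 else 1) :
    ∃ c : Fin n → Fin r → ℝ, (∀ (l : Fin n) (k : Fin r),
      ∑ j, ∑ q, m l j q * krylov T k (pr l j) q * (∑ c' : Fin r, m l j q *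
        krylov T c' (pr l j) q * c l c' - m l j q * S (pr l j) q l) = 0) ∧
      ∀ p q l, (krylovTail.exec eig s).tensor n 1 p q l = ∑ k, c l k * krylov T k p q := by
  obtain ⟨u, hu⟩ : ∃ u, u = krylovTail.exec eig s := ⟨_, rfl⟩
  rw [← hu]
  obtain ⟨s1, hu, hs1, f1, v1⟩ := hs.assign_seq hu rfl
  obtain ⟨s2, hu, key⟩ := of_eq_loop_seq hu
    (fun m t => Ready n r b N t ∧ t.mem 34 = s.mem 34 ∧ t.mem 0 = s.mem 0 ∧
      ∀ k ≤ m, ∀ p q : Fin n, t.mem 32 k p q = krylov T k p q)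
    ⟨hs1, f1 _ (by norm_num) (by norm_num), f1 _ (by norm_num) (by norm_num), fun k hk p q => by
      rw [Nat.le_zero.1 hk, v1 0 p q (by simp) (hs.lt _) (hs.lt _)]
      simp [h33, krylov]⟩ (by
    rintro m - t ⟨t1, t2, t3, t4⟩ v hv
    have hur : Ready n r b N (t.setReg 21 m) := t1.setReg (by norm_num) m
    obtain ⟨s3, hv, r3, f3, v3⟩ := of_eq_assign_seq hv rfl
    have hs3 : Ready n r b N s3 := hur.of_reg fun x hx => r3 x (by omega)
    obtain ⟨r4, f4, v4⟩ := of_eq_assign_offset hv rfl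
    refine ⟨hs3.of_reg fun x hx => r4 x (by omega), ?_, ?_, fun k hk p q => ?_⟩
    · rw [f4 _ (by norm_num) (by norm_num), f3 _ (by norm_num) (by norm_num), Memory.setReg_mem, t2]
    · rw [f4 _ (by norm_num) (by norm_num), f3 _ (by norm_num) (by norm_num), Memory.setReg_mem, t3]
    have a0 : s3.reg 0 = n := hs3 0 (by norm_num)
    have b0 : t.reg 0 = n := t1 0 (by norm_num)
    have a21 : s3.reg 21 = m := (r3 21 (by norm_num)).trans (by simp)
    rw [v4]
    simp only [IndexExpr.eval, IndexExpr.eval_zero, IndexExpr.eval_one, IndexExpr.eval_add,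
      a21, a0]
    by_cases h : k = m + 1
    · subst h
      rw [if_pos (by have := p.2; have := q.2; omega)]
      have := v3 p q 0 (hur.lt _) (hur.lt _) (by simp)
      simp [this, krylov, mul_apply, b0, sum_range, t2, h34, t4 m le_rfl]
    · rw [if_neg (by omega), f3 _ (by norm_num) (by norm_num), Memory.setReg_mem, t4 k (by omega)])
  rw [show (IndexExpr.reg 1).eval s1 = r from hs1 1 (by norm_num)] at key
  obtain ⟨s3, e3, hu⟩ := of_eq_seq hu
  have hs3 : Ready n r b N s3 := e3 ▸ key.1.exec eig rfl
  refine ⟨fun l k => s3.mem 3 l k 0, fun l k => ?_, fun p q l => ?_⟩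
  · rw [e3]
    exact fit_normal_equations eig key.1 (fun p q k => by rw [key.2.2.1, h0]) hpr hm
      (fun k hk => key.2.2.2 k hk.le) l k
  · rw [Memory.tensor, (of_eq_assign hu rfl).2.2 p q l (hs3.lt _) (hs3.lt _) (hs3.lt _)]
    have m32 : s3.mem 32 = s2.mem 32 := by
      rw [e3]
      exact exec_frame_arr eig (A := [3, 8, 9, 10, 11, 12, 13, 14, 15, 16, 17, 18, 20]) rfl _ rfl
    simp [show s3.reg 1 = r from hs3 1 (by norm_num), sum_range, m32,
      fun v : Fin r => key.2.2.2 v v.2.le]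

/-- Find `A` from the spectral decomposition of `T * Tᵀ`, ordered by decreasing eigenvalues, and
`B = Tᵀ * A`, and fit all slices by the matrices `aₖ * bₖᵀ`. -/
def spectralTail : Prog :=
  (Prog.eigen (.reg 0) 34 36 37).seq <|
  (assign 38 0 (.reg 0) 0 1 0 1 (.sum 36 (.reg 0)
    (.ite (.realLe (.get 37 (.reg 36) 0 0) (.get 37 (.reg regI) 0 0))
      (.ite (.realLe (.get 37 (.reg regI) 0 0) (.get 37 (.reg 36) 0 0))
        (indLe (.reg 36 + 1) (.reg regI)) 0) 1))).seq <|
  (assign 39 0 (.reg 0) 0 1 0 1 (.sum 36 (.reg 0) (indLe (.reg 36 + 1) (.reg regI)))).seq <|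
  (assign 1 0 (.reg 0) 0 (.reg 1) 0 1 (.sum 36 (.reg 0)
    (.ite (.realLe (.get 38 (.reg 36) 0 0) (.get 39 (.reg regJ) 0 0))
      (.ite (.realLe (.get 39 (.reg regJ) 0 0) (.get 38 (.reg 36) 0 0))
        (.get 36 (.reg regI) (.reg 36) 0) 0) 0))).seq <|
  (assign 2 0 (.reg 0) 0 (.reg 1) 0 1 (.sum 36 (.reg 0)
    (.get 33 (.reg 36) (.reg regI) 0 * .get 1 (.reg 36) (.reg regJ) 0))).seq <|
  (assign 32 0 (.reg 1) 0 (.reg 0) 0 (.reg 0)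
    (.get 1 (.reg regJ) (.reg regI) 0 * .get 2 (.reg regK) (.reg regI) 0)).seq fit

theorem spectralTail_spec {n r b N : ℕ} {S : Tensor n} (eig : EigenSolver) {s : Memory}
    (hrn : r ≤ n) (hs : Ready n r b N s)
    (h0 : ∀ (p q : Fin n) (k : ℕ), s.mem 0 p q k = slice S k p q)
    {T : Mat n n} (h33 : ∀ p q : Fin n, s.mem 33 p q 0 = T p q)
    (h34 : ∀ p q : Fin n, s.mem 34 p q 0 = (T * Tᵀ) p q)
    {pr : Fin n → Fin 2 → Fin n} (hpr : ∀ l j, (pr l j : ℕ) = probe n l j)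
    {m : Fin n → Fin 2 → Fin n → ℝ}
    (hm : ∀ l j q, m l j q = if InBand b l (pr l j) q then 0 else 1)
    {u : Memory} (hu : u = spectralTail.exec eig s) :
    ∃ (V : Mat n n) (w : Fin n → ℝ), Vᵀ * V = 1 ∧
      T * Tᵀ = V * diagonal w * Vᵀ ∧
      (∀ p c, u.matrix n r 1 p c = ∑ k, if rank w k = c then V p k else 0) ∧
      (∀ q c, u.matrix n r 2 q c = ∑ p, T p q * u.matrix n r 1 p c) ∧
      (∀ l c, ∑ j, ∑ q, m l j q * (u.matrix n r 1 (pr l j) c * u.matrix n r 2 q c) *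
        (∑ c', m l j q * (u.matrix n r 1 (pr l j) c' * u.matrix n r 2 q c') * u.matrix n r 3 l c' -
          m l j q * S (pr l j) q l) = 0) ∧
      u.mem 4 = s.mem 4 ∧ u.mem 5 = s.mem 5 := by
  have hr : ∀ {t : Memory}, Ready n r b N t → ∀ p : Fin r, (p : ℕ) < (IndexExpr.reg 1).eval t :=
    fun ht p => p.2.trans_eq (ht 1 (by norm_num)).symm
  have e0 : s.reg 0 = n := hs 0 (by norm_num)
  have hG : (Matrix.of fun i j : Fin n => s.mem 34 i j 0) = T * Tᵀ := by
    ext p q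
    exact h34 p q
  obtain ⟨s1, e1, hu⟩ := of_eq_seq hu
  rw [exec_eigen, IndexExpr.eval, e0] at e1
  have hs1 : Ready n r b N s1 := e1 ▸ hs
  have f1 : ∀ a, a ≠ 36 → a ≠ 37 → s1.mem a = s.mem a := fun a h h' => by
    funext i j l
    rw [e1, Memory.setEigen]
    simp [h, h']
  have v36 : ∀ p q : Fin n, s1.mem 36 p q 0 = eig.vec n (T * Tᵀ) p q := fun p q => by
    rw [e1, Memory.setEigen]
    simp [hG]
  have v37 : ∀ p : Fin n, s1.mem 37 p 0 0 = eig.val n (T * Tᵀ) p := fun p => by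
    rw [e1, Memory.setEigen]
    simp [hG]
  have hsym : (T * Tᵀ)ᵀ = T * Tᵀ := by rw [Matrix.transpose_mul, transpose_transpose]
  generalize hV : eig.vec n (T * Tᵀ) = V at v36
  generalize hw : eig.val n (T * Tᵀ) = w at v37
  obtain ⟨s2, hu, hs2, f2, v2⟩ := hs1.assign_seq hu rfl
  obtain ⟨s3, hu, hs3, f3, v3⟩ := hs2.assign_seq hu rfl
  obtain ⟨s4, hu, hs4, f4, v4⟩ := hs3.assign_seq hu rfl
  obtain ⟨s5, hu, hs5, f5, v5⟩ := hs4.assign_seq hu rfl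
  obtain ⟨s6, hex, hs6, f6, v6⟩ := hs5.assign_seq hu rfl
  have fu : ∀ a ∈ [1, 2, 4, 5, 32, 0], u.mem a = s6.mem a := fun a ha => by
    rw [hex]
    refine exec_frame_arr eig (A := [3, 8, 9, 10, 11, 12, 13, 14, 15, 16, 17, 18, 20]) rfl _ ?_
    simp only [List.mem_cons, List.not_mem_nil, or_false] at ha
    rcases ha with rfl | rfl | rfl | rfl | rfl | rfl <;> rfl
  have i1 : s1.reg 0 = n := hs1 0 (by norm_num)
  have i2 : s2.reg 0 = n := hs2 0 (by norm_num)
  have i3 : s3.reg 0 = n := hs3 0 (by norm_num)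
  have i4 : s4.reg 0 = n := hs4 0 (by norm_num)
  have w38 : ∀ k : Fin n, s3.mem 38 k 0 0 = (rank w k : ℝ) := fun k => by
    rw [f3 _ (by norm_num) (by norm_num), v2 k 0 0 (hs1.lt _) (by simp) (by simp)]
    simp only [Term.eval_sum, IndexExpr.eval, Memory.at_reg]
    norm_num [i1]
    rw [sum_range]
    rw [rank, Finset.card_filter, Nat.cast_sum]
    refine sum_congr rfl fun k' _ => ?_
    simp only [Term.eval, indLe_eval, Test.Holds, RealExpr.eval, IndexExpr.eval,
      IndexExpr.eval_add, Memory.setReg_reg, Memory.setReg_mem, Memory.at_reg, Memory.at_mem,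
      IndexExpr.eval_zero, IndexExpr.eval_one, Term.eval_zero, Term.eval_one]
    norm_num [v37]
    grind
  -- Ranks are real numbers, sums of zeros and ones; the index `c` is converted by counting too, so
  -- that the two can be compared.
  have w39 : ∀ c : Fin r, s3.mem 39 c 0 0 = (c : ℝ) := fun c => by
    rw [v3 c 0 0 ((c.2.trans_le hrn).trans_eq i2.symm) (by simp) (by simp)]
    simp only [Term.eval_sum, indLe_eval, IndexExpr.eval, IndexExpr.eval_add, Memory.at_reg,
      Memory.setReg_reg, IndexExpr.eval_one]
    norm_num [i2]
    rw [show (range n).filter (fun x => x < (c : ℕ)) = range c by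
      ext x; simpa using fun h => h.trans (c.2.trans_le hrn), card_range]
  have m1 : ∀ p c, u.matrix n r 1 p c = s4.mem 1 p c 0 := fun p c => by
    rw [Memory.matrix, of_apply, fu 1 (by simp), f6 _ (by norm_num) (by norm_num),
      f5 _ (by norm_num) (by norm_num)]
  have m2 : ∀ p c, u.matrix n r 2 p c = s5.mem 2 p c 0 := fun p c => by
    rw [Memory.matrix, of_apply, fu 2 (by simp), f6 _ (by norm_num) (by norm_num)]
  have frame : ∀ a ∈ [4, 5, 0, 33], s6.mem a = s.mem a ∧ s4.mem a = s.mem a := fun a ha => by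
    simp only [List.mem_cons, List.not_mem_nil, or_false] at ha
    rw [f6 a (by omega) (by omega), f5 a (by omega) (by omega), f4 a (by omega) (by omega),
      f3 a (by omega) (by omega), f2 a (by omega) (by omega), f1 a (by omega) (by omega)]
    exact ⟨rfl, rfl⟩
  refine ⟨V, w, hV ▸ eig.orthonormal n _ hsym, ?_, fun p c => ?_, fun q c => ?_, fun l c => ?_, ?_,
    ?_⟩
  · rw [← hV, ← hw, eig.decomposition n _ hsym]
  · rw [m1, v4 p c 0 (hs3.lt _) (hr hs3 _) (by simp)]
    simp only [Term.eval_sum, IndexExpr.eval, Memory.at_reg]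
    norm_num [i3]
    rw [sum_range]
    refine sum_congr rfl fun k _ => ?_
    simp only [Term.eval, Test.Holds, RealExpr.eval, IndexExpr.eval,
      IndexExpr.eval_add, Memory.setReg_reg, Memory.setReg_mem, Memory.at_reg, Memory.at_mem,
      IndexExpr.eval_zero, IndexExpr.eval_one, Term.eval_zero, Term.eval_one]
    norm_num [w38, w39]
    grind
  · rw [m2, v5 q c 0 (hs4.lt _) (hr hs4 _) (by simp)]
    simp only [Term.eval_sum, IndexExpr.eval, Memory.at_reg]
    norm_num [i4]
    rw [sum_range]
    exact sum_congr rfl fun k _ => by rw [(frame 33 (by simp)).2, h33, m1]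
  · rw [← fit_normal_equations eig hs6 (fun p q k => by rw [(frame 0 (by simp)).1, h0]) hpr hm
      (K := fun k => Matrix.of fun p q => if h : k < r then u.matrix n r 1 p ⟨k, h⟩ *
        u.matrix n r 2 q ⟨k, h⟩ else 0) (fun k hk p q => by
        rw [v6 k p q (hr hs5 ⟨k, hk⟩) (hs5.lt _) (hs5.lt _)]
        simp only [Term.eval_mul, Term.eval, IndexExpr.eval, Memory.at_reg, Memory.at_mem,
          IndexExpr.eval_zero, of_apply, dif_pos hk, m1, m2]
        grind) l c, ← hex]
    simp [Memory.matrix]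
  · rw [fu 4 (by simp), (frame 4 (by simp)).1]
  · rw [fu 5 (by simp), (frame 5 (by simp)).1]

/-- Recovery with four arithmetic operations and comparisons. -/
def exactRecovery : Prog := (bothStages Stage.krylov).seq krylovTail

/-- Recovery by alternating least squares. -/
def alsRecovery : Prog := (bothStages Stage.als).seq spectralTail

/-! ### Step counts -/

/-- Nested loops of polynomial length. -/
def polyNesting (Γ : List ℕ) : Bool :=
  Γ.all (fun x => decide (x ∈ [0, 1, 5, 11, 12])) && decide (Γ.length ≤ 20)

/-- Nested loops with few steps. -/
def alsNesting (Γ : List ℕ) : Bool :=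
  Γ.all (fun x => decide (x ∈ [0, 1, 3, 5])) &&
  ((decide (Γ.count 3 = 0) && (decide (Γ.length ≤ 3) ||
      decide (Γ.count 0 ≤ 2) && decide (Γ.length ≤ 4))) ||
    decide (Γ.count 3 = 1) && decide (Γ.count 1 = 0) && decide (Γ.count 0 ≤ 2) &&
      decide (Γ.length ≤ 5))

theorem initConst_fits : initConst.fits 4 polyNesting [] = true ∧
    initConst.fits 4 alsNesting [] = true := ⟨rfl, rfl⟩

theorem exactRecovery_fits : exactRecovery.fits 13 polyNesting [] = true := rfl

theorem alsRecovery_fits : alsRecovery.fits 13 alsNesting [] = true := rfl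

theorem arithmetic_exact : (initConst.seq exactRecovery).Arithmetic := by
  repeat' constructor

theorem polyNesting_le {n r b N : ℕ} (hn : 8 * (4 * b + 2) ≤ n) (hrn : r ≤ n) {Γ : List ℕ}
    (hΓ : polyNesting Γ = true) : (Γ.map (constReg n r b N)).prod ≤ 6 ^ 20 * n ^ 40 := by
  simp only [polyNesting, Bool.and_eq_true, List.all_eq_true, decide_eq_true_eq] at hΓ
  have h : ∀ x ∈ Γ, constReg n r b N x ≤ 6 * n ^ 2 := fun x hx => by
    have := hΓ.1 x hx
    simp only [List.mem_cons, List.not_mem_nil, or_false] at this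
    have h1 : 1 ≤ n := by omega
    have h2 : n ≤ n ^ 2 := Nat.le_self_pow (by norm_num) n
    rcases this with rfl | rfl | rfl | rfl | rfl <;> simp [constReg] <;> nlinarith
  have h' : (Γ.map (constReg n r b N)).prod ≤ (6 * n ^ 2) ^ Γ.length := by
    clear hΓ
    induction Γ with
    | nil => simp
    | cons x Γ ih =>
      rw [List.map_cons, List.prod_cons, List.length_cons, pow_succ, mul_comm]
      exact Nat.mul_le_mul (ih fun y hy => h y (List.mem_cons_of_mem _ hy)) (h x (by simp))
  refine h'.trans ((Nat.pow_le_pow_right ?_ hΓ.2).trans_eq (by rw [mul_pow, ← pow_mul]))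
  have : 0 < n := by omega
  positivity

theorem prod_map_constReg (n r b N : ℕ) {Γ : List ℕ} (h : ∀ x ∈ Γ, x ∈ [0, 1, 3, 5]) :
    (Γ.map (constReg n r b N)).prod =
      n ^ Γ.count 0 * r ^ Γ.count 1 * N ^ Γ.count 3 * (4 * b + 2) ^ Γ.count 5 ∧
    Γ.length = Γ.count 0 + Γ.count 1 + Γ.count 3 + Γ.count 5 := by
  induction Γ with
  | nil => simp
  | cons x Γ ih =>
    obtain ⟨h1, h2⟩ := ih fun y hy => h y (List.mem_cons_of_mem _ hy)
    have := h x (by simp)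
    rw [List.map_cons, List.prod_cons, h1, List.length_cons, h2]
    simp only [List.mem_cons, List.not_mem_nil, or_false] at this
    rcases this with rfl | rfl | rfl | rfl <;>
      simp only [List.count_cons, constReg, List.getD_cons_zero, List.getD_cons_succ] <;>
      norm_num <;> refine ⟨by ring, by ring⟩

/-- The three admissible patterns correspond to the three terms of the maximum. Outside the
iteration a loop over slots is bounded by `r`, because `4b + 2 ≤ r`; inside it there are no loops of
length `r`, and missing loops of length `n` leave room for loops over slots, since `4b + 2 ≤ n`. -/
theorem alsNesting_le {n r b N : ℕ} (hr : 3 * (4 * b + 2) ≤ r) (hrn : r ≤ n) {Γ : List ℕ}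
    (hΓ : alsNesting Γ = true) : (Γ.map (constReg n r b N)).prod ≤
      16 * max (n ^ 3) (max (n ^ 2 * r ^ 2) (n ^ 2 * (b + 1) ^ 2 * N)) := by
  simp only [alsNesting, Bool.and_eq_true, Bool.or_eq_true, List.all_eq_true,
    decide_eq_true_eq] at hΓ
  obtain ⟨h1, h2⟩ := hΓ
  obtain ⟨h3, h4⟩ := prod_map_constReg n r b N h1
  rw [h3]
  have hw : 4 * b + 2 ≤ r := by omega
  generalize Γ.count 0 = i at *
  generalize Γ.count 1 = j at *
  generalize Γ.count 3 = k at *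
  generalize Γ.count 5 = l at *
  rw [h4] at h2
  rcases h2 with ⟨rfl, h2⟩ | ⟨⟨⟨rfl, rfl⟩, h5⟩, h6⟩
  · have h6 : n ^ i * r ^ j * N ^ 0 * (4 * b + 2) ^ l ≤ n ^ i * r ^ (j + l) := by
      rw [pow_zero, mul_one, pow_add, mul_assoc]
      gcongr
    rcases h2 with h2 | ⟨h2, h5⟩
    · have : n ^ i * r ^ (j + l) ≤ n ^ 3 := calc
        _ ≤ n ^ i * n ^ (j + l) := by gcongr
        _ = n ^ (i + (j + l)) := (pow_add _ _ _).symm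
        _ ≤ n ^ 3 := Nat.pow_le_pow_right (by omega) (by omega)
      grind
    · have : n ^ i * r ^ (j + l) ≤ n ^ 2 * r ^ 2 := calc
        _ ≤ n ^ i * r ^ (2 - i + 2) :=
          Nat.mul_le_mul_left _ (Nat.pow_le_pow_right (by omega) (by omega))
        _ = n ^ i * r ^ (2 - i) * r ^ 2 := by rw [pow_add, mul_assoc]
        _ ≤ n ^ i * n ^ (2 - i) * r ^ 2 := by gcongr
        _ = n ^ 2 * r ^ 2 := by rw [← pow_add, show i + (2 - i) = 2 by omega]
      grind
  · refine le_trans (b := 16 * (n ^ 2 * (b + 1) ^ 2 * N)) ?_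
      (Nat.mul_le_mul_left _ ((le_max_right _ _).trans (le_max_right _ _)))
    calc _ = n ^ i * (4 * b + 2) ^ l * N := by ring
      _ ≤ n ^ i * (4 * b + 2) ^ (2 - i + 2) * N := by
        gcongr
        · omega
        · omega
      _ = n ^ i * (4 * b + 2) ^ (2 - i) * (4 * b + 2) ^ 2 * N := by rw [pow_add]; ring
      _ ≤ n ^ i * n ^ (2 - i) * (4 * (b + 1)) ^ 2 * N := by
        gcongr
        · omega
        · omega
      _ = n ^ 2 * (4 * (b + 1)) ^ 2 * N := by rw [← pow_add, show i + (2 - i) = 2 by omega]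
      _ = _ := by ring

/-- The initialization writes the registers `4` to `12`, which afterwards serve as loop bounds and
must stay constant. The two parts are therefore counted separately, with `4` and with `13` protected
registers. -/
theorem exists_initConst_seq_le {dom : List ℕ → Bool} {V : Set (ℕ × ℕ × ℕ × ℕ)} {K₀ : ℕ}
    {g : ℕ × ℕ × ℕ × ℕ → ℕ}
    (hV : ∀ v ∈ V, ∀ Γ : List ℕ, dom Γ = true →
      (Γ.map (constReg v.1 v.2.1 v.2.2.1 v.2.2.2)).prod ≤ K₀ * g v)
    (h : initConst.fits 4 dom [] = true) {c : Prog} (hc : c.fits 13 dom [] = true) :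
    ∃ K, ∀ n r b N, (n, r, b, N) ∈ V → ∀ (eig : EigenSolver) (S : Tensor n),
      ((initConst.seq c).run eig (input n r b N S)).2 ≤ K * g (n, r, b, N) := by
  have hV' : ∀ v ∈ (fun v => (constReg v.1 v.2.1 v.2.2.1 v.2.2.2, g v)) '' V, ∀ Γ : List ℕ,
      dom Γ = true → (Γ.map v.1).prod ≤ K₀ * v.2 := by
    rintro _ ⟨v, hv, rfl⟩
    exact hV v hv
  obtain ⟨K, hK⟩ := exists_cost_le hV' initConst [] h
  obtain ⟨K', hK'⟩ := exists_cost_le hV' c [] hc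
  refine ⟨K + K', fun n r b N hv eig S => ?_⟩
  have h1 := (hK _ ⟨_, hv, rfl⟩ eig (input n r b N S) fun x hx => by
    interval_cases x <;> rfl).2
  have h2 := (hK' _ ⟨_, hv, rfl⟩ eig _ (initConst_ready eig n r b N S)).2
  rw [List.map_nil, List.prod_nil, one_mul] at h1 h2
  simp only [Prog.run, add_mul]
  exact add_le_add h1 h2

/-! ### Correctness of the two programs -/

theorem IsSweep.congr {m n : ℕ} {f g : Stack m n → ℝ} {P : Set (Fin m × Fin n × Fin n)}
    {l : List (Set (Fin m × Fin n × Fin n))} (hl : ∀ D ∈ l, D ⊆ P) {X Y : Stack m n}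
    (hX : stackVec X ∈ supportedIn P) (hfg : ∀ X, stackVec X ∈ supportedIn P → f X = g X)
    (h : IsSweep f l X Y) : IsSweep g l X Y ∧ stackVec Y ∈ supportedIn P := by
  induction l generalizing X with
  | nil => exact ⟨h, by rwa [show Y = X from h]⟩
  | cons D l ih =>
    obtain ⟨W, h1, h2⟩ := h
    have := ih (fun D hD => hl D (List.mem_cons_of_mem _ hD)) (h1.supported (hl D (by simp)) hX) h2
    exact ⟨⟨W, h1.congr (hl D (by simp)) hX hfg, this.1⟩, this.2⟩

section
variable {n r b N : ℕ} {eig : EigenSolver} {s : Memory}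

theorem StagesDone.als_outer {S : Tensor n} (h : StagesDone r b N S eig Stage.als s) :
    ∃ U : ℕ → Stack 5 n, IsAlternating (objective₁ b (fiveSlices b S)) (rowBlocks b n) U ∧
      s.stack 5 n 4 = U N := by
  obtain ⟨t, ht, hM, hX⟩ := h.outer
  obtain ⟨U, h0, hU, hUN⟩ := (outerStage_sound n r b N).als_spec eig ht
  refine ⟨U, ⟨h0, fun k => isSweep_rowBlocks.2 ?_⟩, hX.trans hUN⟩
  have := hU k
  rw [show objective₁ b (fiveSlices b S) = sylvObj (outerWeight b n) (fiveSlices b S) from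
    funext fun X => objective₁_eq _ X, ← hM]
  exact this

theorem StagesDone.als_inner {S : Tensor n} (h : StagesDone r b N S eig Stage.als s) :
    ∃ Z : ℕ → Stack 3 n, IsAlternating (objective₂ (threeSlices b S (s.stack 5 n 4)))
      (columnBlocks b n) Z ∧ s.stack 3 n 5 = Z N := by
  obtain ⟨t, ht, hM, hX⟩ := h.inner
  obtain ⟨U, h0, hU, hUN⟩ := (innerStage_sound n r b N).als_spec eig ht
  have hU' : ∀ k, IsSweep (sylvObj (fun _ _ _ _ => 1)
      (flipStack (threeSlices b S (s.stack 5 n 4)))) (allRows (innerSet b n)) (U k) (U (k + 1)) := by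
    intro k
    rw [← hM]
    exact hU k
  have hU'' : ∀ k, stackVec (U k) ∈ supportedIn (innerSet b n) := by
    intro k
    induction k with
    | zero =>
      rw [h0]
      exact Submodule.zero_mem _
    | succ k ih => exact (IsSweep.congr allRows_subset ih (fun _ _ => rfl) (hU' k)).2
  refine ⟨fun k => flipStack (U k), ⟨?_, fun k => isSweep_columnBlocks.2 ?_⟩, ?_⟩
  · show flipStack (U 0) = 0
    rw [h0]
    rfl
  · exact (IsSweep.congr allRows_subset (hU'' k) (fun X hX => (objective₂_flip hX).symm) (hU' k)).1
  · exact congrArg flipStack (hX.trans hUN)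

theorem StagesDone.krylov_noise (hn : 8 * (4 * b + 2) ≤ n) {A B C : Mat n r}
    (hA : Aᵀ * A = 1) (hB : Bᵀ * B = 1) (h1 : Injective₁ b (cpTensor A B C))
    (h2 : Injective₂ b (cpTensor A B C)) {E : Tensor n} (hE : BandSupported b E)
    (h : StagesDone r b N (cpTensor A B C + E) eig Stage.krylov s) :
    s.stack 5 n 4 = outerNoise b E ∧ s.stack 3 n 5 = innerNoise b E := by
  have hX : s.stack 5 n 4 = outerNoise b E := by
    obtain ⟨t, ht, hM, hX⟩ := h.outer
    have hinj := outer_injective h1 hE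
    have hsys := outer_system hn (A := A) C hB hE
    rw [← hM] at hinj hsys
    exact hX.trans ((outerStage_sound n r b N).krylov_spec eig ht hinj
      (stackVec_mem_outerSet.2 (outerNoise_outer hE)) hsys)
  refine ⟨hX, ?_⟩
  obtain ⟨t, ht, hM, hZ⟩ := h.inner
  have hinj := inner_system_injective hn hA h2 hE
  have hsys := inner_system hn (B := B) C hA hE
  rw [← hX, ← hM] at hinj hsys
  exact congrArg flipStack (hZ.trans ((innerStage_sound n r b N).krylov_spec eig ht hinj
    (stackVec_mem_innerSet.2 (innerNoise_inner hE)) hsys))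

end

/-- The true slice solves the probed equations exactly, so the residual of a least-squares solution
is both a combination of the fitting columns and orthogonal to them. It vanishes, and the probed
entries determine the slice. -/
theorem cpTensor_eq_of_normal_equations {n r b : ℕ} {A B C : Mat n r}
    (hA : Aᵀ * A = 1) (hB : Bᵀ * B = 1) (hpr : ProbeInjective b A B) {d : Fin r → ℝ}
    (hd0 : ∀ k, d k ≠ 0) (hd : ∀ k k', k ≠ k' → d k ^ 2 ≠ d k' ^ 2) {S : Tensor n} (l : Fin n)
    (hS : ∀ i j : Fin n, ¬ InBand b l i j → S i j l = cpTensor A B C i j l)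
    {pr : Fin 2 → Fin n} (hprobe : ∀ j, (pr j : ℕ) = probe n l j) {m : Fin 2 → Fin n → ℝ}
    (hm : ∀ j q, m j q = if InBand b l (pr j) q then 0 else 1) {c : Fin r → ℝ}
    (hc : ∀ k : Fin r, ∑ j, ∑ q, m j q * krylov (cpMat A B d) k (pr j) q *
      (∑ c' : Fin r, m j q * krylov (cpMat A B d) c' (pr j) q * c c' - m j q * S (pr j) q l) = 0)
    (p q : Fin n) : ∑ k : Fin r, c k * krylov (cpMat A B d) k p q = cpTensor A B C p q l := by
  obtain ⟨y, hy⟩ := exists_krylov_coeffs hA hB (krylov_injective hA hB hd0 hd) (C l)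
  have hyS : ∀ i j : Fin n, ∑ k : Fin r, y k * krylov (cpMat A B d) k i j = cpTensor A B C i j l := by
    intro i j
    have := congrFun (congrFun hy i) j
    rw [cpMat_apply, Matrix.sum_apply] at this
    exact this
  have hsub : ∀ j q, ∑ c' : Fin r, m j q * krylov (cpMat A B d) c' (pr j) q * c c' -
      m j q * S (pr j) q l =
      m j q * ∑ k : Fin r, (c k - y k) * krylov (cpMat A B d) k (pr j) q := by
    intro j q
    have : m j q * S (pr j) q l =
        m j q * ∑ k : Fin r, y k * krylov (cpMat A B d) k (pr j) q := by
      rw [hyS, hm]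
      split_ifs with h
      · simp
      · rw [hS _ _ h]
    rw [this]
    simp only [sub_mul, sum_sub_distrib, mul_sub, mul_sum]
    congr 1
    exact sum_congr rfl fun k _ => by ring
  obtain ⟨g, hg⟩ : ∃ g : Fin 2 → Fin n → ℝ, ∀ j q, ∑ k : Fin r, (c k - y k) *
      krylov (cpMat A B d) k (pr j) q = g j q := ⟨_, fun _ _ => rfl⟩
  simp only [hsub, hg] at hc
  have hzero : ∑ j, ∑ q, (m j q * g j q) ^ 2 = 0 := by
    have : ∑ k : Fin r, (c k - y k) * ∑ j, ∑ q, m j q * krylov (cpMat A B d) k (pr j) q *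
        (m j q * g j q) = 0 := sum_eq_zero fun k _ => by rw [hc, mul_zero]
    rw [← this, eq_comm]
    simp only [mul_sum]
    rw [sum_comm]
    refine sum_congr rfl fun j _ => ?_
    rw [sum_comm]
    refine sum_congr rfl fun q _ => ?_
    rw [sq, ← hg, mul_sum, sum_mul]
    exact sum_congr rfl fun k _ => by ring
  have key := krylov_eq_of_probe hA hB hpr l (C l) c fun p q hp hq => by
    obtain ⟨j, hj⟩ : ∃ j, pr j = p := by
      rcases hp with hp | hp
      · exact ⟨0, Fin.ext ((hprobe 0).trans hp.symm)⟩
      · exact ⟨1, Fin.ext ((hprobe 1).trans hp.symm)⟩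
    subst hj
    have h1 := (Finset.sum_eq_zero_iff_of_nonneg fun j _ =>
      sum_nonneg fun q _ => sq_nonneg _).1 hzero j (mem_univ _)
    have h2 := pow_eq_zero_iff (two_ne_zero) |>.1 ((Finset.sum_eq_zero_iff_of_nonneg
      fun q _ => sq_nonneg _).1 h1 q (mem_univ _))
    rw [hm, if_neg hq, one_mul, ← hg] at h2
    simp only [sub_mul, sum_sub_distrib, hyS] at h2
    rw [cpMat_apply, Matrix.sum_apply]
    exact sub_eq_zero.1 h2
  have := congrFun (congrFun key p) q
  rw [cpMat_apply, Matrix.sum_apply] at this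
  exact this

theorem stagesDone_bothStages {n r b N : ℕ} (eig : EigenSolver) {f : Stage → Prog} {A : List ℕ}
    (hA : ∀ a ∈ [0, 4], A.contains a = false)
    (hf : ∀ σ ∈ [outerStage, innerStage], (f σ).writesArr A = true ∧
      (f σ).writesReg (fun x => decide (13 ≤ x)) = true) (S : Tensor n) :
    StagesDone r b N S eig f ((bothStages f).exec eig (initConst.exec eig (input n r b N S))) :=
  bothStages_spec eig hA hf (initConst_ready eig n r b N S) fun p q k => by
    rw [initConst_mem]
    simp [input, slice]

theorem stagesDone_krylov {n r b N : ℕ} (eig : EigenSolver) (S : Tensor n) :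
    StagesDone r b N S eig Stage.krylov
      ((bothStages Stage.krylov).exec eig (initConst.exec eig (input n r b N S))) :=
  stagesDone_bothStages eig (A := 30 :: 31 :: workArrays) (by decide) (fun σ hσ => by
    simp only [List.mem_cons, List.not_mem_nil, or_false] at hσ
    rcases hσ with rfl | rfl <;> exact ⟨rfl, rfl⟩) S

theorem stagesDone_als {n r b N : ℕ} (eig : EigenSolver) (S : Tensor n) :
    StagesDone r b N S eig Stage.als
      ((bothStages Stage.als).exec eig (initConst.exec eig (input n r b N S))) :=
  stagesDone_bothStages eig (A := workArrays) (by decide) (fun σ hσ => by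
    simp only [List.mem_cons, List.not_mem_nil, or_false] at hσ
    rcases hσ with rfl | rfl <;> exact ⟨rfl, rfl⟩) S

theorem exists_probe {n : ℕ} (hn : 2 ≤ n) :
    ∃ pr : Fin n → Fin 2 → Fin n, ∀ l j, (pr l j : ℕ) = probe n l j :=
  ⟨fun l j => ⟨probe n l j, by have := j.2; rw [probe]; split_ifs <;> omega⟩, fun _ _ => rfl⟩

theorem add_apply_of_not_inBand {n b : ℕ} {E : Tensor n} (hE : BandSupported b E) (T : Tensor n)
    (i j l : Fin n) (h : ¬ InBand b l i j) : (T + E) i j l = T i j l := by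
  rw [Pi.add_apply, Pi.add_apply, Pi.add_apply, hE i j l h, add_zero]

theorem exactRecovery_spec {n r b N : ℕ} (hn : 8 * (4 * b + 2) ≤ n)
    {A B C : Mat n r} (hA : Aᵀ * A = 1) (hB : Bᵀ * B = 1)
    (h1 : Injective₁ b (cpTensor A B C)) (h2 : Injective₂ b (cpTensor A B C))
    (h3 : DistinctSquares C) (h4 : ProbeInjective b A B) {E : Tensor n} (hE : BandSupported b E)
    (eig : EigenSolver) :
    (((initConst.seq exactRecovery).run eig (input n r b N (cpTensor A B C + E))).1).tensor n 1 =
      cpTensor A B C := by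
  have hst := stagesDone_krylov (r := r) (b := b) (N := N) eig (cpTensor A B C + E)
  obtain ⟨s, hs⟩ : ∃ s, s = (bothStages Stage.krylov).exec eig
    (initConst.exec eig (input n r b N (cpTensor A B C + E))) := ⟨_, rfl⟩
  rw [← hs] at hst
  obtain ⟨hX, hZ⟩ := hst.krylov_noise hn hA hB h1 h2 hE
  have hn0 : 0 < n := by omega
  obtain ⟨pr, hpr⟩ := exists_probe (n := n) (by omega)
  have h33 : ∀ p q : Fin n, s.mem 33 p q 0 = cpMat A B (C ⟨0, hn0⟩) p q := by
    intro p q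
    have e1 := congrFun (threeSlices_eq (b := b) (T := cpTensor A B C) (E := E) (outerNoise b E)) 0
    have e2 : threeSlices b (cpTensor A B C + E) (outerNoise b E) 0 =
      fiveSlices b (cpTensor A B C + E) 0 - outerNoise b E 0 := rfl
    rw [hst.slice, hX, hZ, ← e2, e1, ← cpTensor_slice, Pi.add_apply, add_sub_cancel_right,
      Pi.add_apply, evenSlices_zero]
    simp [evenPart]
  obtain ⟨c, hc, hout⟩ := krylovTail_spec eig hst.ready hst.tensor h33 (fun p q => by
    rw [hst.gram, mul_apply]
    simp_all) hpr
    (m := fun l j q => if InBand b l (pr l j) q then 0 else 1) fun _ _ _ => rfl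
  obtain ⟨hd0, hd⟩ := h3 ⟨0, hn0⟩ rfl
  have hex : ((initConst.seq exactRecovery).run eig (input n r b N (cpTensor A B C + E))).1 =
      krylovTail.exec eig s := by
    rw [hs]
    exact (exec_seq eig _ _ _).trans (exec_seq eig _ _ _)
  rw [hex]
  funext p q l
  rw [hout]
  exact cpTensor_eq_of_normal_equations hA hB h4 hd0 hd l
    (fun i j => add_apply_of_not_inBand hE _ i j l) (hpr l) (fun _ _ => rfl) (hc l) p q

/-- For each `N` the program runs afresh, with `N` sweeps in both stages, so the second stage has
data that depend on `N`; uniqueness of the first-stage iterates identifies its data with the fixed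
sequence `X`. -/
theorem alsRecovery_spec {n r b : ℕ} (hn : 8 * (4 * b + 2) ≤ n) (hrn : r ≤ n)
    {A B C : Mat n r} (hA : Aᵀ * A = 1) (hB : Bᵀ * B = 1)
    (h2 : Injective₂ b (cpTensor A B C))
    (h3 : DistinctSquares C) (h4 : ProbeInjective b A B) {E : Tensor n} (hE : BandSupported b E)
    {X : ℕ → Stack 5 n}
    (hX : ∀ Y, IsAlternating (objective₁ b (fiveSlices b (cpTensor A B C + E)))
        (rowBlocks b n) Y → Y = X)
    (hXd : GeometricDecay fun N => stackNorm (X N - outerNoise b E)) (eig : EigenSolver)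
    {u : ℕ → Memory}
    (hu : ∀ N, u N = ((initConst.seq alsRecovery).run eig (input n r b N (cpTensor A B C + E))).1) :
    (∀ N, (u N).stack 5 n 4 = X N ∧ ∃ Z : ℕ → Stack 3 n,
      IsAlternating (objective₂ (threeSlices b (cpTensor A B C + E) (X N))) (columnBlocks b n) Z ∧
        (u N).stack 3 n 5 = Z N) ∧
    GeometricDecay fun N => tensorNorm (cpTensor ((u N).matrix n r 1) ((u N).matrix n r 2)
      ((u N).matrix n r 3) - cpTensor A B C) := by
  obtain ⟨s, hs⟩ : ∃ s : ℕ → Memory, ∀ N, s N = (bothStages Stage.als).exec eig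
    (initConst.exec eig (input n r b N (cpTensor A B C + E))) := ⟨_, fun _ => rfl⟩
  have hst : ∀ N, StagesDone r b N (cpTensor A B C + E) eig Stage.als (s N) := fun N => by
    rw [hs]
    exact stagesDone_als eig _
  have hus : ∀ N, u N = spectralTail.exec eig (s N) := fun N => by
    rw [hu, hs]
    exact (exec_seq eig _ _ _).trans (exec_seq eig _ _ _)
  have hsX : ∀ N, (s N).stack 5 n 4 = X N := fun N => by
    obtain ⟨U, hU, hUN⟩ := (hst N).als_outer
    rw [hUN, hX U hU]
  have hZ := fun N => (hst N).als_inner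
  simp only [hsX] at hZ
  choose Z hZ hsZ using hZ
  have hn0 : 0 < n := by omega
  obtain ⟨pr, hpr⟩ := exists_probe (n := n) (by omega)
  set T : ℕ → Mat n n := fun N => Matrix.of fun p q => (s N).mem 33 p q 0 with hT
  have htail := fun N => spectralTail_spec eig hrn (hst N).ready (hst N).tensor (T := T N)
    (fun _ _ => rfl) (fun p q => by
      rw [(hst N).gram, mul_apply]
      rfl) hpr (m := fun l j q => if InBand b l (pr l j) q then 0 else 1) (fun _ _ _ => rfl) (hus N)
  choose V w hV hw hA' hB' hC' hu4 hu5 using htail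
  -- The denoised slice is the first-stage correction plus the inner noise minus its second-stage
  -- estimate, and the last two cancel in the limit.
  have hTlim : ∀ p q, GeometricLimit (fun N => T N p q) (cpMat A B (C ⟨0, hn0⟩) p q) := by
    intro p q
    have h := ((geometricLimit_corrected (T := cpTensor A B C) hXd 0 p q).add
      (GeometricLimit.const (innerNoise b E 0 p q))).sub
      (geometricDecay_inner hn hA h2 hE hXd hZ 0 p q)
    rw [add_sub_cancel_right, evenSlices_zero] at h
    have e := cpTensor_slice A B C ⟨0, hn0⟩
    rw [← e]
    refine (congrArg (fun f : ℕ → ℝ => GeometricLimit f _) (funext fun N => ?_)).mp h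
    have e1 := congrFun (threeSlices_eq (b := b) (T := cpTensor A B C) (E := E) (X N)) 0
    have e2 : threeSlices b (cpTensor A B C + E) (X N) 0 =
      fiveSlices b (cpTensor A B C + E) 0 - X N 0 := rfl
    exact Eq.trans (by rw [hsX, hsZ, ← e2, e1]; rfl) ((hst N).slice p q).symm
  refine ⟨fun N => ⟨by rw [Memory.stack_congr (hu4 N), hsX], Z N, hZ N, by
    rw [Memory.stack_congr (hu5 N), hsZ]⟩, ?_⟩
  obtain ⟨hd0, hd⟩ := h3 ⟨0, hn0⟩ rfl
  have hlim := geometricLimit_output hV hw hA hB hd0 hd hTlim hA' hB' h4 hpr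
    (add_apply_of_not_inBand hE (cpTensor A B C)) (fun _ _ _ => rfl) hC'
  refine GeometricDecay.sqrt (GeometricDecay.sum fun i _ => GeometricDecay.sum fun j _ =>
    GeometricDecay.sum fun l _ => ?_)
  simp only [sq]
  exact GeometricDecay.mul (hlim i j l) (hlim i j l)

theorem generic_conditions {n r b : ℕ} (hn : 8 * (4 * b + 2) ≤ n) (hr : 3 * (4 * b + 2) ≤ r)
    (hrn : r ≤ n) : GenericOrth n r fun A B C =>
      (Injective₁ b (cpTensor A B C) ∧ Injective₂ b (cpTensor A B C)) ∧
        DistinctSquares C ∧ ProbeInjective b A B :=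
  ((generic_injective₁ hn hr hrn).and (generic_injective₂ hr hrn)).and
    ((generic_distinctSquares (by omega) hrn).and (generic_probeInjective hn hr hrn))

end

theorem theorem1 :
    (∃ (prog : Prog) (K d : ℕ), prog.Arithmetic ∧
      ∀ n r b : ℕ, 8 * (4 * b + 2) ≤ n → 3 * (4 * b + 2) ≤ r → r ≤ n →
        (∀ (eig : EigenSolver) (S : Tensor n),
          (prog.run eig (input n r b 0 S)).2 ≤ K * n ^ d) ∧
        GenericOrth n r fun A B C =>
          DeterminedOffBand b A B C ∧
          ∀ E : Tensor n, BandSupported b E → ∀ eig : EigenSolver,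
            (prog.run eig (input n r b 0 (cpTensor A B C + E))).1.tensor n 1 =
              cpTensor A B C) ∧
    (∃ (prog : Prog) (K : ℕ),
      ∀ n r b : ℕ, 8 * (4 * b + 2) ≤ n → 3 * (4 * b + 2) ≤ r → r ≤ n →
        (∀ (eig : EigenSolver) (N : ℕ) (S : Tensor n),
          (prog.run eig (input n r b N S)).2 ≤
            K * max (n ^ 3) (max (n ^ 2 * r ^ 2) (n ^ 2 * (b + 1) ^ 2 * N))) ∧
        GenericOrth n r fun A B C =>
          ∀ E : Tensor n, BandSupported b E →
            ∃ X : ℕ → Stack 5 n,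
              IsAlternating (objective₁ b (fiveSlices b (cpTensor A B C + E))) (rowBlocks b n) X ∧
              (∀ Y, IsAlternating (objective₁ b (fiveSlices b (cpTensor A B C + E)))
                (rowBlocks b n) Y → Y = X) ∧
              ∀ eig : EigenSolver, ∃ ρ c : ℝ, 0 ≤ ρ ∧ ρ < 1 ∧ ∀ N : ℕ,
                let s : Memory := (prog.run eig (input n r b N (cpTensor A B C + E))).1
                s.stack 5 n 4 = X N ∧
                (∃ Z : ℕ → Stack 3 n,
                  IsAlternating (objective₂ (threeSlices b (cpTensor A B C + E) (X N)))
                    (columnBlocks b n) Z ∧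
                  s.stack 3 n 5 = Z N) ∧
                stackNorm (X N - outerNoise b E) ≤ c * ρ ^ N ∧
                tensorNorm (cpTensor (s.matrix n r 1) (s.matrix n r 2) (s.matrix n r 3) -
                  cpTensor A B C) ≤ c * ρ ^ N) := by
  constructor
  · obtain ⟨K, hK⟩ := exists_initConst_seq_le (dom := polyNesting) (K₀ := 6 ^ 20)
      (V := {v | 8 * (4 * v.2.2.1 + 2) ≤ v.1 ∧ v.2.1 ≤ v.1}) (g := fun v => v.1 ^ 40)
      (fun v hv Γ hΓ => polyNesting_le hv.1 hv.2 hΓ) initConst_fits.1 exactRecovery_fits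
    refine ⟨_, K, 40, arithmetic_exact, fun n r b hn hr hrn =>
      ⟨fun eig S => hK n r b 0 ⟨hn, hrn⟩ eig S,
      (generic_conditions hn hr hrn).mono fun A B C hA hB ⟨⟨h1, h2⟩, h3, h4⟩ =>
        ⟨determinedOffBand hn hA hB h1 h2 h3 h4, fun E hE eig =>
          exactRecovery_spec hn hA hB h1 h2 h3 h4 hE eig⟩⟩⟩
  · obtain ⟨K, hK⟩ := exists_initConst_seq_le (dom := alsNesting) (K₀ := 16)
      (V := {v | 3 * (4 * v.2.2.1 + 2) ≤ v.2.1 ∧ v.2.1 ≤ v.1})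
      (g := fun v => max (v.1 ^ 3) (max (v.1 ^ 2 * v.2.1 ^ 2)
        (v.1 ^ 2 * (v.2.2.1 + 1) ^ 2 * v.2.2.2)))
      (fun v hv Γ hΓ => alsNesting_le hv.1 hv.2 hΓ) initConst_fits.2 alsRecovery_fits
    refine ⟨_, K, fun n r b hn hr hrn => ⟨fun eig N S => hK n r b N ⟨hr, hrn⟩ eig S,
      (generic_conditions hn hr hrn).mono fun A B C hA hB ⟨⟨h1, h2⟩, h3, h4⟩ E hE => ?_⟩⟩
    obtain ⟨X, hX, hXu, hXd⟩ := exists_outer_sequence hn hB h1 hE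
    refine ⟨X, hX, hXu, fun eig => ?_⟩
    obtain ⟨hst, hdec⟩ := alsRecovery_spec hn hrn hA hB h2 h3 h4 hE hXu hXd eig fun _ => rfl
    obtain ⟨ρ, c, h0, hρ, hc⟩ := hXd.exists_forall_le hdec
    exact ⟨ρ, c, h0, hρ, fun N => ⟨(hst N).1, (hst N).2, hc N⟩⟩
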